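/- **Conventions.** For $f,g:\mathbb N\to\mathbb N$ write $f\preceq g$ if there is a constant $K$ with $f(n)\le K\,g(Kn+K)+K$ for all $n$, and $f\simeq g$ if $f\preceq g$ and $g\preceq f$. A *van Kampen diagram* over a combinatorial 2-complex $X$ with boundary label an edge-loop $w$ is a finite 1-connected planar combinatorial 2-complex with a combinatorial map to $X$ that sends its boundary cycle to $w$. *Mapping tori.* Let $G$ be a combinatorial 2-complex and let $f:G^{(1)}\to G^{(1)}$ be an edge-path map (a cellular map sending each edge to an edge-path). The mapping torus $M(f)$ is obtained from $G$ by adding an edge $t_x$ from $x$ to $f(x)$ for every vertex $x$, and, for each edge $e$ from $x$ to $y$, a 2-cell with boundary $t_x^{-1}\,e\,t_y\,f(e)^{-1}$. In a diagram over $M(f)$, a *$t$-corridor* is a chain of 2-cells running from one boundary edge with label some $t_x^{\pm1}$ to another, consecutive 2-cells sharing such an edge; its *length* is the number of its 2-cells (possibly $0$). For a null-homotopic edge-loop $w$ in $M(f)$ let $\lambda_t(w)$ be the least $k$ such that some van Kampen diagram with boundary label $w$ has all its $t$-corridors of length at most $k$. The *$t$-corridor length function* of $M(f)$ is $\Lambda(n)=\max\{\lambda_t(w):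 w \text{ a null-homotopic edge-loop in } M(f),\ |w|\le n\}$. *Semidirect products.* Let $\varphi\in\mathrm{Aut}(\Pi)$ and let $\Pi\rtimes_\varphi\mathbb Z$ have generator $t$ of $\mathbb Z$ with $t^{-1}ht=\varphi(h)$ for $h\in\Pi$. For a finite presentation $\langle \mathcal A,t\mid \mathcal R,\ t^{-1}at=\hat\varphi(a)\ (a\in\mathcal A)\rangle$ of $\Pi\rtimes_\varphi\mathbb Z$, where $\mathcal A$ is a finite generating family of $\Pi$, the finitely many relators $\mathcal R$ are words in $\mathcal A^{\pm1}$, and $\hat\varphi(a)$ is a word in $\mathcal A^{\pm1}$ equal to $\varphi(a)$ in $\Pi$, the $t$-corridor length function is defined in the same way from the van Kampen diagrams over the presentation (whose standard 2-complex is the mapping torus of $a\mapsto\hat\varphi(a)$ on the complex of $\langle\mathcal A\mid\mathcal R\rangle$). **Proposition.** Let $\Pi$ be a group. (1) Let $\varphi\in\mathrm{Out}(\Pi)$, let $G_1,G_2$ be compact connected combinatorial 2-complexes with fundamental group $\Pi$, and for $i=1,2$ let $f_i:G_i^{(1)}\to G_i^{(1)}$ be an edge-path map inducing $\varphi$. Then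 the $t$-corridor length functions of $M(f_1)$ and $M(f_2)$ are $\simeq$-equivalent. (2) Let $\varphi\in\mathrm{Aut}(\Pi)$, suppose that $\Pi$ is finitely generated and that $\Pi\rtimes_\varphi\mathbb Z$ is finitely presented, and let $p\ge1$ be an integer. Then $\Pi\rtimes_\varphi\mathbb Z$ and $\Pi\rtimes_{\varphi^p}\mathbb Z$ both have finite presentations of the above form, and the $t$-corridor length function of any such presentation of $\Pi\rtimes_\varphi\mathbb Z$ is $\simeq$-equivalent to that of any such presentation of $\Pi\rtimes_{\varphi^p}\mathbb Z$. -/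

import Mathlib

universe u v w

/-! ### Graphs, edge-paths, combinatorial 2-complexes -/

/-- A 1-dimensional complex (graph; loops and multiple edges allowed), each 1-cell being given a
chosen orientation. -/
structure OneComplex where
  Vert : Type u
  Edge : Type u
  src : Edge → Vert
  tgt : Edge → Vert

namespace OneComplex

/-- Oriented edges: `(e, true)` is the 1-cell `e` with its chosen orientation, `(e, false)` is `e`
with the opposite orientation.  Edge-paths are thus written like words in a free group. -/
abbrev Dart (G : OneComplex.{u}) : Type u := G.Edge × Bool

variable (G : OneComplex.{u})

/-- The initial vertex of an oriented edge. -/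
def dsrc : G.Dart → G.Vert
  | (e, true) => G.src e
  | (e, false) => G.tgt e

/-- The terminal vertex of an oriented edge. -/
def dtgt : G.Dart → G.Vert
  | (e, true) => G.tgt e
  | (e, false) => G.src e

/-- `G.IsPath x p y`: the list `p` of oriented edges is an edge-path from `x` to `y`. -/
def IsPath : G.Vert → List G.Dart → G.Vert → Prop
  | x, [], y => x = y
  | x, d :: p, y => G.dsrc d = x ∧ IsPath (G.dtgt d) p y

/-- Edge-paths from `x` to `y`. -/
def Path (x y : G.Vert) : Type u := {p : List G.Dart // G.IsPath x p y}

/-- Any two vertices are joined by an edge-path. -/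
def Connected : Prop := Nonempty G.Vert ∧ ∀ x y : G.Vert, Nonempty (G.Path x y)

variable {G}

/-- An oriented edge, with its orientation reversed. -/
def rev (d : G.Dart) : G.Dart := (d.1, !d.2)

theorem dsrc_rev (d : G.Dart) : G.dsrc (rev d) = G.dtgt d := by
  obtain ⟨e, _ | _⟩ := d <;> rfl

theorem dtgt_rev (d : G.Dart) : G.dtgt (rev d) = G.dsrc d := by
  obtain ⟨e, _ | _⟩ := d <;> rfl

theorem isPath_append {x y : G.Vert} {p q : List G.Dart} :
    G.IsPath x (p ++ q) y ↔ ∃ z, G.IsPath x p z ∧ G.IsPath z q y := by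
  induction p generalizing x with
  | nil => simp [IsPath]
  | cons d p ih => simp [IsPath, ih, and_assoc]

theorem invRev_cons (d : G.Dart) (p : List G.Dart) :
    FreeGroup.invRev (d :: p) = FreeGroup.invRev p ++ [rev d] := by
  simp [FreeGroup.invRev, rev]

theorem isPath_invRev {x y : G.Vert} {p : List G.Dart} (h : G.IsPath x p y) :
    G.IsPath y (FreeGroup.invRev p) x := by
  induction p generalizing x with
  | nil => exact Eq.symm h
  | cons d p ih =>
    rw [invRev_cons, isPath_append]
    exact ⟨_, ih h.2, dsrc_rev d, (dtgt_rev d).trans h.1⟩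

namespace Path

/-- The constant path. -/
def nil (x : G.Vert) : G.Path x x := ⟨[], rfl⟩

/-- Concatenation: first `p`, then `q`. -/
def comp {x y z : G.Vert} (p : G.Path x y) (q : G.Path y z) : G.Path x z :=
  ⟨p.1 ++ q.1, isPath_append.2 ⟨y, p.2, q.2⟩⟩

/-- The reversed path. -/
def inv {x y : G.Vert} (p : G.Path x y) : G.Path y x :=
  ⟨FreeGroup.invRev p.1, isPath_invRev p.2⟩

end Path

end OneComplex

/-- A combinatorial 2-complex: a graph, with 2-cells attached along closed edge-paths. -/
structure TwoComplex extends OneComplex.{u} where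
  Face : Type u
  /-- the attaching path of a 2-cell, read from one of its vertices in one of its two directions -/
  bdry : Face → List toOneComplex.Dart
  bdry_closed : ∀ F, ∃ x, toOneComplex.IsPath x (bdry F) x

namespace TwoComplex

open OneComplex

/-- Compactness of a complex: finitely many cells. -/
def IsFinite (X : TwoComplex.{u}) : Prop := Finite X.Vert ∧ Finite X.Edge ∧ Finite X.Face

/-! ### Homotopy of edge-paths and the fundamental group -/

/-- Elementary homotopies: deleting a backtracking, or the boundary of a 2-cell. -/
inductive ElemStep (X : TwoComplex.{u}) : List X.Dart → List X.Dart → Prop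
  | cancel (a b : List X.Dart) (d : X.Dart) : ElemStep X (a ++ d :: rev d :: b) (a ++ b)
  | face (a b : List X.Dart) (F : X.Face) : ElemStep X (a ++ X.bdry F ++ b) (a ++ b)

/-- Homotopy relative to the endpoints of edge-paths: the equivalence relation generated, on the
edge-paths with given endpoints, by the elementary homotopies. -/
def Homotopic (X : TwoComplex.{u}) {x y : X.Vert} : X.Path x y → X.Path x y → Prop :=
  Relation.EqvGen fun p q => X.ElemStep p.1 q.1

/-- `p` is a closed edge-path based at `x` which is homotopic to the constant path. -/
def NullHomotopic (X : TwoComplex.{u}) (x : X.Vert) (p : List X.Dart) : Prop :=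
  ∃ h : X.IsPath x p x, X.Homotopic ⟨p, h⟩ (Path.nil x)

/-- 1-connectedness: connected, and every closed edge-path is null-homotopic. -/
def SimplyConnected (X : TwoComplex.{u}) : Prop :=
  X.Connected ∧ ∀ (x : X.Vert) (p : X.Path x x), X.Homotopic p (Path.nil x)

variable {X : TwoComplex.{u}}

theorem Homotopic.refl {x y : X.Vert} (p : X.Path x y) : X.Homotopic p p :=
  Relation.EqvGen.refl p

theorem Homotopic.symm {x y : X.Vert} {p q : X.Path x y} (h : X.Homotopic p q) :
    X.Homotopic q p := Relation.EqvGen.symm _ _ h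

theorem Homotopic.trans {x y : X.Vert} {p q r : X.Path x y} (h : X.Homotopic p q)
    (h' : X.Homotopic q r) : X.Homotopic p r := Relation.EqvGen.trans _ _ _ h h'

theorem ElemStep.congr {p q : List X.Dart} (h : X.ElemStep p q) (a b : List X.Dart) :
    X.ElemStep (a ++ p ++ b) (a ++ q ++ b) := by
  cases h with
  | cancel c e d => simpa using ElemStep.cancel (X := X) (a ++ c) (e ++ b) d
  | face c e F => simpa using ElemStep.face (X := X) (a ++ c) (e ++ b) F

theorem Homotopic.comp_left {x y z : X.Vert} (a : X.Path x y) {p q : X.Path y z}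
    (h : X.Homotopic p q) : X.Homotopic (a.comp p) (a.comp q) := by
  induction h with
  | rel p q h => exact .rel _ _ (by simpa [Path.comp] using h.congr a.1 [])
  | refl p => exact .refl _
  | symm p q _ ih => exact ih.symm
  | trans p q r _ _ ih₁ ih₂ => exact ih₁.trans ih₂

theorem Homotopic.comp_right {x y z : X.Vert} {p q : X.Path x y} (h : X.Homotopic p q)
    (b : X.Path y z) : X.Homotopic (p.comp b) (q.comp b) := by
  induction h with
  | rel p q h => exact .rel _ _ (by simpa [Path.comp] using h.congr [] b.1)
  | refl p => exact .refl _
  | symm p q _ ih => exact ih.symm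
  | trans p q r _ _ ih₁ ih₂ => exact ih₁.trans ih₂

theorem inv_comp_homotopic {x y : X.Vert} (p : X.Path x y) :
    X.Homotopic (p.inv.comp p) (Path.nil y) := by
  obtain ⟨l, hl⟩ := p
  induction l generalizing x with
  | nil => cases hl; exact .refl _
  | cons d l ih =>
    refine Homotopic.trans (.rel _ _ ?_) (ih hl.2)
    have := ElemStep.cancel (X := X) (FreeGroup.invRev l) l (rev d)
    change X.ElemStep (FreeGroup.invRev (d :: l) ++ d :: l) (FreeGroup.invRev l ++ l)
    rw [invRev_cons]
    simpa [rev] using this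

theorem Homotopic.inv {x y : X.Vert} {p q : X.Path x y} (h : X.Homotopic p q) :
    X.Homotopic p.inv q.inv := by
  have h1 : X.Homotopic ((p.inv.comp q).comp q.inv) q.inv := by
    have e := ((h.comp_left p.inv).symm.trans (inv_comp_homotopic p)).comp_right q.inv
    exact e
  have h2 : X.Homotopic (p.inv.comp (q.comp q.inv)) (p.inv.comp (Path.nil x)) := by
    refine Homotopic.comp_left _ ?_
    have := inv_comp_homotopic q.inv
    rwa [show q.inv.inv = q from Subtype.ext (FreeGroup.invRev_invRev)] at this
  have e1 : (p.inv.comp q).comp q.inv = p.inv.comp (q.comp q.inv) :=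
    Subtype.ext (List.append_assoc _ _ _)
  have e2 : p.inv.comp (Path.nil x) = p.inv := Subtype.ext (List.append_nil _)
  rw [e1] at h1
  rw [e2] at h2
  exact h2.symm.trans h1

/-- Homotopy, as a setoid on the closed edge-paths based at `x`. -/
def loopSetoid (X : TwoComplex.{u}) (x : X.Vert) : Setoid (X.Path x x) :=
  ⟨X.Homotopic, ⟨Homotopic.refl, Homotopic.symm, Homotopic.trans⟩⟩

/-- The (edge-path) fundamental group of `X` at `x`. -/
def FundGroup (X : TwoComplex.{u}) (x : X.Vert) : Type u := Quotient (X.loopSetoid x)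

/-- The homotopy class of a closed edge-path. -/
def cls {x : X.Vert} (p : X.Path x x) : X.FundGroup x := Quotient.mk (X.loopSetoid x) p

/-- The group structure given by concatenation. -/
instance (x : X.Vert) : Group (X.FundGroup x) where
  mul := Quotient.lift₂ (s₁ := X.loopSetoid x) (s₂ := X.loopSetoid x) (fun p q => cls (p.comp q))
    fun p q p' q' (h : X.Homotopic p p') (h' : X.Homotopic q q') =>
      Quotient.sound (s := X.loopSetoid x) ((h.comp_right q).trans (h'.comp_left p'))
  one := cls (Path.nil x)
  inv := Quotient.lift (s := X.loopSetoid x) (fun p => cls p.inv)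
    fun p q (h : X.Homotopic p q) => Quotient.sound (s := X.loopSetoid x) h.inv
  mul_assoc := by
    rintro ⟨p⟩ ⟨q⟩ ⟨r⟩
    exact congrArg cls (Subtype.ext (List.append_assoc _ _ _))
  one_mul := by
    rintro ⟨p⟩
    exact congrArg cls (Subtype.ext (List.nil_append _))
  mul_one := by
    rintro ⟨p⟩
    exact congrArg cls (Subtype.ext (List.append_nil _))
  inv_mul_cancel := by
    rintro ⟨p⟩
    exact Quotient.sound (s := X.loopSetoid x) (a := p.inv.comp p) (inv_comp_homotopic p)

end TwoComplex

/-! ### Edge-path maps and mapping tori -/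

/-- An edge-path map of a graph: a cellular map that sends every edge to an edge-path (possibly a
constant one). -/
structure EdgePathMap (G : OneComplex.{u}) where
  onVert : G.Vert → G.Vert
  onEdge : G.Edge → List G.Dart
  isPath : ∀ e, G.IsPath (onVert (G.src e)) (onEdge e) (onVert (G.tgt e))

namespace EdgePathMap

open OneComplex

/-- The image of an oriented edge. -/
def onDart {G : OneComplex.{u}} (f : EdgePathMap G) : G.Dart → List G.Dart
  | (e, true) => f.onEdge e
  | (e, false) => FreeGroup.invRev (f.onEdge e)

theorem isPath_onDart {G : OneComplex.{u}} (f : EdgePathMap G) (d : G.Dart) :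
    G.IsPath (f.onVert (G.dsrc d)) (f.onDart d) (f.onVert (G.dtgt d)) := by
  obtain ⟨e, _ | _⟩ := d
  · exact isPath_invRev (f.isPath e)
  · exact f.isPath e

theorem isPath_flatMap {G : OneComplex.{u}} (f : EdgePathMap G) {x y : G.Vert}
    {p : List G.Dart} (h : G.IsPath x p y) :
    G.IsPath (f.onVert x) (p.flatMap f.onDart) (f.onVert y) := by
  induction p generalizing x with
  | nil => exact congrArg f.onVert h
  | cons d p ih =>
    rw [List.flatMap_cons, isPath_append]
    exact ⟨_, h.1 ▸ f.isPath_onDart d, ih h.2⟩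

/-- The image of an edge-path. -/
def onPath {G : OneComplex.{u}} (f : EdgePathMap G) {x y : G.Vert} (p : G.Path x y) :
    G.Path (f.onVert x) (f.onVert y) :=
  ⟨p.1.flatMap f.onDart, f.isPath_flatMap p.2⟩

/-- The oriented edges of `G`, seen in the mapping torus. -/
def incl {G : OneComplex.{u}} (d : G.Dart) : (G.Edge ⊕ G.Vert) × Bool := (Sum.inl d.1, d.2)

/-- The 1-skeleton of the mapping torus: `G`, with an edge `t_x = inr x` from `x` to `f x` for
every vertex `x`. -/
def torusGraph {G : OneComplex.{u}} (f : EdgePathMap G) : OneComplex.{u} where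
  Vert := G.Vert
  Edge := G.Edge ⊕ G.Vert
  src := Sum.elim G.src id
  tgt := Sum.elim G.tgt f.onVert

theorem isPath_incl {G : OneComplex.{u}} (f : EdgePathMap G) {x y : G.Vert} {p : List G.Dart}
    (h : G.IsPath x p y) : f.torusGraph.IsPath x (p.map incl) y := by
  induction p generalizing x with
  | nil => exact h
  | cons d p ih =>
    obtain ⟨e, _ | _⟩ := d
    · exact ⟨h.1, ih h.2⟩
    · exact ⟨h.1, ih h.2⟩

/-- The mapping torus `M(f)` of an edge-path map `f` of the 1-skeleton of `G`: besides the 2-cells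
of `G` it has, for every edge `e` of `G`, from `x` to `y` say, a 2-cell with boundary
`t_x⁻¹ e t_y f(e)⁻¹`. -/
def mappingTorus {G : TwoComplex.{u}} (f : EdgePathMap G.toOneComplex) : TwoComplex.{u} where
  toOneComplex := f.torusGraph
  Face := G.Face ⊕ G.Edge
  bdry
    | Sum.inl F => (G.bdry F).map incl
    | Sum.inr e => (Sum.inr (G.src e), false) :: (Sum.inl e, true) :: (Sum.inr (G.tgt e), true) ::
        (FreeGroup.invRev (f.onEdge e)).map incl
  bdry_closed := by
    rintro (F | e)
    · obtain ⟨x, hx⟩ := G.bdry_closed F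
      exact ⟨x, f.isPath_incl hx⟩
    · exact ⟨f.onVert (G.src e), rfl, rfl, rfl, f.isPath_incl (isPath_invRev (f.isPath e))⟩

end EdgePathMap

/-- The outer automorphism group. -/
abbrev Out (H : Type w) [Group H] : Type w := MulAut H ⧸ (MulAut.conj : H →* MulAut H).range

/-- Let `H` be identified with the fundamental group of `G` by `ι`.  The edge-path map `f` of the
1-skeleton of `G` induces `φ ∈ Out H`: after some choice of a path `γ` from the base vertex `x` to
`f x`, the map `[p] ↦ [γ · f(p) · γ⁻¹]` is an automorphism of `H` in the class `φ`. -/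
def EdgePathMap.Induces {G : TwoComplex.{u}} {H : Type w} [Group H]
    (f : EdgePathMap G.toOneComplex) {x : G.Vert} (ι : G.FundGroup x ≃* H) (φ : Out H) : Prop :=
  ∃ (γ : G.Path x (f.onVert x)) (Φ : MulAut H), (QuotientGroup.mk Φ : Out H) = φ ∧
    ∀ p : G.Path x x,
      ι (TwoComplex.cls ((γ.comp (f.onPath p)).comp γ.inv)) = Φ (ι (TwoComplex.cls p))

/-! ### Van Kampen diagrams -/

open OneComplex in
/-- The label of an oriented edge, when the 1-cells are labelled by oriented edges. -/
def dartLabel {D : OneComplex.{v}} {X : OneComplex.{u}} (lab : D.Edge → X.Dart) : D.Dart → X.Dart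
  | (e, true) => lab e
  | (e, false) => rev (lab e)

open OneComplex in
/-- A van Kampen diagram over `X` with boundary label `w`: a finite 1-connected combinatorial
2-complex in the oriented plane, with a combinatorial map to `X`, whose boundary cycle is mapped
to `w`.

The planar embedding is recorded combinatorially.  The faces of the embedding are the 2-cells of
the complex and the outer face; `side` gives, for each face, the cyclic sequence of oriented edges
read around it, all faces being read with the same orientation of the plane (`none` is the outer
face, read from the base point).  Each oriented edge occurs exactly once (so that each 1-cell is
passed exactly twice, once in each direction), and the cyclic order in which the oriented edges
leave a vertex is the one determined by the faces: a vertex is exactly one cycle of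
`x ↦ (the successor of rev x on its face)`.  So attaching a disc along the outer cycle yields a
closed oriented surface, which is a sphere because the complex is 1-connected. -/
structure VanKampen (X : TwoComplex.{u}) (w : List X.Dart) extends TwoComplex.{0} where
  finite : toTwoComplex.IsFinite
  oneConnected : toTwoComplex.SimplyConnected
  bdry_ne_nil : ∀ c, bdry c ≠ []
  /-- the boundary cycle of the diagram -/
  outer : List toOneComplex.Dart
  /-- the diagram is not a closed sphere -/
  outer_ne_nil : outer = [] → IsEmpty Edge
  side : Option Face → List toOneComplex.Dart
  side_none : side none = outer
  side_some : ∀ c, side (some c) = bdry c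
  side_nodup : ∀ i, (side i).Nodup
  existsUnique_side : ∀ x : toOneComplex.Dart, ∃! i, x ∈ side i
  /-- two oriented edges start at the same vertex iff they are related by rotation -/
  rotation : ∀ x y : toOneComplex.Dart, toOneComplex.dsrc x = toOneComplex.dsrc y ↔
    Relation.EqvGen (fun a b => ∃ i l, (b :: l).IsRotated (side i) ∧
      (b :: l).getLast? = some (rev a)) x y
  /-- the map to `X`, on vertices -/
  vertLabel : Vert → X.Vert
  /-- the map to `X`, on edges -/
  edgeLabel : Edge → X.Dart
  vertLabel_src : ∀ e, vertLabel (src e) = X.dsrc (edgeLabel e)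
  vertLabel_tgt : ∀ e, vertLabel (tgt e) = X.dtgt (edgeLabel e)
  /-- each 2-cell is mapped to a 2-cell of `X` -/
  face_label : ∀ c, ∃ F : X.Face,
    ((bdry c).map (dartLabel edgeLabel)).IsRotated (X.bdry F) ∨
    ((bdry c).map (dartLabel edgeLabel)).IsRotated (FreeGroup.invRev (X.bdry F))
  outer_label : outer.map (dartLabel edgeLabel) = w

/-! ### Corridors and corridor length functions -/

namespace EdgePathMap

open OneComplex

variable {G : TwoComplex.{u}} (f : EdgePathMap G.toOneComplex)

/-- In a diagram over the mapping torus, the sequence `x :: l` of oriented edges crosses a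
`t`-corridor from one end to the other: all of these edges are labelled by `t`-edges, `x` lies on
the boundary cycle, each edge and the next one are the two (distinct) `t`-edges in the boundary of
a 2-cell, and the last edge is again on the boundary cycle.  The corridor consists of `l.length`
2-cells; it is the corridor of length zero when the boundary cycle traverses the edge `x` in both
directions. -/
def IsCorridor {w : List f.mappingTorus.Dart} (D : VanKampen f.mappingTorus w)
    (x : D.Dart) (l : List D.Dart) : Prop :=
  x ∈ D.outer ∧
  (∀ y ∈ x :: l, (D.edgeLabel y.1).1.isRight = true) ∧
  List.IsChain (fun y z => ∃ c, rev y ∈ D.bdry c ∧ z ∈ D.bdry c ∧ z ≠ rev y) (x :: l) ∧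
  rev ((x :: l).getLast (List.cons_ne_nil x l)) ∈ D.outer

/-- `λ_t(w)`: the least `k` such that some van Kampen diagram with boundary label `w` has all its
`t`-corridors of length at most `k`. -/
noncomputable def corridorLengthOf (w : List f.mappingTorus.Dart) : ℕ :=
  sInf {k | ∃ D : VanKampen f.mappingTorus w, ∀ x l, f.IsCorridor D x l → l.length ≤ k}

/-- The `t`-corridor length function `Λ` of the mapping torus: the maximum of `λ_t(w)` over the
null-homotopic edge-loops `w` of length at most `n`. -/
noncomputable def corridorLength (n : ℕ) : ℕ :=
  sSup {k | ∃ (x : G.Vert) (w : List f.mappingTorus.Dart),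
    f.mappingTorus.NullHomotopic x w ∧ w.length ≤ n ∧ f.corridorLengthOf w = k}

end EdgePathMap

/-- `f ≼ g`. -/
def CoarseLE (f g : ℕ → ℕ) : Prop := ∃ K : ℕ, ∀ n, f n ≤ K * g (K * n + K) + K

/-- `f ≃ g`: the functions differ by a quasi-Lipschitz distortion of domain and range. -/
def CoarseEquiv (f g : ℕ → ℕ) : Prop := CoarseLE f g ∧ CoarseLE g f

/-! ### Presentations of semidirect products `H ⋊_φ ℤ` -/

/-- `H ⋊_φ ℤ`; its generator `s = inr (ofAdd 1)` of `ℤ` satisfies `s h s⁻¹ = φ h`. -/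
abbrev Cyclic (H : Type w) [Group H] (φ : MulAut H) : Type w :=
  H ⋊[zpowersHom (MulAut H) φ] Multiplicative ℤ

/-- The generator `t` of `ℤ` in `H ⋊_φ ℤ` such that `t⁻¹ h t = φ h` for `h` in `H`. -/
def Cyclic.t {H : Type w} [Group H] (φ : MulAut H) : Cyclic H φ :=
  SemidirectProduct.inr (Multiplicative.ofAdd (-1))

/-- The standard 2-complex of `⟨A | R⟩`: one vertex, the edges are the generators, the 2-cells are
the relators. -/
def presentationComplex (A : Type u) (R : Set (List (A × Bool))) : TwoComplex.{u} where
  Vert := PUnit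
  Edge := A
  src _ := PUnit.unit
  tgt _ := PUnit.unit
  Face := R
  bdry r := r.1
  bdry_closed r := ⟨PUnit.unit, by
    induction r.1 with
    | nil => rfl
    | cons d p ih => exact ⟨rfl, ih⟩⟩

/-- A finite presentation of `H ⋊_φ ℤ` of the form `⟨A, t | R, t⁻¹ a t = φ̂(a) (a ∈ A)⟩`, where `A`
is a finite generating family of `H`, `R` is a finite set of words in the letters `A`, and `φ̂(a)`
is a word in the letters `A` that equals `φ(a)` in `H`. -/
structure CyclicPresentation (H : Type w) [Group H] (φ : MulAut H) where
  A : Type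
  finite_A : Finite A
  gen : A → H
  gen_closure : Subgroup.closure (Set.range gen) = ⊤
  hat : A → List (A × Bool)
  hat_eq : ∀ a, FreeGroup.lift gen (FreeGroup.mk (hat a)) = φ (gen a)
  R : Set (List (A × Bool))
  finite_R : R.Finite
  /-- the kernel of the map from the free group on `A ∪ {t}` is normally generated by the
  relators -/
  presents :
    Subgroup.normalClosure
      ({r | ∃ u ∈ R, r = FreeGroup.map Sum.inl (FreeGroup.mk u)} ∪
       {r | ∃ a, r = (FreeGroup.of (Sum.inr PUnit.unit))⁻¹ * FreeGroup.of (Sum.inl a) *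
          FreeGroup.of (Sum.inr PUnit.unit) *
          (FreeGroup.map Sum.inl (FreeGroup.mk (hat a)))⁻¹}) =
    (FreeGroup.lift (Sum.elim (fun a => SemidirectProduct.inl (gen a))
      (fun _ => Cyclic.t φ)) : FreeGroup (A ⊕ PUnit.{1}) →* Cyclic H φ).ker

namespace CyclicPresentation

variable {H : Type w} [Group H] {φ : MulAut H} (P : CyclicPresentation H φ)

/-- The edge-path map `a ↦ φ̂(a)` of the rose with edges `A`.  Its mapping torus, relative to the
complex of `⟨A | R⟩`, is the standard 2-complex of `⟨A, t | R, t⁻¹ a t = φ̂(a)⟩`. -/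
def edgePathMap : EdgePathMap (presentationComplex P.A P.R).toOneComplex where
  onVert := id
  onEdge := P.hat
  isPath e := by
    generalize P.hat e = p
    induction p with
    | nil => rfl
    | cons d p ih => exact ⟨rfl, ih⟩

/-- The `t`-corridor length function of the presentation. -/
noncomputable def corridorLength : ℕ → ℕ := P.edgePathMap.corridorLength

end CyclicPresentation

/-! ### Cyclic successors in lists -/

/-! The corridor length function depends, up to `≃`, only on the group `H ⋊_φ ℤ` with its projection
to `ℤ` and on the word length of `H`. To see this, diagrams are replaced by noncrossing pairings.

In a diagram over a mapping torus a 2-cell has either no `t`-edge or two of them, with opposite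
signs. Hence every corridor that starts on the boundary ends on the boundary, and two corridors do
not cross; so the corridors pair the `t`-edges of the boundary label (`IsDisc.paired_of_corridors`).
Crossing is excluded by a discrete Jordan curve argument: a corridor is dual to a 1-cocycle, and the
potential of this cocycle takes different values on its two sides.

Conversely, let a null-homotopic loop have a noncrossing pairing whose pairs are joined by strips of
at most `k` 2-cells. The strips are glued into a diagram, and the loops that remain are
null-homotopic and can be filled in any way (`Bounds.of_paired`). Keeping the diagram planar
requires foldings, which can reconnect corridors. Therefore the `t`-edges carry colours: each strip
has its own colour with at most `k + 1` edges, colours are constant along corridors, and foldings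
never increase the number of edges of a colour. So the corridors that start on the boundary have
length at most `2 * k + 1` (`Paired.exists_vanKampen`).

Next the pairings are made algebraic. A `t`-edge of a loop is recorded by the group element at its
initial vertex `x`, whatever the direction in which the loop passes it. On that side of a corridor
each 2-cell has exactly one edge, so the length of a corridor is comparable to the word length in
`H` of the difference of the two recorded points. Thus the corridor length function is equivalent to
the optimal width in `Cyclic.PairedWords`, where words in `H` and `t` that represent the identity
are paired (`Marking.dominates_words`, `Marking.dominates_loops`). Two edge-path maps inducing the
same outer automorphism have markings by the same group `H ⋊_Φ ℤ`, which proves (1).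

For (2), `φ` and `φ ^ p` are compared. A word for `φ ^ p` becomes one for `φ` when `t` is replaced
by `t ^ p`; a pairing of the latter word, restricted to the points whose exponent is a multiple of
`p`, pairs the former (`PairedWords.pow`). In the other direction the letters `t` are collected into
blocks `t ^ p` by moving elements of `H` past fewer than `p` letters, and a pair of blocks is
resolved into `p` parallel pairs (`PairedWords.of_pow`). This moves points by amounts linear in the
length of the word. Such errors are harmless, since the word `t⁻¹ h t φ(h)⁻¹` has only one pairing
and forces the width to grow at least linearly (`PairedWords.le_of_le`).

The presentations themselves come from normal forms `t ^ a * u * t ^ (-b)` for `φ`, and for `φ ^ p`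
from an action on sequences by the shift. -/

namespace List

variable {α : Type u} {β : Type v}

/-- `y` directly follows `x` in the list. -/
def Linked : List α → α → α → Prop
  | a :: b :: l, x, y => (a = x ∧ b = y) ∨ Linked (b :: l) x y
  | _, _, _ => False

/-- `y` follows `x` in the list, read cyclically. -/
def CycSucc (l : List α) (x y : α) : Prop :=
  l.Linked x y ∨ (l.getLast? = some x ∧ l.head? = some y)

@[simp] theorem linked_nil (x y : α) : ¬ ([] : List α).Linked x y := id
@[simp] theorem linked_singleton (a x y : α) : ¬ [a].Linked x y := id
@[simp] theorem linked_cons_cons (a b : α) (l : List α) (x y : α) :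
    (a :: b :: l).Linked x y ↔ (a = x ∧ b = y) ∨ (b :: l).Linked x y := Iff.rfl

theorem linked_append {l m : List α} {x y : α} :
    (l ++ m).Linked x y ↔
      l.Linked x y ∨ m.Linked x y ∨ (l.getLast? = some x ∧ m.head? = some y) := by
  induction l with
  | nil => simp
  | cons a l ih =>
    cases l with
    | nil => cases m <;> simp [or_comm]
    | cons b l =>
      simp only [cons_append, linked_cons_cons] at ih ⊢
      rw [ih, or_assoc, getLast?_cons_cons]

theorem linked_iff {l : List α} {x y : α} : l.Linked x y ↔ ∃ a b, l = a ++ x :: y :: b := by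
  constructor
  · intro h
    induction l with
    | nil => exact h.elim
    | cons a l ih =>
      cases l with
      | nil => exact h.elim
      | cons b l =>
        rcases h with ⟨rfl, rfl⟩ | h
        · exact ⟨[], l, rfl⟩
        · obtain ⟨c, d, h⟩ := ih h
          exact ⟨a :: c, d, by rw [h, cons_append]⟩
  · rintro ⟨a, b, rfl⟩
    simp [linked_append]

theorem isRotated_iff_append {l l' : List α} : l ~r l' ↔ ∃ a b, l = a ++ b ∧ l' = b ++ a := by
  constructor
  · rintro ⟨n, rfl⟩
    refine ⟨l.take (n % l.length), l.drop (n % l.length), (take_append_drop _ _).symm, ?_⟩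
    rw [rotate_eq_drop_append_take_mod]
  · rintro ⟨a, b, rfl, rfl⟩
    exact isRotated_append

theorem cycSucc_iff_isRotated {l : List α} {x y : α} :
    l.CycSucc x y ↔ ∃ m, (y :: m).IsRotated l ∧ (y :: m).getLast? = some x := by
  constructor
  · rintro (h | ⟨h, h'⟩)
    · obtain ⟨a, b, rfl⟩ := linked_iff.1 h
      refine ⟨b ++ a ++ [x], ?_, ?_⟩
      · rw [isRotated_iff_append]
        exact ⟨y :: b, a ++ [x], by simp, by simp⟩
      · rw [← cons_append, getLast?_concat]
    · cases l with
      | nil => simp at h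
      | cons a l =>
        obtain rfl : a = y := by simpa using h'
        exact ⟨l, .refl _, h⟩
  · rintro ⟨m, h, h'⟩
    obtain ⟨a, b, e, rfl⟩ := isRotated_iff_append.1 h
    cases b with
    | nil =>
      rw [List.append_nil] at e
      subst e
      exact .inr ⟨h', rfl⟩
    | cons c b =>
      cases a with
      | nil =>
        rw [List.nil_append] at e
        rw [List.append_nil, ← e]
        exact .inr ⟨h', rfl⟩
      | cons d a =>
        left
        obtain ⟨rfl, rfl⟩ : y = d ∧ m = a ++ c :: b := by simpa using e
        rw [linked_append]
        right; right
        refine ⟨?_, rfl⟩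
        rw [← cons_append, getLast?_append] at h'
        simpa using h'

theorem CycSucc.of_isRotated {l l' : List α} {x y : α} (h : l.CycSucc x y) (r : l ~r l') :
    l'.CycSucc x y := by
  rw [cycSucc_iff_isRotated] at *
  obtain ⟨m, h, h'⟩ := h
  exact ⟨m, h.trans r, h'⟩

theorem CycSucc.mem_left {l : List α} {x y : α} (h : l.CycSucc x y) : x ∈ l := by
  rcases h with h | ⟨h, -⟩
  · obtain ⟨a, b, rfl⟩ := linked_iff.1 h; simp
  · exact mem_of_getLast? h

theorem CycSucc.mem_right {l : List α} {x y : α} (h : l.CycSucc x y) : y ∈ l := by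
  rcases h with h | ⟨-, h⟩
  · obtain ⟨a, b, rfl⟩ := linked_iff.1 h; simp
  · exact mem_of_head? h

theorem Linked.map {l : List α} {x y : α} (f : α → β) (h : l.Linked x y) :
    (l.map f).Linked (f x) (f y) := by
  obtain ⟨a, b, rfl⟩ := linked_iff.1 h
  exact linked_iff.2 ⟨a.map f, b.map f, by simp⟩

theorem CycSucc.map {l : List α} {x y : α} (f : α → β) (h : l.CycSucc x y) :
    (l.map f).CycSucc (f x) (f y) := by
  rcases h with h | ⟨h, h'⟩
  · exact .inl (h.map f)
  · right; simp [h, h']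

theorem exists_cycSucc {l : List α} {x : α} (h : x ∈ l) : ∃ y, l.CycSucc x y := by
  obtain ⟨a, b, rfl⟩ := append_of_mem h
  cases b with
  | nil =>
    cases a with
    | nil => exact ⟨x, .inr (by simp)⟩
    | cons c a => exact ⟨c, .inr ⟨List.getLast?_concat, rfl⟩⟩
  | cons c b => exact ⟨c, .inl (linked_iff.2 ⟨a, b, rfl⟩)⟩

theorem CycSucc.right_unique {l : List α} (hl : l.Nodup) {x y z : α} (h : l.CycSucc x y)
    (h' : l.CycSucc x z) : y = z := by
  obtain ⟨m, r, e⟩ := cycSucc_iff_isRotated.1 h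
  obtain ⟨c, hc⟩ := getLast?_eq_some_iff.1 e
  have h1 := h'.of_isRotated r.symm
  have hn := r.nodup_iff.2 hl
  rw [hc] at h1 hn
  rcases h1 with h1 | ⟨-, h1⟩
  · obtain ⟨a, b, e'⟩ := linked_iff.1 h1
    rw [nodup_append] at hn
    rcases eq_nil_or_concat b with rfl | ⟨b, d, rfl⟩
    · have : c ++ [x] = (a ++ [x]) ++ [z] := by simpa using e'
      obtain ⟨rfl, h2⟩ := append_inj' this rfl
      exact (hn.2.2 x (by simp) x (by simp) rfl).elim
    · have : c ++ [x] = (a ++ x :: z :: b) ++ [d] := by simpa using e'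
      obtain ⟨rfl, h2⟩ := append_inj' this rfl
      exact (hn.2.2 x (by simp) x (by simp) rfl).elim
  · rw [← hc] at h1
    simpa using h1

theorem CycSucc.left_unique {l : List α} (hl : l.Nodup) {x y z : α} (h : l.CycSucc x z)
    (h' : l.CycSucc y z) : x = y := by
  obtain ⟨m, r, e⟩ := cycSucc_iff_isRotated.1 h
  have h1 := h'.of_isRotated r.symm
  have hn := r.nodup_iff.2 hl
  rcases h1 with h1 | ⟨h1, -⟩
  · obtain ⟨a, b, e'⟩ := linked_iff.1 h1
    cases a with
    | nil =>
      simp only [nil_append, cons.injEq] at e'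
      obtain ⟨rfl, rfl⟩ := e'
      simp at hn
    | cons c a =>
      simp only [cons_append, cons.injEq] at e'
      obtain ⟨rfl, rfl⟩ := e'
      simp at hn
  · rw [e] at h1
    simpa using h1

end List

/-! ### Removing a link from the orbits of a permutation -/

section Orbit

variable {α : Type u}

open Relation

theorem Relation.EqvGen.map_of {β : Type v} {r : α → α → Prop} {s : β → β → Prop} (f : α → β)
    (h : ∀ a b, r a b → EqvGen s (f a) (f b)) {a b : α} (hab : EqvGen r a b) :
    EqvGen s (f a) (f b) := by
  induction hab with
  | rel a b hab => exact h a b hab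
  | refl a => exact .refl _
  | symm a b _ ih => exact .symm _ _ ih
  | trans a b c _ _ ih ih' => exact .trans _ _ _ ih ih'

theorem Function.Injective.eqvGen_iterate {f : α → α} (a : α) (n : ℕ) :
    EqvGen (fun a b => f a = b) a (f^[n] a) := by
  induction n with
  | zero => exact .refl _
  | succ n ih => exact ih.trans _ _ _ (.rel _ _ (Function.iterate_succ_apply' f n a).symm)

/-- In the orbits of a permutation of a finite set, one may do without one link per orbit. -/
theorem Function.Injective.eqvGen_of_removed [Finite α] {f : α → α} (hf : Function.Injective f)
    (P : α → Prop) (hP : ∀ p q, P p → P q → EqvGen (fun a b => f a = b) p q → p = q) {x y : α}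
    (h : EqvGen (fun a b => f a = b) x y) : EqvGen (fun a b => f a = b ∧ ¬ P a) x y := by
  -- The removed link from `a` to `f a` is replaced by the way round the rest of the cycle. No other
  -- link is missing there: a point of `P` on the way would equal `a` by `hP`, contrary to the
  -- minimality of the period.
  have key : ∀ a, P a → EqvGen (fun a b => f a = b ∧ ¬ P a) (f a) a := by
    intro a ha
    have hper : a ∈ Function.periodicPts f := hf.mem_periodicPts a
    have hpos := Function.minimalPeriod_pos_of_mem_periodicPts hper
    have h1 : ∀ i, i < Function.minimalPeriod f a →
        EqvGen (fun a b => f a = b ∧ ¬ P a) (f a) (f^[i + 1] a) := by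
      intro i
      induction i with
      | zero => exact fun _ => .refl _
      | succ i ih =>
        intro hi
        refine (ih (by omega)).trans _ _ _ (.rel _ _ ?_)
        refine ⟨(Function.iterate_succ_apply' f (i + 1) a).symm, fun hp => ?_⟩
        have h2 := hP _ _ ha hp (Function.Injective.eqvGen_iterate a (i + 1))
        have : Function.IsPeriodicPt f (i + 1) a := h2.symm
        exact absurd (this.minimalPeriod_le (Nat.succ_pos _)) (by omega)
    have h2 := h1 (Function.minimalPeriod f a - 1) (by omega)
    rwa [Nat.sub_add_cancel hpos, Function.iterate_minimalPeriod] at h2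
  refine Relation.EqvGen.map_of id (fun a b hab => ?_) h
  by_cases ha : P a
  · subst hab
    exact (key a ha).symm _ _
  · exact .rel _ _ ⟨hab, ha⟩

end Orbit

/-! ### Paths, maps of complexes and homotopies, on the level of lists -/

namespace OneComplex

variable {X : OneComplex.{u}} {Y : OneComplex.{v}}

@[simp] theorem rev_rev (d : X.Dart) : rev (rev d) = d := by simp [rev]

theorem rev_injective : Function.Injective (rev : X.Dart → X.Dart) :=
  fun d e h => by rw [← rev_rev d, h, rev_rev]

theorem rev_ne (d : X.Dart) : rev d ≠ d := by
  obtain ⟨e, _ | _⟩ := d <;> simp [rev]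

@[simp] theorem isPath_cons {x y : X.Vert} {d : X.Dart} {p : List X.Dart} :
    X.IsPath x (d :: p) y ↔ X.dsrc d = x ∧ X.IsPath (X.dtgt d) p y := Iff.rfl

theorem IsPath.append {x y z : X.Vert} {p q : List X.Dart} (h : X.IsPath x p y)
    (h' : X.IsPath y q z) : X.IsPath x (p ++ q) z := isPath_append.2 ⟨y, h, h'⟩

theorem IsPath.tgt_unique {x y z : X.Vert} {p : List X.Dart} (h : X.IsPath x p y)
    (h' : X.IsPath x p z) : y = z := by
  induction p generalizing x with
  | nil => exact h.symm.trans h'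
  | cons d p ih => exact ih h.2 h'.2

theorem IsPath.src_eq {x y x' y' : X.Vert} {p : List X.Dart} (hp : p ≠ []) (h : X.IsPath x p y)
    (h' : X.IsPath x' p y') : x = x' := by
  cases p with
  | nil => exact (hp rfl).elim
  | cons d p => exact h.1.symm.trans h'.1

theorem isPath_singleton (d : X.Dart) : X.IsPath (X.dsrc d) [d] (X.dtgt d) := ⟨rfl, rfl⟩

theorem IsPath.linked {x y : X.Vert} {p : List X.Dart} (h : X.IsPath x p y) {d e : X.Dart}
    (hde : p.Linked d e) : X.dtgt d = X.dsrc e := by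
  obtain ⟨a, b, rfl⟩ := List.linked_iff.1 hde
  obtain ⟨z, -, -, h2, -⟩ := isPath_append.1 h
  exact h2.symm

theorem IsPath.tgt_of_getLast {x y : X.Vert} {p : List X.Dart} (h : X.IsPath x p y) {d : X.Dart}
    (hd : p.getLast? = some d) : X.dtgt d = y := by
  obtain ⟨q, rfl⟩ := List.getLast?_eq_some_iff.1 hd
  obtain ⟨z, -, -, h2⟩ := isPath_append.1 h
  exact h2

theorem IsPath.src_of_head {x y : X.Vert} {p : List X.Dart} (h : X.IsPath x p y) {d : X.Dart}
    (hd : p.head? = some d) : X.dsrc d = x := by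
  cases p with
  | nil => simp at hd
  | cons e p => obtain rfl : e = d := by simpa using hd
                exact h.1

theorem IsPath.cycSucc {x : X.Vert} {p : List X.Dart} (h : X.IsPath x p x) {d e : X.Dart}
    (hde : p.CycSucc d e) : X.dtgt d = X.dsrc e := by
  rcases hde with hde | ⟨h1, h2⟩
  · exact h.linked hde
  · rw [h.tgt_of_getLast h1, h.src_of_head h2]

/-- A cyclic sequence of matching darts is a closed path. -/
theorem exists_isPath_of_linked {p : List X.Dart} (hp : p ≠ [])
    (h : ∀ d e, p.Linked d e → X.dtgt d = X.dsrc e) :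
    X.IsPath (X.dsrc (p.head hp)) p (X.dtgt (p.getLast hp)) := by
  induction p with
  | nil => exact (hp rfl).elim
  | cons d p ih =>
    cases p with
    | nil => exact ⟨rfl, rfl⟩
    | cons e p =>
      refine ⟨rfl, ?_⟩
      rw [h d e (.inl ⟨rfl, rfl⟩)]
      simpa using ih (by simp) fun a b hab => h a b (.inr hab)

theorem exists_isPath_of_cycSucc [Nonempty X.Vert] {p : List X.Dart}
    (h : ∀ d e, p.CycSucc d e → X.dtgt d = X.dsrc e) : ∃ x, X.IsPath x p x := by
  by_cases hp : p = []
  · exact ⟨Classical.arbitrary _, by rw [hp]; rfl⟩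
  · refine ⟨X.dsrc (p.head hp), ?_⟩
    · have := exists_isPath_of_linked hp fun d e hde => h d e (.inl hde)
      rwa [h (p.getLast hp) (p.head hp)
        (.inr ⟨List.getLast?_eq_some_getLast _, List.head?_eq_some_head _⟩)] at this

theorem isPath_rotate {x : X.Vert} {p q : List X.Dart} (h : X.IsPath x p x) (r : p ~r q) :
    ∃ y, X.IsPath y q y := by
  obtain ⟨a, b, rfl, rfl⟩ := List.isRotated_iff_append.1 r
  obtain ⟨z, h1, h2⟩ := isPath_append.1 h
  exact ⟨z, h2.append h1⟩

/-- A cellular map between graphs that sends edges to edge-paths. -/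
structure PathMap (X : OneComplex.{u}) (Y : OneComplex.{v}) where
  onVert : X.Vert → Y.Vert
  onEdge : X.Edge → List Y.Dart
  isPath : ∀ e, Y.IsPath (onVert (X.src e)) (onEdge e) (onVert (X.tgt e))

namespace PathMap

variable (F : PathMap X Y)

/-- The image of an oriented edge. -/
def onDart : X.Dart → List Y.Dart
  | (e, true) => F.onEdge e
  | (e, false) => FreeGroup.invRev (F.onEdge e)

/-- The image of a list of oriented edges. -/
def onList (p : List X.Dart) : List Y.Dart := p.flatMap F.onDart

theorem onDart_rev (d : X.Dart) : F.onDart (rev d) = FreeGroup.invRev (F.onDart d) := by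
  obtain ⟨e, _ | _⟩ := d
  · exact FreeGroup.invRev_invRev.symm
  · rfl

theorem isPath_onDart (d : X.Dart) :
    Y.IsPath (F.onVert (X.dsrc d)) (F.onDart d) (F.onVert (X.dtgt d)) := by
  obtain ⟨e, _ | _⟩ := d
  · exact isPath_invRev (F.isPath e)
  · exact F.isPath e

@[simp] theorem onList_nil : F.onList [] = [] := rfl
@[simp] theorem onList_cons (d : X.Dart) (p : List X.Dart) :
    F.onList (d :: p) = F.onDart d ++ F.onList p := List.flatMap_cons
@[simp] theorem onList_append (p q : List X.Dart) :
    F.onList (p ++ q) = F.onList p ++ F.onList q := List.flatMap_append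

theorem isPath_onList {x y : X.Vert} {p : List X.Dart} (h : X.IsPath x p y) :
    Y.IsPath (F.onVert x) (F.onList p) (F.onVert y) := by
  induction p generalizing x with
  | nil => exact congrArg F.onVert h
  | cons d p ih =>
    rw [onList_cons]
    exact IsPath.append (h.1 ▸ F.isPath_onDart d) (ih h.2)

end PathMap

theorem invRev_append (p q : List X.Dart) :
    FreeGroup.invRev (p ++ q) = FreeGroup.invRev q ++ FreeGroup.invRev p := by
  simp [FreeGroup.invRev]

theorem PathMap.onList_invRev (F : PathMap X Y) (p : List X.Dart) :
    F.onList (FreeGroup.invRev p) = FreeGroup.invRev (F.onList p) := by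
  induction p with
  | nil => rfl
  | cons d p ih =>
    rw [invRev_cons, F.onList_append, F.onList_cons, F.onList_cons, F.onList_nil,
      List.append_nil, F.onDart_rev, ih, ← invRev_append]

end OneComplex

namespace TwoComplex

open OneComplex

variable {X : TwoComplex.{u}} {Y : TwoComplex.{v}}

/-- Homotopy of edge-paths given as lists. -/
def PathHomotopic (X : TwoComplex.{u}) (x y : X.Vert) (p q : List X.Dart) : Prop :=
  ∃ (hp : X.IsPath x p y) (hq : X.IsPath x q y), X.Homotopic ⟨p, hp⟩ ⟨q, hq⟩

namespace PathHomotopic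

theorem refl {x y : X.Vert} {p : List X.Dart} (h : X.IsPath x p y) : X.PathHomotopic x y p p :=
  ⟨h, h, .refl _⟩

theorem symm {x y : X.Vert} {p q : List X.Dart} (h : X.PathHomotopic x y p q) :
    X.PathHomotopic x y q p := by
  obtain ⟨hp, hq, h⟩ := h
  exact ⟨hq, hp, h.symm⟩

theorem trans {x y : X.Vert} {p q r : List X.Dart} (h : X.PathHomotopic x y p q)
    (h' : X.PathHomotopic x y q r) : X.PathHomotopic x y p r := by
  obtain ⟨hp, hq, h⟩ := h
  obtain ⟨hq', hr, h'⟩ := h'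
  exact ⟨hp, hr, h.trans h'⟩

theorem append {x y z : X.Vert} {p q p' q' : List X.Dart} (h : X.PathHomotopic x y p q)
    (h' : X.PathHomotopic y z p' q') : X.PathHomotopic x z (p ++ p') (q ++ q') := by
  obtain ⟨hp, hq, h⟩ := h
  obtain ⟨hp', hq', h'⟩ := h'
  exact ⟨hp.append hp', hq.append hq', (h.comp_right ⟨p', hp'⟩).trans (h'.comp_left ⟨q, hq⟩)⟩

theorem append_left {x y z : X.Vert} {p q p' : List X.Dart} (h : X.IsPath x p y)
    (h' : X.PathHomotopic y z q p') : X.PathHomotopic x z (p ++ q) (p ++ p') := (refl h).append h'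

theorem append_right {x y z : X.Vert} {p q p' : List X.Dart} (h : X.PathHomotopic x y p q)
    (h' : X.IsPath y p' z) : X.PathHomotopic x z (p ++ p') (q ++ p') := h.append (refl h')

theorem invRev {x y : X.Vert} {p q : List X.Dart} (h : X.PathHomotopic x y p q) :
    X.PathHomotopic y x (FreeGroup.invRev p) (FreeGroup.invRev q) := by
  obtain ⟨hp, hq, h⟩ := h
  exact ⟨isPath_invRev hp, isPath_invRev hq, h.inv⟩

theorem invRev_append_self {x y : X.Vert} {p : List X.Dart} (h : X.IsPath x p y) :
    X.PathHomotopic y y (FreeGroup.invRev p ++ p) [] :=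
  ⟨(isPath_invRev h).append h, rfl, inv_comp_homotopic ⟨p, h⟩⟩

theorem append_invRev_self {x y : X.Vert} {p : List X.Dart} (h : X.IsPath x p y) :
    X.PathHomotopic x x (p ++ FreeGroup.invRev p) [] := by
  have := invRev_append_self (isPath_invRev h)
  rwa [FreeGroup.invRev_invRev] at this

theorem face {x : X.Vert} (F : X.Face) (h : X.IsPath x (X.bdry F) x) :
    X.PathHomotopic x x (X.bdry F) [] :=
  ⟨h, rfl, .rel _ _ (by simpa using ElemStep.face (X := X) [] [] F)⟩

theorem left {x y : X.Vert} {p q : List X.Dart} (h : X.PathHomotopic x y p q) : X.IsPath x p y :=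
  h.1

theorem right {x y : X.Vert} {p q : List X.Dart} (h : X.PathHomotopic x y p q) : X.IsPath x q y :=
  h.2.1

/-- If `p q⁻¹` is null-homotopic then `p` and `q` are homotopic. -/
theorem of_append_invRev {x y : X.Vert} {p q : List X.Dart} (hp : X.IsPath x p y)
    (hq : X.IsPath x q y) (h : X.PathHomotopic x x (p ++ FreeGroup.invRev q) []) :
    X.PathHomotopic x y p q := by
  have h1 := h.append_right hq
  have h2 := append_left hp (invRev_append_self hq)
  rw [List.append_nil] at h2
  rw [List.append_assoc] at h1
  exact h2.symm.trans h1

theorem append_invRev {x y : X.Vert} {p q : List X.Dart} (h : X.PathHomotopic x y p q) :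
    X.PathHomotopic x x (p ++ FreeGroup.invRev q) [] :=
  (h.append_right (isPath_invRev h.right)).trans (append_invRev_self h.right)

/-- Cancelling a common initial path. -/
theorem cancel_left {x y z : X.Vert} {p q r : List X.Dart} (hp : X.IsPath x p y)
    (h : X.PathHomotopic x z (p ++ q) r) :
    X.PathHomotopic y z q (FreeGroup.invRev p ++ r) := by
  have h1 := append_left (isPath_invRev hp) h
  rw [← List.append_assoc] at h1
  obtain ⟨y', hp', hq⟩ := isPath_append.1 h.left
  obtain rfl := hp.tgt_unique hp'
  exact ((invRev_append_self hp).append_right hq).symm.trans h1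

theorem rotate {x : X.Vert} {p q : List X.Dart} (h : X.PathHomotopic x x p []) (r : p ~r q)
    {y : X.Vert} (hq : X.IsPath y q y) : X.PathHomotopic y y q [] := by
  obtain ⟨a, b, rfl, rfl⟩ := List.isRotated_iff_append.1 r
  by_cases hn : b ++ a = []
  · rw [hn]; exact refl rfl
  obtain ⟨z, h1, h2⟩ := isPath_append.1 h.left
  obtain rfl := IsPath.src_eq hn hq (h2.append h1)
  have h3 := (h.cancel_left h1).append_right h1
  rw [List.append_nil] at h3
  exact h3.trans (invRev_append_self h1)

end PathHomotopic

/-- A path map which sends the boundaries of the faces to null-homotopic loops preserves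
homotopy. -/
theorem PathHomotopic.map (F : PathMap X.toOneComplex Y.toOneComplex)
    (hF : ∀ (c : X.Face) (x : X.Vert), X.IsPath x (X.bdry c) x →
      Y.PathHomotopic (F.onVert x) (F.onVert x) (F.onList (X.bdry c)) [])
    {x y : X.Vert} {p q : List X.Dart} (h : X.PathHomotopic x y p q) :
    Y.PathHomotopic (F.onVert x) (F.onVert y) (F.onList p) (F.onList q) := by
  obtain ⟨hp, hq, h⟩ := h
  suffices H : ∀ p q : X.Path x y, X.Homotopic p q →
      Y.PathHomotopic (F.onVert x) (F.onVert y) (F.onList p.1) (F.onList q.1) from H _ _ h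
  intro p q h
  induction h with
  | refl p => exact .refl (F.isPath_onList p.2)
  | symm p q _ ih => exact ih.symm
  | trans p q r _ _ ih ih' => exact ih.trans ih'
  | rel p q h =>
    obtain ⟨p, hp⟩ := p
    obtain ⟨q, hq⟩ := q
    dsimp only at h ⊢
    cases h with
    | cancel a b d =>
      obtain ⟨z, h1, h2⟩ := isPath_append.1 hp
      obtain ⟨h2, -, h3⟩ := h2
      rw [dtgt_rev, h2] at h3
      have h4 := PathHomotopic.append_invRev_self (X := Y) (F.isPath_onDart d)
      rw [h2] at h4
      have := (PathHomotopic.refl (F.isPath_onList h1)).append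
        (h4.append_right (F.isPath_onList h3))
      simpa [F.onDart_rev] using this
    | face a b c =>
      rw [List.append_assoc] at hp
      obtain ⟨z, h1, h2⟩ := isPath_append.1 hp
      obtain ⟨z', h2, h3⟩ := isPath_append.1 h2
      obtain ⟨z₀, h5⟩ := X.bdry_closed c
      obtain rfl : z = z' := by
        by_cases hn : X.bdry c = []
        · rw [hn] at h2; exact h2
        · obtain rfl := IsPath.src_eq hn h2 h5
          exact h5.tgt_unique h2
      have := (PathHomotopic.refl (F.isPath_onList h1)).append
        ((hF c z h2).append_right (F.isPath_onList h3))
      simpa using this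

theorem SimplyConnected.pathHomotopic (h : X.SimplyConnected) {x y : X.Vert} {p q : List X.Dart}
    (hp : X.IsPath x p y) (hq : X.IsPath x q y) : X.PathHomotopic x y p q := by
  refine .of_append_invRev hp hq ?_
  exact ⟨hp.append (isPath_invRev hq), rfl, h.2 x ⟨_, hp.append (isPath_invRev hq)⟩⟩

/-- A complex through which paths can be transported to a 1-connected complex and back, up to
homotopy, is 1-connected. -/
theorem SimplyConnected.of_pathMap (hX : X.SimplyConnected)
    (F : PathMap X.toOneComplex Y.toOneComplex)
    (hF : ∀ (c : X.Face) (x : X.Vert), X.IsPath x (X.bdry c) x →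
      Y.PathHomotopic (F.onVert x) (F.onVert x) (F.onList (X.bdry c)) [])
    (R : PathMap Y.toOneComplex X.toOneComplex) (c : Y.Vert → List Y.Dart)
    (hc : ∀ y, Y.IsPath (F.onVert (R.onVert y)) (c y) y)
    (nat : ∀ e : Y.Edge, Y.PathHomotopic (F.onVert (R.onVert (Y.src e))) (Y.tgt e)
      (c (Y.src e) ++ [(e, true)]) (F.onList (R.onEdge e) ++ c (Y.tgt e))) :
    Y.SimplyConnected := by
  have natd : ∀ d : Y.Dart, Y.PathHomotopic (F.onVert (R.onVert (Y.dsrc d))) (Y.dtgt d)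
      (c (Y.dsrc d) ++ [d]) (F.onList (R.onDart d) ++ c (Y.dtgt d)) := by
    rintro ⟨e, _ | _⟩
    · have h1 : Y.PathHomotopic _ _ _ _ := (nat e).symm
      have h2 := (h1.cancel_left (F.isPath_onList (R.isPath e))).append_right
        (isPath_singleton (X := Y.toOneComplex) (e, false))
      refine h2.trans ?_ |>.trans (.refl ?_)
      · have e1 : FreeGroup.invRev (F.onList (R.onEdge e)) = F.onList (R.onDart (e, false)) :=
          (F.onList_invRev _).symm
        rw [e1, List.append_assoc, List.append_assoc]
        have h3 := PathHomotopic.append_invRev_self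
          (isPath_singleton (X := Y.toOneComplex) (e, true))
        have h4 := PathHomotopic.append_left (hc (Y.src e)) h3
        rw [List.append_nil] at h4
        exact .append_left (F.isPath_onList (R.isPath_onDart (e, false))) h4
      · exact (F.isPath_onList (R.isPath_onDart (e, false))).append (hc _)
    · exact nat e
  -- The paths `c y` are the tracks of a homotopy from `F ∘ R` to the identity. So a loop `p` is
  -- conjugate, by `c x`, to the image under `F` of a loop of `X`.
  have natl : ∀ (p : List Y.Dart) (x y : Y.Vert), Y.IsPath x p y →
      Y.PathHomotopic (F.onVert (R.onVert x)) y (c x ++ p) (F.onList (R.onList p) ++ c y) := by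
    intro p
    induction p with
    | nil => rintro x y rfl; simpa using PathHomotopic.refl (hc x)
    | cons d p ih =>
      rintro x y ⟨rfl, h⟩
      have h1 := (natd d).append_right h
      have h2 := PathHomotopic.append_left (F.isPath_onList (R.isPath_onDart d)) (ih _ _ h)
      simp only [List.append_assoc] at h1 h2
      simpa using h1.trans h2
  refine ⟨⟨hX.1.1.map F.onVert, fun x y => ?_⟩, fun x p => ?_⟩
  · obtain ⟨q⟩ := hX.1.2 (R.onVert x) (R.onVert y)
    exact ⟨⟨_, (isPath_invRev (hc x)).append ((F.isPath_onList q.2).append (hc y))⟩⟩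
  · obtain ⟨p, hp⟩ := p
    suffices h : Y.PathHomotopic x x p [] by
      obtain ⟨_, _, h⟩ := h; exact h
    have h1 := natl p x x hp
    have h2 := (hX.pathHomotopic (R.isPath_onList hp)
      (show X.IsPath _ [] _ from rfl)).map F hF
    have h3 := h1.trans (h2.append_right (hc x))
    have h4 := h3.cancel_left (hc x)
    exact h4.trans (.invRev_append_self (hc x))

end TwoComplex

open OneComplex Relation

/-! ### Disc diagrams as combinatorial maps, and their elementary enlargements -/

namespace TwoComplex

/-- The sides of a planar complex: the outer one and the boundaries of the faces. -/
def sides (C : TwoComplex.{0}) (outer : List C.Dart) : Option C.Face → List C.Dart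
  | none => outer
  | some c => C.bdry c

/-- `y` is the oriented edge that follows `x` in the rotation about its initial vertex. -/
def Turns (C : TwoComplex.{0}) (outer : List C.Dart) (x y : C.Dart) : Prop :=
  ∃ i, (C.sides outer i).CycSucc (rev x) y

/-- The underlying complex of a van Kampen diagram, with its outer cycle. -/
structure IsDisc (C : TwoComplex.{0}) (outer : List C.Dart) : Prop where
  finite : C.IsFinite
  oneConnected : C.SimplyConnected
  bdry_ne_nil : ∀ c, C.bdry c ≠ []
  outer_ne_nil : outer = [] → IsEmpty C.Edge
  nodup : ∀ i, (C.sides outer i).Nodup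
  existsUnique : ∀ x : C.Dart, ∃! i, x ∈ C.sides outer i
  rotation : ∀ x y : C.Dart, C.dsrc x = C.dsrc y ↔ EqvGen (C.Turns outer) x y

namespace IsDisc

variable {C : TwoComplex.{0}} {outer : List C.Dart}

/-- Consecutive edges of a closed path meet in a vertex, so edges related by rotation always have
the same initial vertex. For a new diagram only the converse, that a vertex is a single cycle of the
rotation, needs an argument. -/
theorem rotation_of_forall (hcl : ∃ x, C.IsPath x outer x)
    (h : ∀ x y : C.Dart, C.dsrc x = C.dsrc y → EqvGen (C.Turns outer) x y) (x y : C.Dart) :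
    C.dsrc x = C.dsrc y ↔ EqvGen (C.Turns outer) x y := by
  refine ⟨h x y, fun hxy => ?_⟩
  induction hxy with
  | refl x => rfl
  | symm x y _ ih => exact ih.symm
  | trans x y z _ _ ih ih' => exact ih.trans ih'
  | rel x y h =>
    obtain ⟨i, h⟩ := h
    have hi : ∃ x, C.IsPath x (C.sides outer i) x := by
      cases i with
      | none => exact hcl
      | some c => exact C.bdry_closed c
    obtain ⟨z, hz⟩ := hi
    rw [← hz.cycSucc h, dtgt_rev]

variable (h : C.IsDisc outer)
include h

theorem turns_src {x y : C.Dart} (hxy : C.Turns outer x y) : C.dsrc x = C.dsrc y :=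
  (h.rotation x y).2 (.rel _ _ hxy)

theorem outer_closed : ∃ x, C.IsPath x outer x := by
  have := h.oneConnected.1.1
  refine exists_isPath_of_cycSucc fun d e hde => ?_
  rw [← dsrc_rev]
  exact h.turns_src ⟨none, by rwa [rev_rev]⟩

theorem finite_dart : Finite C.Dart := by
  have := h.finite.2.1
  infer_instance

theorem turns_right_unique {x y z : C.Dart} (hy : C.Turns outer x y) (hz : C.Turns outer x z) :
    y = z := by
  obtain ⟨i, hi⟩ := hy
  obtain ⟨j, hj⟩ := hz
  obtain rfl := (h.existsUnique (rev x)).unique hi.mem_left hj.mem_left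
  exact hi.right_unique (h.nodup i) hj

theorem turns_left_unique {x y z : C.Dart} (hx : C.Turns outer x z) (hy : C.Turns outer y z) :
    x = y := by
  obtain ⟨i, hi⟩ := hx
  obtain ⟨j, hj⟩ := hy
  obtain rfl := (h.existsUnique z).unique hi.mem_right hj.mem_right
  exact rev_injective (hi.left_unique (h.nodup i) hj)

theorem exists_turns (x : C.Dart) : ∃ y, C.Turns outer x y := by
  obtain ⟨i, hi, -⟩ := h.existsUnique (rev x)
  obtain ⟨y, hy⟩ := List.exists_cycSucc hi
  exact ⟨y, i, hy⟩

/-- Rotation as a permutation. -/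
theorem exists_turn : ∃ f : C.Dart → C.Dart, Function.Injective f ∧
    ∀ x y, C.Turns outer x y ↔ f x = y := by
  choose f hf using h.exists_turns
  refine ⟨f, fun x y hxy => ?_, fun x y => ⟨fun hxy => h.turns_right_unique (hf x) hxy, ?_⟩⟩
  · exact h.turns_left_unique (hf x) (hxy ▸ hf y)
  · rintro rfl; exact hf x

theorem eq_side {x : C.Dart} {i j : Option C.Face} (hi : x ∈ C.sides outer i)
    (hj : x ∈ C.sides outer j) : i = j := (h.existsUnique x).unique hi hj

theorem notMem_bdry {x : C.Dart} (hx : x ∈ outer) (c : C.Face) : x ∉ C.bdry c := fun hc => by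
  simpa using h.eq_side (i := none) (j := some c) hx hc

theorem rotate {outer' : List C.Dart} (r : outer ~r outer') : C.IsDisc outer' := by
  have hmem : ∀ i x, x ∈ C.sides outer i ↔ x ∈ C.sides outer' i := by
    rintro (_ | c) x
    · exact r.mem_iff
    · rfl
  have hturn : C.Turns outer = C.Turns outer' := by
    ext x y
    constructor
    · rintro ⟨_ | c, hi⟩
      · exact ⟨none, List.CycSucc.of_isRotated hi r⟩
      · exact ⟨some c, hi⟩
    · rintro ⟨_ | c, hi⟩
      · exact ⟨none, List.CycSucc.of_isRotated hi r.symm⟩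
      · exact ⟨some c, hi⟩
  refine ⟨h.finite, h.oneConnected, h.bdry_ne_nil, ?_, ?_, ?_, ?_⟩
  · rintro rfl
    exact h.outer_ne_nil (by simpa using r)
  · rintro (_ | c)
    · exact r.nodup_iff.1 (h.nodup none)
    · exact h.nodup (some c)
  · intro x
    simpa only [hmem] using h.existsUnique x
  · rw [← hturn]; exact h.rotation

end IsDisc

/-! ### The trivial diagram -/

/-- A single vertex. -/
def point : TwoComplex.{0} where
  Vert := Unit
  Edge := Empty
  src := Empty.elim
  tgt := Empty.elim
  Face := Empty
  bdry := fun c => c.elim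
  bdry_closed := fun c => c.elim

theorem isDisc_point : point.IsDisc [] where
  finite := ⟨inferInstanceAs (Finite Unit), inferInstanceAs (Finite Empty),
    inferInstanceAs (Finite Empty)⟩
  oneConnected := by
    refine ⟨⟨⟨()⟩, fun _ _ => ⟨⟨[], rfl⟩⟩⟩, fun _ p => ?_⟩
    obtain ⟨_ | ⟨d, p⟩, hp⟩ := p
    · exact .refl _
    · exact d.1.elim
  bdry_ne_nil := fun c => c.elim
  outer_ne_nil := fun _ => inferInstanceAs (IsEmpty Empty)
  nodup := by
    rintro (_ | c)
    · exact List.nodup_nil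
    · exact c.elim
  existsUnique := fun x => x.1.elim
  rotation := fun x => x.1.elim

/-! ### Adding an edge with a free end -/

section Embed

variable {E : Type u}

/-- The oriented edges, after a new edge has been added. -/
def someDart (d : E × Bool) : Option E × Bool := (some d.1, d.2)

theorem someDart_injective : Function.Injective (someDart : E × Bool → Option E × Bool) := by
  rintro ⟨a, b⟩ ⟨c, d⟩ h
  simpa [someDart] using h

theorem someDart_ne (d : E × Bool) (b : Bool) : someDart d ≠ (none, b) := by
  simp [someDart]

theorem dart_cases (d : Option E × Bool) :
    d = (none, true) ∨ d = (none, false) ∨ ∃ d', d = someDart d' := by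
  rcases d with ⟨_ | e, _ | _⟩
  · simp
  · simp
  · exact .inr (.inr ⟨(e, false), rfl⟩)
  · exact .inr (.inr ⟨(e, true), rfl⟩)

end Embed

variable (C : TwoComplex.{0}) (v z : C.Vert)

/-- The graph of `C`, with an edge with a free end attached at `v`. -/
def hairGraph : OneComplex.{0} where
  Vert := Option C.Vert
  Edge := Option C.Edge
  src e := e.elim (some v) fun e => some (C.src e)
  tgt e := e.elim none fun e => some (C.tgt e)

/-- The old oriented edges. -/
def hairDart : C.Dart → (C.hairGraph v).Dart := someDart

/-- The new edge. -/
def hairNew : (C.hairGraph v).Dart := (none, true)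

theorem hairGraph_dsrc (d : C.Dart) :
    (C.hairGraph v).dsrc (C.hairDart v d) = some (C.dsrc d) := by
  obtain ⟨e, _ | _⟩ := d <;> rfl

theorem hairGraph_dtgt (d : C.Dart) :
    (C.hairGraph v).dtgt (C.hairDart v d) = some (C.dtgt d) := by
  obtain ⟨e, _ | _⟩ := d <;> rfl

theorem hairNew_dsrc : (C.hairGraph v).dsrc (C.hairNew v) = some v := rfl
theorem hairNew_dtgt : (C.hairGraph v).dtgt (C.hairNew v) = none := rfl
theorem hairDart_injective : Function.Injective (C.hairDart v) := someDart_injective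
theorem hairDart_ne (d : C.Dart) : C.hairDart v d ≠ C.hairNew v := someDart_ne d true
theorem hairDart_ne_rev (d : C.Dart) : C.hairDart v d ≠ rev (C.hairNew v) := someDart_ne d false
theorem hairDart_cases (d : (C.hairGraph v).Dart) :
    d = C.hairNew v ∨ d = rev (C.hairNew v) ∨ ∃ d', d = C.hairDart v d' := dart_cases d

variable {C v z}

theorem isPath_hairGraph {x y : C.Vert} {p : List C.Dart} (h : C.IsPath x p y) :
    (C.hairGraph v).IsPath (some x) (p.map (C.hairDart v)) (some y) := by
  induction p generalizing x with
  | nil => exact congrArg some h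
  | cons d p ih =>
    exact ⟨by rw [hairGraph_dsrc, h.1], by rw [hairGraph_dtgt]; exact ih h.2⟩

variable (C v z)

/-- `C` with an edge with a free end attached at `v`. -/
abbrev hair : TwoComplex.{0} where
  toOneComplex := C.hairGraph v
  Face := C.Face
  bdry c := (C.bdry c).map (C.hairDart v)
  bdry_closed c := by
    obtain ⟨x, hx⟩ := C.bdry_closed c
    exact ⟨some x, isPath_hairGraph hx⟩

/-- The inclusion in `C.hair v`. -/
def hairIncl : PathMap C.toOneComplex (C.hairGraph v) where
  onVert := some
  onEdge e := [(some e, true)]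
  isPath _ := ⟨rfl, rfl⟩

theorem hairIncl_onList (p : List C.Dart) :
    (C.hairIncl v).onList p = p.map (C.hairDart v) := by
  induction p with
  | nil => rfl
  | cons d p ih =>
    rw [PathMap.onList_cons, ih]
    obtain ⟨e, _ | _⟩ := d <;> rfl

variable {C v z}

theorem SimplyConnected.hair (h : C.SimplyConnected) : (C.hair v).SimplyConnected := by
  refine h.of_pathMap (C.hairIncl v) (fun c x hx => ?_)
    { onVert := fun x => x.getD v
      onEdge := fun e => e.elim [] fun e => [(e, true)]
      isPath := by rintro (_ | e) <;> first | exact rfl | exact ⟨rfl, rfl⟩ }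
    (fun x => x.elim [C.hairNew v] fun _ => []) ?_ ?_
  · rw [hairIncl_onList]
    exact PathHomotopic.face (X := C.hair v) c (isPath_hairGraph hx)
  · rintro (_ | x)
    · exact ⟨rfl, rfl⟩
    · exact rfl
  · rintro (_ | e)
    · exact .refl ⟨rfl, rfl⟩
    · exact .refl ⟨rfl, rfl⟩

/-- The hair is drawn in the outer face at the corner of the base point, so the new boundary runs
along it and back before following the old one. -/
theorem IsDisc.hair {outer : List C.Dart} (h : C.IsDisc outer) (hv : C.IsPath v outer v) :
    (C.hair v).IsDisc (C.hairNew v :: rev (C.hairNew v) :: outer.map (C.hairDart v)) := by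
  have hfin := h.finite
  set o := C.hairNew v :: rev (C.hairNew v) :: outer.map (C.hairDart v) with ho
  have ho' : o = [C.hairNew v, rev (C.hairNew v)] ++ outer.map (C.hairDart v) := rfl
  have hout : (C.hair v).IsPath (some v) o (some v) := ⟨rfl, rfl, isPath_hairGraph hv⟩
  -- All old rotation links persist except the one at the base point, between the end and the
  -- beginning of `outer`. It is subdivided into two links by the new edge.
  have hstep : ∀ x y, C.Turns outer x y →
      EqvGen ((C.hair v).Turns o) (C.hairDart v x) (C.hairDart v y) := by
    rintro x y ⟨_ | c, hi⟩
    · change outer.CycSucc (rev x) y at hi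
      rcases hi with hi | ⟨h1, h2⟩
      · refine .rel _ _ ⟨none, .inl ?_⟩
        change o.Linked (C.hairDart v (rev x)) (C.hairDart v y)
        rw [ho', List.linked_append]
        exact .inr (.inl (hi.map _))
      · have e1 : (C.hair v).Turns o (C.hairDart v x) (C.hairNew v) := by
          refine ⟨none, .inr ⟨?_, rfl⟩⟩
          change o.getLast? = some (C.hairDart v (rev x))
          rw [ho', List.getLast?_append, List.getLast?_map, h1]; rfl
        have e2 : (C.hair v).Turns o (C.hairNew v) (C.hairDart v y) := by
          refine ⟨none, .inl ?_⟩
          change o.Linked (rev (C.hairNew v)) (C.hairDart v y)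
          rw [ho', List.linked_append]
          refine .inr (.inr ⟨rfl, ?_⟩)
          rw [List.head?_map, h2]; rfl
        exact (EqvGen.rel _ _ e1).trans _ _ _ (.rel _ _ e2)
    · exact .rel _ _ ⟨some c, hi.map (C.hairDart v)⟩
  have hold : ∀ x y : C.Dart, C.dsrc x = C.dsrc y →
      EqvGen ((C.hair v).Turns o) (C.hairDart v x) (C.hairDart v y) :=
    fun x y hxy => EqvGen.map_of _ hstep ((h.rotation x y).1 hxy)
  have hnew : ∀ x : C.Dart, C.dsrc x = v →
      EqvGen ((C.hair v).Turns o) (C.hairNew v) (C.hairDart v x) := by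
    intro x hx
    cases outer with
    | nil => exact ((h.outer_ne_nil rfl).false x.1).elim
    | cons y l =>
      exact (EqvGen.rel _ _ ⟨none, .inl (.inr (.inl ⟨rfl, rfl⟩))⟩).trans _ _ _
        (hold y x (hv.1.trans hx.symm))
  refine ⟨?_, h.oneConnected.hair, ?_, fun h => by simp at h, ?_, ?_,
    IsDisc.rotation_of_forall ⟨_, hout⟩ ?_⟩
  · have := hfin.1; have := hfin.2.1; have := hfin.2.2
    exact ⟨inferInstanceAs (Finite (Option C.Vert)), inferInstanceAs (Finite (Option C.Edge)), this⟩
  · intro c hc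
    exact h.bdry_ne_nil c (List.map_eq_nil_iff.1 hc)
  · rintro (_ | c)
    · have := List.Nodup.map (C.hairDart_injective v) (h.nodup none)
      change o.Nodup
      rw [ho, List.nodup_cons, List.nodup_cons]
      refine ⟨?_, ?_, this⟩
      · rw [List.mem_cons, not_or]
        refine ⟨(rev_ne _).symm, fun h => ?_⟩
        obtain ⟨d, -, hd⟩ := List.mem_map.1 h
        exact C.hairDart_ne v d hd
      · intro h
        obtain ⟨d, -, hd⟩ := List.mem_map.1 h
        exact C.hairDart_ne_rev v d hd
    · exact List.Nodup.map (C.hairDart_injective v) (h.nodup (some c))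
  · intro x
    have hx : x = C.hairNew v ∨ x = rev (C.hairNew v) → ∃! i, x ∈ (C.hair v).sides o i := by
      intro hx
      refine ⟨none, ?_, ?_⟩
      · change x ∈ o
        rw [ho, List.mem_cons, List.mem_cons]; tauto
      · rintro (_ | c) hc
        · rfl
        · obtain ⟨d, -, hd⟩ := List.mem_map.1 hc
          rcases hx with hx | hx
          · exact (C.hairDart_ne v d (hd.trans hx)).elim
          · exact (C.hairDart_ne_rev v d (hd.trans hx)).elim
    rcases C.hairDart_cases v x with hx' | hx' | ⟨d, rfl⟩
    · exact hx (.inl hx')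
    · exact hx (.inr hx')
    · have hmem : ∀ i : Option C.Face, C.hairDart v d ∈ (C.hair v).sides o i ↔
          d ∈ C.sides outer i := by
        rintro (_ | c)
        · change C.hairDart v d ∈ o ↔ d ∈ outer
          rw [ho, List.mem_cons, List.mem_cons, List.mem_map_of_injective (C.hairDart_injective v)]
          have := C.hairDart_ne v d; have := C.hairDart_ne_rev v d
          tauto
        · exact List.mem_map_of_injective (C.hairDart_injective v)
      obtain ⟨i, hi, hu⟩ := h.existsUnique d
      exact ⟨i, (hmem i).2 hi, fun j hj => hu j ((hmem j).1 hj)⟩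
  · intro x y hxy
    change (C.hairGraph v).dsrc x = (C.hairGraph v).dsrc y at hxy
    rcases C.hairDart_cases v x with rfl | rfl | ⟨x, rfl⟩ <;>
      rcases C.hairDart_cases v y with rfl | rfl | ⟨y, rfl⟩ <;>
      simp only [dsrc_rev, hairNew_dsrc, hairNew_dtgt, hairGraph_dsrc, reduceCtorEq] at hxy
    · exact .refl _
    · exact hnew y (Option.some.inj hxy.symm)
    · exact .refl _
    · exact (hnew x (Option.some.inj hxy)).symm
    · exact hold x y (Option.some.inj hxy)

/-! ### Adding an edge that cuts off a new face -/

variable (C v z)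

/-- The graph of `C`, with an edge from `v` to `z` attached. -/
def chordGraph : OneComplex.{0} where
  Vert := C.Vert
  Edge := Option C.Edge
  src e := e.elim v C.src
  tgt e := e.elim z C.tgt

/-- The old oriented edges. -/
def chordDart : C.Dart → (C.chordGraph v z).Dart := someDart

/-- The new edge. -/
def chordNew : (C.chordGraph v z).Dart := (none, true)

theorem chordGraph_dsrc (d : C.Dart) :
    (C.chordGraph v z).dsrc (C.chordDart v z d) = C.dsrc d := by
  obtain ⟨e, _ | _⟩ := d <;> rfl

theorem chordGraph_dtgt (d : C.Dart) :
    (C.chordGraph v z).dtgt (C.chordDart v z d) = C.dtgt d := by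
  obtain ⟨e, _ | _⟩ := d <;> rfl

theorem chordNew_dsrc : (C.chordGraph v z).dsrc (C.chordNew v z) = v := rfl
theorem chordNew_dtgt : (C.chordGraph v z).dtgt (C.chordNew v z) = z := rfl
theorem chordDart_injective : Function.Injective (C.chordDart v z) := someDart_injective
theorem chordDart_ne (d : C.Dart) : C.chordDart v z d ≠ C.chordNew v z := someDart_ne d true
theorem chordDart_ne_rev (d : C.Dart) : C.chordDart v z d ≠ rev (C.chordNew v z) :=
  someDart_ne d false
theorem chordDart_cases (d : (C.chordGraph v z).Dart) :
    d = C.chordNew v z ∨ d = rev (C.chordNew v z) ∨ ∃ d', d = C.chordDart v z d' := dart_cases d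

variable {C v z}

theorem isPath_chordGraph {x y : C.Vert} {p : List C.Dart} (h : C.IsPath x p y) :
    (C.chordGraph v z).IsPath x (p.map (C.chordDart v z)) y := by
  induction p generalizing x with
  | nil => exact h
  | cons d p ih =>
    exact ⟨by rw [chordGraph_dsrc, h.1], by rw [chordGraph_dtgt]; exact ih h.2⟩

/-- `C` with an edge from `v` to `z` attached, and a face between this edge and a path `u`. -/
abbrev chord {u : List C.Dart} (hu : C.IsPath v u z) : TwoComplex.{0} where
  toOneComplex := C.chordGraph v z
  Face := Option C.Face
  bdry c := c.elim (u.map (C.chordDart v z) ++ [rev (C.chordNew v z)])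
    fun c => (C.bdry c).map (C.chordDart v z)
  bdry_closed := by
    rintro (_ | c)
    · exact ⟨v, IsPath.append (isPath_chordGraph hu) ⟨rfl, rfl⟩⟩
    · obtain ⟨x, hx⟩ := C.bdry_closed c
      exact ⟨x, isPath_chordGraph hx⟩

variable (C v z)

/-- The inclusion in `chord`. -/
def chordIncl : PathMap C.toOneComplex (C.chordGraph v z) where
  onVert := id
  onEdge e := [(some e, true)]
  isPath _ := ⟨rfl, rfl⟩

theorem chordIncl_onList (p : List C.Dart) :
    (C.chordIncl v z).onList p = p.map (C.chordDart v z) := by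
  induction p with
  | nil => rfl
  | cons d p ih =>
    rw [PathMap.onList_cons, ih]
    obtain ⟨e, _ | _⟩ := d <;> rfl

variable {C v z}

/-- The new edge is homotopic to `u` across the new face, so mapping it to `u` gives a retraction
onto `C`. -/
theorem SimplyConnected.chord (h : C.SimplyConnected) {u : List C.Dart} (hu : C.IsPath v u z) :
    (TwoComplex.chord hu).SimplyConnected := by
  refine h.of_pathMap (Y := TwoComplex.chord hu) (C.chordIncl v z) (fun c x hx => ?_)
    { onVert := id
      onEdge := fun e => e.elim u fun e => [(e, true)]
      isPath := by
        rintro (_ | e)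
        · exact hu
        · exact ⟨rfl, rfl⟩ } (fun _ => []) (fun _ => rfl) ?_
  · rw [chordIncl_onList]
    exact PathHomotopic.face (X := TwoComplex.chord hu) (some c) (isPath_chordGraph hx)
  · rintro (_ | e)
    · rw [List.append_nil]
      change PathHomotopic (TwoComplex.chord hu) v z [C.chordNew v z] ((C.chordIncl v z).onList u)
      rw [chordIncl_onList]
      refine (PathHomotopic.of_append_invRev (X := TwoComplex.chord hu) (isPath_chordGraph hu)
        (isPath_singleton (X := C.chordGraph v z) (C.chordNew v z)) ?_).symm
      exact PathHomotopic.face (X := TwoComplex.chord hu) none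
        (IsPath.append (isPath_chordGraph hu) ⟨rfl, rfl⟩)
    · exact .refl ⟨rfl, rfl⟩

/-- The chord is drawn in the outer face. It divides this face into a new 2-cell, which borders on
`u`, and the new outer face, which borders on `b`. -/
theorem IsDisc.chord {u b : List C.Dart} (h : C.IsDisc (u ++ b)) (hu : C.IsPath v u z)
    (hb : C.IsPath z b v) :
    (TwoComplex.chord hu).IsDisc (C.chordNew v z :: b.map (C.chordDart v z)) := by
  have hfin := h.finite
  set o := C.chordNew v z :: b.map (C.chordDart v z) with ho
  have ho' : o = [C.chordNew v z] ++ b.map (C.chordDart v z) := rfl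
  set f := u.map (C.chordDart v z) ++ [rev (C.chordNew v z)] with hf
  have hf0 : (TwoComplex.chord hu).sides o (some none) = f := rfl
  set T := (TwoComplex.chord hu).Turns o with hT
  set ι := C.chordDart v z with hι
  set δ := C.chordNew v z with hδ
  have hinj : Function.Injective ι := C.chordDart_injective v z
  have hne : ∀ d, ι d ≠ δ := C.chordDart_ne v z
  have hne' : ∀ d, ι d ≠ rev δ := C.chordDart_ne_rev v z
  have hout : (TwoComplex.chord hu).IsPath v o v := ⟨rfl, isPath_chordGraph hb⟩
  -- The links of the new rotation: `f1` to `f3'` come from the corners of the new face, `f4` to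
  -- `f6'` from those of the new outer face. The primed versions treat an empty `u` or an empty `b`,
  -- where the chord is a loop and its two ends are adjacent in the rotation.
  have f1 : ∀ x y, u.Linked (rev x) y → T (ι x) (ι y) := fun x y hxy => by
    refine ⟨some none, .inl ?_⟩
    rw [hf0, hf, List.linked_append]
    exact .inl (hxy.map ι)
  have f2 : ∀ x, u.getLast? = some (rev x) → T (ι x) (rev δ) := fun x hx => by
    refine ⟨some none, .inl ?_⟩
    rw [hf0, hf, List.linked_append, List.getLast?_map, hx]
    exact .inr (.inr ⟨rfl, rfl⟩)
  have f3 : ∀ y, u.head? = some y → T δ (ι y) := fun y hy => by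
    refine ⟨some none, .inr ?_⟩
    rw [hf0, hf, List.head?_append, List.head?_map, hy]
    exact ⟨List.getLast?_concat, rfl⟩
  have f3' : u.head? = none → T δ (rev δ) := fun hy => by
    refine ⟨some none, .inr ?_⟩
    rw [hf0, hf, List.head?_append, List.head?_map, hy]
    exact ⟨List.getLast?_concat, rfl⟩
  have f4 : ∀ x y, b.Linked (rev x) y → T (ι x) (ι y) := fun x y hxy => by
    refine ⟨none, .inl ?_⟩
    change o.Linked _ _
    rw [ho', List.linked_append]
    exact .inr (.inl (hxy.map ι))
  have f5 : ∀ y, b.head? = some y → T (rev δ) (ι y) := fun y hy => by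
    refine ⟨none, .inl ?_⟩
    change o.Linked _ _
    rw [ho', List.linked_append, List.head?_map, hy, rev_rev]
    exact .inr (.inr ⟨rfl, rfl⟩)
  have f6 : ∀ x, b.getLast? = some (rev x) → T (ι x) δ := fun x hx => by
    refine ⟨none, .inr ⟨?_, rfl⟩⟩
    change o.getLast? = _
    rw [ho', List.getLast?_append, List.getLast?_map, hx]
    rfl
  have f6' : b.getLast? = none → T (rev δ) δ := fun hx => by
    refine ⟨none, .inr ⟨?_, rfl⟩⟩
    change o.getLast? = _
    rw [ho', List.getLast?_append, List.getLast?_map, hx, rev_rev]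
    rfl
  have g1 : ∀ x, (u ++ b).getLast? = some (rev x) → EqvGen T (ι x) δ := by
    intro x hx
    rw [List.getLast?_append] at hx
    cases hb' : b.getLast? with
    | none =>
      rw [hb'] at hx
      exact (EqvGen.rel _ _ (f2 x hx)).trans _ _ _ (.rel _ _ (f6' hb'))
    | some d =>
      rw [hb'] at hx
      exact .rel _ _ (f6 x (hb'.trans hx))
  have g2 : ∀ y, (u ++ b).head? = some y → EqvGen T δ (ι y) := by
    intro y hy
    rw [List.head?_append] at hy
    cases hu' : u.head? with
    | none =>
      rw [hu'] at hy
      exact (EqvGen.rel _ _ (f3' hu')).trans _ _ _ (.rel _ _ (f5 y hy))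
    | some d =>
      rw [hu'] at hy
      exact .rel _ _ (f3 y (hu'.trans hy))
  -- The old corners of the outer face that the chord divides are those at its two ends. The corner
  -- between `u` and `b` is now passed through `rev δ`, the corner at the base point through `δ`,
  -- and also through the other end of the chord if `u` or `b` is empty.
  have hstep : ∀ x y, C.Turns (u ++ b) x y → EqvGen T (ι x) (ι y) := by
    rintro x y ⟨_ | c, hi⟩
    · rcases hi with hi | ⟨h1, h2⟩
      · rcases List.linked_append.1 hi with hi | hi | ⟨h1, h2⟩
        · exact .rel _ _ (f1 x y hi)
        · exact .rel _ _ (f4 x y hi)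
        · exact (EqvGen.rel _ _ (f2 x h1)).trans _ _ _ (.rel _ _ (f5 y h2))
      · exact (g1 x h1).trans _ _ _ (g2 y h2)
    · exact .rel _ _ ⟨some (some c), hi.map ι⟩
  have hold : ∀ x y : C.Dart, C.dsrc x = C.dsrc y → EqvGen T (ι x) (ι y) :=
    fun x y hxy => EqvGen.map_of ι hstep ((h.rotation x y).1 hxy)
  have hnew : ∀ x : C.Dart, C.dsrc x = v → EqvGen T δ (ι x) := by
    intro x hx
    cases hn : (u ++ b).head? with
    | none => exact ((h.outer_ne_nil (List.head?_eq_none_iff.1 hn)).false x.1).elim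
    | some y =>
      exact (g2 y hn).trans _ _ _ (hold y x (((hu.append hb).src_of_head hn).trans hx.symm))
  have hnew' : ∀ x : C.Dart, C.dsrc x = z → EqvGen T (rev δ) (ι x) := by
    intro x hx
    cases hb' : b.head? with
    | none =>
      have hb0 := List.head?_eq_none_iff.1 hb'
      refine (EqvGen.rel _ _ (f6' (List.getLast?_eq_none_iff.2 hb0))).trans _ _ _ (hnew x ?_)
      rw [hb0] at hb
      exact hx.trans hb
    | some y =>
      exact (EqvGen.rel _ _ (f5 y hb')).trans _ _ _
        (hold y x ((hb.src_of_head hb').trans hx.symm))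
  have hboth : v = z → EqvGen T δ (rev δ) := by
    intro hvz
    cases hn : (u ++ b).head? with
    | none =>
      refine .rel _ _ (f3' ?_)
      rw [List.head?_eq_none_iff, List.append_eq_nil_iff] at hn
      exact List.head?_eq_none_iff.2 hn.1
    | some y =>
      have hy : C.dsrc y = v := (hu.append hb).src_of_head hn
      exact (hnew y hy).trans _ _ _ ((hnew' y (hy.trans hvz)).symm)
  have hn := h.nodup none
  change (u ++ b).Nodup at hn
  rw [List.nodup_append] at hn
  refine ⟨?_, h.oneConnected.chord hu, ?_, fun h => by simp [ho] at h, ?_, ?_,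
    IsDisc.rotation_of_forall ⟨_, hout⟩ ?_⟩
  · have := hfin.1; have := hfin.2.1; have := hfin.2.2
    exact ⟨hfin.1, inferInstanceAs (Finite (Option C.Edge)),
      inferInstanceAs (Finite (Option C.Face))⟩
  · rintro (_ | c) hc
    · change f = [] at hc
      simp [hf] at hc
    · exact h.bdry_ne_nil c (List.map_eq_nil_iff.1 hc)
  · rintro (_ | _ | c)
    · change o.Nodup
      rw [ho, List.nodup_cons]
      refine ⟨fun h => ?_, List.Nodup.map hinj hn.2.1⟩
      obtain ⟨d, -, hd⟩ := List.mem_map.1 h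
      exact hne d hd
    · change f.Nodup
      rw [hf, List.nodup_append]
      refine ⟨List.Nodup.map hinj hn.1, List.nodup_singleton _, ?_⟩
      rintro a ha b hb rfl
      obtain ⟨d, -, hd⟩ := List.mem_map.1 ha
      exact hne' d (hd.trans (List.mem_singleton.1 hb))
    · exact List.Nodup.map hinj (h.nodup (some c))
  · intro x
    have k0 : x ∈ (TwoComplex.chord hu).sides o none ↔ x = δ ∨ ∃ d ∈ b, ι d = x := by
      change x ∈ o ↔ _
      rw [ho, List.mem_cons, List.mem_map]
    have k1 : x ∈ (TwoComplex.chord hu).sides o (some none) ↔ (∃ d ∈ u, ι d = x) ∨ x = rev δ := by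
      rw [hf0, hf, List.mem_append, List.mem_map, List.mem_singleton]
    have k2 : ∀ c, x ∈ (TwoComplex.chord hu).sides o (some (some c)) ↔
        ∃ d ∈ C.bdry c, ι d = x := fun c => List.mem_map
    rcases C.chordDart_cases v z x with hx | hx | ⟨d, rfl⟩
    · refine ⟨none, k0.2 (.inl hx), ?_⟩
      rintro (_ | _ | c) hc
      · rfl
      · rcases k1.1 hc with ⟨d, -, hd⟩ | hd
        · exact (hne d (hd.trans hx)).elim
        · exact (rev_ne δ (hd.symm.trans hx)).elim
      · obtain ⟨d, -, hd⟩ := (k2 c).1 hc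
        exact (hne d (hd.trans hx)).elim
    · refine ⟨some none, k1.2 (.inr hx), ?_⟩
      rintro (_ | _ | c) hc
      · rcases k0.1 hc with hd | ⟨d, -, hd⟩
        · exact (rev_ne δ (hx.symm.trans hd)).elim
        · exact (hne' d (hd.trans hx)).elim
      · rfl
      · obtain ⟨d, -, hd⟩ := (k2 c).1 hc
        exact (hne' d (hd.trans hx)).elim
    · have l0 : ι d ∈ (TwoComplex.chord hu).sides o none → d ∈ b := fun hc => by
        rcases k0.1 hc with hd | ⟨d', hd', hd⟩
        · exact (hne d hd).elim
        · exact hinj hd ▸ hd'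
      have l1 : ι d ∈ (TwoComplex.chord hu).sides o (some none) → d ∈ u := fun hc => by
        rcases k1.1 hc with ⟨d', hd', hd⟩ | hd
        · exact hinj hd ▸ hd'
        · exact (hne' d hd).elim
      have l2 : ∀ c, ι d ∈ (TwoComplex.chord hu).sides o (some (some c)) → d ∈ C.bdry c :=
        fun c hc => by
          obtain ⟨d', hd', hd⟩ := (k2 c).1 hc
          exact hinj hd ▸ hd'
      obtain ⟨i, hi, huniq⟩ := h.existsUnique d
      rcases i with _ | c
      · rcases List.mem_append.1 hi with hi' | hi'
        · refine ⟨some none, k1.2 (.inl ⟨d, hi', rfl⟩), ?_⟩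
          rintro (_ | _ | c) hc
          · exact (hn.2.2 _ hi' _ (l0 hc) rfl).elim
          · rfl
          · exact (h.notMem_bdry hi c (l2 c hc)).elim
        · refine ⟨none, k0.2 (.inr ⟨d, hi', rfl⟩), ?_⟩
          rintro (_ | _ | c) hc
          · rfl
          · exact (hn.2.2 _ (l1 hc) _ hi' rfl).elim
          · exact (h.notMem_bdry hi c (l2 c hc)).elim
      · refine ⟨some (some c), (k2 c).2 ⟨d, hi, rfl⟩, ?_⟩
        rintro (_ | _ | c') hc
        · exact (h.notMem_bdry (List.mem_append.2 (.inr (l0 hc))) c hi).elim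
        · exact (h.notMem_bdry (List.mem_append.2 (.inl (l1 hc))) c hi).elim
        · rw [huniq (some c') (l2 c' hc)]
  · intro x y hxy
    change (C.chordGraph v z).dsrc x = (C.chordGraph v z).dsrc y at hxy
    rcases C.chordDart_cases v z x with rfl | rfl | ⟨x, rfl⟩ <;>
      rcases C.chordDart_cases v z y with rfl | rfl | ⟨y, rfl⟩ <;>
      simp only [dsrc_rev, chordNew_dsrc, chordNew_dtgt, chordGraph_dsrc] at hxy
    · exact .refl _
    · exact hboth hxy
    · exact hnew y hxy.symm
    · exact (hboth hxy.symm).symm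
    · exact .refl _
    · exact hnew' y hxy.symm
    · exact (hnew x hxy).symm
    · exact (hnew' x hxy).symm
    · exact hold x y hxy

end TwoComplex

open OneComplex Relation

/-! ### Sums around closed paths -/

namespace List

theorem sum_map_add_of_linked {α : Type u} {f g : α → ℤ} (a : α) (l : List α)
    (h : ∀ x y, (a :: l).Linked x y → f x = g y) :
    ((a :: l).map f).sum + g a = f ((a :: l).getLast (by simp)) + ((a :: l).map g).sum := by
  induction l generalizing a with
  | nil => simp
  | cons b l ih =>
    have h1 := ih b fun x y hxy => h x y (.inr hxy)
    have h2 := h a b (.inl ⟨rfl, rfl⟩)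
    rw [map_cons, sum_cons, map_cons (f := g), sum_cons, getLast_cons (by simp)]
    omega

/-- Passing to the cyclic successor only reindexes the sum. This is used with the indicator function
of a set of oriented edges that is constant around a face. -/
theorem sum_map_eq_of_cycSucc {α : Type u} {f g : α → ℤ} {l : List α}
    (h : ∀ x y, l.CycSucc x y → f x = g y) : (l.map f).sum = (l.map g).sum := by
  cases l with
  | nil => rfl
  | cons a l =>
    have h1 := sum_map_add_of_linked a l fun x y hxy => h x y (.inl hxy)
    have h2 := h ((a :: l).getLast (by simp)) a (.inr ⟨getLast?_eq_some_getLast _, rfl⟩)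
    omega

theorem sum_map_sub_int {α : Type u} (f g : α → ℤ) (l : List α) :
    (l.map fun x => f x - g x).sum = (l.map f).sum - (l.map g).sum := by
  induction l with
  | nil => rfl
  | cons a l ih => simp only [map_cons, sum_cons, ih]; ring

end List

namespace TwoComplex

/-! ### Cocycles -/

section Cocycle

variable {X : TwoComplex.{u}} {c : X.Dart → ℤ} (hrev : ∀ d, c (rev d) = - c d)
  (hface : ∀ F, ((X.bdry F).map c).sum = 0)
include hrev hface

theorem PathHomotopic.sum_eq {x y : X.Vert} {p q : List X.Dart} (h : X.PathHomotopic x y p q) :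
    (p.map c).sum = (q.map c).sum := by
  obtain ⟨hp, hq, h⟩ := h
  suffices H : ∀ p q : X.Path x y, X.Homotopic p q → (p.1.map c).sum = (q.1.map c).sum from H _ _ h
  intro p q h
  induction h with
  | refl p => rfl
  | symm p q _ ih => exact ih.symm
  | trans p q r _ _ ih ih' => exact ih.trans ih'
  | rel p q h =>
    obtain ⟨p, hp⟩ := p
    obtain ⟨q, hq⟩ := q
    dsimp only at h ⊢
    cases h with
    | cancel a b d => simp [hrev]
    | face a b F => simp [hface]

/-- The potential is the sum of `c` along any path from `x`; by `PathHomotopic.sum_eq` and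
1-connectedness the choice of the path does not matter. -/
theorem SimplyConnected.exists_potential (h : X.SimplyConnected) (x : X.Vert) :
    ∃ s : X.Vert → ℤ, s x = 0 ∧ ∀ d, s (X.dtgt d) = s (X.dsrc d) + c d := by
  have p : ∀ y, X.Path x y := fun y => (h.1.2 x y).some
  refine ⟨fun y => ((p y).1.map c).sum, ?_, fun d => ?_⟩
  · simpa using (h.pathHomotopic (p x).2 (show X.IsPath x [] x from rfl)).sum_eq hrev hface
  · have := (h.pathHomotopic (p (X.dtgt d)).2
      ((p (X.dsrc d)).2.append (isPath_singleton d))).sum_eq hrev hface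
    simpa using this

end Cocycle

/-! ### Subcomplexes that are retracts -/

section Sub

variable (C : TwoComplex.{0}) (V : C.Vert → Prop) (E : C.Edge → Prop)
  (hE : ∀ d : C.Dart, E d.1 → V (C.dsrc d))

/-- The subgraph with vertices `V` and edges `E`. -/
def subGraph : OneComplex.{0} where
  Vert := {v // V v}
  Edge := {e // E e}
  src e := ⟨C.src e.1, hE (e.1, true) e.2⟩
  tgt e := ⟨C.tgt e.1, hE (e.1, false) e.2⟩

/-- The inclusion of the oriented edges. -/
def subDart (d : (C.subGraph V E hE).Dart) : C.Dart := (d.1.1, d.2)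

theorem subDart_injective : Function.Injective (C.subDart V E hE) := by
  rintro ⟨⟨a, ha⟩, b⟩ ⟨⟨c, hc⟩, d⟩ h
  simp only [subDart, Prod.mk.injEq] at h
  obtain ⟨rfl, rfl⟩ := h
  rfl

theorem subDart_prop (d : (C.subGraph V E hE).Dart) : E (C.subDart V E hE d).1 := d.1.2

theorem subGraph_dsrc (d : (C.subGraph V E hE).Dart) :
    ((C.subGraph V E hE).dsrc d).1 = C.dsrc (C.subDart V E hE d) := by
  obtain ⟨e, _ | _⟩ := d <;> rfl

theorem subGraph_dtgt (d : (C.subGraph V E hE).Dart) :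
    ((C.subGraph V E hE).dtgt d).1 = C.dtgt (C.subDart V E hE d) := by
  obtain ⟨e, _ | _⟩ := d <;> rfl

/-- A list of oriented edges of the subgraph. -/
def subList (p : List C.Dart) (h : ∀ d ∈ p, E d.1) : List (C.subGraph V E hE).Dart :=
  p.pmap (fun d hd => (⟨d.1, hd⟩, d.2)) h

theorem subList_map (p : List C.Dart) (h : ∀ d ∈ p, E d.1) :
    (C.subList V E hE p h).map (C.subDart V E hE) = p := by
  rw [subList, List.map_pmap]
  exact (List.pmap_eq_map h).trans (List.map_id p)

variable {C V E}

theorem isPath_subGraph {x y : (C.subGraph V E hE).Vert} {p : List (C.subGraph V E hE).Dart}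
    (h : C.IsPath x.1 (p.map (C.subDart V E hE)) y.1) : (C.subGraph V E hE).IsPath x p y := by
  induction p generalizing x with
  | nil => exact Subtype.ext h
  | cons d p ih =>
    refine ⟨Subtype.ext ((C.subGraph_dsrc V E hE d).trans h.1), ih ?_⟩
    rw [subGraph_dtgt]
    exact h.2

variable (C V E)

theorem exists_isPath_subGraph [Nonempty {v // V v}] {p : List (C.subGraph V E hE).Dart}
    (h : ∃ x, C.IsPath x (p.map (C.subDart V E hE)) x) :
    ∃ x, (C.subGraph V E hE).IsPath x p x := by
  obtain ⟨x, hx⟩ := h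
  cases p with
  | nil => exact ⟨Classical.arbitrary {v // V v}, rfl⟩
  | cons d p =>
    refine ⟨(C.subGraph V E hE).dsrc d, isPath_subGraph hE ?_⟩
    rw [subGraph_dsrc, hx.1]
    exact hx

/-- The subcomplex with vertices `V`, edges `E`, and the faces all of whose edges are in `E`. -/
abbrev sub [Nonempty {v // V v}] : TwoComplex.{0} where
  toOneComplex := C.subGraph V E hE
  Face := {c : C.Face // ∀ d ∈ C.bdry c, E d.1}
  bdry c := C.subList V E hE (C.bdry c.1) c.2
  bdry_closed c := C.exists_isPath_subGraph V E hE (by rw [subList_map]; exact C.bdry_closed c.1)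

/-- The inclusion of the subgraph. -/
def subIncl : PathMap (C.subGraph V E hE) C.toOneComplex where
  onVert := Subtype.val
  onEdge e := [(e.1, true)]
  isPath _ := ⟨rfl, rfl⟩

open Classical in
/-- The retraction to the subgraph which collapses everything else to a vertex, on vertices. -/
noncomputable def subRetrVert (u : (C.subGraph V E hE).Vert) (v : C.Vert) :
    (C.subGraph V E hE).Vert := if h : V v then ⟨v, h⟩ else u

open Classical in
/-- The retraction to the subgraph which collapses everything else to a vertex, on edges. -/
noncomputable def subRetrEdge (e : C.Edge) : List (C.subGraph V E hE).Dart :=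
  if h : E e then [(⟨e, h⟩, true)] else []

theorem subRetrVert_val (u x : (C.subGraph V E hE).Vert) : C.subRetrVert V E hE u x.1 = x :=
  dif_pos x.2

theorem subRetrVert_eq {u : (C.subGraph V E hE).Vert} {v : C.Vert} (h : V v → v = u.1) :
    C.subRetrVert V E hE u v = u := by
  by_cases h' : V v
  · exact (dif_pos h').trans (Subtype.ext (h h'))
  · exact dif_neg h'

theorem subRetrEdge_val (e : (C.subGraph V E hE).Edge) :
    C.subRetrEdge V E hE e.1 = [(e, true)] := dif_pos e.2

theorem subRetrEdge_eq_nil {e : C.Edge} (h : ¬ E e) : C.subRetrEdge V E hE e = [] := dif_neg h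

/-- The retraction to the subgraph which collapses everything else to a vertex. -/
noncomputable def subRetr (u : (C.subGraph V E hE).Vert)
    (hu : ∀ d : C.Dart, ¬ E d.1 → V (C.dsrc d) → C.dsrc d = u.1) :
    PathMap C.toOneComplex (C.subGraph V E hE) where
  onVert := C.subRetrVert V E hE u
  onEdge := C.subRetrEdge V E hE
  isPath e := by
    by_cases h : E e
    · have h0 := C.subRetrEdge_val V E hE ⟨e, h⟩
      have h1 := C.subRetrVert_val V E hE u ((C.subGraph V E hE).src ⟨e, h⟩)
      have h2 := C.subRetrVert_val V E hE u ((C.subGraph V E hE).tgt ⟨e, h⟩)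
      refine (congrArg₂ (fun x y => (C.subGraph V E hE).IsPath x _ y) h1 h2).mpr ?_
      rw [h0]
      exact ⟨rfl, rfl⟩
    · rw [subRetrEdge_eq_nil _ _ _ _ h]
      exact (C.subRetrVert_eq V E hE (hu (e, true) h)).trans
        (C.subRetrVert_eq V E hE (hu (e, false) h)).symm

theorem subRetr_onList (u : (C.subGraph V E hE).Vert)
    (hu : ∀ d : C.Dart, ¬ E d.1 → V (C.dsrc d) → C.dsrc d = u.1)
    (p : List (C.subGraph V E hE).Dart) :
    (C.subRetr V E hE u hu).onList (p.map (C.subDart V E hE)) = p := by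
  induction p with
  | nil => rfl
  | cons d p ih =>
    rw [List.map_cons, PathMap.onList_cons, ih]
    obtain ⟨⟨e, he⟩, _ | _⟩ := d
    · change FreeGroup.invRev (C.subRetrEdge V E hE e) ++ p = _
      rw [C.subRetrEdge_val V E hE ⟨e, he⟩]
      rfl
    · change C.subRetrEdge V E hE e ++ p = _
      rw [C.subRetrEdge_val V E hE ⟨e, he⟩]
      rfl

theorem subRetr_onList_eq_nil (u : (C.subGraph V E hE).Vert)
    (hu : ∀ d : C.Dart, ¬ E d.1 → V (C.dsrc d) → C.dsrc d = u.1)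
    (p : List C.Dart) (h : ∀ d ∈ p, ¬ E d.1) : (C.subRetr V E hE u hu).onList p = [] := by
  induction p with
  | nil => rfl
  | cons d p ih =>
    rw [PathMap.onList_cons, ih fun d hd => h d (List.mem_cons_of_mem _ hd), List.append_nil]
    have := h d List.mem_cons_self
    obtain ⟨e, _ | _⟩ := d
    · change FreeGroup.invRev (C.subRetrEdge V E hE e) = _
      rw [subRetrEdge_eq_nil _ _ _ _ this]
      rfl
    · exact subRetrEdge_eq_nil _ _ _ _ this

/-- The rest of the complex touches the subgraph only in `u`, so it may be collapsed to `u`. The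
collapse respects the 2-cells, because each of them lies entirely inside or entirely outside. -/
theorem SimplyConnected.sub (h : C.SimplyConnected) (u : (C.subGraph V E hE).Vert)
    (hu : ∀ d : C.Dart, ¬ E d.1 → V (C.dsrc d) → C.dsrc d = u.1)
    (hface : ∀ c, (∀ d ∈ C.bdry c, E d.1) ∨ (∀ d ∈ C.bdry c, ¬ E d.1)) :
    haveI : Nonempty {v // V v} := ⟨u⟩
    (C.sub V E hE).SimplyConnected := by
  have : Nonempty {v // V v} := ⟨u⟩
  refine h.of_pathMap (Y := C.sub V E hE) (C.subRetr V E hE u hu) (fun c x hx => ?_)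
    (C.subIncl V E hE) (fun _ => []) (C.subRetrVert_val V E hE u) (fun e => ?_)
  · have h1 := (C.subRetr V E hE u hu).isPath_onList hx
    rcases hface c with hc | hc
    · have h2 : (C.subRetr V E hE u hu).onList (C.bdry c) = C.subList V E hE (C.bdry c) hc := by
        conv_lhs => rw [← C.subList_map V E hE (C.bdry c) hc]
        exact C.subRetr_onList V E hE u hu _
      rw [h2] at h1 ⊢
      exact PathHomotopic.face (X := C.sub V E hE) ⟨c, hc⟩ h1
    · rw [C.subRetr_onList_eq_nil V E hE u hu _ hc]
      exact .refl rfl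
  · have h1 : (C.subRetr V E hE u hu).onList ((C.subIncl V E hE).onEdge e) = [(e, true)] :=
      C.subRetr_onList V E hE u hu [(e, true)]
    rw [h1]
    exact .refl ⟨Subtype.ext (congrArg Subtype.val
      (C.subRetrVert_val V E hE u ((C.subGraph V E hE).src e)).symm), rfl⟩

end Sub

/-! ### Cutting off a disc attached at a boundary vertex -/

namespace IsDisc

variable {C : TwoComplex.{0}} {α β y₀ : C.Dart} {b : List C.Dart}

/-- The oriented edges that lie, in the rotation about a vertex, between `α` and `rev β`. -/
theorem exists_interval (h : C.IsDisc (α :: β :: y₀ :: b)) (hαβ : C.dsrc α = C.dtgt β) :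
    ∃ I : C.Dart → Prop, I α ∧ I (rev β) ∧ ¬ I y₀ ∧ (∀ x, I x → C.dsrc x = C.dsrc α) ∧
      ∀ x y, C.Turns (α :: β :: y₀ :: b) x y → x ≠ rev β → y ≠ α → (I x ↔ I y) := by
  classical
  have := h.finite_dart
  obtain ⟨f, hf, hft⟩ := h.exists_turn
  have hit : ∀ j, C.dsrc (f^[j] α) = C.dsrc α := by
    intro j
    induction j with
    | zero => rfl
    | succ j ih => rw [Function.iterate_succ_apply', ← h.turns_src ((hft _ _).2 rfl), ih]
  -- Both edges start at the same vertex, hence lie in the same cycle of the rotation; since the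
  -- cycle is finite, forward steps from `α` suffice.
  have hex : ∃ m, f^[m] α = rev β := by
    have h1 : EqvGen (C.Turns (α :: β :: y₀ :: b)) α (rev β) :=
      (h.rotation _ _).1 (by rw [dsrc_rev, hαβ])
    have h3 : EqvGen (fun x y => f x = y) α (rev β) := by
      refine EqvGen.map_of id (fun a b hab => .rel _ _ ((hft _ _).1 hab)) h1
    have h2 : ∀ x y, EqvGen (fun x y => f x = y) x y → ((∃ m, f^[m] α = x) ↔ ∃ m, f^[m] α = y) := by
      intro x y hxy
      induction hxy with
      | refl x => rfl
      | symm x y _ ih => exact ih.symm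
      | trans x y z _ _ ih ih' => exact ih.trans ih'
      | rel x y hxy =>
        subst hxy
        constructor
        · rintro ⟨m, rfl⟩
          exact ⟨m + 1, Function.iterate_succ_apply' f m α⟩
        · rintro ⟨_ | m, hm⟩
          · have hpos := Function.minimalPeriod_pos_of_mem_periodicPts (hf.mem_periodicPts α)
            refine ⟨Function.minimalPeriod f α - 1, hf ?_⟩
            rw [← Function.iterate_succ_apply' f, Nat.succ_eq_add_one, Nat.sub_add_cancel hpos,
              Function.iterate_minimalPeriod]
            exact hm
          · rw [Function.iterate_succ_apply'] at hm
            exact ⟨m, hf hm⟩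
    exact (h2 _ _ h3).1 ⟨0, rfl⟩
  have hm := Nat.find_spec hex
  have hmin : ∀ j, j < Nat.find hex → f^[j] α ≠ rev β := fun j hj => Nat.find_min hex hj
  generalize Nat.find hex = m at hm hmin
  have hy : f (rev β) = y₀ := (hft _ _).1
    ⟨none, .inl (.inr (.inl ⟨(rev_rev β).symm, rfl⟩))⟩
  -- The interval consists of the first `m + 1` edges of the rotation from `α` on. Since `m` is
  -- minimal, it is left only after `rev β`, where `y₀` follows, and entered only at `α`.
  refine ⟨fun x => ∃ j ≤ m, f^[j] α = x, ⟨0, Nat.zero_le _, rfl⟩, ⟨m, le_rfl, hm⟩, ?_, ?_, ?_⟩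
  · rintro ⟨_ | j, hj, hj'⟩
    · have hn := h.nodup none
      obtain rfl : α = y₀ := hj'
      change (α :: β :: α :: b).Nodup at hn
      simp at hn
    · rw [Function.iterate_succ_apply', ← hy] at hj'
      exact hmin j (by omega) (hf hj')
  · rintro x ⟨j, -, rfl⟩
    exact hit j
  · intro x y hxy hx hy
    obtain rfl := (hft _ _).1 hxy
    constructor
    · rintro ⟨j, hj, rfl⟩
      have : j ≠ m := by rintro rfl; exact hx hm
      exact ⟨j + 1, by omega, Function.iterate_succ_apply' f j α⟩
    · rintro ⟨_ | j, hj, hj'⟩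
      · exact (hy hj'.symm).elim
      · rw [Function.iterate_succ_apply'] at hj'
        exact ⟨j, by omega, hf hj'⟩

/-- The part of a disc that remains when the part enclosed by a closed boundary path of length two
is cut off. -/
theorem exists_retract (h : C.IsDisc (α :: β :: y₀ :: b)) (hαβ : C.dsrc α = C.dtgt β) :
    ∃ (V : C.Vert → Prop) (E : C.Edge → Prop), V (C.dsrc α) ∧ ¬ E α.1 ∧ ¬ E β.1 ∧
      (∀ d : C.Dart, E d.1 → V (C.dsrc d)) ∧
      (∀ d : C.Dart, ¬ E d.1 → V (C.dsrc d) → C.dsrc d = C.dsrc α) ∧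
      (∀ d ∈ y₀ :: b, E d.1) ∧
      (∀ x y, C.Turns (α :: β :: y₀ :: b) x y → x ≠ rev β → y ≠ α → (E x.1 ↔ E y.1)) := by
  classical
  obtain ⟨I, hα, hβ, hy₀, hIsrc, hI⟩ := h.exists_interval hαβ
  have hside : ∀ i, ∀ x y, (C.sides (α :: β :: y₀ :: b) i).CycSucc x y →
      C.Turns (α :: β :: y₀ :: b) (rev x) y := fun i x y hxy => ⟨i, by rwa [rev_rev]⟩
  -- A discrete Jordan curve argument. The cocycle `c` counts passages through the part `I` of the
  -- vertex. Its sum around a face vanishes, because `I` is not left or entered at a corner of a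
  -- face: the two exceptional corners belong to the outer cycle.
  let c : C.Dart → ℤ := fun d => (if I (rev d) then 1 else 0) - (if I d then 1 else 0)
  have hcrev : ∀ d, c (rev d) = - c d := fun d => by simp [c]
  have hcface : ∀ F, ((C.bdry F).map c).sum = 0 := by
    intro F
    have h1 : ((C.bdry F).map fun d => if I (rev d) then (1 : ℤ) else 0).sum =
        ((C.bdry F).map fun d => if I d then (1 : ℤ) else 0).sum := by
      refine List.sum_map_eq_of_cycSucc fun x y hxy => ?_
      have hx : x ≠ β := fun hx => h.notMem_bdry (x := β) (by simp) F (hx ▸ hxy.mem_left)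
      have hy : y ≠ α := fun hy => h.notMem_bdry (x := α) (by simp) F (hy ▸ hxy.mem_right)
      have := hI _ _ (hside (some F) x y hxy) (fun e => hx (rev_injective e)) hy
      simp only [this]
    change ((C.bdry F).map fun d => (if I (rev d) then (1 : ℤ) else 0) - if I d then 1 else 0).sum
      = 0
    rw [List.sum_map_sub_int, h1, sub_self]
  obtain ⟨s, hs0, hs⟩ := h.oneConnected.exists_potential hcrev hcface (C.dsrc α)
  -- Unlike `s`, the function `g` distinguishes the two halves into which `I` splits the vertex. It
  -- does not depend on the direction of an edge and is constant along the rotation away from the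
  -- two exceptional corners. The part to be kept is where `s`, respectively `g`, is zero, and `α`
  -- and `β` are not in it.
  let g : C.Dart → ℤ := fun d => s (C.dsrc d) - if I d then 1 else 0
  have hgrev : ∀ d, g (rev d) = g d := fun d => by
    simp only [g, dsrc_rev, hs, c]; ring
  have hgE : ∀ d : C.Dart, g (d.1, true) = 0 ↔ g d = 0 := by
    rintro ⟨e, _ | _⟩
    · rw [← hgrev]; rfl
    · rfl
  have hturn : ∀ x y, C.Turns (α :: β :: y₀ :: b) x y → x ≠ rev β → y ≠ α → g x = g y := by
    intro x y hxy hx hy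
    simp only [g, h.turns_src hxy, hI x y hxy hx hy]
  have hnotI : ∀ d, g d = 0 → ¬ I d := by
    intro d hd hId
    simp only [g, hIsrc d hId, hs0, if_pos hId] at hd
    omega
  have hgα : g α ≠ 0 := fun h0 => hnotI α h0 hα
  have hgβ : g β ≠ 0 := fun h0 => hnotI (rev β) ((hgrev β).trans h0) hβ
  refine ⟨fun v => s v = 0, fun e => g (e, true) = 0, hs0, fun h0 => hgα ((hgE α).1 h0),
    fun h0 => hgβ ((hgE β).1 h0), ?_, ?_, ?_, ?_⟩
  · intro d hd
    have hd := (hgE d).1 hd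
    have := hnotI d hd
    simpa only [g, if_neg this, sub_zero] using hd
  · intro d hd hd'
    have hd := fun h0 => hd ((hgE d).2 h0)
    by_contra hne
    have : ¬ I d := fun hI => hne (hIsrc d hI)
    simp only [g, if_neg this, sub_zero] at hd
    exact hd hd'
  · have hn := h.nodup none
    change (α :: β :: y₀ :: b).Nodup at hn
    rw [List.nodup_cons, List.nodup_cons] at hn
    have hy : g y₀ = 0 := by
      have : C.dsrc y₀ = C.dsrc α := by
        rw [← h.turns_src (x := rev β) ⟨none, .inl (.inr (.inl ⟨(rev_rev β).symm, rfl⟩))⟩, dsrc_rev,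
          hαβ]
      simp only [g, this, hs0, if_neg hy₀, sub_zero]
    have key : ∀ (l : List C.Dart) (a : C.Dart), g a = 0 →
        (∀ x z, (a :: l).Linked x z → g (rev x) = g z) → ∀ d ∈ a :: l, g d = 0 := by
      intro l
      induction l with
      | nil => intro a ha _ d hd; rw [List.mem_singleton.1 hd, ha]
      | cons e l ih =>
        intro a ha hl d hd
        rcases List.mem_cons.1 hd with rfl | hd
        · exact ha
        · refine ih e ?_ (fun x z hxz => hl x z (.inr hxz)) d hd
          rw [← hl a e (.inl ⟨rfl, rfl⟩), hgrev, ha]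
    intro d hd
    refine (hgE d).2 ?_
    refine key b y₀ hy (fun x z hxz => ?_) d hd
    have hm : x ∈ y₀ :: b ∧ z ∈ y₀ :: b := ⟨List.CycSucc.mem_left (.inl hxz),
      List.CycSucc.mem_right (.inl hxz)⟩
    refine hturn _ _ (hside none x z (.inl (.inr (.inr hxz)))) (fun e => ?_) ?_
    · rw [rev_injective e] at hm
      exact hn.2.1 hm.1
    · rintro rfl
      exact hn.1 (List.mem_cons_of_mem _ hm.2)
  · intro x y hxy hx hy
    exact (hgE x).trans (by rw [hturn x y hxy hx hy]; exact (hgE y).symm)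

/-- If two cancelling boundary edges form a closed path, folding them would create a sphere around
the enclosed part. That part is discarded instead, together with both edges, and the subcomplex of
`exists_retract` remains. -/
theorem exists_cut (h : C.IsDisc (α :: β :: y₀ :: b)) (hαβ : C.dsrc α = C.dtgt β) :
    ∃ (C' : TwoComplex.{0}) (o : List C'.Dart) (jV : C'.Vert → C.Vert) (j : C'.Edge → C.Edge),
      C'.IsDisc o ∧ Function.Injective j ∧ (∀ e, jV (C'.src e) = C.src (j e)) ∧
      (∀ e, jV (C'.tgt e) = C.tgt (j e)) ∧
      (∀ c', ∃ c, (C'.bdry c').map (Prod.map j id) = C.bdry c) ∧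
      o.map (Prod.map j id) = y₀ :: b := by
  classical
  obtain ⟨V, E, hVα, hEα, hEβ, hE, hu, hb, hturn⟩ := h.exists_retract hαβ
  have : Nonempty {v // V v} := ⟨⟨C.dsrc α, hVα⟩⟩
  set ι := C.subDart V E hE with hι
  have hinj : Function.Injective ι := C.subDart_injective V E hE
  set o := C.subList V E hE (y₀ :: b) hb with ho
  have hoι : o.map ι = y₀ :: b := C.subList_map V E hE _ hb
  have hbι : ∀ c : (C.sub V E hE).Face, ((C.sub V E hE).bdry c).map ι = C.bdry c.1 :=
    fun c => C.subList_map V E hE _ c.2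
  have hcyc : ∀ (l : List (C.subGraph V E hE).Dart) x y, (l.map ι).CycSucc (ι x) (ι y) →
      l.CycSucc x y := by
    rintro l x y (hxy | ⟨h1, h2⟩)
    · obtain ⟨a, a', e⟩ := List.linked_iff.1 hxy
      obtain ⟨l1, l2, rfl, e1, e2⟩ := List.map_eq_append_iff.1 e
      obtain ⟨x', l3, rfl, e3, e4⟩ := List.map_eq_cons_iff.1 e2
      obtain ⟨y', l4, rfl, e5, e6⟩ := List.map_eq_cons_iff.1 e4
      obtain rfl := hinj e3
      obtain rfl := hinj e5
      exact .inl (List.linked_iff.2 ⟨l1, l4, rfl⟩)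
    · rw [List.getLast?_map, Option.map_eq_some_iff] at h1
      rw [List.head?_map, Option.map_eq_some_iff] at h2
      obtain ⟨x', h1, e1⟩ := h1
      obtain ⟨y', h2, e2⟩ := h2
      obtain rfl := hinj e1
      obtain rfl := hinj e2
      exact .inr ⟨h1, h2⟩
  have hfaceE : ∀ c, (∀ d ∈ C.bdry c, E d.1) ∨ (∀ d ∈ C.bdry c, ¬ E d.1) := by
    intro c
    have hstep : ∀ x y, (C.bdry c).CycSucc x y → (E x.1 ↔ E y.1) := by
      intro x y hxy
      have hx : x ≠ β := fun hx => h.notMem_bdry (x := β) (by simp) c (hx ▸ hxy.mem_left)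
      have hy : y ≠ α := fun hy => h.notMem_bdry (x := α) (by simp) c (hy ▸ hxy.mem_right)
      exact hturn (rev x) y ⟨some c, by rwa [rev_rev]⟩ (fun e => hx (rev_injective e)) hy
    have key : ∀ l : List C.Dart, (∀ x y, l.Linked x y → (E x.1 ↔ E y.1)) →
        (∀ d ∈ l, E d.1) ∨ (∀ d ∈ l, ¬ E d.1) := by
      intro l
      induction l with
      | nil => intro _; left; simp
      | cons a l ih =>
        intro hl
        cases l with
        | nil => by_cases ha : E a.1 <;> simp [ha]
        | cons b l =>
          have h1 := hl a b (.inl ⟨rfl, rfl⟩)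
          rcases ih fun x y hxy => hl x y (.inr hxy) with h2 | h2
          · left
            intro d hd
            rcases List.mem_cons.1 hd with rfl | hd
            · exact h1.2 (h2 b List.mem_cons_self)
            · exact h2 d hd
          · right
            intro d hd
            rcases List.mem_cons.1 hd with rfl | hd
            · exact fun h3 => h2 b List.mem_cons_self (h1.1 h3)
            · exact h2 d hd
    exact key _ fun x y hxy => hstep x y (.inl hxy)
  have hn := h.nodup none
  change (α :: β :: y₀ :: b).Nodup at hn
  have hn' := hn
  rw [List.nodup_cons, List.nodup_cons] at hn'
  obtain ⟨z, hz⟩ := h.outer_closed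
  have hyb : C.IsPath (C.dsrc α) (y₀ :: b) (C.dsrc α) := by
    obtain ⟨h1, -, h2⟩ := hz
    rw [← h1, ← hαβ] at h2
    exact h2
  have hmemE : ∀ x : C.Dart, E x.1 → ∃ x', ι x' = x := fun x hx => ⟨(⟨x.1, hx⟩, x.2), rfl⟩
  have hαE : ∀ x, ι x ≠ α := fun x hx => hEα (hx ▸ C.subDart_prop V E hE x)
  have hβE : ∀ x, ι x ≠ β := fun x hx => hEβ (hx ▸ C.subDart_prop V E hE x)
  have hy₀ : ∃ y', ι y' = y₀ := hmemE _ (hb _ List.mem_cons_self)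
  obtain ⟨y', hy'⟩ := hy₀
  -- Everything that is cut off is sent to the first edge of the new boundary. In this way the
  -- rotation about the cut vertex closes up again where the discarded sector was.
  let ρ : C.Dart → (C.subGraph V E hE).Dart := fun d => if hd : E d.1 then (⟨d.1, hd⟩, d.2) else y'
  have hρ : ∀ x, ρ (ι x) = x := fun x => dif_pos (C.subDart_prop V E hE x)
  have hρ' : ∀ x, ¬ E x.1 → ρ x = y' := fun x hx => dif_neg hx
  have hρE : ∀ x, E x.1 → ι (ρ x) = x := fun x hx => by simp only [ρ, dif_pos hx]; rfl
  have hlast : ∀ x, E x.1 → C.Turns (α :: β :: y₀ :: b) x α →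
      (C.sub V E hE).Turns o (ρ x) y' := by
    rintro x hx ⟨i, hi⟩
    obtain rfl : none = i := h.eq_side (x := α) (i := none) List.mem_cons_self hi.mem_right
    refine ⟨none, ?_⟩
    change o.CycSucc _ _
    refine hcyc _ _ _ ?_
    rw [hoι, hy']
    change (y₀ :: b).CycSucc (rev (ι (ρ x))) y₀
    rw [hρE x hx]
    rcases hi with hi | ⟨hi, -⟩
    · exfalso
      obtain ⟨a, a', e⟩ := List.linked_iff.1 hi
      change α :: β :: y₀ :: b = _ at e
      rw [e] at hn
      cases a with
      | nil =>
        rw [List.nil_append, List.cons.injEq] at e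
        have : rev x = α := e.1.symm
        exact hEα (this ▸ hx)
      | cons a0 a =>
        rw [List.cons_append, List.cons.injEq] at e
        rw [← e.1] at hn
        simp at hn
    · right
      refine ⟨?_, rfl⟩
      change (α :: β :: y₀ :: b).getLast? = _ at hi
      rwa [List.getLast?_cons_cons, List.getLast?_cons_cons] at hi
  have hstep : ∀ x y, C.Turns (α :: β :: y₀ :: b) x y →
      EqvGen ((C.sub V E hE).Turns o) (ρ x) (ρ y) := by
    intro x y hxy
    by_cases hx : E x.1
    · by_cases hy : y = α
      · subst hy
        rw [hρ' y hEα]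
        exact .rel _ _ (hlast x hx hxy)
      · have hxβ : x ≠ rev β := by rintro rfl; exact hEβ hx
        have hyE : E y.1 := (hturn x y hxy hxβ hy).1 hx
        refine .rel _ _ ?_
        obtain ⟨i, hi⟩ := hxy
        rcases i with _ | c
        · refine ⟨none, hcyc _ _ _ ?_⟩
          change (o.map ι).CycSucc (rev (ι (ρ x))) (ι (ρ y))
          rw [hoι, hρE x hx, hρE y hyE]
          have hr1 : rev x ≠ α := fun e => hEα (e ▸ hx)
          have hr2 : rev x ≠ β := fun e => hEβ (e ▸ hx)
          rcases hi with hi | ⟨-, hi⟩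
          · change (α :: β :: y₀ :: b).Linked (rev x) y at hi
            rcases hi with hi | hi | hi
            · exact (hr1 hi.1.symm).elim
            · exact (hr2 hi.1.symm).elim
            · exact .inl hi
          · exact (hy (Option.some.inj hi).symm).elim
        · have hc : ∀ d ∈ C.bdry c, E d.1 := by
            rcases hfaceE c with hc | hc
            · exact hc
            · exact (hc _ hi.mem_right hyE).elim
          refine ⟨some ⟨c, hc⟩, hcyc _ _ _ ?_⟩
          change (((C.sub V E hE).bdry ⟨c, hc⟩).map ι).CycSucc (rev (ι (ρ x))) (ι (ρ y))
          rw [hbι, hρE x hx, hρE y hyE]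
          exact hi
    · rw [hρ' x hx]
      by_cases hy : E y.1
      · have hyα : y ≠ α := by rintro rfl; exact hEα hy
        by_cases hxβ : x = rev β
        · subst hxβ
          have : y = y₀ := h.turns_right_unique hxy
            ⟨none, .inl (.inr (.inl ⟨(rev_rev β).symm, rfl⟩))⟩
          rw [this, ← hy', hρ]
          exact .refl _
        · exact (hx ((hturn x y hxy hxβ hyα).2 hy)).elim
      · rw [hρ' y hy]
        exact .refl _
  refine ⟨C.sub V E hE, o, Subtype.val, Subtype.val, ⟨?_, ?_, ?_, ?_, ?_, ?_, ?_⟩,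
    Subtype.val_injective, fun _ => rfl, fun _ => rfl, fun c => ⟨c.1, hbι c⟩, hoι⟩
  · obtain ⟨f1, f2, f3⟩ := h.finite
    exact ⟨inferInstanceAs (Finite {v // V v}), inferInstanceAs (Finite {e // E e}),
      inferInstanceAs (Finite {c : C.Face // ∀ d ∈ C.bdry c, E d.1})⟩
  · exact SimplyConnected.sub C V E hE h.oneConnected ⟨C.dsrc α, hVα⟩ hu hfaceE
  · intro c hc
    refine h.bdry_ne_nil c.1 ?_
    rw [← hbι c]
    exact List.map_eq_nil_iff.2 hc
  · intro ho'
    rw [ho', List.map_nil] at hoι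
    simp at hoι
  · rintro (_ | c)
    · refine List.Nodup.of_map ι ?_
      change (o.map ι).Nodup
      rw [hoι]
      exact hn'.2.2
    · refine List.Nodup.of_map ι ?_
      change (((C.sub V E hE).bdry c).map ι).Nodup
      rw [hbι]
      exact h.nodup (some c.1)
  · intro x
    have k0 : x ∈ (C.sub V E hE).sides o none ↔ ι x ∈ C.sides (α :: β :: y₀ :: b) none := by
      change x ∈ o ↔ ι x ∈ α :: β :: y₀ :: b
      rw [← List.mem_map_of_injective hinj, hoι, List.mem_cons (a := ι x) (b := α),
        List.mem_cons (a := ι x) (b := β)]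
      have h1 := hαE x; have h2 := hβE x
      tauto
    have k1 : ∀ c, x ∈ (C.sub V E hE).sides o (some c) ↔
        ι x ∈ C.sides (α :: β :: y₀ :: b) (some c.1) := by
      intro c
      change x ∈ (C.sub V E hE).bdry c ↔ ι x ∈ C.bdry c.1
      rw [← hbι c]
      exact (List.mem_map_of_injective hinj).symm
    obtain ⟨i, hi, huniq⟩ := h.existsUnique (ι x)
    rcases i with _ | c
    · refine ⟨none, k0.2 hi, ?_⟩
      rintro (_ | c) hc
      · rfl
      · simpa using huniq _ ((k1 c).1 hc)
    · have hc : ∀ d ∈ C.bdry c, E d.1 := by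
        rcases hfaceE c with hc | hc
        · exact hc
        · exact (hc _ hi (C.subDart_prop V E hE x)).elim
      refine ⟨some ⟨c, hc⟩, (k1 ⟨c, hc⟩).2 hi, ?_⟩
      rintro (_ | c') hc'
      · simpa using huniq _ (k0.1 hc')
      · have := huniq _ ((k1 c').1 hc')
        rw [Option.some.injEq] at this
        exact congrArg some (Subtype.ext this)
  · refine IsDisc.rotation_of_forall ⟨⟨C.dsrc α, hVα⟩, isPath_subGraph hE ?_⟩ fun x y hxy => ?_
    · change C.IsPath (C.dsrc α) (o.map ι) (C.dsrc α)
      rw [hoι]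
      exact hyb
    · have h1 : C.dsrc (ι x) = C.dsrc (ι y) := by
        rw [← subGraph_dsrc, ← subGraph_dsrc]
        exact congrArg Subtype.val hxy
      have := EqvGen.map_of ρ hstep ((h.rotation _ _).1 h1)
      rwa [hρ, hρ] at this

end IsDisc

end TwoComplex

open OneComplex Relation

namespace TwoComplex

/-! ### Folding two consecutive boundary edges -/

section Fold

variable (C : TwoComplex.{0}) (u' : C.Vert) (u : {x : C.Vert // x ≠ u'}) (e₀ : C.Edge)

open Classical in
/-- The identification of the vertex `u'` with `u`. -/
noncomputable def foldVert (x : C.Vert) : {x : C.Vert // x ≠ u'} := if h : x = u' then u else ⟨x, h⟩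

theorem foldVert_self : C.foldVert u' u u' = u := dif_pos rfl

theorem foldVert_of_ne {x : C.Vert} (h : x ≠ u') : C.foldVert u' u x = ⟨x, h⟩ := dif_neg h

theorem foldVert_val (x : {x : C.Vert // x ≠ u'}) : C.foldVert u' u x.1 = x := dif_neg x.2

theorem foldVert_eq_iff {x y : C.Vert} (h : C.foldVert u' u x = C.foldVert u' u y) :
    x = y ∨ (x = u' ∧ y = u.1) ∨ (x = u.1 ∧ y = u') := by
  by_cases hx : x = u' <;> by_cases hy : y = u'
  · exact .inl (hx.trans hy.symm)
  · rw [hx, foldVert_self, foldVert_of_ne _ _ _ hy] at h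
    exact .inr (.inl ⟨hx, (congrArg Subtype.val h).symm⟩)
  · rw [hy, foldVert_self, foldVert_of_ne _ _ _ hx] at h
    exact .inr (.inr ⟨congrArg Subtype.val h, hy⟩)
  · rw [foldVert_of_ne _ _ _ hx, foldVert_of_ne _ _ _ hy] at h
    exact .inl (congrArg Subtype.val h)

/-- The graph obtained by identifying `u'` with `u` and removing the edge `e₀`. -/
noncomputable def foldGraph : OneComplex.{0} where
  Vert := {x : C.Vert // x ≠ u'}
  Edge := {e : C.Edge // e ≠ e₀}
  src e := C.foldVert u' u (C.src e.1)
  tgt e := C.foldVert u' u (C.tgt e.1)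

/-- The oriented edges of the folded graph, as oriented edges of the original one. -/
def foldIncl (d : (C.foldGraph u' u e₀).Dart) : C.Dart := (d.1.1, d.2)

theorem foldIncl_injective : Function.Injective (C.foldIncl u' u e₀) := by
  rintro ⟨⟨a, ha⟩, b⟩ ⟨⟨c, hc⟩, d⟩ h
  simp only [foldIncl, Prod.mk.injEq] at h
  obtain ⟨rfl, rfl⟩ := h
  rfl

theorem foldGraph_dsrc (d : (C.foldGraph u' u e₀).Dart) :
    (C.foldGraph u' u e₀).dsrc d = C.foldVert u' u (C.dsrc (C.foldIncl u' u e₀ d)) := by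
  obtain ⟨e, _ | _⟩ := d <;> rfl

theorem exists_foldIncl {d : C.Dart} (h : d.1 ≠ e₀) : ∃ d', C.foldIncl u' u e₀ d' = d :=
  ⟨(⟨d.1, h⟩, d.2), rfl⟩

end Fold

open Classical in
/-- The map on oriented edges which replaces `β` by `rev α`. -/
noncomputable def foldDart {C : TwoComplex.{0}} (α β d : C.Dart) : C.Dart :=
  if d = β then rev α else if d = rev β then α else d

section FoldDart

variable {C : TwoComplex.{0}} {α β : C.Dart}

theorem foldDart_self : foldDart α β β = rev α := if_pos rfl

theorem foldDart_rev_self : foldDart α β (rev β) = α :=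
  (if_neg (rev_ne β)).trans (if_pos rfl)

theorem foldDart_of_ne {d : C.Dart} (h : d.1 ≠ β.1) : foldDart α β d = d :=
  (if_neg fun h' => h (by rw [h'])).trans (if_neg fun h' => h (by rw [h']; rfl))

theorem eq_or_eq_rev {d e : C.Dart} (h : d.1 = e.1) : d = e ∨ d = rev e := by
  obtain ⟨d, b⟩ := d
  obtain ⟨e, b'⟩ := e
  obtain rfl : d = e := h
  cases b <;> cases b' <;> simp [rev]

theorem foldDart_rev (d : C.Dart) : foldDart α β (rev d) = rev (foldDart α β d) := by
  by_cases h : d.1 = β.1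
  · rcases eq_or_eq_rev h with rfl | rfl
    · rw [foldDart_rev_self, foldDart_self, rev_rev]
    · rw [foldDart_rev_self, rev_rev, foldDart_self]
  · rw [foldDart_of_ne h, foldDart_of_ne (d := rev d) h]

theorem foldDart_fst_ne (h : α.1 ≠ β.1) (d : C.Dart) : (foldDart α β d).1 ≠ β.1 := by
  by_cases hd : d.1 = β.1
  · rcases eq_or_eq_rev hd with rfl | rfl
    · rw [foldDart_self]; exact h
    · rw [foldDart_rev_self]; exact h
  · rwa [foldDart_of_ne hd]

end FoldDart

namespace IsDisc

variable {C : TwoComplex.{0}} {α β : C.Dart} {b : List C.Dart}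

/-- The edges `α` and `rev β` have the same end and, by hypothesis, different beginnings. These
beginnings are identified, and `β` is replaced everywhere by `rev α`. The faces remain, and both
edges disappear from the boundary. -/
theorem exists_fold (h : C.IsDisc (α :: β :: b)) (hαβ : C.dsrc α ≠ C.dtgt β) :
    ∃ (C' : TwoComplex.{0}) (o : List C'.Dart) (jV : C'.Vert → C.Vert) (j : C'.Edge → C.Edge),
      C'.IsDisc o ∧ Function.Injective j ∧
      (∀ e, jV (C'.src e) = C.src (j e) ∨ (jV (C'.src e) = C.dsrc α ∧ C.src (j e) = C.dtgt β)) ∧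
      (∀ e, jV (C'.tgt e) = C.tgt (j e) ∨ (jV (C'.tgt e) = C.dsrc α ∧ C.tgt (j e) = C.dtgt β)) ∧
      (∀ c', ∃ c, (C'.bdry c').map (Prod.map j id) = (C.bdry c).map (foldDart α β)) ∧
      o.map (Prod.map j id) = b.map (foldDart α β) := by
  classical
  have hfin := h.finite_dart
  obtain ⟨z, hz⟩ := h.outer_closed
  obtain ⟨rfl, hz1, hz2⟩ := hz
  have hn := h.nodup none
  change (α :: β :: b).Nodup at hn
  rw [List.nodup_cons, List.nodup_cons] at hn
  have hne : α.1 ≠ β.1 := by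
    intro he
    rcases eq_or_eq_rev he with rfl | rfl
    · exact hn.1 List.mem_cons_self
    · exact hαβ (dsrc_rev β)
  set u' := C.dtgt β with hu'
  set u : {x : C.Vert // x ≠ u'} := ⟨C.dsrc α, hαβ⟩ with hu
  set G := C.foldGraph u' u β.1 with hG
  set ι := C.foldIncl u' u β.1 with hι
  set q := C.foldVert u' u with hq
  have hinj : Function.Injective ι := C.foldIncl_injective u' u β.1
  choose m hm using fun d : C.Dart => C.exists_foldIncl u' u β.1 (foldDart_fst_ne hne d)
  change ∀ d, ι (m d) = foldDart α β d at hm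
  have hmrev : ∀ d, m (rev d) = rev (m d) := fun d => hinj (by
    rw [hm, foldDart_rev]
    change _ = rev (ι (m d))
    rw [hm])
  have hmι : ∀ x, m (ι x) = x := fun x => hinj (by rw [hm, foldDart_of_ne x.1.2])
  have hmβ : m β = rev (m α) := hinj (by
    change _ = rev (ι (m α))
    rw [hm, hm, foldDart_self, foldDart_of_ne hne])
  have hqu : q u' = q (C.dsrc α) := (C.foldVert_self u' u).trans (C.foldVert_val u' u u).symm
  have hmsrc : ∀ d, G.dsrc (m d) = q (C.dsrc d) := by
    intro d
    refine (C.foldGraph_dsrc u' u β.1 (m d)).trans ?_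
    change q (C.dsrc (ι (m d))) = _
    rw [hm]
    by_cases hd : d.1 = β.1
    · rcases eq_or_eq_rev hd with rfl | rfl
      · rw [foldDart_self, dsrc_rev, hz1]
      · rw [foldDart_rev_self, dsrc_rev, hqu]
    · rw [foldDart_of_ne hd]
  have hmtgt : ∀ d, G.dtgt (m d) = q (C.dtgt d) := fun d => by
    rw [← dsrc_rev, ← hmrev, hmsrc, dsrc_rev]
  have hpath : ∀ {x y : C.Vert} {p : List C.Dart}, C.IsPath x p y →
      G.IsPath (q x) (p.map m) (q y) := by
    intro x y p hp
    induction p generalizing x with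
    | nil => exact congrArg q hp
    | cons d p ih => exact ⟨by rw [hmsrc, hp.1], by rw [hmtgt]; exact ih hp.2⟩
  let C' : TwoComplex.{0} :=
    { toOneComplex := G
      Face := C.Face
      bdry := fun c => (C.bdry c).map m
      bdry_closed := fun c => by
        obtain ⟨x, hx⟩ := C.bdry_closed c
        exact ⟨q x, hpath hx⟩ }
  have hside : ∀ i : Option C.Face, ∃ l : List C.Dart,
      (∀ d, d ∈ l ↔ d ∈ C.sides (α :: β :: b) i ∧ d ≠ α ∧ d ≠ β) ∧
      l.Nodup ∧ C'.sides (b.map m) i = l.map m := by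
    rintro (_ | c)
    · refine ⟨b, fun d => ?_, hn.2.2, rfl⟩
      change _ ↔ d ∈ α :: β :: b ∧ _
      rw [List.mem_cons, List.mem_cons]
      constructor
      · intro hd
        exact ⟨.inr (.inr hd), fun e => hn.1 (List.mem_cons_of_mem _ (e ▸ hd)),
          fun e => hn.2.1 (e ▸ hd)⟩
      · rintro ⟨hd, h1, h2⟩
        tauto
    · refine ⟨C.bdry c, fun d => ⟨fun hd => ⟨hd, ?_, ?_⟩, fun hd => hd.1⟩, h.nodup (some c), rfl⟩
      · rintro rfl
        exact h.notMem_bdry List.mem_cons_self c hd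
      · rintro rfl
        exact h.notMem_bdry (List.mem_cons_of_mem _ List.mem_cons_self) c hd
  -- Since `α` and `β` leave the boundary, the place of `α` is now that of `rev β`. With this choice
  -- the folding is a bijection from the oriented edges other than `α` and `β` to those of the
  -- folded graph, so each still lies on exactly one side.
  let jD : G.Dart → C.Dart := fun x => if ι x = α then rev β else ι x
  have hmj : ∀ x, m (jD x) = x := by
    intro x
    by_cases hx : ι x = α
    · simp only [jD, if_pos hx]
      apply hinj
      rw [hm, foldDart_rev_self, hx]
    · simp only [jD, if_neg hx]
      exact hmι x
  have hjα : ∀ x, jD x ≠ α ∧ jD x ≠ β := by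
    intro x
    have hxβ : (ι x).1 ≠ β.1 := x.1.2
    by_cases hx : ι x = α
    · simp only [jD, if_pos hx]
      exact ⟨fun e => hne (by rw [← e]; rfl), rev_ne β⟩
    · simp only [jD, if_neg hx]
      exact ⟨hx, fun e => hxβ (by rw [e])⟩
  have hjm : ∀ d, d ≠ α → d ≠ β → jD (m d) = d := by
    intro d h1 h2
    by_cases hd : d.1 = β.1
    · rcases eq_or_eq_rev hd with rfl | rfl
      · exact (h2 rfl).elim
      · simp only [jD, hm, foldDart_rev_self, if_true]
    · simp only [jD, hm, foldDart_of_ne hd, if_neg h1]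
  have hmem : ∀ x i, x ∈ C'.sides (b.map m) i ↔ jD x ∈ C.sides (α :: β :: b) i := by
    intro x i
    obtain ⟨l, hl, -, hl2⟩ := hside i
    rw [hl2, List.mem_map]
    constructor
    · rintro ⟨d, hd, rfl⟩
      obtain ⟨h1, h2, h3⟩ := (hl d).1 hd
      rwa [hjm d h2 h3]
    · intro hx
      exact ⟨jD x, (hl _).2 ⟨hx, hjα x⟩, hmj x⟩
  -- simple connectivity
  let F : PathMap C.toOneComplex G :=
    { onVert := q
      onEdge := fun e => [m (e, true)]
      isPath := fun e => ⟨hmsrc _, hmtgt _⟩ }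
  have hFd : ∀ d, F.onDart d = [m d] := by
    rintro ⟨e, _ | _⟩
    · change [rev (m (e, true))] = _
      rw [← hmrev]; rfl
    · rfl
  have hF : ∀ p, F.onList p = p.map m := by
    intro p
    induction p with
    | nil => rfl
    | cons d p ih => rw [PathMap.onList_cons, ih, hFd]; rfl
  -- The track from the image of a vertex back to the vertex. It runs along `α` and `β` for the
  -- identified vertex, and its image is a backtracking.
  let κ : C.Vert → List C.Dart := fun x => if x = u' then [α, β] else []
  have hκ : ∀ x, C.IsPath (q x).1 (κ x) x := by
    intro x
    by_cases hx : x = u'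
    · simp only [κ, hq, hx, foldVert_self]
      exact ⟨rfl, hz1, rfl⟩
    · simp only [κ, if_neg hx, hq, foldVert_of_ne _ _ _ hx]
      exact rfl
  have hFκ : ∀ x, C'.PathHomotopic (q x) (q x) (F.onList (κ x)) [] := by
    intro x
    by_cases hx : x = u'
    · simp only [κ, if_pos hx, hF]
      have := PathHomotopic.append_invRev_self (X := C') (isPath_singleton (X := G) (m α))
      rw [hmsrc, ← hqu] at this
      rw [hx]
      simpa [hmβ, FreeGroup.invRev, rev] using this
    · simp only [κ, if_neg hx]
      exact .refl rfl
  have hsc : C'.SimplyConnected := by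
    refine h.oneConnected.of_pathMap F (fun c x hx => ?_)
      { onVert := Subtype.val
        onEdge := fun e => κ (C.src e.1) ++ ([(e.1, true)] ++ FreeGroup.invRev (κ (C.tgt e.1)))
        isPath := fun e => (hκ _).append (IsPath.append ⟨rfl, rfl⟩ (isPath_invRev (hκ _))) }
      (fun _ => []) (C.foldVert_val u' u) (fun e => ?_)
    · rw [hF]
      exact PathHomotopic.face (X := C') c (hpath hx)
    · have h1 : F.onList (FreeGroup.invRev (κ (C.tgt e.1))) =
          FreeGroup.invRev (F.onList (κ (C.tgt e.1))) := F.onList_invRev _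
      have h2 : m (e.1, true) = (e, true) := hmι (e, true)
      have h3 : F.onList [(e.1, true)] = [(e, true)] := by rw [hF, List.map_singleton, h2]
      have h4 : C'.PathHomotopic (q (C.src e.1)) (q (C.tgt e.1))
          (F.onList (κ (C.src e.1)) ++ ([(e, true)] ++ F.onList (FreeGroup.invRev (κ (C.tgt e.1)))))
          ([] ++ ([(e, true)] ++ [])) := by
        refine (hFκ _).append (PathHomotopic.append (.refl ⟨rfl, rfl⟩) ?_)
        rw [h1]
        exact (hFκ _).invRev
      have h5 : C'.PathHomotopic (q (C.src e.1)) (q (C.tgt e.1)) ([] ++ [(e, true)])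
          (F.onList (κ (C.src e.1) ++ ([(e.1, true)] ++ FreeGroup.invRev (κ (C.tgt e.1))))
            ++ []) := by
        rw [F.onList_append, F.onList_append, h3, List.append_nil]
        exact h4.symm
      have h6 : q (q (C.src e.1)).1 = q (C.src e.1) := C.foldVert_val u' u _
      change C'.PathHomotopic (q (q (C.src e.1)).1) (q (C.tgt e.1)) _ _
      rw [h6]
      exact h5
  -- rotation
  have hclosed : C'.IsPath u (b.map m) u := by
    have := hpath hz2
    rwa [show q u' = u from C.foldVert_self u' u,
      show q (C.dsrc α) = u from C.foldVert_val u' u u] at this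
  obtain ⟨f, hf, hft⟩ := h.exists_turn
  set T := C'.Turns (b.map m) with hT
  have hstep : ∀ x y, C.Turns (α :: β :: b) x y → x ≠ rev β → y ≠ α → EqvGen T (m x) (m y) := by
    rintro x y ⟨i, hi⟩ hx hy
    rcases i with _ | c
    · rcases hi with hi | ⟨-, hi⟩
      · change (α :: β :: b).Linked (rev x) y at hi
        cases b with
        | nil =>
          rcases hi with ⟨h1, h2⟩ | hi
          · obtain rfl : x = rev α := by rw [h1, rev_rev]
            rw [← h2, hmβ, hmrev]; exact .refl _
          · exact hi.elim
        | cons y₀ b =>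
          rcases hi with ⟨h1, h2⟩ | ⟨h1, -⟩ | hi
          · obtain rfl : x = rev α := by rw [h1, rev_rev]
            rw [← h2, hmβ, hmrev]; exact .refl _
          · exact (hx (by rw [h1, rev_rev])).elim
          · refine .rel _ _ ⟨none, .inl ?_⟩
            rw [← hmrev]
            exact hi.map m
      · exact (hy (Option.some.inj hi).symm).elim
    · refine .rel _ _ ⟨some c, ?_⟩
      rw [← hmrev]
      exact hi.map m
  have hsame : ∀ x y, C.dsrc x = C.dsrc y → EqvGen T (m x) (m y) := by
    intro x y hxy
    have h1 : EqvGen (fun a b => f a = b) x y :=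
      EqvGen.map_of id (fun a b hab => .rel _ _ ((hft _ _).1 hab)) ((h.rotation x y).1 hxy)
    have hsrc : ∀ x y, EqvGen (fun a b => f a = b) x y → C.dsrc x = C.dsrc y := fun x y hxy =>
      (h.rotation x y).2 (EqvGen.map_of id (fun a b hab => .rel _ _ ((hft _ _).2 hab)) hxy)
    -- The folding destroys two corners, the one after `rev β` and the one before `α`. They are at
    -- the different vertices `dtgt β` and `dsrc α`, so no rotation loses more than one link and
    -- none falls apart.
    have h2 := hf.eqvGen_of_removed (fun a => a = rev β ∨ f a = α) (by
      rintro p p' (hp | hp) (hp' | hp') hpp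
      · exact hp.trans hp'.symm
      · have h3 := hsrc _ _ hpp
        rw [h.turns_src ((hft _ _).2 hp'), hp, dsrc_rev] at h3
        exact (hαβ h3.symm).elim
      · have h3 := hsrc _ _ hpp
        rw [h.turns_src ((hft _ _).2 hp), hp', dsrc_rev] at h3
        exact (hαβ h3).elim
      · exact hf (hp.trans hp'.symm)) h1
    refine EqvGen.map_of m (fun a b hab => ?_) h2
    obtain ⟨hab, hP⟩ := hab
    rw [not_or] at hP
    exact hstep a b ((hft _ _).2 hab) hP.1 (hab ▸ hP.2)
  -- The corner between the end and the beginning of the new boundary joins the rotations about the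
  -- two identified vertices into one.
  have hlink : ∃ x y, C.dsrc x = C.dsrc α ∧ C.dsrc y = u' ∧ EqvGen T (m x) (m y) := by
    rcases List.eq_nil_or_concat' b with rfl | ⟨b', d, hb'⟩
    · exact (hαβ hz2.symm).elim
    · have hne' : b ≠ [] := by rw [hb']; simp
      have hd : b.getLast? = some d := by rw [hb']; exact List.getLast?_concat
      refine ⟨rev d, b.head hne', ?_, ?_, ?_⟩
      · rw [dsrc_rev]
        exact hz2.tgt_of_getLast hd
      · exact hz2.src_of_head (List.head?_eq_some_head _)
      · refine .rel _ _ ⟨none, ?_⟩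
        rw [hmrev, rev_rev]
        exact .inr ⟨by change (b.map m).getLast? = _; rw [List.getLast?_map, hd]; rfl,
          by change (b.map m).head? = _; rw [List.head?_map, List.head?_eq_some_head hne']; rfl⟩
  refine ⟨C', b.map m, Subtype.val, Subtype.val,
    ⟨?_, hsc, ?_, ?_, ?_, ?_, IsDisc.rotation_of_forall ⟨u, hclosed⟩ fun x y hxy => ?_⟩,
    Subtype.val_injective, fun e => ?_, fun e => ?_, fun c => ⟨c, ?_⟩, ?_⟩
  · obtain ⟨f1, f2, f3⟩ := h.finite
    exact ⟨inferInstanceAs (Finite {x // x ≠ u'}), inferInstanceAs (Finite {e // e ≠ β.1}), f3⟩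
  · intro c hc
    exact h.bdry_ne_nil c (List.map_eq_nil_iff.1 hc)
  · intro hb
    rw [List.map_eq_nil_iff] at hb
    subst hb
    exact (hαβ hz2.symm).elim
  · intro i
    obtain ⟨l, hl, hl1, hl2⟩ := hside i
    rw [hl2]
    refine List.Nodup.map_on (fun x hx y hy hxy => ?_) hl1
    obtain ⟨-, h1, h2⟩ := (hl x).1 hx
    obtain ⟨-, h3, h4⟩ := (hl y).1 hy
    rw [← hjm x h1 h2, hxy, hjm y h3 h4]
  · intro x
    simp only [hmem]
    exact h.existsUnique (jD x)
  · rw [← hmj x, ← hmj y] at hxy ⊢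
    change G.dsrc _ = G.dsrc _ at hxy
    rw [hmsrc, hmsrc] at hxy
    obtain ⟨x₁, y₁, h1, h2, h3⟩ := hlink
    rcases C.foldVert_eq_iff u' u hxy with h4 | ⟨h4, h5⟩ | ⟨h4, h5⟩
    · exact hsame _ _ h4
    · exact ((hsame _ _ (h4.trans h2.symm)).trans _ _ _ (h3.symm _ _)).trans _ _ _
        (hsame _ _ (h1.trans h5.symm))
    · exact ((hsame _ _ (h4.trans h1.symm)).trans _ _ _ h3).trans _ _ _
        (hsame _ _ (h2.trans h5.symm))
  · change (q (C.src e.1)).1 = C.src e.1 ∨ _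
    by_cases he : C.src e.1 = u'
    · right
      exact ⟨by change (q (C.src e.1)).1 = _; rw [he, hq, foldVert_self], he⟩
    · left
      rw [hq, foldVert_of_ne _ _ _ he]
  · change (q (C.tgt e.1)).1 = C.tgt e.1 ∨ _
    by_cases he : C.tgt e.1 = u'
    · right
      exact ⟨by change (q (C.tgt e.1)).1 = _; rw [he, hq, foldVert_self], he⟩
    · left
      rw [hq, foldVert_of_ne _ _ _ he]
  · change ((C.bdry c).map m).map ι = _
    rw [List.map_map]
    exact List.map_congr_left fun d _ => hm d
  · change (b.map m).map ι = _
    rw [List.map_map]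
    exact List.map_congr_left fun d _ => hm d

end IsDisc

end TwoComplex

open OneComplex Relation

/-! ### Labelled and coloured disc diagrams -/

section DartLabel

variable {D : OneComplex.{v}} {X : OneComplex.{u}} (lab : D.Edge → X.Dart)

theorem dartLabel_rev (d : D.Dart) : dartLabel lab (rev d) = rev (dartLabel lab d) := by
  obtain ⟨e, _ | _⟩ := d
  · exact (rev_rev _).symm
  · rfl

theorem dartLabel_fst (d : D.Dart) : (dartLabel lab d).1 = (lab d.1).1 := by
  obtain ⟨e, _ | _⟩ := d <;> rfl

variable {lab} {vert : D.Vert → X.Vert} (hs : ∀ e, vert (D.src e) = X.dsrc (lab e))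
  (ht : ∀ e, vert (D.tgt e) = X.dtgt (lab e))
include hs ht

theorem dsrc_dartLabel (d : D.Dart) : X.dsrc (dartLabel lab d) = vert (D.dsrc d) := by
  obtain ⟨e, _ | _⟩ := d
  · exact (dsrc_rev _).trans (ht e).symm
  · exact (hs e).symm

theorem dtgt_dartLabel (d : D.Dart) : X.dtgt (dartLabel lab d) = vert (D.dtgt d) := by
  rw [← dsrc_rev, ← dartLabel_rev, dsrc_dartLabel hs ht, dsrc_rev]

theorem isPath_dartLabel {x y : D.Vert} {p : List D.Dart} (h : D.IsPath x p y) :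
    X.IsPath (vert x) (p.map (dartLabel lab)) (vert y) := by
  induction p generalizing x with
  | nil => exact congrArg vert h
  | cons d p ih =>
    exact ⟨by rw [dsrc_dartLabel hs ht, h.1], by rw [dtgt_dartLabel hs ht]; exact ih h.2⟩

end DartLabel

namespace TwoComplex

/-- A combinatorial map from `C` to `X`, with a colouring of the edges of `C`, such that the edges
of a face that are mapped to edges in `T` have the same colour; there are at most `B n` edges of
colour `n`, for `n ≠ 0`. -/
structure Decoration (X : TwoComplex.{u}) (T : X.Edge → Prop) (B : ℕ → ℕ) (C : TwoComplex.{0}) where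
  vert : C.Vert → X.Vert
  edge : C.Edge → X.Dart
  colour : C.Edge → ℕ
  src : ∀ e, vert (C.src e) = X.dsrc (edge e)
  tgt : ∀ e, vert (C.tgt e) = X.dtgt (edge e)
  face : ∀ c, ∃ F : X.Face, (C.bdry c).map (dartLabel edge) ~r X.bdry F ∨
    (C.bdry c).map (dartLabel edge) ~r FreeGroup.invRev (X.bdry F)
  mono : ∀ c, ∀ d ∈ C.bdry c, ∀ d' ∈ C.bdry c, T (edge d.1).1 → T (edge d'.1).1 →
    colour d.1 = colour d'.1
  count : ∀ n, n ≠ 0 → {e | colour e = n}.ncard ≤ B n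

/-- The label and the colour of an oriented edge. -/
def Decoration.dart {X : TwoComplex.{u}} {T : X.Edge → Prop} {B : ℕ → ℕ} {C : TwoComplex.{0}}
    (L : X.Decoration T B C) (d : C.Dart) : X.Dart × ℕ := (dartLabel L.edge d, L.colour d.1)

/-- There is a decorated disc diagram with the decorated loop `w` at `x` as boundary label. -/
def Bounds (X : TwoComplex.{u}) (T : X.Edge → Prop) (B : ℕ → ℕ) (x : X.Vert)
    (w : List (X.Dart × ℕ)) : Prop :=
  ∃ (C : TwoComplex.{0}) (o : List C.Dart) (L : X.Decoration T B C), C.IsDisc o ∧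
    o.map L.dart = w ∧ ∃ v, C.IsPath v o v ∧ L.vert v = x

namespace Bounds

variable {X : TwoComplex.{u}} {T : X.Edge → Prop} {B B' : ℕ → ℕ} {x y : X.Vert}
  {w : List (X.Dart × ℕ)}

theorem nil (X : TwoComplex.{u}) (T : X.Edge → Prop) (B : ℕ → ℕ) (x : X.Vert) :
    X.Bounds T B x [] :=
  ⟨point, [], ⟨fun _ => x, fun e : Empty => e.elim, fun e : Empty => e.elim,
    fun e : Empty => e.elim, fun e : Empty => e.elim, fun e : Empty => e.elim,
    fun e : Empty => e.elim, fun n _ => by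
      refine le_of_eq_of_le ?_ (Nat.zero_le _)
      exact (congrArg Set.ncard (Set.eq_empty_of_forall_notMem fun e : Empty => e.elim)).trans
        (Set.ncard_empty _)⟩,
    isDisc_point, rfl, (), rfl, rfl⟩

theorem mono (h : X.Bounds T B x w) (hB : ∀ n, n ≠ 0 → B n ≤ B' n) : X.Bounds T B' x w := by
  obtain ⟨C, o, L, h1, h2, h3⟩ := h
  exact ⟨C, o, { L with count := fun n hn => (L.count n hn).trans (hB n hn) }, h1, h2, h3⟩

theorem isPath (h : X.Bounds T B x w) : X.IsPath x (w.map Prod.fst) x := by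
  obtain ⟨C, o, L, h1, rfl, v, hv, rfl⟩ := h
  rw [List.map_map]
  exact isPath_dartLabel L.src L.tgt hv

theorem rotate {a b : List (X.Dart × ℕ)} (h : X.Bounds T B x (a ++ b))
    (ha : X.IsPath x (a.map Prod.fst) y) : X.Bounds T B y (b ++ a) := by
  obtain ⟨C, o, L, h1, h2, v, hv, rfl⟩ := h
  obtain ⟨a', b', rfl, rfl, rfl⟩ := List.map_eq_append_iff.1 h2
  obtain ⟨z, hz1, hz2⟩ := isPath_append.1 hv
  refine ⟨C, b' ++ a', L, h1.rotate (List.isRotated_iff_append.2 ⟨_, _, rfl, rfl⟩), List.map_append,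
    z, hz2.append hz1, ?_⟩
  have := isPath_dartLabel L.src L.tgt hz1
  rw [List.map_map] at ha
  exact this.tgt_unique ha

/-- A colour that does not occur. -/
theorem exists_fresh (h : X.Bounds T B x w) :
    ∃ a, a ≠ 0 ∧ X.Bounds T (Function.update B a 0) x w := by
  obtain ⟨C, o, L, h1, h2, h3⟩ := h
  have := h1.finite.2.1
  obtain ⟨a, ha⟩ := Set.Finite.exists_notMem ((Set.finite_range L.colour).insert 0)
  rw [Set.mem_insert_iff, not_or] at ha
  refine ⟨a, ha.1, C, o, { L with count := fun n hn => ?_ }, h1, h2, h3⟩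
  by_cases hna : n = a
  · subst hna
    rw [Function.update_self, Set.eq_empty_of_forall_notMem (s := {e | L.colour e = n})
      fun e he => ha.2 ⟨e, he⟩]
    simp
  · rw [Function.update_of_ne hna]
    exact L.count n hn

theorem ncard_option_le {E : Type} [Finite E] (κ : E → ℕ) (a n : ℕ) :
    {e : Option E | e.elim a κ = n}.ncard ≤ {e | κ e = n}.ncard + if n = a then 1 else 0 := by
  classical
  have h1 : {e : Option E | e.elim a κ = n} ⊆
      some '' {e | κ e = n} ∪ if n = a then {none} else ∅ := by
    rintro (_ | e) he
    · right
      rw [if_pos (show n = a from Eq.symm he)]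
      rfl
    · exact .inl ⟨e, he, rfl⟩
  refine (Set.ncard_le_ncard h1 (Set.toFinite _)).trans ((Set.ncard_union_le _ _).trans ?_)
  refine add_le_add (Set.ncard_image_le (Set.toFinite _)) ?_
  split_ifs <;> simp

theorem hair (h : X.Bounds T B x w) (d : X.Dart) (hd : X.dsrc d = x) (a : ℕ)
    (hB : ∀ n, n ≠ 0 → (B n + if n = a then 1 else 0) ≤ B' n) :
    X.Bounds T B' x ((d, a) :: (rev d, a) :: w) := by
  obtain ⟨C, o, L, h1, rfl, v, hv, rfl⟩ := h
  have := h1.finite.2.1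
  let edge : Option C.Edge → X.Dart := fun e => e.elim d L.edge
  have hlab : ∀ e : C.Dart, dartLabel (D := C.hairGraph v) edge (C.hairDart v e) =
      dartLabel L.edge e := by
    rintro ⟨e, _ | _⟩ <;> rfl
  let L' : X.Decoration T B' (C.hair v) :=
    { vert := fun z => z.elim (X.dtgt d) L.vert
      edge := edge
      colour := fun e => e.elim a L.colour
      src := by
        rintro (_ | e)
        · exact hd.symm
        · exact L.src e
      tgt := by
        rintro (_ | e)
        · rfl
        · exact L.tgt e
      face := fun c => by
        obtain ⟨F, hF⟩ := L.face c
        refine ⟨F, ?_⟩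
        change ((C.bdry c).map (C.hairDart v)).map _ ~r _ ∨
          ((C.bdry c).map (C.hairDart v)).map _ ~r _
        rwa [List.map_map, show dartLabel _ ∘ _ = dartLabel L.edge from funext hlab]
      mono := fun c e he e' he' => by
        obtain ⟨e, hm, rfl⟩ := List.mem_map.1 he
        obtain ⟨e', hm', rfl⟩ := List.mem_map.1 he'
        exact L.mono c e hm e' hm'
      count := fun n hn => (ncard_option_le L.colour a n).trans
        ((add_le_add_left (L.count n hn) _).trans (hB n hn)) }
  refine ⟨C.hair v, _, L', h1.hair hv, ?_, some v, ?_, rfl⟩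
  · change L'.dart (C.hairNew v) :: L'.dart (rev (C.hairNew v)) :: _ = (d, a) :: (rev d, a) :: _
    rw [List.map_map]
    refine congrArg₂ _ rfl (congrArg₂ _ rfl (List.map_congr_left fun e _ => ?_))
    exact Prod.ext (hlab e) rfl
  · exact ⟨rfl, rfl, isPath_hairGraph hv⟩

theorem chord {u b : List (X.Dart × ℕ)} (h : X.Bounds T B x (u ++ b)) (d : X.Dart)
    (hd : X.dsrc d = x) (hu : X.IsPath x (u.map Prod.fst) (X.dtgt d)) (a : ℕ)
    (hface : ∃ F : X.Face, u.map Prod.fst ++ [rev d] ~r X.bdry F ∨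
      u.map Prod.fst ++ [rev d] ~r FreeGroup.invRev (X.bdry F))
    (hmono : ∀ c ∈ (d, a) :: u, ∀ c' ∈ (d, a) :: u, T c.1.1 → T c'.1.1 → c.2 = c'.2)
    (hB : ∀ n, n ≠ 0 → (B n + if n = a then 1 else 0) ≤ B' n) :
    X.Bounds T B' x ((d, a) :: b) := by
  obtain ⟨C, o, L, h1, h2, v, hv, rfl⟩ := h
  obtain ⟨u, b, rfl, rfl, rfl⟩ := List.map_eq_append_iff.1 h2
  obtain ⟨z, hz1, hz2⟩ := isPath_append.1 hv
  have hz : L.vert z = X.dtgt d := by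
    have := isPath_dartLabel L.src L.tgt hz1
    rw [List.map_map] at hu
    exact this.tgt_unique hu
  have := h1.finite.2.1
  let edge : Option C.Edge → X.Dart := fun e => e.elim d L.edge
  have hlab : ∀ e : C.Dart, dartLabel (D := C.chordGraph v z) edge (C.chordDart v z e) =
      dartLabel L.edge e := by
    rintro ⟨e, _ | _⟩ <;> rfl
  let L' : X.Decoration T B' (TwoComplex.chord hz1) :=
    { vert := L.vert
      edge := edge
      colour := fun e => e.elim a L.colour
      src := by
        rintro (_ | e)
        · exact hd.symm
        · exact L.src e
      tgt := by
        rintro (_ | e)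
        · exact hz
        · exact L.tgt e
      face := by
        rintro (_ | c)
        · obtain ⟨F, hF⟩ := hface
          refine ⟨F, ?_⟩
          have : (u.map (C.chordDart v z) ++ [rev (C.chordNew v z)]).map
              (dartLabel (D := C.chordGraph v z) edge) =
              (u.map L.dart).map Prod.fst ++ [rev d] := by
            rw [List.map_append, List.map_map, List.map_map]
            exact congrArg₂ _ (List.map_congr_left fun e _ => hlab e) rfl
          rw [← this] at hF
          exact hF
        · obtain ⟨F, hF⟩ := L.face c
          refine ⟨F, ?_⟩
          change ((C.bdry c).map (C.chordDart v z)).map _ ~r _ ∨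
            ((C.bdry c).map (C.chordDart v z)).map _ ~r _
          rwa [List.map_map, show dartLabel _ ∘ _ = dartLabel L.edge from funext hlab]
      mono := by
        rintro (_ | c) e he e' he'
        · have key : ∀ e ∈ u.map (C.chordDart v z) ++ [rev (C.chordNew v z)],
              ∃ c ∈ (d, a) :: u.map L.dart, c.1.1 = (edge e.1).1 ∧ c.2 = e.1.elim a L.colour := by
            intro e he
            rcases List.mem_append.1 he with he | he
            · obtain ⟨e, hm, rfl⟩ := List.mem_map.1 he
              exact ⟨L.dart e, List.mem_cons_of_mem _ (List.mem_map_of_mem hm),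
                dartLabel_fst L.edge e, rfl⟩
            · obtain rfl := List.mem_singleton.1 he
              exact ⟨_, List.mem_cons_self, rfl, rfl⟩
          obtain ⟨c, hc, h3, h4⟩ := key e he
          obtain ⟨c', hc', h3', h4'⟩ := key e' he'
          have := hmono c hc c' hc'
          rwa [h3, h3', h4, h4'] at this
        · obtain ⟨e, hm, rfl⟩ := List.mem_map.1 he
          obtain ⟨e', hm', rfl⟩ := List.mem_map.1 he'
          exact L.mono c e hm e' hm'
      count := fun n hn => (ncard_option_le L.colour a n).trans
        ((add_le_add_left (L.count n hn) _).trans (hB n hn)) }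
  refine ⟨TwoComplex.chord hz1, _, L', h1.chord hz1 hz2, ?_, v, ?_, rfl⟩
  · change L'.dart (C.chordNew v z) :: _ = (d, a) :: _
    rw [List.map_map]
    refine congrArg₂ _ rfl (List.map_congr_left fun e _ => ?_)
    exact Prod.ext (hlab e) rfl
  · exact ⟨rfl, isPath_chordGraph hz2⟩

/-- Removal of a backtracking, the diagram being changed by a map of complexes. -/
theorem of_decoration_map {C C' : TwoComplex.{0}} (L : X.Decoration T B C) [Finite C.Edge]
    {o : List C'.Dart} (ho : C'.IsDisc o) (g : C.Dart → C.Dart) (hg : ∀ d, L.dart (g d) = L.dart d)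
    (jV : C'.Vert → C.Vert) (j : C'.Edge → C.Edge)
    (hj : Function.Injective j)
    (hsrc : ∀ e, L.vert (jV (C'.src e)) = L.vert (C.src (j e)))
    (htgt : ∀ e, L.vert (jV (C'.tgt e)) = L.vert (C.tgt (j e)))
    (hface : ∀ c', ∃ c, (C'.bdry c').map (Prod.map j id) = (C.bdry c).map g)
    {b : List C.Dart} (hb : o.map (Prod.map j id) = b.map g) (hne : b ≠ [])
    (hp : X.IsPath x ((b.map L.dart).map Prod.fst) x) :
    X.Bounds T B x (b.map L.dart) := by
  have hlab : ∀ d : C'.Dart, dartLabel (fun e => L.edge (j e)) d =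
      dartLabel L.edge (Prod.map j id d : C.Dart) := by
    rintro ⟨e, _ | _⟩ <;> rfl
  have hlist : ∀ (l' : List C'.Dart) (l : List C.Dart), l'.map (Prod.map j id) = l.map g →
      l'.map (fun d => (dartLabel (fun e => L.edge (j e)) d, L.colour (j d.1))) = l.map L.dart := by
    intro l' l hl
    calc l'.map _ = (l'.map (Prod.map j id)).map L.dart := by
          rw [List.map_map]
          exact List.map_congr_left fun d _ => Prod.ext (hlab d) rfl
      _ = l.map L.dart := by
          rw [hl, List.map_map]
          exact List.map_congr_left fun d _ => hg d
  let L' : X.Decoration T B C' :=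
    { vert := fun z => L.vert (jV z)
      edge := fun e => L.edge (j e)
      colour := fun e => L.colour (j e)
      src := fun e => (hsrc e).trans (L.src _)
      tgt := fun e => (htgt e).trans (L.tgt _)
      face := fun c' => by
        obtain ⟨c, hc⟩ := hface c'
        obtain ⟨F, hF⟩ := L.face c
        refine ⟨F, ?_⟩
        have := congrArg (List.map Prod.fst) (hlist _ _ hc)
        rw [List.map_map, List.map_map] at this
        change (C'.bdry c').map (dartLabel fun e => L.edge (j e)) =
          (C.bdry c).map (dartLabel L.edge) at this
        rwa [this]
      mono := fun c' d hd d' hd' hT hT' => by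
        obtain ⟨c, hc⟩ := hface c'
        have key : ∀ d ∈ C'.bdry c', ∃ e ∈ C.bdry c, (L.edge e.1).1 = (L.edge (j d.1)).1 ∧
            L.colour e.1 = L.colour (j d.1) := by
          intro d hd
          have h1 : Prod.map j id d ∈ (C'.bdry c').map (Prod.map j id) := List.mem_map_of_mem hd
          rw [hc] at h1
          obtain ⟨e, he, hed⟩ := List.mem_map.1 h1
          have h2 := hg e
          rw [hed] at h2
          refine ⟨e, he, ?_, (congrArg Prod.snd h2).symm⟩
          have h3 := congrArg (fun a => a.1.1) h2
          simp only [Decoration.dart, dartLabel_fst] at h3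
          exact h3.symm
        obtain ⟨e, he, h1, h2⟩ := key d hd
        obtain ⟨e', he', h1', h2'⟩ := key d' hd'
        rw [← h2, ← h2']
        exact L.mono c e he e' he' (by rwa [h1]) (by rwa [h1'])
      count := fun n hn => le_trans (Set.ncard_le_ncard_of_injOn j (fun e he => he) hj.injOn
        (Set.toFinite _)) (L.count n hn) }
  obtain ⟨v, hv⟩ := ho.outer_closed
  have ho' : o.map L'.dart = b.map L.dart := hlist _ _ hb
  refine ⟨C', o, L', ho, ho', v, hv, ?_⟩
  have h1 := isPath_dartLabel L'.src L'.tgt hv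
  rw [← ho', List.map_map] at hp
  refine IsPath.src_eq ?_ h1 hp
  intro h0
  rw [List.map_eq_nil_iff] at h0
  rw [h0] at hb
  exact hne (List.map_eq_nil_iff.1 hb.symm)

/-- The two boundary edges have inverse labels, so they can be folded together, or cut off if they
form a closed path. Their colours must agree in order that the folded edge has a colour. As the
edges of the new diagram are some of the old ones, no colour gains edges. -/
theorem cancel {d : X.Dart} {a : ℕ} (h : X.Bounds T B x ((d, a) :: (rev d, a) :: w)) :
    X.Bounds T B x w := by
  -- If nothing is left of the boundary, cancelling would produce a closed sphere; the single vertex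
  -- serves as the diagram instead.
  rcases List.eq_nil_or_concat' w with rfl | ⟨w', c, hw⟩
  · exact nil X T B x
  have hne : w ≠ [] := by rw [hw]; simp
  have hp := h.isPath
  obtain ⟨C, o, L, h1, h2, v, hv, -⟩ := h
  obtain ⟨α, o, rfl, hα, h2⟩ := List.map_eq_cons_iff.1 h2
  obtain ⟨β, b, rfl, hβ, rfl⟩ := List.map_eq_cons_iff.1 h2
  have hfin := h1.finite.2.1
  have hp' : X.IsPath x ((b.map L.dart).map Prod.fst) x := by
    obtain ⟨rfl, -, hp⟩ := hp
    rwa [dtgt_rev] at hp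
  have hb : b ≠ [] := fun e => hne (by rw [e]; rfl)
  by_cases hαβ : C.dsrc α = C.dtgt β
  · obtain ⟨y₀, b', rfl⟩ := List.exists_cons_of_ne_nil hb
    obtain ⟨C', o', jV, j, h3, h4, h5, h6, h7, h8⟩ := h1.exists_cut hαβ
    refine of_decoration_map L h3 id (fun _ => rfl) jV j h4 (fun e => congrArg L.vert (h5 e))
      (fun e => congrArg L.vert (h6 e)) (fun c => ?_) (h8.trans (List.map_id _).symm) hb hp'
    obtain ⟨c', hc'⟩ := h7 c
    exact ⟨c', hc'.trans (List.map_id _).symm⟩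
  · obtain ⟨C', o', jV, j, h3, h4, h5, h6, h7, h8⟩ := h1.exists_fold hαβ
    have hv' : L.vert (C.dsrc α) = L.vert (C.dtgt β) := by
      rw [← dsrc_dartLabel L.src L.tgt, ← dtgt_dartLabel L.src L.tgt,
        show dartLabel L.edge α = d from congrArg Prod.fst hα,
        show dartLabel L.edge β = rev d from congrArg Prod.fst hβ, dtgt_rev]
    have hc : L.colour α.1 = L.colour β.1 :=
      (congrArg Prod.snd hα).trans (congrArg Prod.snd hβ).symm
    have hl : rev (dartLabel L.edge α) = dartLabel L.edge β := by
      rw [show dartLabel L.edge α = d from congrArg Prod.fst hα,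
        show dartLabel L.edge β = rev d from congrArg Prod.fst hβ]
    refine of_decoration_map L h3 (foldDart α β) (fun e => ?_) jV j h4 (fun e => ?_) (fun e => ?_)
      h7 h8 hb hp'
    · by_cases he : e.1 = β.1
      · rcases eq_or_eq_rev he with rfl | rfl
        · rw [foldDart_self]
          exact Prod.ext ((dartLabel_rev _ _).trans hl) hc
        · rw [foldDart_rev_self]
          refine Prod.ext ?_ hc
          change _ = dartLabel L.edge (rev β)
          rw [dartLabel_rev, ← hl, rev_rev]
          rfl
      · rw [foldDart_of_ne he]
    · rcases h5 e with h5 | ⟨h5, h6⟩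
      · rw [h5]
      · rw [h5, h6, hv']
    · rcases h6 e with h5 | ⟨h5, h6⟩
      · rw [h5]
      · rw [h5, h6, hv']

end Bounds

end TwoComplex

open OneComplex Relation

/-! ### Changing the boundary label by a homotopy -/

namespace TwoComplex

/-- The decoration of a path by the colour `0`. -/
def plain {X : TwoComplex.{u}} (p : List X.Dart) : List (X.Dart × ℕ) := p.map fun d => (d, 0)

section Plain

variable {X : TwoComplex.{u}}

theorem plain_append (p q : List X.Dart) : plain (p ++ q) = plain p ++ plain q := List.map_append

theorem map_fst_plain (p : List X.Dart) : (plain p).map Prod.fst = p := by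
  simp [plain, Function.comp_def]

theorem snd_of_mem_plain {p : List X.Dart} {c : X.Dart × ℕ} (h : c ∈ plain p) : c.2 = 0 := by
  obtain ⟨d, -, rfl⟩ := List.mem_map.1 h
  rfl

end Plain

namespace Bounds

variable {X : TwoComplex.{u}} {T : X.Edge → Prop} {B : ℕ → ℕ} {x y z : X.Vert}
  {w a b : List (X.Dart × ℕ)}

theorem rotateBack (h : X.Bounds T B x (a ++ b)) (hb : X.IsPath y (b.map Prod.fst) x) :
    X.Bounds T B y (b ++ a) := by
  have hp := h.isPath
  rw [List.map_append] at hp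
  obtain ⟨z, h1, h2⟩ := isPath_append.1 hp
  by_cases hn : b = []
  · subst hn
    obtain rfl : y = x := hb
    simpa using h
  · obtain rfl := IsPath.src_eq (by simpa using hn) hb h2
    exact h.rotate h1

theorem insert_pair (h : X.Bounds T B x w) {d : X.Dart} (hd : X.dsrc d = x) :
    X.Bounds T B x ((d, 0) :: (rev d, 0) :: w) :=
  h.hair d hd 0 fun n hn => by rw [if_neg hn]; exact le_rfl

theorem insert_invRev (h : X.Bounds T B x w) {p : List X.Dart} (hp : X.IsPath x p y) :
    X.Bounds T B x (plain p ++ (plain (FreeGroup.invRev p) ++ w)) := by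
  induction p generalizing x w with
  | nil => exact h
  | cons d p ih =>
    obtain ⟨hd, hp⟩ := hp
    have h1 := (h.insert_pair hd).rotate (a := [(d, 0)]) (y := X.dtgt d) ⟨hd, rfl⟩
    have h2 := ih h1 hp
    rw [List.cons_append, ← List.singleton_append, ← List.append_assoc (plain p),
      ← List.append_assoc, ← List.append_assoc] at h2
    have h3 := h2.rotateBack (y := x) ⟨hd, rfl⟩
    rw [invRev_cons, plain_append]
    simpa [plain] using h3

/-- With `d :: l` the boundary of the face, hairs along `l⁻¹ l` are attached first. Then an edge `d`
is drawn across `l⁻¹`, which cuts off a copy of the face. -/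
theorem insert_face (h : X.Bounds T B x w) (F : X.Face) (hF : X.IsPath x (X.bdry F) x) :
    X.Bounds T B x (plain (X.bdry F) ++ w) := by
  cases hl : X.bdry F with
  | nil => exact h
  | cons d l =>
    rw [hl] at hF
    obtain ⟨hd, hp⟩ := hF
    have h1 := h.insert_invRev (isPath_invRev hp)
    rw [FreeGroup.invRev_invRev] at h1
    refine h1.chord d hd ?_ 0 ⟨F, .inr ?_⟩ ?_ fun n hn => by rw [if_neg hn]; exact le_rfl
    · rw [map_fst_plain]
      exact isPath_invRev hp
    · rw [map_fst_plain, hl, invRev_cons]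
    · intro c hc c' hc' _ _
      rw [snd_of_mem_plain (p := d :: FreeGroup.invRev l) hc,
        snd_of_mem_plain (p := d :: FreeGroup.invRev l) hc']

/-- A further copy of the face is attached along all of its boundary except the first edge `d`. The
new boundary then contains `d` next to `rev d`, and these cancel. -/
theorem delete_face {F : X.Face} (h : X.Bounds T B x (plain (X.bdry F) ++ w))
    (hF : X.IsPath x (X.bdry F) x) : X.Bounds T B x w := by
  cases hl : X.bdry F with
  | nil => rwa [hl] at h
  | cons d l =>
    rw [hl] at h hF
    obtain ⟨hd, hp⟩ := hF
    have h1 := h.rotate (a := [(d, 0)]) (b := plain l ++ w) (y := X.dtgt d) ⟨hd, rfl⟩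
    rw [List.append_assoc] at h1
    have h2 := h1.chord (B' := B) (rev d) (dsrc_rev d) (by
        rw [map_fst_plain, dtgt_rev, hd]; exact hp) 0
      ⟨F, .inl (by
        rw [map_fst_plain, hl, rev_rev]
        exact List.isRotated_append)⟩
      (fun c hc c' hc' _ _ => by
        rw [snd_of_mem_plain (p := rev d :: l) hc, snd_of_mem_plain (p := rev d :: l) hc'])
      (fun n hn => by rw [if_neg hn]; exact le_rfl)
    rw [← List.cons_append] at h2
    exact (h2.rotateBack (y := x) ⟨hd, rfl⟩).cancel

/-- The boundary label may be changed by a homotopy (with edges of colour `0`). -/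
theorem homotopic {p q : List X.Dart} (hpq : X.PathHomotopic x y p q)
    (h : X.Bounds T B x (plain p ++ w)) : X.Bounds T B x (plain q ++ w) := by
  obtain ⟨hp, hq, hpq⟩ := hpq
  suffices H : ∀ p q : X.Path x y, X.Homotopic p q →
      (X.Bounds T B x (plain p.1 ++ w) ↔ X.Bounds T B x (plain q.1 ++ w)) from (H _ _ hpq).1 h
  -- An elementary homotopy in the middle of a path is performed at the beginning of the boundary
  -- label, after the part `a` before it has been rotated to the end.
  have key : ∀ {z : X.Vert} {a r : List X.Dart} {b : List X.Dart}, X.IsPath x a z →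
      (∀ w', X.Bounds T B z (plain r ++ w') ↔ X.Bounds T B z w') →
      (X.Bounds T B x (plain (a ++ r ++ b) ++ w) ↔ X.Bounds T B x (plain (a ++ b) ++ w)) := by
    intro z a r b ha H
    have hr : ∀ w', X.Bounds T B x (plain a ++ w') ↔ X.Bounds T B z (w' ++ plain a) := fun w' =>
      ⟨fun h => h.rotate (by rwa [map_fst_plain]), fun h => h.rotateBack (by rwa [map_fst_plain])⟩
    simp only [plain_append, List.append_assoc, hr, H]
  intro p q hpq
  induction hpq with
  | refl p => rfl
  | symm p q _ ih => exact ih.symm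
  | trans p q r _ _ ih ih' => exact ih.trans ih'
  | rel p q h =>
    obtain ⟨p, hp⟩ := p
    obtain ⟨q, hq⟩ := q
    dsimp only at h ⊢
    cases h with
    | cancel a b d =>
      obtain ⟨z, h1, h2, -⟩ := isPath_append.1 hp
      have := key (r := [d, rev d]) (b := b) h1 fun w' =>
        ⟨fun h => Bounds.cancel h, fun h => h.insert_pair h2⟩
      simpa using this
    | face a b F =>
      rw [List.append_assoc] at hp
      obtain ⟨z, h1, h2⟩ := isPath_append.1 hp
      obtain ⟨z', h2, h3⟩ := isPath_append.1 h2
      obtain ⟨z₀, h5⟩ := X.bdry_closed F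
      obtain rfl : z = z' := by
        by_cases hn : X.bdry F = []
        · rw [hn] at h2; exact h2
        · obtain rfl := IsPath.src_eq hn h2 h5
          exact h5.tgt_unique h2
      exact key h1 fun w' => ⟨fun h => h.delete_face h2, fun h => h.insert_face F h2⟩

end Bounds

/-! ### Loops around faces, strips and noncrossing pairings -/

/-- `p` is the boundary of a face, read from any vertex in any direction. -/
def FaceLoop (X : TwoComplex.{u}) (p : List X.Dart) : Prop :=
  ∃ F : X.Face, p ~r X.bdry F ∨ p ~r FreeGroup.invRev (X.bdry F)

section FaceLoop

variable {X : TwoComplex.{u}} {p q : List X.Dart}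

theorem isRotated_invRev (h : p ~r q) : FreeGroup.invRev p ~r FreeGroup.invRev q := by
  obtain ⟨a, b, rfl, rfl⟩ := List.isRotated_iff_append.1 h
  rw [invRev_append, invRev_append]
  exact List.isRotated_append

theorem FaceLoop.of_isRotated (h : X.FaceLoop p) (hq : q ~r p) : X.FaceLoop q := by
  obtain ⟨F, h | h⟩ := h
  · exact ⟨F, .inl (hq.trans h)⟩
  · exact ⟨F, .inr (hq.trans h)⟩

theorem FaceLoop.invRev (h : X.FaceLoop p) : X.FaceLoop (FreeGroup.invRev p) := by
  obtain ⟨F, h | h⟩ := h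
  · exact ⟨F, .inr (isRotated_invRev h)⟩
  · exact ⟨F, .inl (by simpa using isRotated_invRev h)⟩

theorem FaceLoop.pathHomotopic (h : X.FaceLoop p) {x : X.Vert} (hp : X.IsPath x p x) :
    X.PathHomotopic x x p [] := by
  obtain ⟨F, h⟩ := h
  obtain ⟨y, hy⟩ := X.bdry_closed F
  rcases h with h | h
  · exact (PathHomotopic.face F hy).rotate h.symm hp
  · exact (PathHomotopic.face F hy).invRev.rotate h.symm hp

end FaceLoop

/-- A chain of `n` faces, from the edge `s` to the edge `s'`, with sides `p` and `q`. -/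
inductive Strip (X : TwoComplex.{u}) (T : X.Edge → Prop) :
    ℕ → X.Dart → List X.Dart → List X.Dart → X.Dart → Prop
  | nil {s : X.Dart} (hs : T s.1) : Strip X T 0 s [] [] s
  | cons {n : ℕ} {s s₁ s' : X.Dart} {p q p' q' : List X.Dart} (hs : T s.1)
      (hp : X.IsPath (X.dsrc s) p (X.dsrc s₁)) (hq : X.IsPath (X.dtgt s) q (X.dtgt s₁))
      (hpT : ∀ d ∈ p, ¬ T d.1) (hqT : ∀ d ∈ q, ¬ T d.1)
      (hface : X.FaceLoop (s :: q ++ rev s₁ :: FreeGroup.invRev p))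
      (h : Strip X T n s₁ p' q' s') : Strip X T (n + 1) s (p ++ p') (q ++ q') s'

/-- The path `w` from `x` to `y` has a noncrossing pairing of its `T`-edges, such that paired edges
are joined by strips of length at most `k`. -/
inductive Paired (X : TwoComplex.{u}) (T : X.Edge → Prop) (k : ℕ) :
    X.Vert → List X.Dart → X.Vert → Prop
  | nil (x : X.Vert) : Paired X T k x [] x
  | cons {y : X.Vert} {w : List X.Dart} (d : X.Dart) (hd : ¬ T d.1)
      (h : Paired X T k (X.dtgt d) w y) : Paired X T k (X.dsrc d) (d :: w) y
  | pair {n : ℕ} {z : X.Vert} {s s' : X.Dart} {p q b c : List X.Dart} (hst : X.Strip T n s p q s')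
      (hn : n ≤ k) (hb : X.PathHomotopic (X.dtgt s) (X.dtgt s') b q)
      (h₁ : Paired X T k (X.dtgt s) b (X.dtgt s')) (h₂ : Paired X T k (X.dsrc s') c z) :
      Paired X T k (X.dsrc s) (s :: b ++ rev s' :: c) z

section Strip

variable {X : TwoComplex.{u}} {T : X.Edge → Prop} {n k : ℕ} {s s' : X.Dart} {p q : List X.Dart}

namespace Strip

theorem fst (h : X.Strip T n s p q s') : T s.1 := by
  cases h <;> assumption

theorem snd (h : X.Strip T n s p q s') : T s'.1 := by
  induction h <;> assumption

theorem isPath_left (h : X.Strip T n s p q s') : X.IsPath (X.dsrc s) p (X.dsrc s') := by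
  induction h with
  | nil => rfl
  | cons hs hp hq hpT hqT hface h ih => exact hp.append ih

theorem isPath_right (h : X.Strip T n s p q s') : X.IsPath (X.dtgt s) q (X.dtgt s') := by
  induction h with
  | nil => rfl
  | cons hs hp hq hpT hqT hface h ih => exact hq.append ih

theorem pathHomotopic (h : X.Strip T n s p q s') :
    X.PathHomotopic (X.dsrc s) (X.dtgt s') (s :: q) (p ++ [s']) := by
  induction h with
  | nil => exact .refl ⟨rfl, rfl⟩
  | @cons n s s₁ s' p q p' q' hs hp hq hpT hqT hface h ih =>
    have h1 : X.IsPath (X.dsrc s) (s :: q) (X.dtgt s₁) := ⟨rfl, hq⟩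
    have h2 : X.IsPath (X.dsrc s) (p ++ [s₁]) (X.dtgt s₁) := hp.append ⟨rfl, rfl⟩
    have h3 : X.PathHomotopic (X.dsrc s) (X.dtgt s₁) (s :: q) (p ++ [s₁]) := by
      refine .of_append_invRev h1 h2 ?_
      refine FaceLoop.pathHomotopic ?_ (h1.append (isPath_invRev h2))
      rwa [invRev_append]
    have h4 := h3.append_right h.isPath_right
    have h5 := PathHomotopic.append_left hp ih
    simp only [List.append_assoc, List.cons_append, List.nil_append] at h4 h5 ⊢
    exact h4.trans h5

end Strip

theorem Paired.isPath {x y : X.Vert} {w : List X.Dart} (h : X.Paired T k x w y) :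
    X.IsPath x w y := by
  induction h with
  | nil => rfl
  | cons d hd h ih => exact ⟨rfl, ih⟩
  | pair hst hn hb h₁ h₂ ih₁ ih₂ =>
    exact ⟨rfl, ih₁.append ⟨dsrc_rev _, by rwa [dtgt_rev]⟩⟩

end Strip

/-! ### Diagrams from noncrossing pairings -/

namespace Bounds

variable {X : TwoComplex.{u}} {T : X.Edge → Prop} {B B' : ℕ → ℕ} {x y z : X.Vert}
  {w : List (X.Dart × ℕ)}

/-- The 2-cells of the strip are attached one after another. Each attachment replaces the current
cross edge, with one side, by the other side and the next cross edge, so it adds one edge of colour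
`a`; the edges of the sides have colour `0`, which is not counted. -/
theorem strip {n : ℕ} {s s' : X.Dart} {p q : List X.Dart} (hst : X.Strip T n s p q s') {a : ℕ}
    (h : X.Bounds T B (X.dtgt s) ((rev s, a) :: (plain p ++ w)))
    (hB : ∀ m, m ≠ 0 → (B m + if m = a then n else 0) ≤ B' m) :
    X.Bounds T B' (X.dtgt s) (plain q ++ (rev s', a) :: w) := by
  induction hst generalizing B w with
  | nil => exact h.mono fun m hm => (Nat.le_add_right _ _).trans (hB m hm)
  | @cons n s s₁ s' p q p' q' hs hp hq hpT hqT hface hst ih =>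
    have h1 := (h.insert_invRev hq).rotate (by rwa [map_fst_plain])
    rw [plain_append] at h1
    have h2 := Bounds.chord (u := plain (FreeGroup.invRev q) ++ (rev s, a) :: plain p)
      (b := plain p' ++ (w ++ plain q)) (B' := fun m => B m + if m = a then 1 else 0)
      (by simpa using h1) (rev s₁) (dsrc_rev _)
      (by
        rw [List.map_append, List.map_cons, map_fst_plain, map_fst_plain, dtgt_rev]
        exact (isPath_invRev hq).append ⟨dsrc_rev _, by rwa [dtgt_rev]⟩) a
      (by
        rw [List.map_append, List.map_cons, map_fst_plain, map_fst_plain, rev_rev]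
        refine hface.invRev.of_isRotated ?_
        rw [List.cons_append, invRev_cons, invRev_append, invRev_cons, FreeGroup.invRev_invRev,
          rev_rev]
        simp only [List.append_assoc, List.cons_append, List.nil_append]
        refine List.isRotated_iff_append.2 ⟨FreeGroup.invRev q ++ [rev s], p ++ [s₁], ?_, ?_⟩ <;>
          simp)
      (by
        have : ∀ c ∈ (rev s₁, a) :: (plain (FreeGroup.invRev q) ++ (rev s, a) :: plain p),
            T c.1.1 → c.2 = a := by
          intro c hc hT
          rw [List.mem_cons, List.mem_append, List.mem_cons] at hc
          rcases hc with rfl | hc | rfl | hc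
          · rfl
          · obtain ⟨d, hd, rfl⟩ := List.mem_map.1 hc
            simp only [FreeGroup.invRev, List.mem_reverse, List.mem_map] at hd
            obtain ⟨d, hd, rfl⟩ := hd
            exact (hqT d hd hT).elim
          · rfl
          · obtain ⟨d, hd, rfl⟩ := List.mem_map.1 hc
            exact (hpT d hd hT).elim
        intro c hc c' hc' h3 h4
        rw [this c hc h3, this c' hc' h4])
      (fun m _ => le_rfl)
    have h3 := ih h2 (fun m hm => by
      refine le_trans ?_ (hB m hm)
      split_ifs <;> omega)
    have h4 := Bounds.rotateBack (a := plain q' ++ (rev s', a) :: w) (b := plain q)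
      (y := X.dtgt s) (by simpa using h3) (by rwa [map_fst_plain])
    rw [plain_append]
    simpa using h4

/-- Induction on the pairing, starting from a plain boundary path `q` homotopic to `p`; each pair is
realised by a strip of its own colour. What lies beside the strips is filled by the homotopies of
the diagram, whose edges have colour `0`. -/
theorem of_paired {k : ℕ} {p : List X.Dart} (hw : X.Paired T k x p y) {q : List X.Dart}
    (hq : X.PathHomotopic x y p q) (h : X.Bounds T (fun _ => k + 1) x (plain q ++ w)) :
    ∃ p', p'.map Prod.fst = p ∧ (∀ c ∈ p', T c.1.1 → c.2 ≠ 0) ∧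
      X.Bounds T (fun _ => k + 1) x (p' ++ w) := by
  induction hw generalizing q w with
  | nil x => exact ⟨[], rfl, nofun, h.homotopic (p := q) (q := []) hq.symm⟩
  | @cons y p d hd hp ih =>
    have h1 := (h.homotopic hq.symm).rotate (a := [(d, 0)]) (b := plain p ++ w)
      (y := X.dtgt d) ⟨rfl, rfl⟩
    rw [List.append_assoc] at h1
    obtain ⟨p', h2, h3, h4⟩ := ih (.refl hp.isPath) h1
    rw [← List.append_assoc] at h4
    refine ⟨(d, 0) :: p', congrArg _ h2, ?_, h4.rotateBack (y := X.dsrc d) ⟨rfl, rfl⟩⟩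
    intro c hc hT
    rcases List.mem_cons.1 hc with rfl | hc
    · exact (hd hT).elim
    · exact h3 c hc hT
  | @pair n z s s' p₀ p₁ b c hst hn hb hpb hpc ih₁ ih₂ =>
    -- A colour not used so far. The hair `s` has one edge of this colour and the strip adds `n ≤ k`
    -- more, which explains the bound `k + 1`.
    obtain ⟨a, ha, h0⟩ := h.exists_fresh
    have h1 := ((h0.insert_invRev hst.isPath_left).hair s rfl a
      (B' := Function.update (fun _ => k + 1) a 1) (fun m hm => by
        by_cases hma : m = a
        · subst hma; simp
        · simp [hma])).rotate (a := [(s, a)]) (y := X.dtgt s) ⟨rfl, rfl⟩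
    rw [List.cons_append, List.append_assoc] at h1
    have h2 := h1.strip (B' := fun _ => k + 1) hst (fun m hm => by
        by_cases hma : m = a
        · subst hma; simp; omega
        · simp [hma])
    obtain ⟨b', h3, h4, h5⟩ := ih₁ hb h2
    have h6 := Bounds.rotate (a := b' ++ [(rev s', a)])
      (b := plain (FreeGroup.invRev p₀ ++ q) ++ (w ++ [(s, a)])) (y := X.dsrc s')
      (by simpa [plain_append] using h5)
      (by
        rw [List.map_append, h3]
        exact hpb.isPath.append ⟨dsrc_rev _, dtgt_rev _⟩)
    rw [List.append_assoc] at h6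
    have hl : X.PathHomotopic (X.dsrc s) (X.dsrc s') (s :: b ++ [rev s']) p₀ := by
      have e1 := ((PathHomotopic.append_left (isPath_singleton s) hb).trans
        hst.pathHomotopic).append_right (p' := [rev s']) ⟨dsrc_rev _, dtgt_rev _⟩
      have e2 := PathHomotopic.append_left hst.isPath_left
        (PathHomotopic.append_invRev_self (isPath_singleton s'))
      rw [List.append_nil] at e2
      simp only [List.append_assoc, List.cons_append, List.nil_append] at e1 ⊢
      exact e1.trans e2
    -- Once the strip is in place, the remaining part of the boundary runs back along its side `p₀`
    -- and then along `q`. This path is homotopic to `c`, so the induction hypothesis applies.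
    have hc' : X.PathHomotopic (X.dsrc s') z c (FreeGroup.invRev p₀ ++ q) := by
      have e1 : X.PathHomotopic (X.dsrc s) z ((s :: b ++ [rev s']) ++ c) q := by
        simpa using hq
      exact (e1.cancel_left hl.left).trans (hl.invRev.append_right hq.right)
    obtain ⟨c', h7, h8, h9⟩ := ih₂ hc' h6
    have h10 := Bounds.rotateBack (a := c' ++ w) (b := (s, a) :: b' ++ [(rev s', a)])
      (y := X.dsrc s) (by simpa using h9) (by
        rw [List.map_append, List.map_cons, h3]
        exact hl.left)
    refine ⟨(s, a) :: b' ++ (rev s', a) :: c', by simp [h3, h7], ?_, by simpa using h10⟩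
    intro e he hT
    simp only [List.cons_append, List.mem_cons, List.mem_append] at he
    rcases he with rfl | he | rfl | he
    · exact ha
    · exact h4 e he hT
    · exact ha
    · exact h8 e he hT

end Bounds

end TwoComplex

/-! ### Corridors of a diagram and the pairing that they define -/

open OneComplex Relation

/-- The first repetition in the chain could be moved back step by step, predecessors being unique,
until it involves `x`, which has no predecessor. -/
theorem List.IsChain.nodup {α : Type u} {r : α → α → Prop} {x : α} {l : List α}
    (h : List.IsChain r (x :: l)) (hx : ∀ y ∈ x :: l, ¬ r y x)
    (hr : ∀ y ∈ x :: l, ∀ y' ∈ x :: l, ∀ z, r y z → r y' z → y = y') : (x :: l).Nodup := by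
  rw [List.isChain_iff_getElem] at h
  have key : ∀ i j (hj : j < (x :: l).length) (hij : i < j),
      (x :: l)[i]'(hij.trans hj) ≠ (x :: l)[j] := by
    intro i
    induction i with
    | zero =>
      intro j hj hij e
      obtain ⟨j, rfl⟩ := Nat.exists_eq_succ_of_ne_zero hij.ne'
      have := h j hj
      rw [← e] at this
      exact hx _ (List.getElem_mem _) this
    | succ i ih =>
      intro j hj hij e
      obtain ⟨j, rfl⟩ := Nat.exists_eq_succ_of_ne_zero (by omega : j ≠ 0)
      have h1 := h i (hij.trans hj)
      have h2 := h j hj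
      rw [← e] at h2
      exact ih j (by omega) (by omega) (hr _ (List.getElem_mem _) _ (List.getElem_mem _) _ h1 h2)
  rw [List.nodup_iff_pairwise_ne, List.pairwise_iff_getElem]
  exact fun i j hi hj hij => key i j hj hij

namespace TwoComplex

/-- Every face has no edge or exactly two edges in `T`, the latter of opposite signs. -/
def TwoSided (C : TwoComplex.{u}) (T : C.Edge → Prop) (sgn : C.Dart → Bool) : Prop :=
  ∀ c, ∀ α ∈ C.bdry c, T α.1 → ∃ β ∈ C.bdry c, T β.1 ∧ sgn β = !sgn α ∧
    ∀ γ ∈ C.bdry c, T γ.1 → γ = α ∨ γ = β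

/-- `y` and `z` are two edges of a face, which is crossed from `y` to `z`. -/
def Crosses (C : TwoComplex.{u}) (y z : C.Dart) : Prop :=
  ∃ c, rev y ∈ C.bdry c ∧ z ∈ C.bdry c ∧ z ≠ rev y

section Free

variable {X : TwoComplex.{u}} {T : X.Edge → Prop} {n : ℕ} {s s' : X.Dart} {p q : List X.Dart}

theorem Strip.free_left (h : X.Strip T n s p q s') : ∀ d ∈ p, ¬ T d.1 := by
  induction h with
  | nil => exact nofun
  | cons hs hp hq hpT hqT hface h ih =>
    intro d hd
    rcases List.mem_append.1 hd with hd | hd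
    · exact hpT d hd
    · exact ih d hd

theorem Strip.free_right (h : X.Strip T n s p q s') : ∀ d ∈ q, ¬ T d.1 := by
  induction h with
  | nil => exact nofun
  | cons hs hp hq hpT hqT hface h ih =>
    intro d hd
    rcases List.mem_append.1 hd with hd | hd
    · exact hqT d hd
    · exact ih d hd

theorem eq_of_isPath_of_forall {β : Type v} {g : X.Vert → β} {x y : X.Vert}
    (h : X.IsPath x p y) (hp : ∀ d ∈ p, g (X.dtgt d) = g (X.dsrc d)) : g x = g y := by
  induction p generalizing x with
  | nil => exact congrArg g h
  | cons d p ih =>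
    rw [← h.1, ← hp d List.mem_cons_self]
    exact ih h.2 fun e he => hp e (List.mem_cons_of_mem _ he)

end Free

section Corridor

variable {C : TwoComplex.{0}} {o : List C.Dart} {T : C.Edge → Prop} {sgn : C.Dart → Bool}

theorem TwoSided.eq (hT : C.TwoSided T sgn) {c : C.Face} {α β γ : C.Dart} (hα : α ∈ C.bdry c)
    (hβ : β ∈ C.bdry c) (hγ : γ ∈ C.bdry c) (hαT : T α.1) (hβT : T β.1) (hγT : T γ.1)
    (h1 : α ≠ γ) (h2 : β ≠ γ) : α = β := by
  obtain ⟨δ, -, -, -, h⟩ := hT c γ hγ hγT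
  rcases h α hα hαT with e | e
  · exact (h1 e).elim
  · rcases h β hβ hβT with e' | e'
    · exact (h2 e').elim
    · rw [e, e']

theorem TwoSided.sgn_eq (hT : C.TwoSided T sgn) (hsgn : ∀ d, sgn (rev d) = !sgn d) {y z : C.Dart}
    (hy : T y.1) (hz : T z.1) (h : C.Crosses y z) : sgn z = sgn y := by
  obtain ⟨c, h1, h2, h3⟩ := h
  obtain ⟨β, h4, h5, h6, h7⟩ := hT c (rev y) h1 hy
  rcases h7 z h2 hz with e | e
  · exact (h3 e).elim
  · rw [e, h6, hsgn, Bool.not_not]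

namespace IsDisc

variable (h : C.IsDisc o) (hT : C.TwoSided T sgn)
include h

theorem eq_face {x : C.Dart} {c c' : C.Face} (hc : x ∈ C.bdry c) (hc' : x ∈ C.bdry c') : c = c' :=
  Option.some.inj (h.eq_side (i := some c) (j := some c') hc hc')

theorem not_crosses_outer {x y : C.Dart} (hx : x ∈ o) : ¬ C.Crosses y x :=
  fun ⟨c, _, h2, _⟩ => h.notMem_bdry hx c h2

include hT

/-- An oriented edge lies on only one face, and this face has just one other `T`-edge, so
predecessors in a corridor are unique. An edge of the boundary cycle has no predecessor. -/
theorem corridor_nodup {x : C.Dart} {l : List C.Dart} (hx : x ∈ o) (hl : ∀ y ∈ x :: l, T y.1)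
    (hc : List.IsChain C.Crosses (x :: l)) : (x :: l).Nodup := by
  have hc' : List.IsChain (fun y z => T z.1 ∧ C.Crosses y z) (x :: l) := by
    rw [List.isChain_iff_getElem] at hc ⊢
    exact fun i hi => ⟨hl _ (List.getElem_mem _), hc i hi⟩
  refine hc'.nodup (fun y _ hy => h.not_crosses_outer hx hy.2) ?_
  rintro y hy y' hy' z ⟨hz, c, h1, h2, h3⟩ ⟨-, c', h1', h2', h3'⟩
  obtain rfl := h.eq_face h2 h2'
  exact rev_injective (hT.eq h1 h1' h2 (hl y hy) (hl y' hy') hz h3.symm h3'.symm)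

/-- As long as the boundary is not reached, the face ahead has a second `T`-edge and the corridor
can be continued. It never repeats an edge, so finiteness makes it end. -/
theorem exists_corridor {x : C.Dart} (hx : x ∈ o) (hxT : T x.1) :
    ∃ l, (∀ y ∈ x :: l, T y.1) ∧ List.IsChain C.Crosses (x :: l) ∧
      rev ((x :: l).getLast (List.cons_ne_nil x l)) ∈ o := by
  by_contra hcon
  have hfin := h.finite_dart
  have hcl : ∀ n, ∃ l, l.length = n ∧ (∀ y ∈ x :: l, T y.1) ∧ List.IsChain C.Crosses (x :: l) := by
    intro n
    induction n with
    | zero => exact ⟨[], rfl, by simpa using hxT, .singleton _⟩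
    | succ n ih =>
      obtain ⟨l, hl, h1, h2⟩ := ih
      set y := (x :: l).getLast (List.cons_ne_nil x l) with hy
      have h3 : rev y ∉ o := fun h3 => hcon ⟨l, h1, h2, h3⟩
      have hyT : T y.1 := h1 y (List.getLast_mem _)
      obtain ⟨i, hi, -⟩ := h.existsUnique (rev y)
      rcases i with _ | c
      · exact (h3 hi).elim
      obtain ⟨z, hz1, hz2, hz3, -⟩ := hT c (rev y) hi hyT
      refine ⟨l ++ [z], by simp [hl], ?_, ?_⟩
      · intro d hd
        rw [← List.cons_append, List.mem_append, List.mem_singleton] at hd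
        rcases hd with hd | rfl
        · exact h1 d hd
        · exact hz2
      · rw [← List.cons_append, List.isChain_append]
        refine ⟨h2, .singleton z, ?_⟩
        intro a ha b hb
        rw [List.getLast?_eq_some_getLast (List.cons_ne_nil x l), Option.mem_some_iff] at ha
        obtain rfl : z = b := by simpa using hb
        subst ha
        refine ⟨c, hi, hz1, fun e => ?_⟩
        rw [← e] at hz3
        simp at hz3
  obtain ⟨l, hl, h1, h2⟩ := hcl (Nat.card C.Dart)
  have h3 := h.corridor_nodup hT hx h1 h2
  have : Fintype C.Dart := Fintype.ofFinite _
  have h4 := h3.length_le_card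
  rw [Nat.card_eq_fintype_card] at hl
  simp only [List.length_cons] at h4
  omega

/-- The two `T`-edges divide the boundary of each crossed face into two paths without `T`-edges;
these are the pieces of the sides of the strip. -/
theorem corridor_strip {x : C.Dart} {l : List C.Dart} (hl : ∀ y ∈ x :: l, T y.1)
    (hc : List.IsChain C.Crosses (x :: l)) :
    ∃ p q, C.Strip T l.length x p q ((x :: l).getLast (List.cons_ne_nil x l)) := by
  induction l generalizing x with
  | nil => exact ⟨[], [], .nil (hl x (by simp))⟩
  | cons z l ih =>
    rw [List.isChain_cons_cons] at hc
    obtain ⟨p, q, hpq⟩ := ih (fun y hy => hl y (List.mem_cons_of_mem _ hy)) hc.2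
    obtain ⟨c, h1, h2, h3⟩ := hc.1
    have hx := hl x List.mem_cons_self
    have hz := hl z (List.mem_cons_of_mem _ List.mem_cons_self)
    obtain ⟨u₁, u₂, hu⟩ := List.append_of_mem h1
    have hr : rev x :: (u₂ ++ u₁) ~r C.bdry c :=
      List.isRotated_iff_append.2 ⟨rev x :: u₂, u₁, rfl, hu⟩
    have hz2 : z ∈ u₂ ++ u₁ := by
      rcases List.mem_cons.1 (hr.perm.mem_iff.2 h2) with e | e
      · exact (h3 e).elim
      · exact e
    obtain ⟨u, v, huv⟩ := List.append_of_mem hz2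
    rw [huv] at hr
    have hn := (hr.perm.nodup_iff).2 (h.nodup (some c))
    obtain ⟨β, -, -, -, hβ⟩ := hT c (rev x) h1 hx
    have hfree : ∀ d ∈ u ++ v, ¬ T d.1 := by
      intro d hd hdT
      have hdz : d ∈ rev x :: (u ++ z :: v) := by
        rw [List.mem_append] at hd
        simp only [List.mem_cons, List.mem_append]
        tauto
      have hdm : d ∈ C.bdry c := hr.perm.mem_iff.1 hdz
      have h4 : d ≠ rev x := by
        rintro rfl
        rw [List.nodup_cons] at hn
        refine hn.1 ?_
        rw [List.mem_append] at hd
        simp only [List.mem_cons, List.mem_append]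
        tauto
      have h5 : d = z := by
        have e1 := (hβ d hdm hdT).resolve_left h4
        have e2 := (hβ z h2 hz).resolve_left h3
        rw [e1, e2]
      subst h5
      have h6 := (List.nodup_middle.1 (List.nodup_cons.1 hn).2)
      exact (List.nodup_cons.1 h6).1 hd
    obtain ⟨w, hw⟩ := C.bdry_closed c
    obtain ⟨w', hw'⟩ : ∃ w', C.IsPath w' (rev x :: (u ++ z :: v)) w' := isPath_rotate hw hr.symm
    obtain ⟨e1, hw'⟩ := hw'
    rw [dsrc_rev] at e1
    subst e1
    rw [dtgt_rev] at hw'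
    obtain ⟨y, hu', hy, hv'⟩ := isPath_append.1 hw'
    subst hy
    refine ⟨u ++ p, FreeGroup.invRev v ++ q, .cons hx hu' (isPath_invRev hv')
      (fun d hd => hfree d (List.mem_append_left _ hd)) ?_ ?_ hpq⟩
    · intro d hd
      simp only [FreeGroup.invRev, List.mem_reverse, List.mem_map] at hd
      obtain ⟨d, hd, rfl⟩ := hd
      exact hfree d (List.mem_append_right _ hd)
    · have h5 : C.FaceLoop (rev x :: (u ++ z :: v)) := ⟨c, .inl hr⟩
      refine h5.invRev.of_isRotated ?_
      rw [invRev_cons, invRev_append, invRev_cons, rev_rev]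
      refine List.isRotated_iff_append.2 ⟨[x], FreeGroup.invRev v ++ rev z :: FreeGroup.invRev u,
        ?_, ?_⟩ <;> simp

omit h in
theorem corridor_sgn (hsgn : ∀ d, sgn (rev d) = !sgn d) {x : C.Dart} {l : List C.Dart}
    (hl : ∀ y ∈ x :: l, T y.1) (hc : List.IsChain C.Crosses (x :: l)) :
    sgn ((x :: l).getLast (List.cons_ne_nil x l)) = sgn x := by
  induction l generalizing x with
  | nil => rfl
  | cons z l ih =>
    rw [List.isChain_cons_cons] at hc
    rw [List.getLast_cons (List.cons_ne_nil z l),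
      ih (fun y hy => hl y (List.mem_cons_of_mem _ hy)) hc.2]
    exact hT.sgn_eq hsgn (hl x List.mem_cons_self)
      (hl z (List.mem_cons_of_mem _ List.mem_cons_self)) hc.1

/-- A function on the vertices that jumps along a corridor. -/
theorem corridor_potential (hsgn : ∀ d, sgn (rev d) = !sgn d) {x : C.Dart} {l : List C.Dart}
    (hx : x ∈ o) (hl : ∀ y ∈ x :: l, T y.1) (hc : List.IsChain C.Crosses (x :: l))
    (ho : rev ((x :: l).getLast (List.cons_ne_nil x l)) ∈ o) :
    ∃ s : C.Vert → ℤ, s (C.dsrc x) = 0 ∧ s (C.dtgt x) = 1 ∧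
      s (C.dsrc ((x :: l).getLast (List.cons_ne_nil x l))) = 0 ∧
      s (C.dtgt ((x :: l).getLast (List.cons_ne_nil x l))) = 1 ∧
      (∀ d : C.Dart, ¬ T d.1 → s (C.dtgt d) = s (C.dsrc d)) ∧
      ∀ d ∈ o, d ≠ x → d ≠ rev ((x :: l).getLast (List.cons_ne_nil x l)) →
        s (C.dtgt d) = s (C.dsrc d) := by
  classical
  set e := (x :: l).getLast (List.cons_ne_nil x l) with he
  have hout : ∀ d ∈ x :: l, d ∈ o → d = x := by
    intro d hd hdo
    obtain ⟨i, hi, rfl⟩ := List.getElem_of_mem hd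
    rcases i with _ | i
    · rfl
    · exact (h.not_crosses_outer hdo (List.isChain_iff_getElem.1 hc i hi)).elim
  have hout' : ∀ d ∈ x :: l, rev d ∈ o → d = e := by
    intro d hd hdo
    obtain ⟨i, hi, rfl⟩ := List.getElem_of_mem hd
    by_cases hi' : i + 1 < (x :: l).length
    · obtain ⟨c, h1, -⟩ := List.isChain_iff_getElem.1 hc i hi'
      exact (h.notMem_bdry hdo c h1).elim
    · rw [he, List.getLast_eq_getElem]
      congr 1
      omega
  -- The sign is constant along a corridor, so no edge is crossed in both directions and the cocycle
  -- below has the value `1` on the edges of the corridor.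
  have hsg : ∀ d ∈ x :: l, rev d ∉ x :: l := by
    have hs : ∀ d ∈ x :: l, sgn d = sgn x := by
      intro d hd
      obtain ⟨a, b, hab⟩ := List.append_of_mem hd
      have h1 : (a ++ [d]) <+: (x :: l) := ⟨b, by rw [hab]; simp⟩
      rcases a with _ | ⟨a₀, a⟩
      · simp only [List.nil_append, List.cons.injEq] at hab
        rw [hab.1]
      · have hab' := hab
        simp only [List.cons_append, List.cons.injEq] at hab'
        obtain ⟨rfl, -⟩ := hab'
        have := corridor_sgn hT hsgn (x := x) (l := a ++ [d])
          (fun y hy => hl y (h1.subset hy)) (hc.prefix h1)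
        simpa using this
    intro d hd hd'
    have h1 := hs _ hd'
    rw [hsgn, hs d hd] at h1
    simp at h1
  have hstep : ∀ c α β, α ∈ C.bdry c → β ∈ C.bdry c → T β.1 → β ≠ α → α ∈ x :: l →
      rev β ∈ x :: l := by
    intro c α β hα hβ hβT hne hαl
    obtain ⟨i, hi, rfl⟩ := List.getElem_of_mem hαl
    rcases i with _ | i
    · exact (h.notMem_bdry hx c hα).elim
    · obtain ⟨c', h1, h2, h3⟩ := List.isChain_iff_getElem.1 hc i hi
      obtain rfl := h.eq_face hα h2
      have : β = rev (x :: l)[i] :=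
        hT.eq hβ h1 hα hβT (hl (x :: l)[i] (List.getElem_mem _)) (hl _ (List.getElem_mem _)) hne
          h3.symm
      rw [this, rev_rev]
      exact List.getElem_mem _
  have hstep' : ∀ c α β, α ∈ C.bdry c → β ∈ C.bdry c → T β.1 → β ≠ α → rev α ∈ x :: l →
      β ∈ x :: l := by
    intro c α β hα hβ hβT hne hαl
    obtain ⟨i, hi, hia⟩ := List.getElem_of_mem hαl
    by_cases hi' : i + 1 < (x :: l).length
    · obtain ⟨c', h1, h2, h3⟩ := List.isChain_iff_getElem.1 hc i hi'
      rw [hia, rev_rev] at h1 h3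
      obtain rfl := h.eq_face hα h1
      have : β = (x :: l)[i + 1] :=
        hT.eq hβ h2 hα hβT (hl _ (List.getElem_mem _)) (hl (rev α) hαl) hne h3
      rw [this]
      exact List.getElem_mem _
    · have : rev α = e := by
        rw [← hia, he, List.getLast_eq_getElem]
        congr 1
        omega
      rw [← this, rev_rev] at ho
      exact (h.notMem_bdry ho c hα).elim
  -- The cocycle dual to the corridor: the intersection number with it. On the boundary of a face
  -- the sum is zero, because a corridor that passes one of the two `T`-edges of the face also
  -- passes the other one, in the opposite sense.
  let c : C.Dart → ℤ := fun d => (if d ∈ x :: l then 1 else 0) - if rev d ∈ x :: l then 1 else 0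
  have hcrev : ∀ d, c (rev d) = -c d := fun d => by simp only [c, rev_rev]; ring
  have hcT : ∀ d : C.Dart, ¬ T d.1 → c d = 0 := by
    intro d hd
    have h1 : d ∉ x :: l := fun h => hd (hl d h)
    have h2 : rev d ∉ x :: l := fun h => hd (hl (rev d) h)
    simp only [c, if_neg h1, if_neg h2, sub_zero]
  have hcface : ∀ F, ((C.bdry F).map c).sum = 0 := by
    intro F
    have hn : (C.bdry F).Nodup := h.nodup (some F)
    rw [← List.sum_toFinset c hn]
    by_cases hF : ∃ α ∈ C.bdry F, T α.1
    · obtain ⟨α, hα, hαT⟩ := hF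
      obtain ⟨β, hβ, hβT, hs, hγ⟩ := hT F α hα hαT
      have hne : β ≠ α := by
        rintro rfl
        simp at hs
      have h1 : α ∈ x :: l ↔ rev β ∈ x :: l :=
        ⟨hstep F α β hα hβ hβT hne, fun hb => hstep' F β α hβ hα hαT hne.symm hb⟩
      have h2 : β ∈ x :: l ↔ rev α ∈ x :: l :=
        ⟨hstep F β α hβ hα hαT hne.symm, fun hb => hstep' F α β hα hβ hβT hne hb⟩
      rw [Finset.sum_eq_add_of_mem α β (by simpa) (by simpa) hne.symm]
      · simp only [h1, h2]; ring
      · intro γ hγF hγ'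
        rw [List.mem_toFinset] at hγF
        refine hcT γ fun hγT => ?_
        rcases hγ γ hγF hγT with e | e
        · exact hγ'.1 e
        · exact hγ'.2 e
    · push Not at hF
      exact Finset.sum_eq_zero fun d hd => hcT d (hF d (by simpa using hd))
  obtain ⟨s, hs0, hs⟩ := h.oneConnected.exists_potential hcrev hcface (C.dsrc x)
  have hcl : ∀ d ∈ x :: l, c d = 1 := by
    intro d hd
    simp only [c, if_pos hd, if_neg (hsg d hd), sub_zero]
  have hel : e ∈ x :: l := List.getLast_mem _
  obtain ⟨p, q, hpq⟩ := h.corridor_strip hT hl hc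
  have hfree : ∀ d : C.Dart, ¬ T d.1 → s (C.dtgt d) = s (C.dsrc d) := fun d hd => by
    rw [hs, hcT d hd, add_zero]
  -- The potential is constant along the side of the corridor, which contains no `T`-edge.
  have hse : s (C.dsrc e) = 0 := by
    rw [← hs0]
    exact (eq_of_isPath_of_forall hpq.isPath_left fun d hd => hfree d (hpq.free_left d hd)).symm
  refine ⟨s, hs0, by rw [hs, hs0, hcl x List.mem_cons_self, zero_add], hse,
    by rw [hs, hse, hcl e hel, zero_add], hfree, fun d hd h1 h2 => ?_⟩
  have h3 : d ∉ x :: l := fun h' => h1 (hout d h' hd)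
  have h4 : rev d ∉ x :: l := fun h' => h2 (by
    rw [← hout' _ h' (by rwa [rev_rev]), rev_rev])
  rw [hs]
  simp only [c, if_neg h3, if_neg h4, sub_zero, add_zero]

/-- The `T`-edges on the boundary of a diagram are paired by the corridors. -/
theorem paired_of_corridors (hsgn : ∀ d, sgn (rev d) = !sgn d) {k : ℕ}
    (hk : ∀ x l, x ∈ o → (∀ y ∈ x :: l, T y.1) → List.IsChain C.Crosses (x :: l) →
      rev ((x :: l).getLast (List.cons_ne_nil x l)) ∈ o → l.length ≤ k) {v : C.Vert}
    (hv : C.IsPath v o v) : C.Paired T k v o v := by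
  choose! l hl hc ho using fun x : C.Dart => fun hx : x ∈ o ∧ T x.1 =>
    h.exists_corridor hT hx.1 hx.2
  let r : C.Dart → C.Dart := fun x => rev ((x :: l x).getLast (List.cons_ne_nil x _))
  -- The induction runs over segments `m` of the boundary cycle that contain with each `T`-edge also
  -- the other end of its corridor.
  have key : ∀ (n : ℕ) (m : List C.Dart) (y z : C.Vert), m.length ≤ n → C.IsPath y m z →
      m.Nodup → (∀ d ∈ m, d ∈ o) → (∀ d ∈ m, T d.1 → r d ∈ m) → C.Paired T k y m z := by
    intro n
    induction n with
    | zero =>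
      intro m y z hm hp _ _ _
      obtain rfl := List.length_eq_zero_iff.1 (Nat.le_zero.1 hm)
      obtain rfl : y = z := hp
      exact .nil y
    | succ n ih =>
      intro m y z hm hp hn hmo hr
      rcases m with _ | ⟨x, m⟩
      · obtain rfl : y = z := hp
        exact .nil y
      obtain ⟨rfl, hp⟩ := hp
      rw [List.nodup_cons] at hn
      rw [List.length_cons] at hm
      by_cases hxT : T x.1
      · have hx : x ∈ o ∧ T x.1 := ⟨hmo x List.mem_cons_self, hxT⟩
        have hsg := corridor_sgn hT hsgn (hl x hx) (hc x hx)
        -- The potential of the corridor that starts at `x`. It is `1` along the part `b` of the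
        -- boundary between the two ends of this corridor, and `0` along the part `c` after it.
        obtain ⟨s, hs1, hs2, hs3, hs4, hs5, hs6⟩ :=
          h.corridor_potential hT hsgn hx.1 (hl x hx) (hc x hx) (ho x hx)
        obtain ⟨p, q, hst⟩ := h.corridor_strip hT (hl x hx) (hc x hx)
        have hlen := hk x (l x) hx.1 (hl x hx) (hc x hx) (ho x hx)
        have hrx := hr x List.mem_cons_self hxT
        simp only [r] at hrx
        generalize (x :: l x).getLast (List.cons_ne_nil x (l x)) = e at *
        have hex : rev e ≠ x := by
          rintro rfl
          rw [hsgn] at hsg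
          simp at hsg
        obtain ⟨b, c, rfl⟩ := List.append_of_mem ((List.mem_cons.1 hrx).resolve_left hex)
        obtain ⟨w, hpb, hw, hpc⟩ := isPath_append.1 hp
        rw [dsrc_rev] at hw
        subst hw
        rw [dtgt_rev] at hpc
        have hn' := List.nodup_middle.1 hn.2
        rw [List.nodup_cons] at hn'
        have hflat : ∀ d ∈ b ++ c, s (C.dtgt d) = s (C.dsrc d) := by
          intro d hd
          have hd' : d ∈ b ++ rev e :: c := by
            simp only [List.mem_append, List.mem_cons] at hd ⊢
            tauto
          refine hs6 d (hmo d (List.mem_cons_of_mem _ hd')) ?_ ?_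
          · rintro rfl
            exact hn.1 hd'
          · rintro rfl
            exact hn'.1 hd
        have hb1 : ∀ d ∈ b, s (C.dsrc d) = 1 := by
          intro d hd
          obtain ⟨b₁, b₂, rfl⟩ := List.append_of_mem hd
          obtain ⟨w, h1, rfl, -⟩ := isPath_append.1 hpb
          rw [← hs2]
          exact (eq_of_isPath_of_forall h1 fun d hd =>
            hflat d (List.mem_append_left _ (List.mem_append_left _ hd))).symm
        have hc0 : ∀ d ∈ c, s (C.dsrc d) = 0 := by
          intro d hd
          obtain ⟨b₁, b₂, rfl⟩ := List.append_of_mem hd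
          obtain ⟨w, h1, rfl, -⟩ := isPath_append.1 hpc
          rw [← hs3]
          exact (eq_of_isPath_of_forall h1 fun d hd =>
            hflat d (List.mem_append_right _ (List.mem_append_left _ hd))).symm
        -- The sides of any other corridor contain no `T`-edge, so the potential is the same at both
        -- of its ends. Thus a corridor that starts in `b` cannot end in `c`, nor conversely.
        have hpart : ∀ d ∈ x :: (b ++ rev e :: c), T d.1 → s (C.dsrc (r d)) = s (C.dtgt d) ∧
            s (C.dtgt (r d)) = s (C.dsrc d) := by
          intro d hd hdT
          have hd' : d ∈ o ∧ T d.1 := ⟨hmo d hd, hdT⟩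
          obtain ⟨p, q, hst⟩ := h.corridor_strip hT (hl d hd') (hc d hd')
          simp only [r, dsrc_rev, dtgt_rev]
          exact ⟨(eq_of_isPath_of_forall hst.isPath_right fun d hd =>
            hs5 d (hst.free_right d hd)).symm, (eq_of_isPath_of_forall hst.isPath_left fun d hd =>
            hs5 d (hst.free_left d hd)).symm⟩
        simp only [List.length_append, List.length_cons] at hm
        refine .pair hst hlen (h.oneConnected.pathHomotopic hpb hst.isPath_right)
          (ih b _ _ (by omega) hpb (hn.2.sublist (List.sublist_append_left _ _))
            (fun d hd => hmo d (by simp [hd])) fun d hd hdT => ?_)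
          (ih c _ _ (by omega) hpc ((List.nodup_cons.1 (hn.2.sublist
            (List.sublist_append_right _ _))).2) (fun d hd => hmo d (by simp [hd]))
            fun d hd hdT => ?_)
        · have h1 : d ∈ x :: (b ++ rev e :: c) := by simp [hd]
          obtain ⟨h2, h3⟩ := hpart d h1 hdT
          rw [hflat d (List.mem_append_left _ hd), hb1 d hd] at h2
          rw [hb1 d hd] at h3
          have h4 := hr d h1 hdT
          simp only [List.mem_cons, List.mem_append] at h4
          rcases h4 with h4 | h4 | h4 | h4
          · rw [h4, hs1] at h2; omega
          · exact h4
          · rw [h4, dtgt_rev, hs3] at h3; omega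
          · rw [hc0 _ h4] at h2; omega
        · have h1 : d ∈ x :: (b ++ rev e :: c) := by simp [hd]
          obtain ⟨h2, h3⟩ := hpart d h1 hdT
          rw [hflat d (List.mem_append_right _ hd), hc0 d hd] at h2
          rw [hc0 d hd] at h3
          have h4 := hr d h1 hdT
          simp only [List.mem_cons, List.mem_append] at h4
          rcases h4 with h4 | h4 | h4 | h4
          · rw [h4, hs2] at h3; omega
          · rw [hb1 _ h4] at h2; omega
          · rw [h4, dsrc_rev, hs4] at h2; omega
          · exact h4
      · refine .cons x hxT (ih m _ _ (by omega) hp hn.2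
          (fun d hd => hmo d (List.mem_cons_of_mem _ hd)) fun d hd hdT => ?_)
        refine (List.mem_cons.1 (hr d (List.mem_cons_of_mem _ hd) hdT)).resolve_left ?_
        rintro e
        have hd' : d ∈ o ∧ T d.1 := ⟨hmo d (List.mem_cons_of_mem _ hd), hdT⟩
        refine hxT ?_
        rw [← e]
        exact (hl d hd' ((d :: l d).getLast (List.cons_ne_nil _ _)) (List.getLast_mem _) :)
  exact key o.length o v v le_rfl hv (h.nodup none) (fun d hd => hd)
    fun d hd hdT => ho d ⟨hd, hdT⟩

end IsDisc

end Corridor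

end TwoComplex

open OneComplex Relation

/-! ### From diagrams to pairings of boundary labels, and back -/

namespace TwoComplex

section Label

variable {X : TwoComplex.{u}} {C : TwoComplex.{0}} (T : X.Edge → Prop) {vert : C.Vert → X.Vert}
  {edge : C.Edge → X.Dart} (hs : ∀ e, vert (C.src e) = X.dsrc (edge e))
  (ht : ∀ e, vert (C.tgt e) = X.dtgt (edge e))
  (hf : ∀ c, X.FaceLoop ((C.bdry c).map (dartLabel edge)))

theorem map_dartLabel_invRev (p : List C.Dart) : (FreeGroup.invRev p).map (dartLabel edge) =
    FreeGroup.invRev (p.map (dartLabel edge)) := by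
  induction p with
  | nil => rfl
  | cons d p ih => simp [invRev_cons, ih, dartLabel_rev]

include hf in
theorem FaceLoop.map_dartLabel {p : List C.Dart} (h : C.FaceLoop p) :
    X.FaceLoop (p.map (dartLabel edge)) := by
  obtain ⟨c, h | h⟩ := h
  · exact (hf c).of_isRotated (h.map _)
  · refine (hf c).invRev.of_isRotated ?_
    rw [← map_dartLabel_invRev]
    exact h.map _

include hs ht hf

theorem PathHomotopic.map_dartLabel {x y : C.Vert} {p q : List C.Dart}
    (h : C.PathHomotopic x y p q) : X.PathHomotopic (vert x) (vert y)
      (p.map (dartLabel edge)) (q.map (dartLabel edge)) := by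
  let F : PathMap C.toOneComplex X.toOneComplex :=
    { onVert := vert
      onEdge := fun e => [edge e]
      isPath := fun e => ⟨(hs e).symm, (ht e).symm⟩ }
  have hF : ∀ p, F.onList p = p.map (dartLabel edge) := by
    intro p
    induction p with
    | nil => rfl
    | cons d p ih =>
      rw [F.onList_cons, ih]
      obtain ⟨e, _ | _⟩ := d <;> rfl
  have := h.map F fun c x hx => by
    rw [hF]
    exact (hf c).pathHomotopic (isPath_dartLabel hs ht hx)
  rwa [hF, hF] at this

theorem Strip.map_dartLabel {n : ℕ} {s s' : C.Dart} {p q : List C.Dart}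
    (h : C.Strip (fun e => T (edge e).1) n s p q s') :
    X.Strip T n (dartLabel edge s) (p.map (dartLabel edge)) (q.map (dartLabel edge))
      (dartLabel edge s') := by
  induction h with
  | nil hs' => exact .nil (by rwa [dartLabel_fst])
  | cons hs' hp hq hpT hqT hface h ih =>
    rw [List.map_append, List.map_append]
    refine .cons (by rwa [dartLabel_fst]) ?_ ?_ ?_ ?_ ?_ ih
    · simpa only [dsrc_dartLabel hs ht] using isPath_dartLabel hs ht hp
    · simpa only [dtgt_dartLabel hs ht] using isPath_dartLabel hs ht hq
    · intro d hd
      obtain ⟨d, hd', rfl⟩ := List.mem_map.1 hd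
      rw [dartLabel_fst]
      exact hpT d hd'
    · intro d hd
      obtain ⟨d, hd', rfl⟩ := List.mem_map.1 hd
      rw [dartLabel_fst]
      exact hqT d hd'
    · simpa [map_dartLabel_invRev, dartLabel_rev] using hface.map_dartLabel hf

theorem Paired.map_dartLabel {k : ℕ} {x y : C.Vert} {p : List C.Dart}
    (h : C.Paired (fun e => T (edge e).1) k x p y) :
    X.Paired T k (vert x) (p.map (dartLabel edge)) (vert y) := by
  induction h with
  | nil x => exact .nil _
  | cons d hd h ih =>
    rw [← dsrc_dartLabel hs ht]
    rw [← dtgt_dartLabel hs ht] at ih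
    exact .cons _ (by rwa [dartLabel_fst]) ih
  | pair hst hn hb h₁ h₂ ih₁ ih₂ =>
    rw [List.map_append, List.map_cons, List.map_cons, dartLabel_rev, ← dsrc_dartLabel hs ht]
    rw [← dtgt_dartLabel hs ht, ← dtgt_dartLabel hs ht] at ih₁
    rw [← dsrc_dartLabel hs ht] at ih₂
    refine .pair (hst.map_dartLabel T hs ht hf) hn ?_ ih₁ ih₂
    have := hb.map_dartLabel hs ht hf
    rwa [← dtgt_dartLabel hs ht, ← dtgt_dartLabel hs ht] at this

end Label

section VanKampen

variable {X : TwoComplex.{u}} {T : X.Edge → Prop}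

theorem _root_.VanKampen.isDisc {w : List X.Dart} (D : VanKampen X w) :
    D.toTwoComplex.IsDisc D.outer := by
  have hside : D.toTwoComplex.sides D.outer = D.side := by
    funext i
    cases i with
    | none => exact D.side_none.symm
    | some c => exact (D.side_some c).symm
  refine ⟨D.finite, D.oneConnected, D.bdry_ne_nil, D.outer_ne_nil, ?_, ?_, fun x y => ?_⟩
  · rw [hside]
    exact D.side_nodup
  · rw [hside]
    exact D.existsUnique_side
  · have : D.toTwoComplex.Turns D.outer = fun a b => ∃ i l, (b :: l).IsRotated (D.side i) ∧
        (b :: l).getLast? = some (rev a) := by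
      funext a b
      simp only [Turns, hside, List.cycSucc_iff_isRotated]
    rw [this]
    exact D.rotation x y

theorem Bounds.exists_vanKampen {B : ℕ → ℕ} {x : X.Vert} {w : List (X.Dart × ℕ)}
    (h : X.Bounds T B x w) : ∃ (D : VanKampen X (w.map Prod.fst)) (L : X.Decoration T B
      D.toTwoComplex), L.edge = D.edgeLabel ∧ D.outer.map L.dart = w := by
  obtain ⟨C, o, L, h1, rfl, -⟩ := h
  exact ⟨{ C with
    finite := h1.finite
    oneConnected := h1.oneConnected
    bdry_ne_nil := h1.bdry_ne_nil
    outer := o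
    outer_ne_nil := h1.outer_ne_nil
    side := C.sides o
    side_none := rfl
    side_some := fun _ => rfl
    side_nodup := h1.nodup
    existsUnique_side := h1.existsUnique
    rotation := fun x y => by
      have : C.Turns o = fun a b => ∃ i l, (b :: l).IsRotated (C.sides o i) ∧
          (b :: l).getLast? = some (rev a) := by
        funext a b
        simp only [Turns, List.cycSucc_iff_isRotated]
      exact (h1.rotation x y).trans (by rw [this])
    vertLabel := L.vert
    edgeLabel := L.edge
    vertLabel_src := L.src
    vertLabel_tgt := L.tgt
    face_label := L.face
    outer_label := by rw [List.map_map]; rfl }, L, rfl, rfl⟩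

/-- The boundary of every face contains either no edge in `T`, or one edge in `T` in each
direction. -/
def Transverse (X : TwoComplex.{u}) (T : X.Edge → Prop) : Prop :=
  open Classical in ∀ F, (X.bdry F).filter (fun d => T d.1) = [] ∨
    (((X.bdry F).filter fun d => T d.1).map Prod.snd).Perm [true, false]

theorem FaceLoop.perm_of_transverse (hX : X.Transverse T) [DecidablePred T] {p : List X.Dart}
    (h : X.FaceLoop p) : p.filter (fun d => T d.1) = [] ∨
      ((p.filter fun d => T d.1).map Prod.snd).Perm [true, false] := by
  have key : ∀ q : List X.Dart, p.Perm q → (q.filter (fun d => T d.1) = [] ∨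
      ((q.filter fun d => T d.1).map Prod.snd).Perm [true, false]) →
      (p.filter (fun d => T d.1) = [] ∨
      ((p.filter fun d => T d.1).map Prod.snd).Perm [true, false]) := by
    rintro q hq (h | h)
    · left
      have := hq.filter fun d => T d.1
      rw [h] at this
      exact this.eq_nil
    · exact .inr (((hq.filter _).map _).trans h)
  obtain ⟨F, h⟩ := h
  have hF : ((X.bdry F).filter fun d => T d.1) = [] ∨
      (((X.bdry F).filter fun d => T d.1).map Prod.snd).Perm [true, false] := by
    convert hX F
  rcases h with h | h
  · exact key _ h.perm hF
  · have h1 : p.Perm ((X.bdry F).map rev) := h.perm.trans (List.reverse_perm _)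
    refine key _ h1 ?_
    rw [List.filter_map]
    change ((X.bdry F).filter fun d => T d.1).map rev = [] ∨ _
    rcases hF with hF | hF
    · left
      rw [hF]
      rfl
    · right
      change ((((X.bdry F).filter fun d => T d.1).map rev).map Prod.snd).Perm _
      have h2 := hF.map not
      rw [List.map_map] at h2 ⊢
      exact h2.trans (List.Perm.swap _ _ _)

theorem Transverse.twoSided (hX : X.Transverse T) {C : TwoComplex.{0}} {edge : C.Edge → X.Dart}
    (hf : ∀ c, X.FaceLoop ((C.bdry c).map (dartLabel edge))) :
    C.TwoSided (fun e => T (edge e).1) fun d => (dartLabel edge d).2 := by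
  classical
  intro c α hα hαT
  have h1 := (hf c).perm_of_transverse hX
  rw [List.filter_map, List.map_map] at h1
  have h2 : ((fun d : X.Dart => decide (T d.1)) ∘ dartLabel edge) =
      fun d : C.Dart => decide (T (edge d.1).1) := by
    funext d
    simp [dartLabel_fst]
  rw [h2, List.map_eq_nil_iff] at h1
  have hmem : ∀ γ, γ ∈ (C.bdry c).filter (fun d : C.Dart => decide (T (edge d.1).1)) ↔
      γ ∈ C.bdry c ∧ T (edge γ.1).1 := by
    intro γ
    simp
  generalize (C.bdry c).filter (fun d : C.Dart => decide (T (edge d.1).1)) = L at *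
  rcases h1 with rfl | h1
  · exact absurd ((hmem α).2 ⟨hα, hαT⟩) (by simp)
  · have hlen := h1.length_eq
    rw [List.length_map] at hlen
    obtain ⟨a, b, rfl⟩ := List.length_eq_two.1 hlen
    obtain ⟨ha1, ha2⟩ := (hmem a).1 (by simp)
    obtain ⟨hb1, hb2⟩ := (hmem b).1 (by simp)
    have hab : (dartLabel edge b).2 = !(dartLabel edge a).2 :=
      (by decide : ∀ x y : Bool, [x, y].Perm [true, false] → y = !x) _ _ h1
    have hγ : ∀ γ ∈ C.bdry c, T (edge γ.1).1 → γ = a ∨ γ = b := by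
      intro γ h3 h4
      have := (hmem γ).2 ⟨h3, h4⟩
      simpa using this
    rcases hγ α hα hαT with rfl | rfl
    · exact ⟨b, hb1, hb2, hab, hγ⟩
    · exact ⟨a, ha1, ha2, by simp [hab], fun γ h3 h4 => (hγ γ h3 h4).symm⟩

/-- The pairing is found in the diagram itself, where all homotopies needed exist by
1-connectedness, and is then carried to `X` by the labels. -/
theorem _root_.VanKampen.paired {w : List X.Dart} (D : VanKampen X w) (hX : X.Transverse T) {k : ℕ}
    (hk : ∀ x l, x ∈ D.outer → (∀ y ∈ x :: l, T (D.edgeLabel y.1).1) →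
      List.IsChain D.Crosses (x :: l) → rev ((x :: l).getLast (List.cons_ne_nil x l)) ∈ D.outer →
      l.length ≤ k) {x : X.Vert} (hx : X.IsPath x w x) : X.Paired T k x w x := by
  have h := D.isDisc
  obtain ⟨v, hv⟩ := h.outer_closed
  have hT := hX.twoSided D.face_label
  have h1 := (h.paired_of_corridors hT (fun d => by rw [dartLabel_rev]; rfl) hk hv).map_dartLabel T
    D.vertLabel_src D.vertLabel_tgt D.face_label
  rw [D.outer_label] at h1
  by_cases hw : w = []
  · subst hw
    exact .nil x
  · rwa [IsPath.src_eq hw h1.isPath hx] at h1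

/-- A corridor from the boundary has a single, nonzero colour. This colour has at most `k + 1`
edges, hence at most `2 * (k + 1)` oriented ones; the corridor passes each of them at most once, and
it has one 2-cell less than it has edges. -/
theorem Paired.exists_vanKampen (hX : X.Transverse T) {k : ℕ} {x : X.Vert} {w : List X.Dart}
    (h : X.Paired T k x w x) (hw : X.PathHomotopic x x w []) :
    ∃ D : VanKampen X w, ∀ x l, x ∈ D.outer → (∀ y ∈ x :: l, T (D.edgeLabel y.1).1) →
      List.IsChain D.Crosses (x :: l) → l.length ≤ 2 * k + 1 := by
  obtain ⟨w', h1, h2, h3⟩ := Bounds.of_paired (w := []) h hw (Bounds.nil X T _ x)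
  rw [List.append_nil] at h3
  subst h1
  obtain ⟨D, L, h4, h5⟩ := h3.exists_vanKampen
  refine ⟨D, fun y l hy hl hc => ?_⟩
  have hD := D.isDisc
  have hT := hX.twoSided D.face_label
  have hn := hD.corridor_nodup hT hy hl hc
  have hcol : ∀ d ∈ y :: l, L.colour d.1 = L.colour y.1 := by
    clear hn hy
    induction l generalizing y with
    | nil => simp
    | cons z l ih =>
      rw [List.isChain_cons_cons] at hc
      obtain ⟨⟨c, h6, h7, -⟩, hc⟩ := hc
      intro d hd
      rcases List.mem_cons.1 hd with rfl | hd
      · rfl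
      · rw [ih z (fun y hy => hl y (List.mem_cons_of_mem _ hy)) hc d hd]
        refine L.mono c z h7 (rev y) h6 ?_ ?_
        · rw [h4]
          exact hl z (List.mem_cons_of_mem _ List.mem_cons_self)
        · rw [h4]
          exact hl y List.mem_cons_self
  have h0 : L.colour y.1 ≠ 0 := by
    refine h2 (L.dart y) ((congrArg (L.dart y ∈ ·) h5).mp (List.mem_map_of_mem hy)) ?_
    change T (dartLabel L.edge y).1
    rw [dartLabel_fst, h4]
    exact hl y List.mem_cons_self
  have hcount := L.count _ h0
  classical
  have := hD.finite.2.1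
  have h8 : ((y :: l).toFinset : Set D.Dart) ⊆
      {e | L.colour e = L.colour y.1} ×ˢ (Set.univ : Set Bool) := by
    intro d hd
    exact ⟨hcol d (by simpa using hd), trivial⟩
  have h9 := Set.ncard_le_ncard h8 (Set.toFinite _)
  rw [Set.ncard_coe_finset, List.toFinset_card_of_nodup hn, Set.ncard_prod, Set.ncard_univ,
    Nat.card_eq_fintype_card, Fintype.card_bool, List.length_cons] at h9
  omega

/-- Van Kampen's lemma: the homotopy from the constant path to `w` is applied to the boundary label
of the trivial diagram. Colours play no role here. -/
theorem PathHomotopic.nonempty_vanKampen {x : X.Vert} {w : List X.Dart}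
    (hw : X.PathHomotopic x x w []) : Nonempty (VanKampen X w) := by
  have h := (Bounds.nil X (fun _ => False) (fun _ => 0) x).homotopic (w := []) (p := []) hw.symm
  rw [List.append_nil] at h
  obtain ⟨D, -⟩ := h.exists_vanKampen
  rw [map_fst_plain] at D
  exact ⟨D⟩

/-- Since the infimum of the empty set is `0`, some diagram must have a bound on its corridors
before `λ_t` has a meaning; finiteness of the diagram gives one. -/
theorem _root_.VanKampen.exists_bound {w : List X.Dart} (D : VanKampen X w) (hX : X.Transverse T) :
    ∃ k, ∀ x l, x ∈ D.outer → (∀ y ∈ x :: l, T (D.edgeLabel y.1).1) →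
      List.IsChain D.Crosses (x :: l) → l.length ≤ k := by
  have hD := D.isDisc
  have hT := hX.twoSided D.face_label
  have := hD.finite_dart
  have : Fintype D.Dart := Fintype.ofFinite _
  refine ⟨Fintype.card D.Dart, fun y l hy hl hc => ?_⟩
  have h4 := (hD.corridor_nodup hT hy hl hc).length_le_card
  simp only [List.length_cons] at h4
  omega

end VanKampen

end TwoComplex

/-! ### Corridor length functions in terms of pairings -/

namespace EdgePathMap

open TwoComplex

variable {G : TwoComplex.{u}} (f : EdgePathMap G.toOneComplex)

theorem filter_incl (p : List G.Dart) :
    ((p.map incl : List f.mappingTorus.Dart).filter fun d => d.1.isRight) = [] := by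
  rw [List.filter_eq_nil_iff]
  intro d hd
  obtain ⟨d, -, rfl⟩ := List.mem_map.1 hd
  simp [incl]

theorem transverse : f.mappingTorus.Transverse fun e => e.isRight = true := by
  rintro (F | e) <;> simp only [Bool.decide_eq_true]
  · exact .inl (f.filter_incl (G.bdry F))
  · right
    have h : (f.mappingTorus.bdry (Sum.inr e)).filter (fun d => d.1.isRight) =
        [(Sum.inr (G.src e), false), (Sum.inr (G.tgt e), true)] :=
      congrArg (fun l => (Sum.inr (G.src e), false) :: (Sum.inr (G.tgt e), true) :: l)
        (f.filter_incl (FreeGroup.invRev (f.onEdge e)))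
    rw [h]
    exact List.Perm.swap _ _ _

/-- Loops of length at most `n` have noncrossing pairings of width at most `k`. -/
def PairedLoops (n k : ℕ) : Prop :=
  ∀ x w, f.mappingTorus.NullHomotopic x w → w.length ≤ n →
    f.mappingTorus.Paired (fun e => e.isRight = true) k x w x

theorem corridorLengthOf_spec {w : List f.mappingTorus.Dart} {x : G.Vert}
    (h : f.mappingTorus.NullHomotopic x w) : f.mappingTorus.Paired (fun e => e.isRight = true)
      (f.corridorLengthOf w) x w x := by
  obtain ⟨D⟩ := PathHomotopic.nonempty_vanKampen ⟨h.1, rfl, h.2⟩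
  obtain ⟨k, hk⟩ := D.exists_bound f.transverse
  have hne : {k | ∃ D : VanKampen f.mappingTorus w, ∀ x l, f.IsCorridor D x l →
      l.length ≤ k}.Nonempty := ⟨k, D, fun x l hc => hk x l hc.1 hc.2.1 hc.2.2.1⟩
  obtain ⟨D, hD⟩ := Nat.sInf_mem hne
  exact D.paired f.transverse (fun x l h1 h2 h3 h4 => hD x l ⟨h1, h2, h3, h4⟩) h.1

theorem corridorLengthOf_le {w : List f.mappingTorus.Dart} {x : G.Vert} {k : ℕ}
    (h : f.mappingTorus.NullHomotopic x w)
    (hp : f.mappingTorus.Paired (fun e => e.isRight = true) k x w x) :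
    f.corridorLengthOf w ≤ 2 * k + 1 := by
  obtain ⟨D, hD⟩ := hp.exists_vanKampen f.transverse ⟨h.1, rfl, h.2⟩
  exact Nat.sInf_le ⟨D, fun x l hc => hD x l hc.1 hc.2.1 hc.2.2.1⟩

theorem corridorLength_le {n k : ℕ} (h : f.PairedLoops n k) : f.corridorLength n ≤ 2 * k + 1 := by
  refine csSup_le' ?_
  rintro _ ⟨x, w, h1, h2, rfl⟩
  exact f.corridorLengthOf_le h1 (h x w h1 h2)

theorem _root_.TwoComplex.Paired.mono {X : TwoComplex.{u}} {T : X.Edge → Prop} {k k' : ℕ}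
    {x y : X.Vert} {w : List X.Dart} (h : X.Paired T k x w y) (hk : k ≤ k') :
    X.Paired T k' x w y := by
  induction h with
  | nil x => exact .nil x
  | cons d hd h ih => exact .cons d hd ih
  | pair hst hn hb h₁ h₂ ih₁ ih₂ => exact .pair hst (hn.trans hk) hb ih₁ ih₂

/-- Finiteness of `G` leaves only finitely many edge-loops of length at most `n`. So the set whose
supremum defines `Λ` is bounded, and the supremum is not the default value `0` of an unbounded set.
-/
theorem pairedLoops_corridorLength (hG : G.IsFinite) (n : ℕ) :
    f.PairedLoops n (f.corridorLength n) := by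
  intro x w h hw
  refine (f.corridorLengthOf_spec h).mono (le_csSup ?_ ⟨x, w, h, hw, rfl⟩)
  obtain ⟨_, _, -⟩ := hG
  have : Finite f.mappingTorus.Dart := inferInstanceAs (Finite ((G.Edge ⊕ G.Vert) × Bool))
  refine Set.Finite.bddAbove (((List.finite_length_le f.mappingTorus.Dart n).image
    f.corridorLengthOf).subset ?_)
  rintro _ ⟨x, w, -, h2, rfl⟩
  exact ⟨w, h2, rfl⟩

end EdgePathMap

open OneComplex Relation

/-! ### Word lengths -/

/-- `ℓ` is, up to a finite set of generators, the word length of a finitely generated group. -/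
structure IsWordLength {H : Type w} [Group H] (ℓ : H → ℕ) : Prop where
  one : ℓ 1 = 0
  mul : ∀ a b, ℓ (a * b) ≤ ℓ a + ℓ b
  inv : ∀ a, ℓ a⁻¹ = ℓ a
  gen : ∃ S : Set H, S.Finite ∧ ∀ h, ∃ l : List H, l.length ≤ ℓ h ∧ (∀ s ∈ l, s ∈ S) ∧ l.prod = h

section WordLength

variable {H : Type w} [Group H]

theorem exists_isWordLength (h : Group.FG H) : ∃ ℓ : H → ℕ, IsWordLength ℓ := by
  obtain ⟨S₀, hS₀⟩ := h.out
  let S : Set H := S₀ ∪ (S₀ : Set H)⁻¹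
  have hS : S.Finite := S₀.finite_toSet.union S₀.finite_toSet.inv
  have hinv : ∀ s ∈ S, s⁻¹ ∈ S := by
    rintro s (hs | hs)
    · exact .inr (by simpa using hs)
    · exact .inl hs
  let N : H → Set ℕ := fun h => {n | ∃ l : List H, l.length = n ∧ (∀ s ∈ l, s ∈ S) ∧ l.prod = h}
  have hN : ∀ h, (N h).Nonempty := by
    intro h
    have : h ∈ (Subgroup.closure (S₀ : Set H)).toSubmonoid := by rw [hS₀]; trivial
    rw [Subgroup.closure_toSubmonoid] at this
    obtain ⟨l, hl, rfl⟩ := Submonoid.exists_list_of_mem_closure this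
    exact ⟨_, l, rfl, fun s hs => hl s hs, rfl⟩
  have hmin : ∀ h, ∃ l : List H, l.length = sInf (N h) ∧ (∀ s ∈ l, s ∈ S) ∧ l.prod = h :=
    fun h => Nat.sInf_mem (hN h)
  have hle : ∀ l : List H, (∀ s ∈ l, s ∈ S) → sInf (N l.prod) ≤ l.length :=
    fun l hl => Nat.sInf_le ⟨l, rfl, hl, rfl⟩
  have hinv_le : ∀ a, sInf (N a⁻¹) ≤ sInf (N a) := by
    intro a
    obtain ⟨l, h1, h2, rfl⟩ := hmin a
    rw [← h1, List.prod_inv_reverse]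
    refine (hle _ fun s hs => ?_).trans_eq (by simp)
    rw [List.mem_reverse, List.mem_map] at hs
    obtain ⟨s, hs, rfl⟩ := hs
    exact hinv s (h2 s hs)
  refine ⟨fun h => sInf (N h), ?_, ?_, ?_, S, hS, fun h => ?_⟩
  · exact Nat.le_zero.1 (hle [] (by simp))
  · intro a b
    obtain ⟨l, h1, h2, h3⟩ := hmin a
    obtain ⟨l', h1', h2', h3'⟩ := hmin b
    have := hle (l ++ l') fun s hs => (List.mem_append.1 hs).elim (h2 s) (h2' s)
    rwa [List.prod_append, h3, h3', List.length_append, h1, h1'] at this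
  · intro a
    have := hinv_le a⁻¹
    rw [inv_inv] at this
    exact le_antisymm (hinv_le a) this
  · obtain ⟨l, h1, h2⟩ := hmin h
    exact ⟨l, h1.le, h2⟩

/-- Subadditive functions are bounded by multiples of the word length. -/
theorem IsWordLength.exists_le_mul {ℓ : H → ℕ} (hℓ : IsWordLength ℓ) (g : H → ℕ) (h1 : g 1 = 0)
    (hm : ∀ a b, g (a * b) ≤ g a + g b) : ∃ C, ∀ h, g h ≤ C * ℓ h := by
  obtain ⟨S, hS, hgen⟩ := hℓ.gen
  obtain ⟨C, hC⟩ := (hS.image g).bddAbove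
  have key : ∀ l : List H, (∀ s ∈ l, s ∈ S) → g l.prod ≤ C * l.length := by
    intro l
    induction l with
    | nil => simp [h1]
    | cons s l ih =>
      intro hl
      have h2 := hC ⟨s, hl s List.mem_cons_self, rfl⟩
      have h3 := ih fun x hx => hl x (List.mem_cons_of_mem _ hx)
      have h4 := hm s l.prod
      rw [List.prod_cons, List.length_cons, mul_add, mul_one]
      omega
  refine ⟨C, fun h => ?_⟩
  obtain ⟨l, h2, h3, rfl⟩ := hgen h
  exact (key l h3).trans (Nat.mul_le_mul_left C h2)

end WordLength

/-! ### Noncrossing pairings of sequences of points -/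

/-- A sequence of signed points that has a noncrossing pairing, in which points of opposite signs
related by `R` are paired. -/
inductive Noncrossing {α : Type u} (R : α → α → Prop) : List (Bool × α) → Prop
  | nil : Noncrossing R []
  | pair {s : Bool} {a b : α} {L M : List (Bool × α)} (h : R a b) (hL : Noncrossing R L)
      (hM : Noncrossing R M) : Noncrossing R ((s, a) :: L ++ (!s, b) :: M)

namespace Noncrossing

variable {α : Type u} {β : Type v} {R R' : α → α → Prop} {L M : List (Bool × α)}

theorem append (hL : Noncrossing R L) (hM : Noncrossing R M) : Noncrossing R (L ++ M) := by
  induction hL with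
  | nil => exact hM
  | pair h hL hM' ih ih' =>
    rw [List.append_assoc, List.cons_append]
    exact .pair h hL ih'

/-- Two adjacent points can be paired with each other without crossing any other pair; the induction
locates the place of insertion inside or after the first pair. -/
theorem insert {X Y : List (Bool × α)} {s : Bool} {a b : α} (hab : R a b)
    (h : Noncrossing R (X ++ Y)) : Noncrossing R (X ++ (s, a) :: (!s, b) :: Y) := by
  have h0 : Noncrossing R [(s, a), (!s, b)] := .pair (L := []) (M := []) hab .nil .nil
  generalize hZ : X ++ Y = Z at h
  induction h generalizing X Y with
  | nil =>
    obtain ⟨rfl, rfl⟩ := List.append_eq_nil_iff.1 hZ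
    exact h0
  | @pair s' a' b' L M h hL hM ihL ihM =>
    rcases X with _ | ⟨x, X⟩
    · obtain rfl : Y = _ := hZ
      exact h0.append (.pair h hL hM)
    · rw [List.cons_append, List.cons_append, List.cons.injEq] at hZ
      obtain ⟨rfl, hZ⟩ := hZ
      rcases List.append_eq_append_iff.1 hZ with ⟨W, rfl, rfl⟩ | ⟨W, rfl, hW⟩
      · have := Noncrossing.pair (s := s') h (ihL (X := X) (Y := W) rfl) hM
        simpa using this
      · rcases W with _ | ⟨w, W⟩
        · obtain rfl : (!s', b') :: M = Y := hW
          have := Noncrossing.pair (s := s') h (hL.append h0) hM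
          simpa using this
        · rw [List.cons_append, List.cons.injEq] at hW
          obtain ⟨rfl, rfl⟩ := hW
          have := Noncrossing.pair (s := s') h hL (ihM (X := W) (Y := Y) rfl)
          simpa using this

/-- Paired points are kept or discarded together, and omitting pairs creates no crossing. -/
theorem filter {P : α → Bool} (hP : ∀ a b, R a b → P a = P b) (h : Noncrossing R L) :
    Noncrossing R (L.filter fun c => P c.2) := by
  induction h with
  | nil => exact .nil
  | @pair s a b L M h hL hM ihL ihM =>
    rw [List.filter_append, List.filter_cons, List.filter_cons]
    simp only [hP a b h]
    split_ifs
    · exact .pair h ihL ihM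
    · exact ihL.append ihM

theorem of_map {S : β → β → Prop} (f : α → β) (hf : ∀ a b, S (f a) (f b) → R a b)
    (h : Noncrossing S (L.map (Prod.map id f))) : Noncrossing R L := by
  generalize hZ : L.map (Prod.map id f) = Z at h
  induction h generalizing L with
  | nil =>
    rw [List.map_eq_nil_iff.1 hZ]
    exact .nil
  | @pair s a b L' M' h hL hM ihL ihM =>
    rw [List.cons_append] at hZ
    obtain ⟨⟨s₁, a₁⟩, L, rfl, h1, h2⟩ := List.map_eq_cons_iff.1 hZ
    obtain ⟨L, M, rfl, rfl, h3⟩ := List.map_eq_append_iff.1 h2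
    obtain ⟨⟨s₂, b₁⟩, M, rfl, h4, rfl⟩ := List.map_eq_cons_iff.1 h3
    simp only [Prod.map_apply, id, Prod.mk.injEq] at h1 h4
    obtain ⟨rfl, rfl⟩ := h1
    obtain ⟨rfl, rfl⟩ := h4
    exact .pair (hf _ _ h) (ihL rfl) (ihM rfl)

theorem congr {E : α → α → Prop} (hE : ∀ a b a' b', E a' a → R a b → E b' b → R' a' b')
    {L' : List (Bool × α)} (h : Noncrossing R L)
    (hL : List.Forall₂ (fun c d => c.1 = d.1 ∧ E c.2 d.2) L' L) : Noncrossing R' L' := by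
  induction h generalizing L' with
  | nil =>
    rw [List.forall₂_nil_right_iff.1 hL]
    exact .nil
  | @pair s a b L M h _ _ ihL ihM =>
    rw [List.cons_append] at hL
    obtain ⟨⟨s₁, a₁⟩, X, ⟨h1, h2⟩, hX, rfl⟩ := List.forall₂_cons_right_iff.1 hL
    obtain ⟨X₁, X₂, h3, h4, rfl⟩ : ∃ X₁ X₂, List.Forall₂ (fun c d => c.1 = d.1 ∧ E c.2 d.2) X₁ L ∧
        List.Forall₂ (fun c d => c.1 = d.1 ∧ E c.2 d.2) X₂ ((!s, b) :: M) ∧ X = X₁ ++ X₂ :=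
      ⟨_, _, List.forall₂_take_append _ _ _ hX, List.forall₂_drop_append _ _ _ hX,
        (List.take_append_drop _ _).symm⟩
    obtain ⟨⟨s₂, b₂⟩, X₂, ⟨h5, h6⟩, h7, rfl⟩ := List.forall₂_cons_right_iff.1 h4
    dsimp only at h1 h2 h5 h6
    subst h1 h5
    exact .pair (hE _ _ _ _ h2 h h6) (ihL h3) (ihM h7)

end Noncrossing

/-- The points of a word: the letter `a` of positive sign, after a prefix of value `g`, contributes
the point `g`; if its sign is negative it contributes the value of the prefix that it ends. -/
def signedPoints {A : Type u} {Γ : Type v} [Mul Γ] (val : A → Γ) (sgn : A → Option Bool) :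
    Γ → List A → List (Bool × Γ)
  | _, [] => []
  | g, a :: w => (match sgn a with
      | none => []
      | some true => [(true, g)]
      | some false => [(false, g * val a)]) ++ signedPoints val sgn (g * val a) w

section SignedPoints

variable {A : Type u} {Γ : Type v} [Group Γ] {val : A → Γ} {sgn : A → Option Bool} {g : Γ}

theorem signedPoints_append (u v : List A) : signedPoints val sgn g (u ++ v) =
    signedPoints val sgn g u ++ signedPoints val sgn (g * (u.map val).prod) v := by
  induction u generalizing g with
  | nil => simp [signedPoints]
  | cons a u ih => simp [signedPoints, ih, mul_assoc]

theorem signedPoints_none {a : A} (ha : sgn a = none) (w : List A) :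
    signedPoints val sgn g (a :: w) = signedPoints val sgn (g * val a) w := by
  simp [signedPoints, ha]

theorem signedPoints_some {a : A} {s : Bool} (ha : sgn a = some s) (w : List A) :
    signedPoints val sgn g (a :: w) =
      (s, if s then g else g * val a) :: signedPoints val sgn (g * val a) w := by
  cases s <;> simp [signedPoints, ha]

theorem signedPoints_eq_nil {w : List A} (h : ∀ a ∈ w, sgn a = none) :
    signedPoints val sgn g w = [] := by
  induction w generalizing g with
  | nil => rfl
  | cons a w ih =>
    rw [signedPoints_none (h a List.mem_cons_self), ih fun b hb => h b (List.mem_cons_of_mem _ hb)]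

theorem exists_of_signedPoints_eq {w : List A} {L M : List (Bool × Γ)} {s : Bool} {v : Γ}
    (h : signedPoints val sgn g w = L ++ (s, v) :: M) : ∃ b a c, w = b ++ a :: c ∧
      sgn a = some s ∧ signedPoints val sgn g b = L ∧
      v = (if s then g * (b.map val).prod else g * (b.map val).prod * val a) ∧
      signedPoints val sgn (g * (b.map val).prod * val a) c = M := by
  induction w generalizing g L with
  | nil => simp [signedPoints] at h
  | cons a w ih =>
    rcases ha : sgn a with _ | s'
    · rw [signedPoints_none ha] at h
      obtain ⟨b, a', c, rfl, h1, h2, h3, h4⟩ := ih h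
      refine ⟨a :: b, a', c, rfl, h1, by rw [signedPoints_none ha, h2], ?_, ?_⟩
      · simpa [mul_assoc] using h3
      · simpa [mul_assoc] using h4
    · rw [signedPoints_some ha] at h
      rcases L with _ | ⟨x, L⟩
      · simp only [List.nil_append, List.cons.injEq, Prod.mk.injEq] at h
        obtain ⟨⟨rfl, rfl⟩, h⟩ := h
        exact ⟨[], a, w, rfl, ha, rfl, by simp, by simpa using h⟩
      · rw [List.cons_append, List.cons.injEq] at h
        obtain ⟨rfl, h⟩ := h
        obtain ⟨b, a', c, rfl, h1, h2, h3, h4⟩ := ih h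
        refine ⟨a :: b, a', c, rfl, h1, by rw [signedPoints_some ha, h2], ?_, ?_⟩
        · simpa [mul_assoc] using h3
        · simpa [mul_assoc] using h4

end SignedPoints

/-! ### Pairings of words in `H` and `t` -/

namespace Cyclic

variable {H : Type w} [Group H] {φ : MulAut H}

theorem t_inv_mul_inl_mul_t (h : H) : (t φ)⁻¹ * SemidirectProduct.inl h * t φ =
    (SemidirectProduct.inl (φ h) : Cyclic H φ) := by
  have := SemidirectProduct.inl_aut (φ := zpowersHom (MulAut H) φ) (Multiplicative.ofAdd 1) h
  simp only [zpowersHom_apply, toAdd_ofAdd, zpow_one] at this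
  rw [this, t, ← map_inv, ← ofAdd_neg, neg_neg, ← ofAdd_neg]

/-- The letters of the words in `H` and `t`. -/
def letterVal (φ : MulAut H) : H ⊕ Bool → Cyclic H φ
  | .inl h => SemidirectProduct.inl h
  | .inr true => t φ
  | .inr false => (t φ)⁻¹

/-- The exponent of a letter `t` or `t⁻¹`. -/
def letterSgn : H ⊕ Bool → Option Bool := Sum.elim (fun _ => none) some

/-- The length of a letter, if elements of `H` have length `ℓ`. -/
def letterCost (ℓ : H → ℕ) : H ⊕ Bool → ℕ := Sum.elim ℓ fun _ => 1

/-- The points differ by an element of `H` of length at most `k`. -/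
def Near (ℓ : H → ℕ) (φ : MulAut H) (k : ℕ) (a b : Cyclic H φ) : Prop :=
  ∃ h, ℓ h ≤ k ∧ b = a * SemidirectProduct.inl h

/-- The words of length at most `n` that represent the identity have noncrossing pairings of
width at most `k`. -/
def PairedWords (ℓ : H → ℕ) (φ : MulAut H) (n k : ℕ) : Prop :=
  ∀ w : List (H ⊕ Bool), (w.map (letterVal φ)).prod = 1 → (w.map (letterCost ℓ)).sum ≤ n →
    Noncrossing (Near ℓ φ k) (signedPoints (letterVal φ) letterSgn 1 w)

end Cyclic

/-- If `P` holds with parameters `n` and `k` then `Q` holds, after linear changes of the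
parameters. -/
def Dominates (P Q : ℕ → ℕ → Prop) : Prop := ∃ C, ∀ n k, P (C * n + C) k → Q n (C * k + C)

theorem Dominates.trans {P Q R : ℕ → ℕ → Prop} (h : Dominates P Q) (h' : Dominates Q R)
    (hP : ∀ n n' k, n ≤ n' → P n' k → P n k) (hR : ∀ n k k', k ≤ k' → R n k → R n k') :
    Dominates P R := by
  obtain ⟨C, h⟩ := h
  obtain ⟨D, h'⟩ := h'
  refine ⟨C * D + C + D, fun n k hk => hR _ _ _ ?_ (h' n _ (h _ k (hP _ _ _ ?_ hk)))⟩
  · nlinarith [Nat.zero_le (C * k), Nat.zero_le (D * k), Nat.zero_le (C * D)]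
  · nlinarith [Nat.zero_le (C * n), Nat.zero_le (D * n), Nat.zero_le (C * D)]

namespace Cyclic

variable {H : Type w} [Group H] {φ : MulAut H} {ℓ : H → ℕ}

theorem t_zpow (z : ℤ) : (t φ) ^ z = SemidirectProduct.inr (Multiplicative.ofAdd (-z)) := by
  rw [t, ← map_zpow, ← ofAdd_zsmul]
  simp

theorem inl_mul_t_zpow (h : H) (z : ℤ) : (SemidirectProduct.inl h : Cyclic H φ) * t φ ^ z =
    t φ ^ z * SemidirectProduct.inl ((φ ^ z) h) := by
  have := SemidirectProduct.inl_aut (φ := zpowersHom (MulAut H) φ) (Multiplicative.ofAdd z) h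
  simp only [zpowersHom_apply, toAdd_ofAdd] at this
  rw [this, t_zpow, ofAdd_neg, map_inv]
  group

theorem toAdd_right_t_zpow (z : ℤ) : ((t φ) ^ z).right.toAdd = -z := by
  rw [t_zpow]; rfl

theorem toAdd_right_mul (a b : Cyclic H φ) :
    (a * b).right.toAdd = a.right.toAdd + b.right.toAdd := rfl

/-! #### Nearness of points -/

theorem Near.refl (hℓ : IsWordLength ℓ) (k : ℕ) (a : Cyclic H φ) : Near ℓ φ k a a :=
  ⟨1, by rw [hℓ.one]; exact Nat.zero_le k, by simp⟩

theorem Near.symm (hℓ : IsWordLength ℓ) {k : ℕ} {a b : Cyclic H φ} (h : Near ℓ φ k a b) :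
    Near ℓ φ k b a := by
  obtain ⟨h, hk, rfl⟩ := h
  exact ⟨h⁻¹, by rwa [hℓ.inv], by rw [mul_assoc, ← map_mul]; simp⟩

theorem Near.trans (hℓ : IsWordLength ℓ) {k m : ℕ} {a b c : Cyclic H φ} (h : Near ℓ φ k a b)
    (h' : Near ℓ φ m b c) : Near ℓ φ (k + m) a c := by
  obtain ⟨h, hk, rfl⟩ := h
  obtain ⟨h', hm, rfl⟩ := h'
  exact ⟨h * h', (hℓ.mul _ _).trans (add_le_add hk hm), by rw [map_mul, mul_assoc]⟩

theorem Near.mono {k m : ℕ} {a b : Cyclic H φ} (h : Near ℓ φ k a b) (hkm : k ≤ m) :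
    Near ℓ φ m a b := by
  obtain ⟨h, hk, rfl⟩ := h
  exact ⟨h, hk.trans hkm, rfl⟩

/-- Moving `t ^ z` past an element of `H` applies `φ ^ z`, which multiplies lengths at most by `D`.
-/
theorem Near.mul_t_zpow {k D : ℕ} {z : ℤ} (hD : ∀ h, ℓ ((φ ^ z) h) ≤ D * ℓ h) {a b : Cyclic H φ}
    (h : Near ℓ φ k a b) : Near ℓ φ (D * k) (a * t φ ^ z) (b * t φ ^ z) := by
  obtain ⟨h, hk, rfl⟩ := h
  refine ⟨(φ ^ z) h, (hD h).trans (Nat.mul_le_mul_left D hk), ?_⟩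
  rw [mul_assoc, inl_mul_t_zpow, mul_assoc]

theorem Near.toAdd_right {k : ℕ} {a b : Cyclic H φ} (h : Near ℓ φ k a b) :
    b.right.toAdd = a.right.toAdd := by
  obtain ⟨h, -, rfl⟩ := h
  rw [toAdd_right_mul, SemidirectProduct.right_inl]
  simp

theorem PairedWords.mono {n n' k k' : ℕ} (h : PairedWords ℓ φ n k) (hn : n' ≤ n) (hk : k ≤ k') :
    PairedWords ℓ φ n' k' := by
  intro w h1 h2
  refine (h w h1 (h2.trans hn)).congr (E := Eq) ?_ (List.forall₂_same.2 fun _ _ => ⟨rfl, rfl⟩)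
  rintro a b _ _ rfl h3 rfl
  exact h3.mono hk

theorem exists_zpow_le_mul (hℓ : IsWordLength ℓ) (φ : MulAut H) (p : ℕ) :
    ∃ D, ∀ z : ℤ, |z| ≤ p → ∀ h, ℓ ((φ ^ z) h) ≤ D * ℓ h := by
  choose D hD using fun z : ℤ => hℓ.exists_le_mul (fun h => ℓ ((φ ^ z) h)) (by simp [hℓ.one])
    fun a b => by rw [map_mul]; exact hℓ.mul _ _
  obtain ⟨E, hE⟩ := ((Set.finite_Icc (-p : ℤ) p).image D).bddAbove
  refine ⟨E, fun z hz h => (hD z h).trans (Nat.mul_le_mul_right _ (hE ⟨z, ?_, rfl⟩))⟩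
  rw [abs_le] at hz
  exact hz

/-- The word `t⁻¹ h t φ(h)⁻¹` represents the identity and has only two letters `t` or `t⁻¹`. They
have to be paired with each other, and their points differ by `h`. So widths grow at least linearly,
and errors linear in the length of a word are absorbed. -/
theorem PairedWords.le_of_le (hℓ : IsWordLength ℓ) {D n k : ℕ} (hD : ∀ h, ℓ (φ h) ≤ D * ℓ h)
    (hP : PairedWords ℓ φ (2 + n + D * n) k) {h : H} (hn : ℓ h ≤ n) : ℓ h ≤ k := by
  have h1 := hP [.inr false, .inl h, .inr true, .inl (φ h)⁻¹] (by
    simp only [List.map_cons, List.map_nil, List.prod_cons, List.prod_nil, letterVal, mul_one,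
      map_inv]
    rw [← t_inv_mul_inl_mul_t]
    group) (by
    have := hD h
    have h2 : D * ℓ h ≤ D * n := Nat.mul_le_mul_left D hn
    simp only [List.map_cons, List.map_nil, List.sum_cons, List.sum_nil, letterCost, Sum.elim_inl,
      Sum.elim_inr, hℓ.inv]
    omega)
  simp only [signedPoints, letterSgn, Sum.elim_inl, Sum.elim_inr, letterVal, one_mul,
    List.nil_append, List.singleton_append] at h1
  generalize hZ : [(false, (t φ)⁻¹), (true, (t φ)⁻¹ * SemidirectProduct.inl h)] = Z at h1
  cases h1 with
  | nil => simp at hZ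
  | @pair s a b L M hab hL hM =>
    rw [List.cons_append, List.cons.injEq] at hZ
    obtain ⟨h2, hZ⟩ := hZ
    have hLM : L = [] ∧ M = [] := by
      have := congrArg List.length hZ
      simp at this
      exact ⟨List.length_eq_zero_iff.1 (by omega), List.length_eq_zero_iff.1 (by omega)⟩
    obtain ⟨rfl, rfl⟩ := hLM
    simp only [List.nil_append, List.cons.injEq, Prod.mk.injEq, and_true] at hZ h2
    obtain ⟨h', h3, h4⟩ := hab
    rw [← hZ.2, ← h2.2] at h4
    rw [SemidirectProduct.inl_inj.1 (mul_left_cancel h4)]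
    exact h3

/-! #### The subgroup generated by `H` and a power of `t` -/

section Power

variable {p : ℕ}

/-- The inclusion of `H ⋊_{φ^p} ℤ` in `H ⋊_φ ℤ`. -/
def powHom (φ : MulAut H) (p : ℕ) : Cyclic H (φ ^ p) →* Cyclic H φ :=
  SemidirectProduct.map (MonoidHom.id H) (powMonoidHom p) fun g => by
    ext h
    simp [zpowersHom_apply, zpow_mul]

theorem powHom_inl (h : H) : powHom φ p (SemidirectProduct.inl h) = SemidirectProduct.inl h :=
  SemidirectProduct.map_inl _ _ _ _

theorem powHom_t : powHom φ p (t (φ ^ p)) = t φ ^ p := by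
  have : t φ ^ p = SemidirectProduct.inr (Multiplicative.ofAdd (-1) ^ p) := (map_pow _ _ _).symm
  rw [this]
  exact SemidirectProduct.map_inr _ _ _ _

theorem powHom_injective (hp : 1 ≤ p) : Function.Injective (powHom φ p) := by
  intro a b hab
  refine SemidirectProduct.ext (congrArg SemidirectProduct.left hab :) ?_
  have h1 : a.right ^ p = b.right ^ p := congrArg SemidirectProduct.right hab
  have h2 := congrArg Multiplicative.toAdd h1
  rw [toAdd_pow, toAdd_pow, nsmul_eq_mul, nsmul_eq_mul] at h2
  exact Multiplicative.toAdd.injective (mul_left_cancel₀ (by exact_mod_cast (by omega : p ≠ 0)) h2)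

theorem toAdd_right_powHom (a : Cyclic H (φ ^ p)) :
    (powHom φ p a).right.toAdd = p * a.right.toAdd := by
  change (a.right ^ p).toAdd = _
  rw [toAdd_pow, nsmul_eq_mul]

/-- Replacing `t` by `t ^ p`. -/
def expand (p : ℕ) : H ⊕ Bool → List (H ⊕ Bool)
  | .inl h => [.inl h]
  | .inr b => List.replicate p (.inr b)

/-- `1` or `-1`. -/
def signValue (s : Bool) : ℤ := if s then 1 else -1

theorem letterVal_inr (s : Bool) : letterVal φ (.inr s) = t φ ^ signValue s := by
  cases s <;> simp [letterVal, signValue]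

theorem prod_replicate (s : Bool) (r : ℕ) :
    ((List.replicate r (.inr s : H ⊕ Bool)).map (letterVal φ)).prod = t φ ^ (signValue s * r) := by
  rw [List.map_replicate, List.prod_replicate, letterVal_inr, zpow_mul, zpow_natCast]

theorem powHom_letterVal (a : H ⊕ Bool) :
    powHom φ p (letterVal (φ ^ p) a) = ((expand p a).map (letterVal φ)).prod := by
  rcases a with h | _ | _
  · simp [letterVal, expand, powHom_inl]
  · simp [letterVal, expand, powHom_t]
  · simp [letterVal, expand, powHom_t]

theorem powHom_prod (u : List (H ⊕ Bool)) : powHom φ p (u.map (letterVal (φ ^ p))).prod =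
    ((u.flatMap (expand p)).map (letterVal φ)).prod := by
  induction u with
  | nil => simp
  | cons a u ih => simp [ih, powHom_letterVal]

omit [Group H] in
theorem cost_expand (hp : 1 ≤ p) (u : List (H ⊕ Bool)) :
    ((u.flatMap (expand p)).map (letterCost ℓ)).sum ≤ p * (u.map (letterCost ℓ)).sum := by
  induction u with
  | nil => simp
  | cons a u ih =>
    rw [List.flatMap_cons, List.map_append, List.sum_append, List.map_cons, List.sum_cons, mul_add]
    refine add_le_add ?_ ih
    rcases a with h | b
    · simpa [expand, letterCost] using Nat.le_mul_of_pos_left (ℓ h) hp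
    · simp [expand, letterCost]

/-- The points of the block `t ^ r` are its prefixes of lengths `0` to `r - 1`, those of `t ^ (-r)`
its prefixes of lengths `1` to `r`. This is why the range of `i` depends on the sign. -/
theorem filter_replicate {s : Bool} {r : ℕ} {g : Cyclic H φ}
    (h : ∀ i : ℤ, (if s then 0 ≤ i ∧ i < r else 0 < i ∧ i ≤ r) →
      ¬ (p : ℤ) ∣ g.right.toAdd - signValue s * i) :
    (signedPoints (letterVal φ) letterSgn g (List.replicate r (.inr s))).filter
      (fun c => decide ((p : ℤ) ∣ c.2.right.toAdd)) = [] := by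
  induction r generalizing g with
  | zero => rfl
  | succ r ih =>
    rw [List.replicate_succ, signedPoints_some (sgn := letterSgn) (a := .inr s) rfl, letterVal_inr]
    have h1 : (g * t φ ^ signValue s).right.toAdd = g.right.toAdd - signValue s := by
      rw [toAdd_right_mul, toAdd_right_t_zpow]; ring
    rw [List.filter_cons_of_neg, ih]
    · intro i hi
      have := h (i + 1) (by cases s <;> simp at hi ⊢ <;> omega)
      rw [h1]
      convert this using 1
      ring_nf
    · cases s
      · have := h 1 (by simp)
        rw [mul_one, ← h1] at this
        simpa using this
      · have := h 0 (by simp)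
        simpa using this

/-- Each letter becomes a block of `p` points with consecutive exponents, so exactly one exponent is
a multiple of `p`: that of the first point for `t ^ p`, and that of the last point for `t ^ (-p)`.
In both cases this is the image of the original point. -/
theorem filter_expand (hp : 1 ≤ p) (g : Cyclic H (φ ^ p)) (u : List (H ⊕ Bool)) :
    (signedPoints (letterVal φ) letterSgn (powHom φ p g) (u.flatMap (expand p))).filter
      (fun c => decide ((p : ℤ) ∣ c.2.right.toAdd)) =
    (signedPoints (letterVal (φ ^ p)) letterSgn g u).map (Prod.map id (powHom φ p)) := by
  obtain ⟨q, rfl⟩ : ∃ q, p = q + 1 := ⟨p - 1, by omega⟩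
  induction u generalizing g with
  | nil => rfl
  | cons a u ih =>
    rw [List.flatMap_cons, signedPoints_append, List.filter_append, ← powHom_letterVal, ← map_mul,
      ih]
    have hg : ((q + 1 : ℕ) : ℤ) ∣ (powHom φ (q + 1) g).right.toAdd := by
      rw [toAdd_right_powHom]; exact dvd_mul_right _ _
    have hndvd : ∀ i : ℤ, 0 < i → i ≤ q → ¬ ((q + 1 : ℕ) : ℤ) ∣ i := by
      intro i h1 h2 h3
      have := Int.le_of_dvd h1 h3
      push_cast at this
      omega
    rcases a with h | _ | _
    · rfl
    · rw [signedPoints_some (sgn := letterSgn) (a := .inr false) rfl, List.map_cons]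
      have h1 : powHom φ (q + 1) (g * letterVal (φ ^ (q + 1)) (.inr false)) =
          powHom φ (q + 1) g * t φ ^ (signValue false * q) * t φ ^ signValue false := by
        rw [map_mul, powHom_letterVal, expand, prod_replicate, mul_assoc, ← zpow_add]
        congr 2
        push_cast
        ring
      have h2 : ((q + 1 : ℕ) : ℤ) ∣
          (powHom φ (q + 1) (g * letterVal (φ ^ (q + 1)) (.inr false))).right.toAdd := by
        rw [toAdd_right_powHom]; exact dvd_mul_right _ _
      rw [expand, List.replicate_succ', signedPoints_append, List.filter_append, prod_replicate,
        filter_replicate, signedPoints_some (sgn := letterSgn) (a := .inr false) rfl, letterVal_inr]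
      · simp only [Bool.false_eq_true, if_false]
        rw [← h1, List.filter_cons_of_pos (by simpa using h2)]
        rfl
      · intro i hi hdvd
        simp only [Bool.false_eq_true, if_false] at hi
        refine hndvd i hi.1 hi.2 ?_
        have := dvd_sub hdvd hg
        simpa [signValue] using this
    · rw [signedPoints_some (sgn := letterSgn) (a := .inr true) rfl, List.map_cons, expand,
        List.replicate_succ,
        signedPoints_some (sgn := letterSgn) (a := .inr true) rfl,
        List.filter_cons_of_pos (by simpa using hg),
        filter_replicate]
      · rfl
      · intro i hi hdvd
        simp only [if_true] at hi
        refine hndvd (i + 1) (by omega) (by omega) ?_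
        have := dvd_sub hg hdvd
        rw [letterVal_inr, toAdd_right_mul, toAdd_right_t_zpow] at this
        have e : i + 1 = (powHom φ (q + 1) g).right.toAdd -
            ((powHom φ (q + 1) g).right.toAdd + -signValue true - signValue true * i) := by
          simp only [signValue, if_true]
          ring
        rwa [e]

/-- The word is expanded by `t ↦ t ^ p` and the points whose exponent is a multiple of `p` are
retained. The pairing can be restricted to them, since paired points differ by an element of `H` and
so have equal exponents. -/
theorem PairedWords.pow (hp : 1 ≤ p) {n k : ℕ} (h : PairedWords ℓ φ (p * n) k) :
    PairedWords ℓ (φ ^ p) n k := by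
  intro u h1 h2
  have h3 := h (u.flatMap (expand p)) (by rw [← powHom_prod, h1, map_one])
    ((cost_expand hp u).trans (Nat.mul_le_mul_left p h2))
  have h4 := h3.filter (P := fun a => decide ((p : ℤ) ∣ a.right.toAdd))
    fun a b hab => by simp only [hab.toAdd_right]
  have h5 := filter_expand (φ := φ) hp 1 u
  rw [map_one] at h5
  rw [h5] at h4
  refine h4.of_map _ fun a b hab => ?_
  obtain ⟨h, hk, hab⟩ := hab
  refine ⟨h, hk, powHom_injective hp ?_⟩
  rw [hab, map_mul, powHom_inl]

end Power

end Cyclic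

/-! ### Collecting the letters `t` into blocks `t ^ p` -/

namespace Cyclic

variable {H : Type w} [Group H] {φ : MulAut H} {ℓ : H → ℕ} {p : ℕ}

/-- The exponent `e` such that a letter `t` or `t⁻¹` after a prefix `g` contributes the point
`g t ^ e`. -/
def pointShift (s : Bool) : ℤ := if s then 0 else -1

theorem signedPoints_inr (g : Cyclic H φ) (s : Bool) (w : List (H ⊕ Bool)) :
    signedPoints (letterVal φ) letterSgn g (.inr s :: w) = (s, g * t φ ^ pointShift s) ::
      signedPoints (letterVal φ) letterSgn (g * t φ ^ signValue s) w := by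
  rw [signedPoints_some (sgn := letterSgn) (a := .inr s) rfl, letterVal_inr]
  cases s <;> simp [pointShift, signValue]

theorem signedPoints_replicate_succ (g : Cyclic H φ) (s : Bool) (r : ℕ) :
    signedPoints (letterVal φ) letterSgn g (List.replicate (r + 1) (.inr s)) =
      signedPoints (letterVal φ) letterSgn g (List.replicate r (.inr s)) ++
        [(s, g * t φ ^ (signValue s * r + pointShift s))] := by
  rw [List.replicate_succ', signedPoints_append, prod_replicate, signedPoints_inr, mul_assoc,
    ← zpow_add]
  rfl

/-- The points of the word that replaces a letter `t ^ p` or `t ^ (-p)`. -/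
def powBlock (φ : MulAut H) (r : ℕ) : Bool × Cyclic H φ → List (Bool × Cyclic H φ)
  | (true, v) => signedPoints (letterVal φ) letterSgn v (List.replicate r (.inr true))
  | (false, v) => signedPoints (letterVal φ) letterSgn (v * t φ ^ (r : ℤ))
      (List.replicate r (.inr false))

/-- One of the two blocks runs through the exponents `0` to `r - 1` upwards and the other one
downwards. So pairing equal exponents gives nested pairs around `Y`. -/
theorem noncrossing_powBlock {R : Cyclic H φ → Cyclic H φ → Prop} {Y : List (Bool × Cyclic H φ)}
    (hY : Noncrossing R Y) (s : Bool) (r : ℕ) (v v' : Cyclic H φ)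
    (h : ∀ l : ℕ, l < r → R (v * t φ ^ (l : ℤ)) (v' * t φ ^ (l : ℤ))) :
    Noncrossing R (powBlock φ r (s, v) ++ Y ++ powBlock φ r (!s, v')) := by
  cases s
  · induction r generalizing v v' Y with
    | zero => simpa [powBlock, signedPoints] using hY
    | succ r ih =>
      have h1 : powBlock φ (r + 1) (false, v) = powBlock φ r (false, v * t φ) ++ [(false, v)] := by
        simp only [powBlock]
        rw [signedPoints_replicate_succ, mul_assoc v, mul_assoc v, ← zpow_one_add, ← zpow_add]
        push_cast
        simp only [signValue, pointShift]
        congr 4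
        · ring
        · simp only [Bool.false_eq_true, if_false]
          rw [show (r : ℤ) + 1 + (-1 * r + -1) = 0 by ring, zpow_zero, mul_one]
      have h2 : powBlock φ (r + 1) (true, v') = (true, v') :: powBlock φ r (true, v' * t φ) := by
        simp only [powBlock]
        rw [List.replicate_succ, signedPoints_inr]
        simp [signValue, pointShift]
      have h3 := ih (Y := (false, v) :: Y ++ [(true, v')])
        (.pair (s := false) (by simpa using h 0 (by omega)) hY .nil) (v * t φ) (v' * t φ) (by
          intro l hl
          have := h (l + 1) (by omega)
          push_cast at this
          rwa [add_comm (l : ℤ), zpow_one_add, ← mul_assoc, ← mul_assoc] at this)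
      simp only [Bool.not_false] at h3 ⊢
      rw [h1, h2]
      simpa using h3
  · induction r generalizing Y with
    | zero => simpa [powBlock, signedPoints] using hY
    | succ r ih =>
      have h1 : powBlock φ (r + 1) (true, v) =
          powBlock φ r (true, v) ++ [(true, v * t φ ^ (r : ℤ))] := by
        simp only [powBlock]
        rw [signedPoints_replicate_succ]
        simp [signValue, pointShift]
      have h2 : powBlock φ (r + 1) (false, v') =
          (false, v' * t φ ^ (r : ℤ)) :: powBlock φ r (false, v') := by
        simp only [powBlock]
        rw [List.replicate_succ, signedPoints_inr, mul_assoc, mul_assoc, ← zpow_add, ← zpow_add]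
        simp [signValue, pointShift]
      have h3 := ih (Y := (true, v * t φ ^ (r : ℤ)) :: Y ++ [(false, v' * t φ ^ (r : ℤ))])
        (.pair (s := true) (h r (by omega)) hY .nil) fun l hl => h l (by omega)
      simp only [Bool.not_true] at h3 ⊢
      rw [h1, h2]
      simpa using h3

theorem signedPoints_expand (g : Cyclic H (φ ^ p)) (u : List (H ⊕ Bool)) :
    signedPoints (letterVal φ) letterSgn (powHom φ p g) (u.flatMap (expand p)) =
      (signedPoints (letterVal (φ ^ p)) letterSgn g u).flatMap
        fun c => powBlock φ p (c.1, powHom φ p c.2) := by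
  induction u generalizing g with
  | nil => rfl
  | cons a u ih =>
    rw [List.flatMap_cons, signedPoints_append, ← powHom_letterVal, ← map_mul, ih]
    rcases a with h | _ | _
    · rfl
    · rw [signedPoints_some (sgn := letterSgn) (a := .inr false) rfl, List.flatMap_cons]
      congr 1
      simp only [Bool.false_eq_true, if_false, powBlock]
      rw [map_mul, letterVal, map_inv, powHom_t, expand]
      simp
    · rw [signedPoints_some (sgn := letterSgn) (a := .inr true) rfl, List.flatMap_cons]
      rfl

theorem noncrossing_expand {R : Cyclic H (φ ^ p) → Cyclic H (φ ^ p) → Prop}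
    {R' : Cyclic H φ → Cyclic H φ → Prop}
    (hR : ∀ a b, R a b → ∀ l : ℕ, l < p →
      R' (powHom φ p a * t φ ^ (l : ℤ)) (powHom φ p b * t φ ^ (l : ℤ)))
    {L : List (Bool × Cyclic H (φ ^ p))} (h : Noncrossing R L) :
    Noncrossing R' (L.flatMap fun c => powBlock φ p (c.1, powHom φ p c.2)) := by
  induction h with
  | nil => exact .nil
  | @pair s a b L M hab hL hM ihL ihM =>
    have := (noncrossing_powBlock ihL s p _ _ (hR a b hab)).append ihM
    simpa using this

/-- If the prefix before the block changes by `h`, each point of the block changes by some `φ ^ z`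
applied to `h`, with `z` of absolute value at most `p`. -/
theorem forall₂_near_replicate {D : ℕ} (hD : ∀ z : ℤ, |z| ≤ p → ∀ h, ℓ ((φ ^ z) h) ≤ D * ℓ h)
    (g : Cyclic H φ) (h : H) (s : Bool) {r : ℕ} (hr : r ≤ p) :
    List.Forall₂ (fun c d => c.1 = d.1 ∧ Near ℓ φ (D * ℓ h) c.2 d.2)
      (signedPoints (letterVal φ) letterSgn g (List.replicate r (.inr s)))
      (signedPoints (letterVal φ) letterSgn (g * SemidirectProduct.inl h)
        (List.replicate r (.inr s))) := by
  induction r with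
  | zero => exact .nil
  | succ r ih =>
    rw [signedPoints_replicate_succ, signedPoints_replicate_succ]
    refine List.rel_append (ih (by omega)) (.cons ⟨rfl, ?_⟩ .nil)
    have h1 : |signValue s * r + pointShift s| ≤ p := by
      rw [abs_le]
      cases s <;> simp [signValue, pointShift] <;> omega
    exact Near.mul_t_zpow (hD _ h1) ⟨h, le_rfl, rfl⟩

theorem forall₂_near_trans (hℓ : IsWordLength ℓ) {k m : ℕ} {X Y Z : List (Bool × Cyclic H φ)}
    (h : List.Forall₂ (fun c d => c.1 = d.1 ∧ Near ℓ φ k c.2 d.2) X Y)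
    (h' : List.Forall₂ (fun c d => c.1 = d.1 ∧ Near ℓ φ m c.2 d.2) Y Z) :
    List.Forall₂ (fun c d => c.1 = d.1 ∧ Near ℓ φ (k + m) c.2 d.2) X Z := by
  induction h generalizing Z with
  | nil => cases h'; exact .nil
  | cons h _ ih =>
    cases h' with
    | cons h₁ h₂ => exact .cons ⟨h.1.trans h₁.1, h.2.trans hℓ h₁.2⟩ (ih h₂)

/-- Every word can be rewritten as a word in `H` and `t ^ p`, followed by less than `p` letters
`t` or `t⁻¹`; the points of the former are paired, or move close to those of the latter. -/
theorem exists_collapse (hp : 1 ≤ p) (hℓ : IsWordLength ℓ) {D : ℕ}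
    (hD : ∀ z : ℤ, |z| ≤ p → ∀ h, ℓ ((φ ^ z) h) ≤ D * ℓ h) (w : List (H ⊕ Bool)) :
    ∃ (u : List (H ⊕ Bool)) (r : ℕ) (s : Bool) (L : List (Bool × Cyclic H φ)), r < p ∧
      (u.map (letterCost ℓ)).sum ≤ (D + 1) * (w.map (letterCost ℓ)).sum ∧
      (w.map (letterVal φ)).prod =
        ((u.flatMap (expand p)).map (letterVal φ)).prod * t φ ^ (signValue s * r) ∧
      List.Forall₂ (fun c d => c.1 = d.1 ∧ Near ℓ φ (D * D * (w.map (letterCost ℓ)).sum) c.2 d.2) L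
        (signedPoints (letterVal φ) letterSgn 1
          (u.flatMap (expand p) ++ List.replicate r (.inr s))) ∧
      ∀ R : Cyclic H φ → Cyclic H φ → Prop,
        (∀ a b, Near ℓ φ (D * D * (w.map (letterCost ℓ)).sum) a b → R a b) →
        ∀ M, Noncrossing R (L ++ M) →
          Noncrossing R (signedPoints (letterVal φ) letterSgn 1 w ++ M) := by
  induction w using List.reverseRecOn with
  | nil => exact ⟨[], 0, true, [], by omega, by simp, by simp, .nil, fun _ _ _ h => h⟩
  | append_singleton w a ih =>
    obtain ⟨u, r, s, L, hr, hcost, hval, hL, hNC⟩ := ih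
    set c := (w.map (letterCost ℓ)).sum with hc
    have hc' : ((w ++ [a]).map (letterCost ℓ)).sum = c + letterCost ℓ a := by simp [hc]
    rw [hc', List.map_append, List.prod_append]
    have hmono : ∀ {L₁ L₂ : List (Bool × Cyclic H φ)} {m m' : ℕ}, m ≤ m' →
        List.Forall₂ (fun c d => c.1 = d.1 ∧ Near ℓ φ m c.2 d.2) L₁ L₂ →
        List.Forall₂ (fun c d => c.1 = d.1 ∧ Near ℓ φ m' c.2 d.2) L₁ L₂ := fun hm h =>
      h.imp fun _ _ h => ⟨h.1, h.2.mono hm⟩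
    have hle : D * D * c ≤ D * D * (c + letterCost ℓ a) :=
      Nat.mul_le_mul_left _ (Nat.le_add_right _ _)
    rcases a with h | b
    · have hz : |signValue s * (r : ℤ)| ≤ p ∧ |-(signValue s * (r : ℤ))| ≤ p := by
        rw [abs_neg, and_self, abs_le]
        cases s <;> simp [signValue] <;> omega
      set h' := (φ ^ (-(signValue s * (r : ℤ)))) h with hh'
      have hlen : ℓ h' ≤ D * ℓ h := hD _ hz.2 h
      have hconj : t φ ^ (signValue s * (r : ℤ)) * (SemidirectProduct.inl h : Cyclic H φ) =
          SemidirectProduct.inl h' * t φ ^ (signValue s * (r : ℤ)) := by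
        rw [inl_mul_t_zpow, hh', ← MulAut.mul_apply, ← zpow_add]
        simp
      refine ⟨u ++ [.inl h'], r, s, L, hr, ?_, ?_, ?_, ?_⟩
      · simp only [List.map_append, List.sum_append, List.map_cons, List.map_nil, List.sum_cons,
          List.sum_nil, letterCost, Sum.elim_inl]
        calc (u.map (letterCost ℓ)).sum + (ℓ h' + 0) ≤ (D + 1) * c + (D * ℓ h + ℓ h) := by omega
          _ = (D + 1) * (c + ℓ h) := by ring
      · simp only [hval, List.flatMap_append, List.flatMap_cons, List.flatMap_nil, expand,
          List.map_append, List.prod_append, List.map_cons, List.map_nil, List.prod_cons,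
          List.prod_nil, letterVal, mul_one, List.append_nil, mul_assoc]
        rw [hconj]
      · have h1 : signedPoints (letterVal φ) letterSgn 1
            ((u ++ [Sum.inl h']).flatMap (expand p) ++ List.replicate r (.inr s)) =
            signedPoints (letterVal φ) letterSgn 1 (u.flatMap (expand p)) ++
              signedPoints (letterVal φ) letterSgn
                (1 * ((u.flatMap (expand p)).map (letterVal φ)).prod * SemidirectProduct.inl h')
                (List.replicate r (.inr s)) := by
          rw [List.flatMap_append, List.append_assoc, signedPoints_append]
          rfl
        rw [h1]
        rw [signedPoints_append] at hL
        refine hmono ?_ (forall₂_near_trans hℓ hL (List.rel_append (List.forall₂_same.2 fun x _ =>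
          ⟨rfl, Near.refl hℓ (D * ℓ h') x.2⟩) (forall₂_near_replicate hD _ h' s hr.le)))
        rw [mul_add, letterCost, Sum.elim_inl, mul_assoc D D (ℓ h)]
        exact Nat.add_le_add_left (Nat.mul_le_mul_left D hlen) _
      · intro R hR M hM
        rw [signedPoints_append, List.append_assoc]
        exact hNC R (fun a b hab => hR a b (hab.mono hle)) M hM
    · have hD1 : (D + 1) * c + 1 ≤ (D + 1) * (c + letterCost ℓ (.inr b)) := by
        simp only [letterCost, Sum.elim_inr]
        have : (D + 1) * (c + 1) = (D + 1) * c + (D + 1) := by ring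
        omega
      have hpt : ∀ M : List (Bool × Cyclic H φ),
          signedPoints (letterVal φ) letterSgn 1 (w ++ [.inr b]) ++ M =
          signedPoints (letterVal φ) letterSgn 1 w ++
            (b, (w.map (letterVal φ)).prod * t φ ^ pointShift b) :: M := by
        intro M
        rw [signedPoints_append, signedPoints_inr, one_mul]
        simp [signedPoints]
      -- An empty block has no sign, so it may be given that of the new letter. Hence either the
      -- signs agree, or the block is nonempty and its last letter cancels with the new one.
      obtain ⟨s, hsb, hval, hL⟩ : ∃ s' : Bool, (s' = b ∨ (b = !s' ∧ ∃ r', r = r' + 1)) ∧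
          (w.map (letterVal φ)).prod = ((u.flatMap (expand p)).map (letterVal φ)).prod *
            t φ ^ (signValue s' * r) ∧
          List.Forall₂ (fun c₁ d => c₁.1 = d.1 ∧ Near ℓ φ (D * D * c) c₁.2 d.2) L
            (signedPoints (letterVal φ) letterSgn 1
              (u.flatMap (expand p) ++ List.replicate r (.inr s'))) := by
        rcases r with _ | r
        · exact ⟨b, .inl rfl, by simpa using hval, hL⟩
        · refine ⟨s, ?_, hval, hL⟩
          by_cases hs : s = b
          · exact .inl hs
          · exact .inr ⟨by cases s <;> cases b <;> simp_all, r, rfl⟩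
      rcases hsb with rfl | ⟨rfl, r, rfl⟩
      · have h1 : List.Forall₂ (fun c₁ d => c₁.1 = d.1 ∧
            Near ℓ φ (D * D * (c + letterCost ℓ (.inr s))) c₁.2 d.2)
            (L ++ [(s, (w.map (letterVal φ)).prod * t φ ^ pointShift s)])
            (signedPoints (letterVal φ) letterSgn 1
              (u.flatMap (expand p) ++ List.replicate (r + 1) (.inr s))) := by
          rw [List.replicate_succ', ← List.append_assoc, signedPoints_append, signedPoints_inr]
          refine List.rel_append (hmono hle hL) (.cons ⟨rfl, ?_⟩ .nil)
          rw [List.map_append, List.prod_append, prod_replicate, ← hval, one_mul]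
          exact .refl hℓ _ _
        have h2 : ∀ R : Cyclic H φ → Cyclic H φ → Prop,
            (∀ a b, Near ℓ φ (D * D * (c + letterCost ℓ (.inr s))) a b → R a b) →
            ∀ M, Noncrossing R (L ++ [(s, (w.map (letterVal φ)).prod * t φ ^ pointShift s)] ++ M) →
            Noncrossing R (signedPoints (letterVal φ) letterSgn 1 (w ++ [.inr s]) ++ M) := by
          intro R hR M hM
          rw [hpt]
          refine hNC R (fun a b hab => hR a b (hab.mono hle)) _ ?_
          simpa using hM
        have h3 : ((u.flatMap (expand p)).map (letterVal φ)).prod * t φ ^ (signValue s * (r : ℤ)) *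
            t φ ^ signValue s = ((u.flatMap (expand p)).map (letterVal φ)).prod *
            t φ ^ (signValue s * (r + 1 : ℕ)) := by
          rw [mul_assoc, ← zpow_add]
          congr 2
          push_cast
          ring
        have h4 : ([(.inr s : H ⊕ Bool)].map (letterVal φ)).prod = t φ ^ signValue s := by
          simp [letterVal_inr]
        by_cases hrp : r + 1 < p
        · exact ⟨u, r + 1, s, _, hrp, by omega, by rw [h4, hval, h3], h1, h2⟩
        · obtain rfl : p = r + 1 := by omega
          refine ⟨u ++ [.inr s], 0, s, _, hp, ?_, ?_, ?_, h2⟩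
          · simp only [List.map_append, List.sum_append, List.map_cons, List.map_nil, List.sum_cons,
              List.sum_nil]
            simp only [letterCost, Sum.elim_inr] at hD1 hcost ⊢
            omega
          · rw [h4, hval, h3, List.flatMap_append, List.map_append, List.prod_append]
            simp only [List.flatMap_cons, List.flatMap_nil, List.append_nil, expand]
            rw [prod_replicate]
            simp
          · rw [List.flatMap_append]
            simpa [expand] using h1
      · have hx : (w.map (letterVal φ)).prod * t φ ^ pointShift (!s) =
            ((u.flatMap (expand p)).map (letterVal φ)).prod *
              t φ ^ (signValue s * r + pointShift s) := by
          rw [hval, mul_assoc, ← zpow_add]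
          congr 2
          push_cast
          cases s
          · simp [signValue, pointShift]
            ring_nf
          · simp [signValue, pointShift]
        have hsplit : signedPoints (letterVal φ) letterSgn 1
            (u.flatMap (expand p) ++ List.replicate (r + 1) (.inr s)) =
            signedPoints (letterVal φ) letterSgn 1
              (u.flatMap (expand p) ++ List.replicate r (.inr s)) ++
              [(s, (w.map (letterVal φ)).prod * t φ ^ pointShift (!s))] := by
          rw [hx, signedPoints_append, signedPoints_append, signedPoints_replicate_succ, one_mul,
            List.append_assoc]
        rw [hsplit] at hL
        obtain ⟨L, L', h1, h2, rfl⟩ : ∃ X₁ X₂,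
            List.Forall₂ (fun c₁ d : Bool × Cyclic H φ => c₁.1 = d.1 ∧
              Near ℓ φ (D * D * c) c₁.2 d.2) X₁ _ ∧
            List.Forall₂ (fun c₁ d : Bool × Cyclic H φ => c₁.1 = d.1 ∧
              Near ℓ φ (D * D * c) c₁.2 d.2) X₂ _ ∧
            L = X₁ ++ X₂ :=
          ⟨_, _, List.forall₂_take_append _ _ _ hL, List.forall₂_drop_append _ _ _ hL,
            (List.take_append_drop _ _).symm⟩
        obtain ⟨⟨s', y⟩, L', ⟨h3, h4⟩, h5, rfl⟩ := List.forall₂_cons_right_iff.1 h2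
        obtain rfl := List.forall₂_nil_right_iff.1 h5
        dsimp only at h3 h4
        subst h3
        refine ⟨u, r, s', L, by omega, by omega, ?_, hmono hle h1, ?_⟩
        · rw [hval]
          simp only [List.map_cons, List.map_nil, List.prod_cons, List.prod_nil, mul_one,
            letterVal_inr, mul_assoc, ← zpow_add]
          congr 2
          push_cast
          cases s' <;> simp [signValue]
        · intro R hR M hM
          rw [hpt]
          refine hNC R (fun a b hab => hR a b (hab.mono hle)) _ ?_
          have := Noncrossing.insert (s := s') (hR _ _ (h4.mono hle)) hM
          simpa using this

/-- A word for `φ` is collapsed to one for `φ ^ p`, the latter is paired, and each of its pairs is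
resolved into `p` parallel ones. The displacement of the points in the collapse is at most `D * D`
times the cost, hence at most `k` by the linear lower bound for widths. -/
theorem PairedWords.of_pow (hp : 1 ≤ p) (hℓ : IsWordLength ℓ) (φ : MulAut H) :
    Dominates (PairedWords ℓ (φ ^ p)) (PairedWords ℓ φ) := by
  obtain ⟨D, hD⟩ := exists_zpow_le_mul hℓ φ p
  have hDp : ∀ h, ℓ ((φ ^ p) h) ≤ D * ℓ h := by
    simpa using hD p (by simp)
  refine ⟨(D + 1) + (D * D + D * (D * D)) + 2 + D, fun n k hP => ?_⟩
  intro w hw hn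
  obtain ⟨u, r, s, L, hr, hcost, hval, hL, hNC⟩ := exists_collapse hp hℓ hD w
  set c := (w.map (letterCost ℓ)).sum
  have hball : ∀ h, ℓ h ≤ D * D * c → ℓ h ≤ k := by
    intro h hh
    refine (hP.mono (n' := 2 + D * D * c + D * (D * D * c)) ?_ le_rfl).le_of_le hℓ hDp hh
    have h1 : (D * D + D * (D * D)) * c ≤ (D * D + D * (D * D)) * n := Nat.mul_le_mul_left _ hn
    nlinarith [Nat.zero_le (D * n), Nat.zero_le n, Nat.zero_le (D * D), Nat.zero_le (D * (D * D))]
  have hnear : ∀ a b : Cyclic H φ, Near ℓ φ (D * D * c) a b → Near ℓ φ k a b := by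
    rintro a _ ⟨h, hh, rfl⟩
    exact ⟨h, hball h hh, rfl⟩
  rw [hw] at hval
  -- The exponent of the whole word is zero and that of the expanded part is a multiple of `p`, so
  -- `p` divides `r < p`.
  obtain rfl : r = 0 := by
    have h1 := congrArg (fun a : Cyclic H φ => a.right.toAdd) hval
    simp only [← powHom_prod, toAdd_right_mul, toAdd_right_powHom, toAdd_right_t_zpow,
      SemidirectProduct.one_right, toAdd_one] at h1
    have h2 : (p : ℤ) ∣ signValue s * r := 
      ⟨(u.map (letterVal (φ ^ p))).prod.right.toAdd, by linarith⟩
    have h3 : (p : ℤ) ∣ r := by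
      cases s
      · simpa [signValue] using h2
      · simpa [signValue] using h2
    exact Nat.eq_zero_of_dvd_of_lt (Int.natCast_dvd_natCast.1 h3) hr
  have hu : (u.map (letterVal (φ ^ p))).prod = 1 := by
    refine powHom_injective hp ?_
    rw [powHom_prod, map_one]
    simpa using hval.symm
  have h1 := hP u hu (hcost.trans (by
    have : (D + 1) * c ≤ (D + 1) * n := Nat.mul_le_mul_left _ hn
    nlinarith [Nat.zero_le (D * n), Nat.zero_le n, Nat.zero_le ((D * D + D * (D * D)) * n)]))
  have h2 := noncrossing_expand (φ := φ) (R' := Near ℓ φ (D * k)) (fun a b hab l hl => by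
    obtain ⟨h, hk, rfl⟩ := hab
    rw [map_mul, powHom_inl]
    exact Near.mul_t_zpow (hD l (by simp; omega)) ⟨h, hk, rfl⟩) h1
  rw [← signedPoints_expand, map_one] at h2
  rw [List.replicate_zero, List.append_nil] at hL
  -- The width is `D * k` between the expanded points, and `k` is added at each end for their
  -- displacement.
  have h3 : Noncrossing (Near ℓ φ (k + D * k + k)) L := by
    refine h2.congr (E := Near ℓ φ (D * D * c)) ?_ hL
    intro a b a' b' h4 h5 h6
    exact ((hnear _ _ h4).trans hℓ h5).trans hℓ (hnear _ _ (h6.symm hℓ))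
  have h4 := hNC (Near ℓ φ (k + D * k + k)) (fun a b hab => (hnear a b hab).mono (by omega)) []
    (by simpa using h3)
  rw [List.append_nil] at h4
  refine h4.congr (E := Eq) ?_ (List.forall₂_same.2 fun _ _ => ⟨rfl, rfl⟩)
  rintro a b _ _ rfl h5 rfl
  refine h5.mono ?_
  nlinarith [Nat.zero_le (D * k), Nat.zero_le k, Nat.zero_le ((D * D + D * (D * D)) * k)]

theorem PairedWords.dominates_pow (hp : 1 ≤ p) (φ : MulAut H) :
    Dominates (PairedWords ℓ φ) (PairedWords ℓ (φ ^ p)) := by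
  refine ⟨p, fun n k h => ?_⟩
  exact ((h.mono (Nat.le_add_right _ _) le_rfl).pow hp).mono le_rfl (by nlinarith)

end Cyclic

/-! ### Comparison of loops in a mapping torus with words in `H` and `t` -/

open OneComplex Relation

/-- The value of an oriented edge, if `v` gives the values of the edges. -/
def dartVal {E : Type u} {Γ : Type v} [Group Γ] (v : E → Γ) (d : E × Bool) : Γ :=
  cond d.2 (v d.1) (v d.1)⁻¹

section FlatMap

variable {A : Type u} {B : Type v} {Γ : Type w} [Group Γ] {val : A → Γ} {val' : B → Γ}
  {sgn : A → Option Bool} {sgn' : B → Option Bool} {F : A → List B}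

theorem prod_flatMap_of_forall (hv : ∀ a, ((F a).map val').prod = val a) (u : List A) :
    ((u.flatMap F).map val').prod = (u.map val).prod := by
  induction u with
  | nil => rfl
  | cons a u ih => rw [List.flatMap_cons, List.map_append, List.prod_append, ih, hv, List.map_cons,
      List.prod_cons]

theorem signedPoints_flatMap (hv : ∀ a, ((F a).map val').prod = val a)
    (hs : ∀ g a, signedPoints val' sgn' g (F a) = signedPoints val sgn g [a]) (g : Γ)
    (u : List A) : signedPoints val' sgn' g (u.flatMap F) = signedPoints val sgn g u := by
  induction u generalizing g with
  | nil => rfl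
  | cons a u ih =>
    have h := signedPoints_append (val := val) (sgn := sgn) (g := g) [a] u
    rw [List.flatMap_cons, signedPoints_append, hs, hv, ih]
    simpa using h.symm

theorem sum_flatMap_le {cost : A → ℕ} {cost' : B → ℕ} {C : ℕ}
    (h : ∀ a, ((F a).map cost').sum ≤ C * cost a) (u : List A) :
    ((u.flatMap F).map cost').sum ≤ C * (u.map cost).sum := by
  induction u with
  | nil => simp
  | cons a u ih =>
    rw [List.flatMap_cons, List.map_append, List.sum_append, List.map_cons, List.sum_cons, mul_add]
    exact Nat.add_le_add (h a) ih

end FlatMap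

section DartVal

variable {E : Type u} {Γ : Type v} [Group Γ] (v : E → Γ)

theorem prod_dartVal (p : List (E × Bool)) :
    (p.map (dartVal v)).prod = FreeGroup.lift v (FreeGroup.mk p) :=
  FreeGroup.lift_mk.symm

theorem prod_dartVal_invRev (p : List (E × Bool)) :
    ((FreeGroup.invRev p).map (dartVal v)).prod = (p.map (dartVal v)).prod⁻¹ := by
  rw [prod_dartVal, prod_dartVal, ← FreeGroup.inv_mk, map_inv]

end DartVal

namespace EdgePathMap

open TwoComplex

variable {G : TwoComplex.{u}} (f : EdgePathMap G.toOneComplex)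

/-- The property of being one of the edges `t_x`. -/
def IsT (e : f.mappingTorus.Edge) : Prop := e.isRight = true

instance : DecidablePred f.IsT := fun e => inferInstanceAs (Decidable (e.isRight = true))

/-- The oriented edges of `G`, as oriented edges of the mapping torus. -/
def inclDart (d : G.Dart) : f.mappingTorus.Dart := incl d

/-- The paths of `G`, as paths of the mapping torus. -/
def inclList (p : List G.Dart) : List f.mappingTorus.Dart := p.map f.inclDart

/-- The edge `t_x`, with its orientation. -/
def tDart (x : G.Vert) : f.mappingTorus.Dart := (Sum.inr x, true)

theorem inclDart_rev (d : G.Dart) : f.inclDart (rev d) = rev (f.inclDart d) := rfl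

theorem inclList_invRev (p : List G.Dart) :
    f.inclList (FreeGroup.invRev p) = FreeGroup.invRev (f.inclList p) := by
  induction p with
  | nil => rfl
  | cons d p ih =>
    have h : f.inclList (d :: p) = f.inclDart d :: f.inclList p := rfl
    rw [invRev_cons, h, invRev_cons, ← ih, inclList, List.map_append]
    rfl

theorem isPath_inclList {x y : G.Vert} {p : List G.Dart} (h : G.IsPath x p y) :
    f.mappingTorus.IsPath x (f.inclList p) y := f.isPath_incl h

theorem not_isT_of_mem_inclList {p : List G.Dart} :
    ∀ d ∈ f.inclList p, ¬ f.IsT d.1 := by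
  intro d hd
  obtain ⟨d, -, rfl⟩ := List.mem_map.1 hd
  exact Bool.false_ne_true

theorem exists_inclList {w : List f.mappingTorus.Dart} (h : ∀ d ∈ w, ¬ f.IsT d.1) :
    ∃ p, f.inclList p = w := by
  induction w with
  | nil => exact ⟨[], rfl⟩
  | cons d w ih =>
    obtain ⟨p, rfl⟩ := ih fun e he => h e (List.mem_cons_of_mem _ he)
    obtain ⟨e | x, b⟩ := d
    · exact ⟨(e, b) :: p, rfl⟩
    · exact (h _ List.mem_cons_self rfl).elim

theorem faceLoop (d : G.Dart) : f.mappingTorus.FaceLoop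
    (f.tDart (G.dsrc d) :: f.inclList (f.onDart d) ++ rev (f.tDart (G.dtgt d)) ::
      FreeGroup.invRev [f.inclDart d]) := by
  obtain ⟨e, b⟩ := d
  have h : f.mappingTorus.bdry (Sum.inr e) = rev (f.tDart (G.src e)) :: f.inclDart (e, true) ::
      f.tDart (G.tgt e) :: f.inclList (FreeGroup.invRev (f.onEdge e)) := rfl
  cases b
  · refine ⟨Sum.inr e, .inl ?_⟩
    rw [h]
    refine List.isRotated_iff_append.2
      ⟨f.tDart (G.tgt e) :: f.inclList (FreeGroup.invRev (f.onEdge e)),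
        [rev (f.tDart (G.src e)), f.inclDart (e, true)], rfl, rfl⟩
  · refine ⟨Sum.inr e, .inr ?_⟩
    have h' : FreeGroup.invRev (f.mappingTorus.bdry (Sum.inr e)) = f.inclList (f.onEdge e) ++
        [rev (f.tDart (G.tgt e)), rev (f.inclDart (e, true)), f.tDart (G.src e)] := by
      rw [h, invRev_cons, invRev_cons, invRev_cons, ← inclList_invRev, FreeGroup.invRev_invRev,
        rev_rev, List.append_assoc, List.append_assoc]
      rfl
    rw [h']
    exact List.isRotated_iff_append.2 ⟨[f.tDart (G.src e)],
      f.inclList (f.onEdge e) ++ [rev (f.tDart (G.tgt e)), rev (f.inclDart (e, true))], rfl,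
      by rw [List.append_assoc]; rfl⟩

/-- The 2-cells over the edges of `p` are placed side by side. Each edge of `G` carries exactly one
such 2-cell, so on the side of the initial vertices of the `t`-edges the number of 2-cells is the
length of the path. -/
theorem strip_up {x y : G.Vert} {p : List G.Dart} (h : G.IsPath x p y) :
    f.mappingTorus.Strip f.IsT p.length (f.tDart x) (f.inclList p)
      (f.inclList (p.flatMap f.onDart)) (f.tDart y) := by
  induction p generalizing x with
  | nil =>
    obtain rfl : x = y := h
    exact .nil rfl
  | cons d p ih =>
    obtain ⟨rfl, h⟩ := h
    have e1 : f.inclList (d :: p) = [f.inclDart d] ++ f.inclList p := rfl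
    have e2 : f.inclList ((d :: p).flatMap f.onDart) =
        f.inclList (f.onDart d) ++ f.inclList (p.flatMap f.onDart) := by
      rw [List.flatMap_cons, inclList, List.map_append]; rfl
    rw [e1, e2]
    refine .cons (s₁ := f.tDart (G.dtgt d)) rfl
      (show f.mappingTorus.IsPath (G.dsrc d) _ (G.dtgt d) from
        f.isPath_inclList (p := [d]) ⟨rfl, rfl⟩)
      (show f.mappingTorus.IsPath (f.onVert (G.dsrc d)) _ (f.onVert (G.dtgt d)) from
        f.isPath_inclList (f.isPath_onDart d)) (f.not_isT_of_mem_inclList (p := [d]))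
      f.not_isT_of_mem_inclList (f.faceLoop d) (ih h)

theorem strip_down {x y : G.Vert} {p : List G.Dart} (h : G.IsPath x p y) :
    f.mappingTorus.Strip f.IsT p.length (rev (f.tDart x)) (f.inclList (p.flatMap f.onDart))
      (f.inclList p) (rev (f.tDart y)) := by
  induction p generalizing x with
  | nil =>
    obtain rfl : x = y := h
    exact .nil rfl
  | cons d p ih =>
    obtain ⟨rfl, h⟩ := h
    have e1 : f.inclList (d :: p) = [f.inclDart d] ++ f.inclList p := rfl
    have e2 : f.inclList ((d :: p).flatMap f.onDart) =
        f.inclList (f.onDart d) ++ f.inclList (p.flatMap f.onDart) := by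
      rw [List.flatMap_cons, inclList, List.map_append]; rfl
    rw [e1, e2]
    refine .cons (s₁ := rev (f.tDart (G.dtgt d))) rfl
      (show f.mappingTorus.IsPath (f.onVert (G.dsrc d)) _ (f.onVert (G.dtgt d)) from
        f.isPath_inclList (f.isPath_onDart d))
      (show f.mappingTorus.IsPath (G.dsrc d) _ (G.dtgt d) from
        f.isPath_inclList (p := [d]) ⟨rfl, rfl⟩)
      f.not_isT_of_mem_inclList (f.not_isT_of_mem_inclList (p := [d])) ?_ (ih h)
    refine (f.faceLoop d).invRev.of_isRotated ?_
    have h' : FreeGroup.invRev (f.tDart (G.dsrc d) :: f.inclList (f.onDart d) ++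
        rev (f.tDart (G.dtgt d)) :: FreeGroup.invRev [f.inclDart d]) =
        ([f.inclDart d] ++ f.tDart (G.dtgt d) :: FreeGroup.invRev (f.inclList (f.onDart d))) ++
          [rev (f.tDart (G.dsrc d))] := by
      have h1 : FreeGroup.invRev (rev (f.tDart (G.dtgt d)) :: FreeGroup.invRev [f.inclDart d]) =
          [f.inclDart d, f.tDart (G.dtgt d)] := by
        rw [show FreeGroup.invRev [f.inclDart d] = [rev (f.inclDart d)] from rfl, invRev_cons,
          invRev_cons, rev_rev, rev_rev]
        rfl
      rw [invRev_append, h1, invRev_cons, ← List.append_assoc]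
      rfl
    rw [h', rev_rev]
    exact List.isRotated_iff_append.2 ⟨[rev (f.tDart (G.dsrc d))], [f.inclDart d] ++
      f.tDart (G.dtgt d) :: FreeGroup.invRev (f.inclList (f.onDart d)), rfl, rfl⟩

/-- The sign of an edge `t_x`. -/
def tSgn (d : f.mappingTorus.Dart) : Option Bool :=
  match d with
  | (.inl _, _) => none
  | (.inr _, b) => some b

theorem tSgn_of_isT {d : f.mappingTorus.Dart} (h : f.IsT d.1) : f.tSgn d = some d.2 := by
  obtain ⟨e | x, b⟩ := d
  · exact (Bool.false_ne_true h).elim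
  · rfl

theorem tSgn_of_not_isT {d : f.mappingTorus.Dart} (h : ¬ f.IsT d.1) : f.tSgn d = none := by
  obtain ⟨e | x, b⟩ := d
  · rfl
  · exact (h rfl).elim

theorem isT_of_tSgn {d : f.mappingTorus.Dart} {s : Bool} (h : f.tSgn d = some s) :
    f.IsT d.1 ∧ d.2 = s := by
  obtain ⟨e | x, b⟩ := d
  · simp [tSgn] at h
  · exact ⟨rfl, Option.some.inj h⟩

variable {H : Type w} [Group H]

/-- The value of an edge of the mapping torus in `H ⋊ ℤ`. -/
def torusVal (φ : MulAut H) (lab : G.Edge → H) (tw : G.Vert → H) :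
    f.mappingTorus.Edge → Cyclic H φ :=
  Sum.elim (fun e => SemidirectProduct.inl (lab e))
    fun x => Cyclic.t φ * SemidirectProduct.inl (tw x)

theorem prod_dartVal_inclList {φ : MulAut H} (lab : G.Edge → H) (tw : G.Vert → H)
    (p : List G.Dart) : ((f.inclList p).map (dartVal (f.torusVal φ lab tw))).prod =
      SemidirectProduct.inl ((p.map (dartVal lab)).prod) := by
  induction p with
  | nil => simp [inclList]
  | cons d p ih =>
    have h : f.inclList (d :: p) = f.inclDart d :: f.inclList p := rfl
    rw [h, List.map_cons, List.prod_cons, ih, List.map_cons, List.prod_cons, map_mul]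
    congr 1
    obtain ⟨e, _ | _⟩ := d <;> simp [dartVal, inclDart, incl, torusVal]

theorem prod_bdry_inr {φ : MulAut H} (lab : G.Edge → H) (tw : G.Vert → H) (e : G.Edge)
    (h : (tw (G.src e))⁻¹ * φ (lab e) * tw (G.tgt e) = ((f.onEdge e).map (dartVal lab)).prod) :
    ((f.mappingTorus.bdry (Sum.inr e)).map (dartVal (f.torusVal φ lab tw))).prod = 1 := by
  have h1 : f.mappingTorus.bdry (Sum.inr e) = rev (f.tDart (G.src e)) :: f.inclDart (e, true) ::
      f.tDart (G.tgt e) :: f.inclList (FreeGroup.invRev (f.onEdge e)) := rfl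
  rw [h1, List.map_cons, List.map_cons, List.map_cons, List.prod_cons, List.prod_cons,
    List.prod_cons, prod_dartVal_inclList, prod_dartVal_invRev, ← h, map_inv, map_mul, map_mul,
    map_inv, ← Cyclic.t_inv_mul_inl_mul_t]
  change (Cyclic.t φ * SemidirectProduct.inl (tw (G.src e)))⁻¹ * (SemidirectProduct.inl (lab e) *
    (Cyclic.t φ * SemidirectProduct.inl (tw (G.tgt e)) * _)) = 1
  group

/-- An identification of the fundamental groupoid of the mapping torus with `H ⋊_φ ℤ`. -/
structure Marking (φ : MulAut H) where
  lab : G.Edge → H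
  tw : G.Vert → H
  null : ∀ (x : G.Vert) (w : List f.mappingTorus.Dart), f.mappingTorus.IsPath x w x →
    (f.mappingTorus.NullHomotopic x w ↔ (w.map (dartVal (f.torusVal φ lab tw))).prod = 1)
  surj : ∀ (x y : G.Vert) (h : H), ∃ p, G.IsPath x p y ∧ (p.map (dartVal lab)).prod = h

namespace Marking

variable {f} {φ : MulAut H} (m : f.Marking φ)

/-- The value of an oriented edge. -/
def val (d : f.mappingTorus.Dart) : Cyclic H φ := dartVal (f.torusVal φ m.lab m.tw) d

theorem val_rev (d : f.mappingTorus.Dart) : m.val (rev d) = (m.val d)⁻¹ := by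
  obtain ⟨e, _ | _⟩ := d <;> simp [val, dartVal, rev]

theorem prod_val_inclList (p : List G.Dart) : ((f.inclList p).map m.val).prod =
    SemidirectProduct.inl ((p.map (dartVal m.lab)).prod) :=
  prod_dartVal_inclList f m.lab m.tw p

theorem prod_val_eq {x y : G.Vert} {p q : List f.mappingTorus.Dart}
    (h : f.mappingTorus.PathHomotopic x y p q) : (p.map m.val).prod = (q.map m.val).prod := by
  obtain ⟨h1, h2, h3⟩ := h.append_invRev
  have h4 := (m.null x _ h1).1 ⟨h1, h3⟩
  rw [List.map_append, List.prod_append, prod_dartVal_invRev] at h4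
  exact mul_inv_eq_one.1 h4

theorem pathHomotopic {x y : G.Vert} {p q : List f.mappingTorus.Dart}
    (hp : f.mappingTorus.IsPath x p y) (hq : f.mappingTorus.IsPath x q y)
    (h : (p.map m.val).prod = (q.map m.val).prod) : f.mappingTorus.PathHomotopic x y p q := by
  refine .of_append_invRev hp hq ?_
  have h1 := hp.append (isPath_invRev hq)
  obtain ⟨h2, h3⟩ := (m.null x _ h1).2 (by
    rw [List.map_append, List.prod_append, prod_dartVal_invRev]
    exact mul_inv_eq_one.2 h)
  exact ⟨h2, rfl, h3⟩

section Length

variable {ℓ : H → ℕ} (hℓ : IsWordLength ℓ)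
include hℓ

theorem length_prod_le {C : ℕ} (hC : ∀ e, ℓ (m.lab e) ≤ C) (p : List G.Dart) :
    ℓ (p.map (dartVal m.lab)).prod ≤ C * p.length := by
  induction p with
  | nil => simp [hℓ.one]
  | cons d p ih =>
    have h1 : ℓ (dartVal m.lab d) ≤ C := by
      obtain ⟨e, _ | _⟩ := d
      · exact (hℓ.inv _).trans_le (hC e)
      · exact hC e
    have h2 := hℓ.mul (dartVal m.lab d) (p.map (dartVal m.lab)).prod
    rw [List.map_cons, List.prod_cons, List.length_cons, mul_add, mul_one]
    omega

/-- The least length of a loop with value `h` is subadditive in `h`, hence bounded by a multiple of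
the word length. -/
theorem exists_loop_length_le (x : G.Vert) : ∃ C, ∀ h, ∃ p, G.IsPath x p x ∧
    (p.map (dartVal m.lab)).prod = h ∧ p.length ≤ C * ℓ h := by
  let N : H → Set ℕ := fun h => {n | ∃ p, G.IsPath x p x ∧ (p.map (dartVal m.lab)).prod = h ∧
    p.length = n}
  have hN : ∀ h, sInf (N h) ∈ N h := fun h => Nat.sInf_mem (by
    obtain ⟨p, h1, h2⟩ := m.surj x x h
    exact ⟨_, p, h1, h2, rfl⟩)
  obtain ⟨C, hC⟩ := hℓ.exists_le_mul (fun h => sInf (N h))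
    (Nat.le_zero.1 (Nat.sInf_le ⟨[], rfl, rfl, rfl⟩)) fun a b => by
      obtain ⟨p, h1, h2, h3⟩ := hN a
      obtain ⟨q, h1', h2', h3'⟩ := hN b
      refine Nat.sInf_le ⟨p ++ q, h1.append h1', ?_, ?_⟩
      · rw [List.map_append, List.prod_append, h2, h2']
      · rw [List.length_append, h3, h3']
  refine ⟨C, fun h => ?_⟩
  obtain ⟨p, h1, h2, h3⟩ := hN h
  exact ⟨p, h1, h2, h3.trans_le (hC h)⟩

/-- A loop at `x` is continued to `y` by a fixed path with value `1`; there are only finitely many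
such paths, and the additive constant bounds their lengths. -/
theorem exists_path_length_le [Finite G.Vert] : ∃ C, ∀ x y h, ∃ p, G.IsPath x p y ∧
    (p.map (dartVal m.lab)).prod = h ∧ p.length ≤ C * ℓ h + C := by
  choose C hC using fun x => m.exists_loop_length_le hℓ x
  choose δ hδ hδ' using fun x y => m.surj x y 1
  obtain ⟨C', hC'⟩ := (Set.finite_range C).bddAbove
  obtain ⟨D, hD⟩ := (Set.finite_range fun z : G.Vert × G.Vert => (δ z.1 z.2).length).bddAbove
  refine ⟨C' + D, fun x y h => ?_⟩
  obtain ⟨p, h1, h2, h3⟩ := hC x h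
  refine ⟨p ++ δ x y, h1.append (hδ x y), by simp [h2, hδ'], ?_⟩
  have h4 := hD ⟨(x, y), rfl⟩
  have h5 := Nat.mul_le_mul_right (ℓ h) (hC' ⟨x, rfl⟩)
  dsimp only at h4
  rw [List.length_append, add_mul]
  omega

omit hℓ in
/-- From pairings of points to pairings of edges. -/
theorem paired_of_noncrossing {C : ℕ} (hC : ∀ x y h, ∃ p, G.IsPath x p y ∧
    (p.map (dartVal m.lab)).prod = h ∧ p.length ≤ C * ℓ h + C) {k : ℕ} (n : ℕ)
    (w : List f.mappingTorus.Dart) (hn : w.length ≤ n) (x y : G.Vert) (g : Cyclic H φ)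
    (hw : f.mappingTorus.IsPath x w y)
    (h : Noncrossing (Cyclic.Near ℓ φ k) (signedPoints m.val f.tSgn g w)) :
    f.mappingTorus.Paired f.IsT (C * k + C) x w y := by
  induction n generalizing w x y g with
  | zero =>
    obtain rfl := List.length_eq_zero_iff.1 (Nat.le_zero.1 hn)
    obtain rfl : x = y := hw
    exact Paired.nil (X := f.mappingTorus) x
  | succ n ih =>
    rcases w with _ | ⟨s, w⟩
    · obtain rfl : x = y := hw
      exact Paired.nil (X := f.mappingTorus) x
    obtain ⟨rfl, hw⟩ := hw
    rw [List.length_cons] at hn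
    by_cases hs : f.IsT s.1
    · rw [signedPoints_some (f.tSgn_of_isT hs)] at h
      generalize hZ : (s.2, if s.2 = true then g else g * m.val s) ::
        signedPoints m.val f.tSgn (g * m.val s) w = Z at h
      cases h with
      | nil => simp at hZ
      | @pair s₂ a b L M hab hL hM =>
        rw [List.cons_append, List.cons.injEq, Prod.mk.injEq] at hZ
        obtain ⟨⟨rfl, rfl⟩, hZ⟩ := hZ
        obtain ⟨b', d, c', rfl, hd, rfl, rfl, rfl⟩ := exists_of_signedPoints_eq hZ
        obtain ⟨hdT, hd2⟩ := f.isT_of_tSgn hd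
        obtain ⟨z, hb', rfl, hc'⟩ := isPath_append.1 hw
        obtain ⟨h', hk, hab⟩ := hab
        rw [List.length_append, List.length_cons] at hn
        have hb := ih b' (by omega) _ _ _ hb' hL
        have hc := ih c' (by omega) _ _ _ hc' hM
        have hlen : C * ℓ h' + C ≤ C * k + C := by gcongr
        obtain ⟨e | x, sb⟩ := s
        · exact (Bool.false_ne_true hs).elim
        obtain ⟨e | y, db⟩ := d
        · exact (Bool.false_ne_true hdT).elim
        dsimp only at hd2
        subst hd2
        -- The difference `h'` of the two points is realised by a path between the initial vertices
        -- of the two `t`-edges, and the strip over this path joins them.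
        obtain ⟨p, h1, h2, h3⟩ := hC x y h'
        have h4 := m.prod_val_inclList p
        rw [h2] at h4
        cases sb
        · have hst := f.strip_down h1
          refine Paired.pair (s' := rev (f.tDart y)) hst (h3.trans hlen) ?_ hb hc
          refine m.pathHomotopic hb' (f.isPath_inclList h1) ?_
          rw [h4]
          simpa using hab
        · have hst := f.strip_up h1
          refine Paired.pair (s' := f.tDart y) hst (h3.trans hlen) ?_ hb hc
          refine m.pathHomotopic hb' hst.isPath_right ?_
          have h5 := m.prod_val_eq hst.pathHomotopic
          rw [List.map_cons, List.prod_cons, List.map_append, List.prod_append, h4] at h5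
          have h6 : m.val (Sum.inr y, !true) = (m.val (f.tDart y))⁻¹ := m.val_rev (f.tDart y)
          simp only [if_true, Bool.not_true, Bool.false_eq_true, if_false] at hab
          rw [Bool.not_true] at h6
          rw [h6, mul_assoc, mul_assoc, mul_left_cancel_iff, ← mul_assoc,
            mul_inv_eq_iff_eq_mul] at hab
          have h7 : m.val (f.tDart x) * (b'.map m.val).prod = m.val (f.tDart x) *
              ((f.inclList (p.flatMap f.onDart)).map m.val).prod := by
            rw [h5]
            refine hab.trans ?_
            simp
          exact mul_left_cancel h7
    · rw [signedPoints_none (f.tSgn_of_not_isT hs)] at h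
      exact .cons s hs (ih w (by omega) _ _ _ hw h)

omit hℓ in
-- A 2-cell of the strip has its two `t`-edges with opposite signs on its boundary, so the strip
-- crosses them in the same sense. Each 2-cell contributes to either side at most the length of its
-- boundary.
theorem strip_sgn_length {L : ℕ} (hL : ∀ F, (f.mappingTorus.bdry F).length ≤ L) {n : ℕ}
    {s s' : f.mappingTorus.Dart} {p q : List f.mappingTorus.Dart}
    (h : f.mappingTorus.Strip f.IsT n s p q s') :
    s'.2 = s.2 ∧ p.length ≤ L * n ∧ q.length ≤ L * n := by
  induction h with
  | nil => simp
  | @cons n s s₁ s' p q p' q' hs hp hq hpT hqT hface h ih =>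
    have h1 := hface.perm_of_transverse (T := f.IsT) f.transverse
    have h2 : (s :: q ++ rev s₁ :: FreeGroup.invRev p).filter (fun d => decide (f.IsT d.1)) =
        [s, rev s₁] := by
      have e1 : q.filter (fun d => decide (f.IsT d.1)) = [] := by
        rw [List.filter_eq_nil_iff]
        intro d hd
        simpa using hqT d hd
      have e2 : (FreeGroup.invRev p).filter (fun d => decide (f.IsT d.1)) = [] := by
        rw [List.filter_eq_nil_iff]
        intro d hd
        simp only [FreeGroup.invRev, List.mem_reverse, List.mem_map] at hd
        obtain ⟨d, hd, rfl⟩ := hd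
        simpa using hpT d hd
      have e3 : f.IsT (rev s₁).1 := h.fst
      rw [List.filter_append, List.filter_cons_of_pos (by simpa using hs), e1,
        List.filter_cons_of_pos (by simpa using e3), e2]
      rfl
    rw [h2] at h1
    have h3 : s₁.2 = s.2 := by
      rcases h1 with h1 | h1
      · simp at h1
      · have := (by decide : ∀ x y : Bool, [x, y].Perm [true, false] → y = !x) _ _ h1
        simpa [rev] using this
    have h4 : (s :: q ++ rev s₁ :: FreeGroup.invRev p).length ≤ L := by
      obtain ⟨F, h | h⟩ := hface
      · exact h.perm.length_eq.trans_le (hL F)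
      · refine (h.perm.length_eq.trans ?_).trans_le (hL F)
        exact FreeGroup.invRev_length
    simp only [List.length_append, List.length_cons, FreeGroup.invRev_length] at h4
    refine ⟨ih.1.trans h3, ?_, ?_⟩ <;> rw [List.length_append, mul_add, mul_one] <;> omega

/-- From pairings of edges to pairings of points. -/
theorem noncrossing_of_paired {C L : ℕ} (hC : ∀ e, ℓ (m.lab e) ≤ C)
    (hL : ∀ F, (f.mappingTorus.bdry F).length ≤ L) {k : ℕ} {x y : f.mappingTorus.Vert}
    {w : List f.mappingTorus.Dart} (h : TwoComplex.Paired f.mappingTorus f.IsT k x w y)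
    (g : Cyclic H φ) :
    Noncrossing (Cyclic.Near ℓ φ (C * (L * k))) (signedPoints m.val f.tSgn g w) := by
  induction h generalizing g with
  | nil => exact .nil
  | cons d hd h ih =>
    rw [signedPoints_none (f.tSgn_of_not_isT hd)]
    exact ih _
  | @pair n z s s' p q b c hst hn hb h₁ h₂ ih₁ ih₂ =>
    obtain ⟨h3, h4, h5⟩ := strip_sgn_length hL hst
    have hs' : f.IsT (rev s').1 := hst.snd
    rw [List.cons_append, signedPoints_some (f.tSgn_of_isT hst.fst), signedPoints_append,
      signedPoints_some (f.tSgn_of_isT hs')]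
    have h6 : (rev s').2 = !s.2 := by rw [← h3]; rfl
    rw [h6]
    refine .pair ?_ (ih₁ _) (ih₂ _)
    have hfree : ∀ r : List f.mappingTorus.Dart, (∀ d ∈ r, ¬ f.IsT d.1) → r.length ≤ L * n →
        ∃ h, ℓ h ≤ C * (L * k) ∧ (r.map m.val).prod = SemidirectProduct.inl h := by
      intro r hr hrn
      obtain ⟨r, rfl⟩ := f.exists_inclList hr
      refine ⟨_, (m.length_prod_le hℓ hC r).trans ?_, m.prod_val_inclList r⟩
      have : r.length ≤ L * n := by simpa [inclList] using hrn
      exact Nat.mul_le_mul_left _ (this.trans (Nat.mul_le_mul_left _ hn))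
    have hbq := m.prod_val_eq hb
    -- The recorded points are the initial vertices of the `t`-edges, whose side of the strip is `q`
    -- if the loop reads `t⁻¹` first, and `p` if it reads `t` first. The difference of the points is
    -- the value of that side.
    cases hs2 : s.2
    · obtain ⟨h, hh, hq⟩ := hfree q hst.free_right h5
      refine ⟨h, hh, ?_⟩
      simp only [Bool.false_eq_true, if_false, Bool.not_false, if_true]
      rw [hbq, hq]
    · obtain ⟨h, hh, hp⟩ := hfree p hst.free_left h4
      refine ⟨h, hh, ?_⟩
      simp only [Bool.false_eq_true, if_false, Bool.not_true, if_true]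
      have h7 := m.prod_val_eq hst.pathHomotopic
      rw [List.map_cons, List.prod_cons, List.map_append, List.prod_append] at h7
      rw [hbq, mul_assoc g, h7, hp, m.val_rev]
      simp [mul_assoc]

include m in
-- A word is turned into a loop at `x` by substituting short loops of `G` for the elements of `H`,
-- and for `t` a loop that passes `t_x` once. The substitution preserves values and points, so a
-- pairing of the loop is one of the word.
theorem dominates_words (hG : G.IsFinite) (x : G.Vert) :
    Dominates f.PairedLoops (Cyclic.PairedWords ℓ φ) := by
  obtain ⟨hV, hE, hF⟩ := hG
  obtain ⟨C, hC⟩ := (Set.finite_range fun e => ℓ (m.lab e)).bddAbove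
  have : Finite f.mappingTorus.Face := inferInstanceAs (Finite (G.Face ⊕ G.Edge))
  obtain ⟨L, hL⟩ := (Set.finite_range fun F => (f.mappingTorus.bdry F).length).bddAbove
  obtain ⟨D, hD⟩ := m.exists_loop_length_le hℓ x
  choose P hP hPv hPl using hD
  -- The path back from `f x` to `x` is chosen to compensate for the twist, so that `t_x q` has the
  -- value `t`.
  obtain ⟨q, hq, hqv⟩ := m.surj (f.onVert x) x (m.tw x)⁻¹
  let F : H ⊕ Bool → List f.mappingTorus.Dart
    | .inl h => f.inclList (P h)
    | .inr true => f.tDart x :: f.inclList q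
    | .inr false => f.inclList (FreeGroup.invRev q) ++ [rev (f.tDart x)]
  have hval : m.val (f.tDart x) = Cyclic.t φ * SemidirectProduct.inl (m.tw x) := rfl
  have hqv' := m.prod_val_inclList q
  rw [hqv] at hqv'
  have hv : ∀ a, ((F a).map m.val).prod = Cyclic.letterVal φ a := by
    rintro (h | _ | _)
    · rw [show F (.inl h) = f.inclList (P h) from rfl, m.prod_val_inclList, hPv]
      rfl
    · rw [show F (.inr false) = f.inclList (FreeGroup.invRev q) ++ [rev (f.tDart x)] from rfl,
        List.map_append, List.prod_append, m.prod_val_inclList, prod_dartVal_invRev, hqv]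
      simp only [List.map_cons, List.map_nil, List.prod_cons, List.prod_nil, mul_one]
      rw [m.val_rev, hval]
      simp [Cyclic.letterVal]
    · rw [show F (.inr true) = f.tDart x :: f.inclList q from rfl, List.map_cons, List.prod_cons,
        hqv', hval]
      simp [Cyclic.letterVal]
  have hnil : ∀ (g : Cyclic H φ) p, signedPoints m.val f.tSgn g (f.inclList p) = [] := fun g p =>
    signedPoints_eq_nil fun d hd => f.tSgn_of_not_isT (f.not_isT_of_mem_inclList d hd)
  have hs : ∀ (g : Cyclic H φ) a, signedPoints m.val f.tSgn g (F a) =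
      signedPoints (Cyclic.letterVal φ) Cyclic.letterSgn g [a] := by
    rintro g (h | _ | _)
    · exact hnil _ _
    · have h1 := hv (.inr false)
      change ((f.inclList (FreeGroup.invRev q) ++ [rev (f.tDart x)]).map m.val).prod = _ at h1
      rw [List.map_append, List.prod_append, List.map_singleton, List.prod_singleton] at h1
      change signedPoints m.val f.tSgn g (f.inclList (FreeGroup.invRev q) ++ [rev (f.tDart x)]) = _
      rw [signedPoints_append, hnil, List.nil_append,
        signedPoints_some (sgn := f.tSgn) (s := false) rfl,
        signedPoints_some (sgn := Cyclic.letterSgn) (a := .inr false) (s := false) rfl]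
      simp only [Bool.false_eq_true, if_false]
      rw [mul_assoc, h1]
      rfl
    · change signedPoints m.val f.tSgn g (f.tDart x :: f.inclList q) = _
      rw [signedPoints_some (sgn := f.tSgn) (s := true) rfl, hnil,
        signedPoints_some (sgn := Cyclic.letterSgn) (a := .inr true) (s := true) rfl]
      rfl
  have hp : ∀ a, f.mappingTorus.IsPath x (F a) x := by
    rintro (h | _ | _)
    · exact f.isPath_inclList (hP h)
    · exact (f.isPath_inclList (isPath_invRev hq)).append ⟨rfl, rfl⟩
    · exact ⟨rfl, f.isPath_inclList hq⟩
  have hp' : ∀ u : List (H ⊕ Bool), f.mappingTorus.IsPath x (u.flatMap F) x := by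
    intro u
    induction u with
    | nil => rfl
    | cons a u ih => rw [List.flatMap_cons]; exact (hp a).append ih
  have hlen : ∀ p, (f.inclList p).length = p.length := fun p => List.length_map _
  have hc : ∀ a, ((F a).map fun _ => 1).sum ≤ (D + q.length + 1) * Cyclic.letterCost ℓ a := by
    intro a
    rw [List.map_const', List.sum_replicate, smul_eq_mul, mul_one]
    rcases a with h | _ | _
    · change (f.inclList (P h)).length ≤ _ * ℓ h
      rw [hlen]
      exact (hPl h).trans (Nat.mul_le_mul_right _ (by omega))
    · change (f.inclList (FreeGroup.invRev q) ++ [rev (f.tDart x)]).length ≤ _ * 1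
      rw [List.length_append, hlen, FreeGroup.invRev_length, List.length_singleton]
      omega
    · change (f.tDart x :: f.inclList q).length ≤ _ * 1
      rw [List.length_cons, hlen]
      omega
  refine ⟨D + q.length + 1 + C * L, fun n k h u hu hn => ?_⟩
  have h1 : (u.flatMap F).length ≤ (D + q.length + 1) * n := by
    have := sum_flatMap_le hc u
    rw [List.map_const', List.sum_replicate, smul_eq_mul, mul_one] at this
    exact this.trans (Nat.mul_le_mul_left _ hn)
  have h2 := h x (u.flatMap F) ((m.null x _ (hp' u)).2 ((prod_flatMap_of_forall hv u).trans hu))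
    (h1.trans (by nlinarith [Nat.zero_le (C * L * n)]))
  have h3 := m.noncrossing_of_paired hℓ (fun e => hC ⟨e, rfl⟩) (fun F => hL ⟨F, rfl⟩) h2 1
  rw [signedPoints_flatMap hv hs] at h3
  refine h3.congr (E := Eq) ?_ (List.forall₂_same.2 fun _ _ => ⟨rfl, rfl⟩)
  rintro a b _ _ rfl hab rfl
  exact hab.mono (by nlinarith [Nat.zero_le ((D + q.length + 1) * k)])

include m in
-- Every oriented edge is replaced by its value, written with at most one letter `t` or `t⁻¹` and
-- one element of `H`; the elements of `H` that occur are of bounded length.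
theorem dominates_loops (hG : G.IsFinite) :
    Dominates (Cyclic.PairedWords ℓ φ) f.PairedLoops := by
  obtain ⟨hV, hE, hF⟩ := hG
  obtain ⟨C, hC⟩ := (Set.finite_range fun e => ℓ (m.lab e)).bddAbove
  obtain ⟨D, hD⟩ := (Set.finite_range fun y => ℓ (m.tw y)).bddAbove
  obtain ⟨K, hK⟩ := m.exists_path_length_le hℓ
  let F : f.mappingTorus.Dart → List (H ⊕ Bool)
    | (.inl e, b) => [.inl (dartVal m.lab (e, b))]
    | (.inr y, true) => [.inr true, .inl (m.tw y)]
    | (.inr y, false) => [.inl (m.tw y)⁻¹, .inr false]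
  have hv : ∀ d, ((F d).map (Cyclic.letterVal φ)).prod = m.val d := by
    rintro ⟨e | y, _ | _⟩ <;>
      simp [F, Cyclic.letterVal, val, dartVal, EdgePathMap.torusVal]
  have hs : ∀ (g : Cyclic H φ) d, signedPoints (Cyclic.letterVal φ) Cyclic.letterSgn g (F d) =
      signedPoints m.val f.tSgn g [d] := by
    rintro g ⟨e | y, _ | _⟩ <;>
      simp [F, signedPoints, Cyclic.letterVal, Cyclic.letterSgn, EdgePathMap.tSgn, val, dartVal,
        EdgePathMap.torusVal, mul_assoc]
  have hc : ∀ d, ((F d).map (Cyclic.letterCost ℓ)).sum ≤ (C + D + 1) * 1 := by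
    rintro ⟨e | y, b⟩
    · have h1 := hC ⟨e, rfl⟩
      have h2 : ℓ (dartVal m.lab (e, b)) = ℓ (m.lab e) := by
        cases b
        · exact hℓ.inv _
        · rfl
      change ℓ (dartVal m.lab (e, b)) + 0 ≤ _
      dsimp only at h1
      omega
    · have h1 := hD ⟨y, rfl⟩
      dsimp only at h1
      cases b
      · change ℓ (m.tw y)⁻¹ + (1 + 0) ≤ _
        rw [hℓ.inv]
        omega
      · change 1 + (ℓ (m.tw y) + 0) ≤ _
        omega
  refine ⟨C + D + 1 + K, fun n k h x w hw hn => ?_⟩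
  have h1 := sum_flatMap_le hc w
  rw [List.map_const', List.sum_replicate, smul_eq_mul, mul_one] at h1
  have h2 := h (w.flatMap F) ((prod_flatMap_of_forall hv w).trans ((m.null x w hw.1).1 hw))
    (h1.trans (by nlinarith [Nat.zero_le (K * n), Nat.mul_le_mul_left (C + D + 1) hn]))
  rw [signedPoints_flatMap hv hs] at h2
  exact (m.paired_of_noncrossing hK _ w le_rfl x x 1 hw.1 h2).mono
    (by nlinarith [Nat.zero_le ((C + D + 1) * k)])

end Length

end Marking

end EdgePathMap

open OneComplex Relation

/-! ### Fundamental groups and values of edge-paths -/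

namespace TwoComplex

/-- Values of edges which multiply to the identity along the 2-cells give values of homotopy
classes of edge-paths. -/
theorem PathHomotopic.prod_eq {X : TwoComplex.{u}} {Γ : Type v} [Group Γ] {v : X.Edge → Γ}
    (hv : ∀ F, ((X.bdry F).map (dartVal v)).prod = 1) {x y : X.Vert} {p q : List X.Dart}
    (h : X.PathHomotopic x y p q) : (p.map (dartVal v)).prod = (q.map (dartVal v)).prod := by
  obtain ⟨hp, hq, h⟩ := h
  suffices H : ∀ p q : X.Path x y, X.Homotopic p q →
      (p.1.map (dartVal v)).prod = (q.1.map (dartVal v)).prod from H _ _ h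
  intro p q h
  induction h with
  | rel p q h =>
    obtain ⟨p, hp⟩ := p
    obtain ⟨q, hq⟩ := q
    dsimp only at h ⊢
    cases h with
    | cancel a b d =>
      have h1 : dartVal v d * dartVal v (rev d) = 1 := by
        obtain ⟨e, _ | _⟩ := d <;> simp [dartVal, rev]
      simp only [List.map_append, List.map_cons, List.prod_append, List.prod_cons]
      rw [← mul_assoc (dartVal v d), h1, one_mul]
    | face a b F =>
      simp only [List.map_append, List.prod_append]
      rw [hv, mul_one]
  | refl p => rfl
  | symm p q _ ih => exact ih.symm
  | trans p q r _ _ ih ih' => exact ih.trans ih'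

theorem cls_eq_iff {X : TwoComplex.{u}} {x : X.Vert} {p q : X.Path x x} :
    cls p = cls q ↔ X.PathHomotopic x x p.1 q.1 :=
  ⟨fun h => ⟨p.2, q.2, Quotient.exact (s := X.loopSetoid x) h⟩,
    fun ⟨_, _, h⟩ => Quotient.sound (s := X.loopSetoid x) h⟩

theorem cls_mul {X : TwoComplex.{u}} {x : X.Vert} (p q : X.Path x x) :
    cls p * cls q = cls (p.comp q) := rfl

theorem cls_inv {X : TwoComplex.{u}} {x : X.Vert} (p : X.Path x x) : (cls p)⁻¹ = cls p.inv := rfl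

theorem exists_cls {X : TwoComplex.{u}} {x : X.Vert} (g : X.FundGroup x) :
    ∃ p : X.Path x x, cls p = g := Quotient.exists_rep g

section TreeVal

variable {X : TwoComplex.{u}} {x : X.Vert} (δ : ∀ y, X.Path x y)

/-- Edges as elements of the fundamental group, given paths from the base point to all
vertices. -/
def treeVal (e : X.Edge) : X.FundGroup x :=
  cls (((δ (X.src e)).comp ⟨[(e, true)], ⟨rfl, rfl⟩⟩).comp (δ (X.tgt e)).inv)

/-- The product telescopes: the path to the base point that ends the value of an edge cancels with
the beginning of the next value. -/
theorem prod_treeVal {y z : X.Vert} {p : List X.Dart} (h : X.IsPath y p z) :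
    (p.map (dartVal (treeVal δ))).prod = cls (((δ y).comp ⟨p, h⟩).comp (δ z).inv) := by
  induction p generalizing y with
  | nil =>
    obtain rfl : y = z := h
    refine (cls_eq_iff.2 ?_).symm
    change X.PathHomotopic x x ((δ y).1 ++ [] ++ FreeGroup.invRev (δ y).1) []
    rw [List.append_nil]
    exact .append_invRev_self (δ y).2
  | cons d p ih =>
    obtain ⟨rfl, h⟩ := h
    have hd : dartVal (treeVal δ) d =
        cls (((δ (X.dsrc d)).comp ⟨[d], ⟨rfl, rfl⟩⟩).comp (δ (X.dtgt d)).inv) := by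
      obtain ⟨e, _ | _⟩ := d
      · change (treeVal δ e)⁻¹ = _
        rw [treeVal, cls_inv]
        refine congrArg cls (Subtype.ext ?_)
        change
          FreeGroup.invRev ((δ (X.src e)).1 ++ [(e, true)] ++ FreeGroup.invRev (δ (X.tgt e)).1) =
          (δ (X.tgt e)).1 ++ [(e, false)] ++ FreeGroup.invRev (δ (X.src e)).1
        rw [invRev_append, invRev_append, FreeGroup.invRev_invRev, List.append_assoc]
        rfl
      · rfl
    rw [List.map_cons, List.prod_cons, ih h, hd, cls_mul, cls_eq_iff]
    change X.PathHomotopic x x ((δ (X.dsrc d)).1 ++ [d] ++ FreeGroup.invRev (δ (X.dtgt d)).1 ++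
      ((δ (X.dtgt d)).1 ++ p ++ FreeGroup.invRev (δ z).1))
      ((δ (X.dsrc d)).1 ++ (d :: p) ++ FreeGroup.invRev (δ z).1)
    have h1 : X.IsPath x ((δ (X.dsrc d)).1 ++ [d]) (X.dtgt d) := (δ (X.dsrc d)).2.append ⟨rfl, rfl⟩
    have h2 : X.IsPath (X.dtgt d) (p ++ FreeGroup.invRev (δ z).1) x :=
      h.append (isPath_invRev (δ z).2)
    have h3 := ((PathHomotopic.invRev_append_self (δ (X.dtgt d)).2).append_left h1).append_right h2
    simpa using h3

theorem prod_treeVal_of_homotopic {y z : X.Vert} {p q : List X.Dart}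
    (h : X.PathHomotopic y z p q) :
    (p.map (dartVal (treeVal δ))).prod = (q.map (dartVal (treeVal δ))).prod := by
  rw [prod_treeVal δ h.left, prod_treeVal δ h.right, cls_eq_iff]
  exact (h.append_left (δ y).2).append_right (isPath_invRev (δ z).2)

theorem prod_treeVal_path (y : X.Vert) (hx : δ x = Path.nil x) :
    ((δ y).1.map (dartVal (treeVal δ))).prod = 1 := by
  rw [prod_treeVal δ (δ y).2, hx]
  exact cls_eq_iff.2 (.append_invRev_self (δ y).2)

theorem prod_treeVal_loop (hx : δ x = Path.nil x) (p : X.Path x x) :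
    (p.1.map (dartVal (treeVal δ))).prod = cls p := by
  rw [prod_treeVal δ p.2, hx]
  refine congrArg cls (Subtype.ext ?_)
  change p.1 ++ [] = p.1
  exact List.append_nil _

theorem nullHomotopic_of_prod_treeVal {y : X.Vert} {p : List X.Dart} (hp : X.IsPath y p y)
    (h : (p.map (dartVal (treeVal δ))).prod = 1) : X.NullHomotopic y p := by
  rw [prod_treeVal δ hp] at h
  have h1 : X.PathHomotopic x x ((δ y).1 ++ p ++ FreeGroup.invRev (δ y).1) [] :=
    (cls_eq_iff (q := Path.nil x)).1 h
  rw [List.append_assoc] at h1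
  have h2 := (h1.cancel_left (δ y).2).append_right (δ y).2
  rw [List.append_nil, List.append_assoc] at h2
  have h3 := (PathHomotopic.invRev_append_self (δ y).2).append_left hp
  rw [List.append_nil] at h3
  obtain ⟨h4, h5, h6⟩ := h3.symm.trans (h2.trans (.invRev_append_self (δ y).2))
  exact ⟨h4, h6⟩

end TreeVal

theorem bdry_prod_treeVal {X : TwoComplex.{u}} {x : X.Vert} (δ : ∀ y, X.Path x y) (F : X.Face) :
    ((X.bdry F).map (dartVal (treeVal δ))).prod = 1 := by
  obtain ⟨y, hy⟩ := X.bdry_closed F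
  exact prod_treeVal_of_homotopic δ (.face F hy)

theorem exists_tree {X : TwoComplex.{u}} (hX : X.Connected) (x : X.Vert) :
    ∃ δ : ∀ y, X.Path x y, δ x = Path.nil x := by
  classical
  let δ₀ : ∀ y, X.Path x y := fun y => (hX.2 x y).some
  exact ⟨Function.update δ₀ x (Path.nil x), Function.update_self x _ δ₀⟩

end TwoComplex

namespace Cyclic

variable {H : Type w} [Group H] {φ : MulAut H}

/-- Homomorphisms from `H ⋊_φ ℤ`. -/
theorem exists_lift {K : Type v} [Group K] (j : H →* K) (τ : K)
    (h : ∀ g, j (φ g) = τ⁻¹ * j g * τ) :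
    ∃ θ : Cyclic H φ →* K, (∀ g, θ (SemidirectProduct.inl g) = j g) ∧ θ (t φ) = τ := by
  have h1 : ∀ (n : ℕ) g, j ((φ ^ n) g) = (τ ^ n)⁻¹ * j g * τ ^ n := by
    intro n
    induction n with
    | zero => simp
    | succ n ih =>
      intro g
      rw [pow_succ, MulAut.mul_apply, ih, h, pow_succ']
      group
  have h2 : ∀ (n : ℤ) g, j ((φ ^ n) g) = τ⁻¹ ^ n * j g * (τ⁻¹ ^ n)⁻¹ := by
    rintro (n | n) g
    · rw [Int.ofNat_eq_natCast, zpow_natCast, zpow_natCast, h1]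
      simp
    · have h3 := h1 (n + 1) ((φ ^ Int.negSucc n) g)
      rw [← MulAut.mul_apply, zpow_negSucc, mul_inv_cancel, MulAut.one_apply] at h3
      rw [zpow_negSucc, zpow_negSucc, h3]
      simp [mul_assoc]
  refine ⟨SemidirectProduct.lift j (zpowersHom K τ⁻¹) fun n => MonoidHom.ext fun g => ?_,
    fun g => SemidirectProduct.lift_inl _ _ _ _, ?_⟩
  · exact h2 n.toAdd g
  · rw [t, SemidirectProduct.lift_inr]
    simp

end Cyclic

namespace EdgePathMap

open TwoComplex

/-- A vertex of `G`, as a vertex of the mapping torus. -/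
def torusVert {G : TwoComplex.{u}} (f : EdgePathMap G.toOneComplex) (x : G.Vert) :
    f.mappingTorus.Vert := x

/-- The homomorphism induced by the inclusion in the mapping torus. -/
def inclHom {G : TwoComplex.{u}} (f : EdgePathMap G.toOneComplex) (x : G.Vert) :
    G.FundGroup x →* f.mappingTorus.FundGroup (f.torusVert x) where
  toFun := Quotient.lift (s := G.loopSetoid x)
    (fun p =>
      cls (X := f.mappingTorus) (x := f.torusVert x) ⟨f.inclList p.1, f.isPath_inclList p.2⟩) (by
      intro p q (h : G.Homotopic p q)
      refine Quotient.sound (s := f.mappingTorus.loopSetoid (f.torusVert x)) ?_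
      induction h with
      | rel p q h =>
        obtain ⟨p, hp⟩ := p
        obtain ⟨q, hq⟩ := q
        dsimp only at h
        refine .rel _ _ ?_
        dsimp only
        cases h with
        | cancel a b d =>
          have := ElemStep.cancel (X := f.mappingTorus) (f.inclList a) (f.inclList b) (f.inclDart d)
          simpa [inclList, inclDart_rev] using this
        | face a b F =>
          have := ElemStep.face (X := f.mappingTorus) (f.inclList a) (f.inclList b) (Sum.inl F)
          change f.mappingTorus.ElemStep (f.inclList a ++ f.inclList (G.bdry F) ++ f.inclList b)
            (f.inclList a ++ f.inclList b) at this
          simpa [inclList] using this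
      | refl p => exact .refl _
      | symm p q _ ih => exact ih.symm
      | trans p q r _ _ ih ih' => exact ih.trans ih')
  map_one' := rfl
  map_mul' := by
    rintro ⟨p⟩ ⟨q⟩
    refine congrArg cls (Subtype.ext ?_)
    exact List.map_append

end EdgePathMap

open OneComplex Relation

/-! ### Markings by induced automorphisms and by presentations -/

namespace EdgePathMap

open TwoComplex

section Induced

variable {G : TwoComplex.{u}} {f : EdgePathMap G.toOneComplex} {H : Type w} [Group H]

/-- The automorphism in a class that is induced by an edge-path map may be prescribed. -/
theorem Induces.exists_path {x : G.Vert} {ι : G.FundGroup x ≃* H} {φ : Out H}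
    (h : f.Induces ι φ) (Φ : MulAut H) (hΦ : (QuotientGroup.mk Φ : Out H) = φ) :
    ∃ γ : G.Path x (f.onVert x), ∀ p : G.Path x x,
      ι (cls ((γ.comp (f.onPath p)).comp γ.inv)) = Φ (ι (cls p)) := by
  obtain ⟨γ, Ψ, hΨ, h⟩ := h
  -- Two representatives of the class differ by conjugation with some `a`. A loop `β` that
  -- represents `Ψ a`, put before `γ`, accounts for this difference.
  obtain ⟨a, ha⟩ := QuotientGroup.eq.1 (hΨ.trans hΦ.symm)
  obtain ⟨β, hβ⟩ := exists_cls (ι.symm (Ψ a))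
  refine ⟨β.comp γ, fun p => ?_⟩
  have h1 : cls (((β.comp γ).comp (f.onPath p)).comp (β.comp γ).inv) =
      cls β * cls ((γ.comp (f.onPath p)).comp γ.inv) * (cls β)⁻¹ := by
    refine congrArg cls (Subtype.ext ?_)
    change ((β.1 ++ γ.1) ++ (f.onPath p).1) ++ FreeGroup.invRev (β.1 ++ γ.1) =
      (β.1 ++ ((γ.1 ++ (f.onPath p).1) ++ FreeGroup.invRev γ.1)) ++ FreeGroup.invRev β.1
    rw [invRev_append]
    simp only [List.append_assoc]
  have h2 : Φ = Ψ * MulAut.conj a := by rw [ha, mul_inv_cancel_left]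
  rw [h1, map_mul, map_mul, map_inv, h, hβ, h2, MulAut.mul_apply, MulAut.conj_apply, map_mul,
    map_mul, map_inv, MulEquiv.apply_symm_apply]

theorem prod_val_torusTree {x : G.Vert} (δ : ∀ y, G.Path x y) (p : List G.Dart) :
    ((f.inclList p).map (dartVal (treeVal (X := f.mappingTorus) (x := f.torusVert x)
      fun y => ⟨f.inclList (δ y).1, f.isPath_inclList (δ y).2⟩))).prod =
    f.inclHom x ((p.map (dartVal (treeVal δ))).prod) := by
  induction p with
  | nil => exact (map_one _).symm
  | cons d p ih =>
    rw [List.map_cons, List.prod_cons, map_mul, ← ih]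
    change (f.inclDart d :: f.inclList p |>.map _).prod = _
    rw [List.map_cons, List.prod_cons]
    congr 1
    have h : ∀ e, treeVal (X := f.mappingTorus) (x := f.torusVert x)
        (fun y => ⟨f.inclList (δ y).1, f.isPath_inclList (δ y).2⟩) (Sum.inl e) =
        f.inclHom x (treeVal δ e) := by
      intro e
      refine congrArg cls (Subtype.ext ?_)
      change f.inclList (δ (G.src e)).1 ++ f.inclList [(e, true)] ++
        FreeGroup.invRev (f.inclList (δ (G.tgt e)).1) = f.inclList
          ((δ (G.src e)).1 ++ [(e, true)] ++ FreeGroup.invRev (δ (G.tgt e)).1)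
      rw [← inclList_invRev]
      simp [inclList]
    obtain ⟨e, _ | _⟩ := d
    · change (treeVal (X := f.mappingTorus) (x := f.torusVert x) _ (Sum.inl e))⁻¹ = _
      rw [h]
      exact (map_inv _ _).symm
    · exact h e

/-- The edges of `G` get the values given by paths from the base point, and the twists `tw y` are
determined by the images of these paths under `f`. The 2-cells then have value `1`, so
null-homotopic loops have value `1`. For the converse, a homomorphism `θ` from `H ⋊_Φ ℤ` to the
fundamental group of the mapping torus recovers the class of a loop from its value; it need not be
shown to be bijective. -/
theorem exists_marking (hG : G.Connected) {x : G.Vert} (ι : G.FundGroup x ≃* H) (Φ : MulAut H)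
    (γ : G.Path x (f.onVert x)) (h : ∀ p : G.Path x x,
      ι (cls ((γ.comp (f.onPath p)).comp γ.inv)) = Φ (ι (cls p))) : Nonempty (f.Marking Φ) := by
  obtain ⟨δ, hδ⟩ := exists_tree hG x
  let c : List G.Dart → G.FundGroup x := fun p => (p.map (dartVal (treeVal δ))).prod
  have c_append : ∀ p q, c (p ++ q) = c p * c q := fun p q => by
    simp only [c, List.map_append, List.prod_append]
  have c_invRev : ∀ p, c (FreeGroup.invRev p) = (c p)⁻¹ := fun p => prod_dartVal_invRev _ p
  have c_tree : ∀ y, c (δ y).1 = 1 := fun y => prod_treeVal_path δ y hδ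
  have c_loop : ∀ p : G.Path x x, c p.1 = cls p := fun p => prod_treeVal_loop δ hδ p
  let F : List G.Dart → List G.Dart := fun p => p.flatMap f.onDart
  have F_append : ∀ p q, F (p ++ q) = F p ++ F q := fun p q => List.flatMap_append
  have F_invRev : ∀ p, F (FreeGroup.invRev p) = FreeGroup.invRev (F p) := fun p =>
    PathMap.onList_invRev ⟨f.onVert, f.onEdge, f.isPath⟩ p
  have hΦ : ∀ p, G.IsPath x p x → Φ (ι (c p)) = ι (c γ.1 * c (F p) * (c γ.1)⁻¹) := by
    intro p hp
    have h1 : ι (c ((γ.1 ++ F p) ++ FreeGroup.invRev γ.1)) = Φ (ι (c p)) :=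
      (congrArg ι (c_loop _)).trans ((h ⟨p, hp⟩).trans
        (congrArg (fun g => Φ (ι g)) (c_loop ⟨p, hp⟩).symm))
    rw [← h1, c_append, c_append, c_invRev]
  let lab : G.Edge → H := fun e => ι (treeVal δ e)
  let tw : G.Vert → H := fun y => ι (c γ.1 * c (F (δ y).1))
  have hlab : ∀ p : List G.Dart, (p.map (dartVal lab)).prod = ι (c p) := by
    intro p
    induction p with
    | nil => exact (map_one ι).symm
    | cons d p ih =>
      rw [List.map_cons, List.prod_cons, ih]
      change _ = ι (dartVal (treeVal δ) d * c p)
      rw [map_mul]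
      congr 1
      obtain ⟨e, _ | _⟩ := d
      · exact (map_inv ι _).symm
      · rfl
  have hedge : ∀ e, (tw (G.src e))⁻¹ * Φ (lab e) * tw (G.tgt e) = ι (c (f.onEdge e)) := by
    intro e
    have h1 : lab e =
        ι (c ((δ (G.src e)).1 ++ [(e, true)] ++ FreeGroup.invRev (δ (G.tgt e)).1)) := by
      rw [c_append, c_append, c_invRev, c_tree, c_tree]
      simp [lab, c, dartVal]
    have h2 : F [(e, true)] = f.onEdge e := List.append_nil _
    rw [h1, hΦ _ (((δ (G.src e)).2.append (isPath_singleton (e, true))).append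
      (isPath_invRev (δ (G.tgt e)).2)),
      F_append, F_append, F_invRev, c_append, c_append, c_invRev, h2,
      ← map_inv, ← map_mul, ← map_mul]
    congr 1
    group
  let δM : ∀ y : f.mappingTorus.Vert, f.mappingTorus.Path (f.torusVert x) y :=
    fun y => ⟨f.inclList (δ y).1, f.isPath_inclList (δ y).2⟩
  let cM : List f.mappingTorus.Dart → f.mappingTorus.FundGroup (f.torusVert x) :=
    fun p => (p.map (dartVal (treeVal δM))).prod
  -- The image of `t` under `θ`: the loop that crosses `t_x` and returns from `f x` to `x` along
  -- `γ⁻¹`.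
  let τ := treeVal δM (Sum.inr x) * (f.inclHom x (c γ.1))⁻¹
  have cM_append : ∀ p q, cM (p ++ q) = cM p * cM q := fun p q => by
    simp only [cM, List.map_append, List.prod_append]
  have cM_incl : ∀ p, cM (f.inclList p) = f.inclHom x (c p) := fun p => prod_val_torusTree δ p
  have cM_t : ∀ y, cM [f.tDart y] = treeVal δM (Sum.inr y) := fun y => List.prod_singleton
  -- The strip over `p` is a homotopy from `t_y f(p)` to `p t_z`. For loops at `x` it gives the
  -- relation required of `τ`, and for the paths `δ y` it determines the values of all edges `t_y`.
  have hstrip : ∀ y z p, G.IsPath y p z → treeVal δM (Sum.inr y) * f.inclHom x (c (F p)) =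
      f.inclHom x (c p) * treeVal δM (Sum.inr z) := by
    intro y z p hp
    have h1 := prod_treeVal_of_homotopic δM (f.strip_up hp).pathHomotopic
    change cM ([f.tDart y] ++ f.inclList (F p)) = cM (f.inclList p ++ [f.tDart z]) at h1
    rwa [cM_append, cM_append, cM_incl, cM_incl, cM_t, cM_t] at h1
  have hτ : ∀ g, (f.inclHom x).comp ι.symm.toMonoidHom (Φ g) =
      τ⁻¹ * (f.inclHom x).comp ι.symm.toMonoidHom g * τ := by
    intro g
    obtain ⟨p, hp⟩ := exists_cls (ι.symm g)
    have h1 : g = ι (c p.1) := by rw [c_loop, hp, MulEquiv.apply_symm_apply]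
    change f.inclHom x (ι.symm (Φ g)) = τ⁻¹ * f.inclHom x (ι.symm g) * τ
    rw [h1, hΦ _ p.2, MulEquiv.symm_apply_apply, MulEquiv.symm_apply_apply, map_mul, map_mul,
      map_inv]
    have h2 := hstrip _ _ _ p.2
    have h3 : f.inclHom x (c (F p.1)) = (treeVal δM (Sum.inr x))⁻¹ *
        (f.inclHom x (c p.1) * treeVal δM (Sum.inr x)) := by rw [← h2, inv_mul_cancel_left]
    rw [h3]
    simp only [τ]
    group
  obtain ⟨θ, hθ, hθt⟩ := Cyclic.exists_lift _ τ hτ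
  have hval : ∀ e, θ (f.torusVal Φ lab tw e) = treeVal δM e := by
    rintro (e | y)
    · change θ (SemidirectProduct.inl (ι (treeVal δ e))) = _
      rw [hθ]
      change f.inclHom x (ι.symm (ι (treeVal δ e))) = _
      rw [MulEquiv.symm_apply_apply]
      have h1 := cM_incl [(e, true)]
      simp only [c, List.map_cons, List.map_nil, List.prod_singleton] at h1
      exact h1.symm.trans List.prod_singleton
    · change θ (Cyclic.t Φ * SemidirectProduct.inl (tw y)) = _
      rw [map_mul, hθ, hθt]
      change τ * f.inclHom x (ι.symm (ι (c γ.1 * c (F (δ y).1)))) = _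
      rw [MulEquiv.symm_apply_apply, map_mul]
      have h1 := hstrip _ _ _ (δ y).2
      rw [c_tree, map_one, one_mul] at h1
      rw [← h1]
      simp only [τ]
      group
  have hvalM : ∀ p : List f.mappingTorus.Dart,
      θ ((p.map (dartVal (f.torusVal Φ lab tw))).prod) = cM p := by
    intro p
    induction p with
    | nil => exact map_one θ
    | cons d p ih =>
      rw [List.map_cons, List.prod_cons, map_mul, ih]
      change _ = dartVal (treeVal δM) d * cM p
      congr 1
      obtain ⟨e, _ | _⟩ := d
      · exact (map_inv θ _).trans (congrArg _ (hval e))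
      · exact hval e
  have hinl : ∀ p : List G.Dart, ((f.inclList p).map (dartVal (f.torusVal Φ lab tw))).prod =
      SemidirectProduct.inl ((p.map (dartVal lab)).prod) := prod_dartVal_inclList f lab tw
  have hface : ∀ F, ((f.mappingTorus.bdry F).map (dartVal (f.torusVal Φ lab tw))).prod = 1 := by
    rintro (F | e)
    · change ((f.inclList (G.bdry F)).map _).prod = 1
      rw [hinl, hlab]
      have h1 : c (G.bdry F) = 1 := bdry_prod_treeVal δ F
      rw [h1, map_one, map_one]
    · refine prod_bdry_inr f lab tw e ?_
      rw [hedge, hlab]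
  refine ⟨lab, tw, fun y w hw => ⟨fun h1 => ?_, fun h1 => ?_⟩, fun y z g => ?_⟩
  · obtain ⟨h2, h3⟩ := h1
    exact PathHomotopic.prod_eq hface (q := []) ⟨h2, rfl, h3⟩
  · refine nullHomotopic_of_prod_treeVal δM hw ?_
    change cM w = 1
    rw [← hvalM, h1, map_one]
  · obtain ⟨p, hp⟩ := exists_cls (ι.symm g)
    refine ⟨FreeGroup.invRev (δ y).1 ++ p.1 ++ (δ z).1,
      ((isPath_invRev (δ y).2).append p.2).append (δ z).2, ?_⟩
    rw [hlab, c_append, c_append, c_invRev, c_tree, c_tree, c_loop, hp]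
    simp

end Induced

end EdgePathMap

namespace CyclicPresentation

open TwoComplex

variable {H : Type w} [Group H] {φ : MulAut H} (P : CyclicPresentation H φ)

theorem isPath (p : List (presentationComplex P.A P.R).Dart) :
    (presentationComplex P.A P.R).IsPath PUnit.unit p PUnit.unit := by
  induction p with
  | nil => rfl
  | cons d p ih => exact ⟨rfl, ih⟩

theorem isFinite : (presentationComplex P.A P.R).IsFinite :=
  ⟨inferInstanceAs (Finite PUnit), P.finite_A, P.finite_R.to_subtype⟩

/-- There is one vertex only, so the paths from the base point are constant and no twist is needed.
By `presents`, a word with value `1` lies in the normal closure of the boundary words, and these are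
trivial in the fundamental group. -/
theorem nonempty_marking : Nonempty (P.edgePathMap.Marking φ) := by
  let M := P.edgePathMap.mappingTorus
  let v : M.Edge → Cyclic H φ := P.edgePathMap.torusVal φ P.gen fun _ => 1
  have hv : v = Sum.elim (fun a => SemidirectProduct.inl (P.gen a)) fun _ => Cyclic.t φ := by
    funext e
    rcases e with a | y
    · rfl
    · exact (congrArg (Cyclic.t φ * ·) (map_one _)).trans (mul_one _)
  have hker : ∀ p : List M.Dart, (p.map (dartVal v)).prod = 1 ↔ FreeGroup.mk p ∈
      (FreeGroup.lift (Sum.elim (fun a => SemidirectProduct.inl (P.gen a))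
        (fun _ => Cyclic.t φ)) : FreeGroup (P.A ⊕ PUnit.{1}) →* Cyclic H φ).ker := by
    intro p
    rw [prod_dartVal, hv]
    rfl
  let x₀ : M.Vert := P.edgePathMap.torusVert PUnit.unit
  let δ : ∀ y : M.Vert, M.Path x₀ y := fun y => ⟨[], rfl⟩
  let K : Subgroup (FreeGroup (P.A ⊕ PUnit.{1})) := (FreeGroup.lift (treeVal δ) :
    FreeGroup (P.A ⊕ PUnit.{1}) →* M.FundGroup x₀).ker
  have hbdry : ∀ F : M.Face, FreeGroup.mk (M.bdry F) ∈ K := by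
    intro F
    have h1 := bdry_prod_treeVal δ F
    rw [prod_dartVal] at h1
    exact h1
  have hmap : ∀ u : List (P.A × Bool), FreeGroup.map Sum.inl (FreeGroup.mk u) =
      (FreeGroup.mk (P.edgePathMap.inclList u) : FreeGroup (P.A ⊕ PUnit.{1})) := fun u =>
    FreeGroup.map.mk
  have hrel : ∀ a, (FreeGroup.of (Sum.inr PUnit.unit))⁻¹ * FreeGroup.of (Sum.inl a) *
      FreeGroup.of (Sum.inr PUnit.unit) * (FreeGroup.map Sum.inl (FreeGroup.mk (P.hat a)))⁻¹ =
      (FreeGroup.mk (M.bdry (Sum.inr a)) : FreeGroup (P.A ⊕ PUnit.{1})) := by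
    intro a
    exact (congrArg (fun r => (FreeGroup.of (Sum.inr PUnit.unit))⁻¹ * FreeGroup.of (Sum.inl a) *
      FreeGroup.of (Sum.inr PUnit.unit) * r⁻¹) (hmap (P.hat a))).trans
      (congrArg (fun l => (FreeGroup.mk ((Sum.inr PUnit.unit, false) :: (Sum.inl a, true) ::
        (Sum.inr PUnit.unit, true) :: l) : FreeGroup (P.A ⊕ PUnit.{1})))
        (P.edgePathMap.inclList_invRev (P.hat a)).symm)
  have hle : Subgroup.normalClosure
      ({r | ∃ u ∈ P.R, r = FreeGroup.map Sum.inl (FreeGroup.mk u)} ∪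
       {r | ∃ a, r = (FreeGroup.of (Sum.inr PUnit.unit))⁻¹ * FreeGroup.of (Sum.inl a) *
          FreeGroup.of (Sum.inr PUnit.unit) *
          (FreeGroup.map Sum.inl (FreeGroup.mk (P.hat a)))⁻¹}) ≤ K := by
    have : K.Normal := MonoidHom.normal_ker _
    refine Subgroup.normalClosure_le_normal ?_
    rintro r (⟨u, hu, rfl⟩ | ⟨a, rfl⟩)
    · rw [hmap]
      exact hbdry (Sum.inl ⟨u, hu⟩)
    · rw [hrel]
      exact hbdry (Sum.inr a)
  have hface : ∀ F, ((M.bdry F).map (dartVal v)).prod = 1 := by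
    intro F
    rw [hker, ← P.presents]
    refine Subgroup.subset_normalClosure ?_
    rcases F with ⟨u, hu⟩ | a
    · exact .inl ⟨u, hu, (hmap u).symm⟩
    · exact .inr ⟨a, (hrel a).symm⟩
  refine ⟨P.gen, fun _ => 1, fun y w hw => ⟨fun h1 => ?_, fun h1 => ?_⟩, fun y z g => ?_⟩
  · obtain ⟨h2, h3⟩ := h1
    exact PathHomotopic.prod_eq hface (q := []) ⟨h2, rfl, h3⟩
  · refine nullHomotopic_of_prod_treeVal δ hw ?_
    rw [prod_dartVal]
    exact hle (P.presents ▸ (hker w).1 h1)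
  · have h1 : g ∈ (FreeGroup.lift P.gen).range := by
      rw [FreeGroup.range_lift_eq_closure, P.gen_closure]
      trivial
    obtain ⟨p, rfl⟩ := h1
    obtain ⟨p, rfl⟩ := Quot.exists_rep p
    exact ⟨p, P.isPath p, prod_dartVal _ p⟩

end CyclicPresentation

/-! ### Existence of the presentations -/

open OneComplex Relation

/-- Whether the kernel of a homomorphism from a free group of finite rank onto a finitely presented
group is generated by finitely many conjugacy classes does not depend on the generators. -/
theorem Group.IsFinitelyPresented.ker_isFinitelyNormallyGenerated {Γ : Type w} [Group Γ]
    (h : Group.IsFinitelyPresented Γ) {α : Type v} [Finite α] (π : FreeGroup α →* Γ)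
    (hπ : Function.Surjective π) : π.ker.IsFinitelyNormallyGenerated := by
  obtain ⟨n, ψ, hψ, S, hS, hSker⟩ := h
  choose a ha using fun i : Fin n => hπ (ψ (FreeGroup.of i))
  choose b hb using fun i : α => hψ (π (FreeGroup.of i))
  have hα : ∀ g, π (FreeGroup.lift a g) = ψ g := fun g =>
    DFunLike.congr_fun
      (FreeGroup.ext_hom (f := π.comp (FreeGroup.lift a)) (g := ψ) (by simp [ha])) g
  have hβ : ∀ g, ψ (FreeGroup.lift b g) = π g := fun g =>
    DFunLike.congr_fun
      (FreeGroup.ext_hom (f := ψ.comp (FreeGroup.lift b)) (g := π) (by simp [hb])) g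
  -- The translated old relators, together with one relator for each new generator, which equates it
  -- with its rewriting through the old generators.
  refine ⟨FreeGroup.lift a '' S ∪
    Set.range fun i => (FreeGroup.of i)⁻¹ * FreeGroup.lift a (FreeGroup.lift b (FreeGroup.of i)),
    (hS.image _).union (Set.finite_range _), le_antisymm ?_ ?_⟩
  · refine Subgroup.normalClosure_le_normal ?_
    rintro _ (⟨s, hs, rfl⟩ | ⟨i, rfl⟩)
    · have h1 : s ∈ ψ.ker := hSker ▸ Subgroup.subset_normalClosure hs
      exact (hα s).trans h1
    · change π _ = 1
      rw [map_mul, hα, hβ, map_inv, inv_mul_cancel]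
  · set N := Subgroup.normalClosure (FreeGroup.lift a '' S ∪
      Set.range fun i => (FreeGroup.of i)⁻¹ * FreeGroup.lift a (FreeGroup.lift b (FreeGroup.of i)))
    have h1 : (QuotientGroup.mk' N) = (QuotientGroup.mk' N).comp
        ((FreeGroup.lift a).comp (FreeGroup.lift b)) := by
      refine FreeGroup.ext_hom _ _ fun i => ?_
      exact QuotientGroup.eq.2 (Subgroup.subset_normalClosure (.inr ⟨i, rfl⟩))
    have h2 : ψ.ker ≤ ((QuotientGroup.mk' N).comp (FreeGroup.lift a)).ker := by
      rw [← hSker]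
      refine Subgroup.normalClosure_le_normal fun s hs => ?_
      exact (QuotientGroup.eq_one_iff _).2 (Subgroup.subset_normalClosure (.inl ⟨s, hs, rfl⟩))
    intro g hg
    have h3 : FreeGroup.lift b g ∈ ψ.ker := (hβ g).trans hg
    exact (QuotientGroup.eq_one_iff g).1 ((DFunLike.congr_fun h1 g).trans (h2 h3))

namespace CyclicPresentation

section Relators

variable {A : Type} {H : Type w} [Group H]

/-- The words in the letters of `A`, as words in the letters of `A` and `t`. -/
def base : FreeGroup A →* FreeGroup (A ⊕ PUnit.{1}) := FreeGroup.map Sum.inl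

/-- The letter `t`. -/
def stable : FreeGroup (A ⊕ PUnit.{1}) := FreeGroup.of (Sum.inr PUnit.unit)

/-- The relators of `⟨A, t | R, t⁻¹ a t = hat a⟩`. -/
def relators (hat : A → List (A × Bool)) (R : Set (List (A × Bool))) :
    Set (FreeGroup (A ⊕ PUnit.{1})) :=
  {r | ∃ u ∈ R, r = FreeGroup.map Sum.inl (FreeGroup.mk u)} ∪
    {r | ∃ a, r = (FreeGroup.of (Sum.inr PUnit.unit))⁻¹ * FreeGroup.of (Sum.inl a) *
      FreeGroup.of (Sum.inr PUnit.unit) * (FreeGroup.map Sum.inl (FreeGroup.mk (hat a)))⁻¹}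

/-- The homomorphism from the free group. -/
def eval (φ : MulAut H) (gen : A → H) : FreeGroup (A ⊕ PUnit.{1}) →* Cyclic H φ :=
  FreeGroup.lift (Sum.elim (fun a => SemidirectProduct.inl (gen a)) (fun _ => Cyclic.t φ))

/-- The endomorphism of the free group. -/
def hatHom (hat : A → List (A × Bool)) : Monoid.End (FreeGroup A) :=
  (FreeGroup.lift fun a => FreeGroup.mk (hat a) : FreeGroup A →* FreeGroup A)

theorem base_of (a : A) : base (FreeGroup.of a) = FreeGroup.of (Sum.inl a) := FreeGroup.map.of

theorem hatHom_of (hat : A → List (A × Bool)) (a : A) :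
    hatHom hat (FreeGroup.of a) = FreeGroup.mk (hat a) := FreeGroup.lift_apply_of

variable {φ : MulAut H} {gen : A → H} {hat : A → List (A × Bool)} {R : Set (List (A × Bool))}

theorem eval_base (u : FreeGroup A) : eval φ gen (base u) =
    SemidirectProduct.inl (FreeGroup.lift gen u) :=
  DFunLike.congr_fun (FreeGroup.ext_hom (f := (eval φ gen).comp base)
    (g := SemidirectProduct.inl.comp (FreeGroup.lift gen))
    (by intro a; simp [base_of, eval])) u

theorem eval_stable : eval φ gen stable = Cyclic.t φ := FreeGroup.lift_apply_of

theorem eval_surjective (hgen : Subgroup.closure (Set.range gen) = ⊤) :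
    Function.Surjective (eval φ gen) := by
  intro g
  have h1 : g.left ∈ (FreeGroup.lift gen).range := by
    rw [FreeGroup.range_lift_eq_closure, hgen]
    trivial
  obtain ⟨u, hu⟩ := h1
  refine ⟨base u * stable ^ (-g.right.toAdd), ?_⟩
  rw [map_mul, map_zpow, eval_base, eval_stable, hu, Cyclic.t_zpow, neg_neg, ofAdd_toAdd,
    SemidirectProduct.inl_left_mul_inr_right]

theorem lift_hatHom (hhat : ∀ a, FreeGroup.lift gen (FreeGroup.mk (hat a)) = φ (gen a))
    (u : FreeGroup A) : FreeGroup.lift gen (hatHom hat u) = φ (FreeGroup.lift gen u) :=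
  DFunLike.congr_fun (FreeGroup.ext_hom (f := (FreeGroup.lift gen).comp (hatHom hat))
    (g := φ.toMonoidHom.comp (FreeGroup.lift gen))
    (by
      intro a
      change
        FreeGroup.lift gen (hatHom hat (FreeGroup.of a)) = φ (FreeGroup.lift gen (FreeGroup.of a))
      rw [hatHom_of, hhat, FreeGroup.lift_apply_of])) u

theorem lift_hatHom_pow (hhat : ∀ a, FreeGroup.lift gen (FreeGroup.mk (hat a)) = φ (gen a))
    (n : ℕ) (u : FreeGroup A) :
    FreeGroup.lift gen ((hatHom hat ^ n) u) = (φ ^ n) (FreeGroup.lift gen u) := by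
  induction n with
  | zero => rfl
  | succ n ih =>
    rw [pow_succ', pow_succ', MulAut.mul_apply, ← ih]
    exact lift_hatHom hhat _

theorem relators_le_ker (hhat : ∀ a, FreeGroup.lift gen (FreeGroup.mk (hat a)) = φ (gen a))
    (hR : ∀ u ∈ R, FreeGroup.lift gen (FreeGroup.mk u) = 1) :
    Subgroup.normalClosure (relators hat R) ≤ (eval φ gen).ker := by
  refine Subgroup.normalClosure_le_normal ?_
  rintro _ (⟨u, hu, rfl⟩ | ⟨a, rfl⟩)
  · exact (eval_base (FreeGroup.mk u)).trans (by rw [hR u hu, map_one])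
  · change eval φ gen (stable⁻¹ * _ * stable * (base (FreeGroup.mk (hat a)))⁻¹) = 1
    rw [← base_of, map_mul, map_mul, map_mul, map_inv, map_inv, eval_base, eval_base, eval_stable,
      Cyclic.t_inv_mul_inl_mul_t, FreeGroup.lift_apply_of, hhat, mul_inv_cancel]

variable {K : Type v} [Group K] {ρ : FreeGroup (A ⊕ PUnit.{1}) →* K}

theorem stable_inv_mul_base (h : ∀ r ∈ relators hat R, ρ r = 1) (u : FreeGroup A) :
    (ρ stable)⁻¹ * ρ (base u) * ρ stable = ρ (base (hatHom hat u)) := by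
  have h1 := DFunLike.congr_fun
    (FreeGroup.ext_hom (f := (MulAut.conj (ρ stable)⁻¹).toMonoidHom.comp (ρ.comp base))
    (g := (ρ.comp base).comp (hatHom hat)) (by
      intro a
      have h2 := h _ (.inr ⟨a, rfl⟩)
      change ρ (stable⁻¹ * _ * stable * (base (FreeGroup.mk (hat a)))⁻¹) = 1 at h2
      rw [← base_of, map_mul, map_inv, mul_inv_eq_one, map_mul, map_mul, map_inv] at h2
      change (ρ stable)⁻¹ * ρ (base (FreeGroup.of a)) * (ρ stable)⁻¹⁻¹ =
        ρ (base (hatHom hat (FreeGroup.of a)))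
      rw [hatHom_of, inv_inv]
      exact h2)) u
  change (ρ stable)⁻¹ * ρ (base u) * (ρ stable)⁻¹⁻¹ = _ at h1
  rwa [inv_inv] at h1

theorem stable_pow_inv_mul_base (h : ∀ r ∈ relators hat R, ρ r = 1) (n : ℕ) (u : FreeGroup A) :
    (ρ stable ^ n)⁻¹ * ρ (base u) * ρ stable ^ n = ρ (base ((hatHom hat ^ n) u)) := by
  induction n with
  | zero => simp
  | succ n ih =>
    rw [pow_succ' (hatHom hat)]
    change _ = ρ (base (hatHom hat ((hatHom hat ^ n) u)))
    rw [← stable_inv_mul_base h, ← ih, pow_succ]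
    group

/-- Modulo the relators, every element has the form `t ^ a * u * t ^ (-b)`. -/
theorem exists_normalForm (h : ∀ r ∈ relators hat R, ρ r = 1) (g : FreeGroup (A ⊕ PUnit.{1})) :
    ∃ (a b : ℕ) (u : FreeGroup A), ρ g = ρ (stable ^ a * base u * (stable ^ b)⁻¹) := by
  have h0 : ∀ (n : ℕ) u, ρ (base u) * ρ stable ^ n = ρ stable ^ n * ρ (base ((hatHom hat ^ n) u)) :=
    fun n u => by rw [← stable_pow_inv_mul_base h, mul_assoc, mul_inv_cancel_left]
  have h0' : ∀ (n : ℕ) u, (ρ stable ^ n)⁻¹ * ρ (base u) =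
      ρ (base ((hatHom hat ^ n) u)) * (ρ stable ^ n)⁻¹ :=
    fun n u => by rw [← stable_pow_inv_mul_base h, mul_inv_cancel_right]
  induction g using FreeGroup.induction_on with
  | C1 => exact ⟨0, 0, 1, by simp⟩
  | of x =>
    obtain a | ⟨⟩ := x
    · exact ⟨0, 0, FreeGroup.of a, by simp [base_of]⟩
    · exact ⟨1, 0, 1, by simp [stable]⟩
  | inv_of x _ =>
    obtain a | ⟨⟩ := x
    · exact ⟨0, 0, (FreeGroup.of a)⁻¹, by simp [base_of]⟩
    · exact ⟨0, 1, 1, by simp [stable]⟩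
  | mul x y hx hy =>
    obtain ⟨a, b, u, hx⟩ := hx
    obtain ⟨c, d, v, hy⟩ := hy
    rw [map_mul, hx, hy]
    simp only [map_mul, map_inv, map_pow]
    -- The powers `t ^ (-b)` and `t ^ c` in the middle combine to a single power of `t` or `t⁻¹`. It
    -- is moved outwards past a word, to which `hatHom` is thereby applied; both cases use only
    -- nonnegative powers of this endomorphism, which may fail to be invertible.
    obtain hbc | hbc := le_total b c
    · obtain ⟨e, rfl⟩ := Nat.exists_eq_add_of_le hbc
      refine ⟨a + e, d, (hatHom hat ^ e) u * v, ?_⟩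
      simp only [map_mul, pow_add]
      have h1 := h0 e u
      calc _ = ρ stable ^ a * (ρ (base u) * ρ stable ^ e) * ρ (base v) * (ρ stable ^ d)⁻¹ := by
            group
        _ = _ := by rw [h1]; group
    · obtain ⟨e, rfl⟩ := Nat.exists_eq_add_of_le hbc
      refine ⟨a, d + e, u * (hatHom hat ^ e) v, ?_⟩
      simp only [map_mul, pow_add]
      have h1 := h0' e v
      calc _ = ρ stable ^ a * ρ (base u) * ((ρ stable ^ e)⁻¹ * ρ (base v)) * (ρ stable ^ d)⁻¹ := by
            rw [pow_mul_comm]; group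
        _ = _ := by rw [h1]; group

theorem eval_normalForm {a b : ℕ} {u : FreeGroup A}
    (h : eval φ gen (stable ^ a * base u * (stable ^ b)⁻¹) = 1) :
    a = b ∧ FreeGroup.lift gen u = 1 := by
  rw [map_mul, map_mul, map_inv, map_pow, map_pow, eval_stable, eval_base] at h
  have h1 : a = b := by
    have h2 := congrArg (fun g : Cyclic H φ => g.right.toAdd) h
    simp only [Cyclic.toAdd_right_mul] at h2
    rw [← zpow_natCast, ← zpow_natCast, ← zpow_neg, Cyclic.toAdd_right_t_zpow,
      Cyclic.toAdd_right_t_zpow] at h2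
    simp at h2
    omega
  subst h1
  refine ⟨rfl, ?_⟩
  rw [mul_inv_eq_one, mul_eq_left] at h
  exact SemidirectProduct.inl_injective (h.trans (map_one _).symm)

end Relators

variable {H : Type w} [Group H] {φ : MulAut H}

theorem exists_word {A : Type} (u : FreeGroup A) : ∃ l, FreeGroup.mk l = u := Quot.exists_rep u

/-- The kernel of the map from the free group on the generators and `t` is normally generated by a
finite set. Modulo the relators `t⁻¹ a t = φ̂(a)` each of its elements has a normal form `t ^ a * u
* t ^ (-a)` with `u` trivial in `H`, so it may be replaced by the word `u`, which does not contain
`t`. -/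
theorem nonempty (hH : Group.FG H) (hφ : Group.IsFinitelyPresented (Cyclic H φ)) :
    Nonempty (CyclicPresentation H φ) := by
  obtain ⟨α, hα, ψ, hψ⟩ := Group.fg_iff_exists_freeGroup_hom_surjective_finite.1 hH
  let gen : α → H := fun i => ψ (FreeGroup.of i)
  have hgen' : FreeGroup.lift gen = ψ := FreeGroup.ext_hom _ _ (by simp [gen])
  have hgen : Subgroup.closure (Set.range gen) = ⊤ := by
    rw [← FreeGroup.range_lift_eq_closure, hgen']
    exact MonoidHom.range_eq_top.2 hψ
  choose word hword using exists_word (A := α)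
  choose lift hlift using hψ
  let hat : α → List (α × Bool) := fun a => word (lift (φ (gen a)))
  have hhat : ∀ a, FreeGroup.lift gen (FreeGroup.mk (hat a)) = φ (gen a) := fun a => by
    rw [hword, hgen', hlift]
  obtain ⟨S, hS, hSker⟩ := hφ.ker_isFinitelyNormallyGenerated _ (eval_surjective (φ := φ) hgen)
  let N₀ := Subgroup.normalClosure (relators hat ∅)
  have hN₀ : N₀ ≤ (eval φ gen).ker := relators_le_ker hhat (by simp)
  choose a b u hu using exists_normalForm (ρ := QuotientGroup.mk' N₀) (R := ∅)
    fun r hr => (QuotientGroup.eq_one_iff _).2 (Subgroup.subset_normalClosure hr)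
  have hS' : ∀ s ∈ S, a s = b s ∧ FreeGroup.lift gen (u s) = 1 := by
    intro s hs
    have h1 : s ∈ (eval φ gen).ker := hSker ▸ Subgroup.subset_normalClosure hs
    have h2 : eval φ gen (s⁻¹ * _) = 1 := hN₀ (QuotientGroup.eq.1 (hu s))
    rw [map_mul, map_inv, (show eval φ gen s = 1 from h1), inv_one, one_mul] at h2
    exact eval_normalForm h2
  let R := (fun s => word (u s)) '' S
  refine ⟨α, hα, gen, hgen, hat, hhat, R, hS.image _, le_antisymm ?_ ?_⟩
  · refine relators_le_ker hhat ?_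
    rintro _ ⟨s, hs, rfl⟩
    rw [hword]
    exact (hS' s hs).2
  · change (eval φ gen).ker ≤ Subgroup.normalClosure (relators hat R)
    rw [← hSker]
    refine Subgroup.normalClosure_le_normal fun s hs => ?_
    have h1 : N₀ ≤ Subgroup.normalClosure (relators hat R) := by
      refine Subgroup.normalClosure_mono ?_
      rintro _ (⟨v, hv, -⟩ | h)
      · exact hv.elim
      · exact .inr h
    have h2 := h1 (QuotientGroup.eq.1 (hu s))
    have h3 : base (u s) ∈ Subgroup.normalClosure (relators hat R) := by
      refine Subgroup.subset_normalClosure (.inl ⟨_, ⟨s, hs, rfl⟩, ?_⟩)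
      rw [hword]
      rfl
    rw [(hS' s hs).1] at h2
    have h4 : (Subgroup.normalClosure (relators hat R)).Normal := inferInstance
    have h5 := h4.conj_mem _ h3 (stable ^ b s)
    have h6 := mul_mem h5 (inv_mem h2)
    -- The product of the conjugate of `u s` with the inverse of its quotient by `s` is `s`.
    rw [mul_inv_rev, inv_inv, mul_inv_cancel_left] at h6
    exact h6

/-- The shift of sequences. -/
def shift (Q : Type v) [Group Q] : MulAut (ℤ → Q) where
  toFun y i := y (i + 1)
  invFun y i := y (i - 1)
  left_inv y := funext fun i => congrArg y (by ring)
  right_inv y := funext fun i => congrArg y (by ring)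
  map_mul' _ _ := rfl

/-- The relators are those of `P` with the endomorphism `φ̂` applied `i` times, for `i < p`. That
they suffice is tested on sequences in the quotient `Q` by the new relators, on which `ℤ` acts by
the shift. The old relators hold in the resulting semidirect product, so a word that is trivial in
`H` yields the trivial sequence, and the entry at `0` of this sequence is the class of the word in
`Q`. -/
theorem nonempty_pow (P : CyclicPresentation H φ) {p : ℕ} (hp : 1 ≤ p) :
    Nonempty (CyclicPresentation H (φ ^ p)) := by
  have := P.finite_A
  choose word hword using exists_word (A := P.A)
  let hat : P.A → List (P.A × Bool) := fun a => word ((hatHom P.hat ^ p) (FreeGroup.of a))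
  let R := (fun z : ℕ × List (P.A × Bool) => word ((hatHom P.hat ^ z.1) (FreeGroup.mk z.2))) ''
    (Set.Iio p ×ˢ P.R)
  have hhat : ∀ a, FreeGroup.lift P.gen (FreeGroup.mk (hat a)) = (φ ^ p) (P.gen a) := by
    intro a
    rw [hword, lift_hatHom_pow P.hat_eq, FreeGroup.lift_apply_of]
  have hPR : ∀ u ∈ P.R, FreeGroup.lift P.gen (FreeGroup.mk u) = 1 := by
    intro u hu
    have h1 : base (FreeGroup.mk u) ∈ (eval φ P.gen).ker := by
      refine P.presents ▸ Subgroup.subset_normalClosure (.inl ⟨u, hu, rfl⟩)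
    have h2 := (eval_base (φ := φ) (gen := P.gen) _).symm.trans h1
    exact SemidirectProduct.inl_injective (h2.trans (map_one _).symm)
  have hhom : hatHom hat = hatHom P.hat ^ p :=
    FreeGroup.ext_hom (f := hatHom hat) (g := hatHom P.hat ^ p) (by
      intro a
      exact (hatHom_of hat a).trans (hword _))
  refine ⟨P.A, P.finite_A, P.gen, P.gen_closure, hat, hhat, R,
    ((Set.finite_Iio p).prod P.finite_R).image _, le_antisymm ?_ ?_⟩
  · refine relators_le_ker hhat ?_
    rintro _ ⟨⟨i, u⟩, ⟨-, hu⟩, rfl⟩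
    dsimp only at hu ⊢
    rw [hword, lift_hatHom_pow P.hat_eq, hPR u hu, map_one]
  change (eval (φ ^ p) P.gen).ker ≤ Subgroup.normalClosure (relators hat R)
  let N := Subgroup.normalClosure (relators hat R)
  let ρ := QuotientGroup.mk' N
  have hρ : ∀ r ∈ relators hat R, ρ r = 1 := fun r hr =>
    (QuotientGroup.eq_one_iff _).2 (Subgroup.subset_normalClosure hr)
  -- The entry at `r + p * q`, with `0 ≤ r < p`, is the image of the word under `r` applications of
  -- `φ̂`, conjugated by the power `t ^ (-q)`.
  let x : FreeGroup P.A →* (ℤ → FreeGroup (P.A ⊕ PUnit.{1}) ⧸ N) := MonoidHom.pi fun i =>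
    (MulAut.conj ((ρ stable)⁻¹ ^ (i / p))).toMonoidHom.comp
      ((ρ.comp base).comp (hatHom P.hat ^ (i % p).toNat))
  have hx : ∀ (r : ℕ) (q : ℤ) (u : FreeGroup P.A), r < p → x u (r + p * q) =
      (ρ stable)⁻¹ ^ q * ρ (base ((hatHom P.hat ^ r) u)) * ((ρ stable)⁻¹ ^ q)⁻¹ := by
    intro r q u hr
    have h1 : ((r : ℤ) + p * q) / p = q := by
      rw [Int.add_mul_ediv_left _ _ (by omega), Int.ediv_eq_zero_of_lt (by omega) (by omega),
        zero_add]
    have h2 : (((r : ℤ) + p * q) % p).toNat = r := by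
      rw [Int.add_mul_emod_self_left, Int.emod_eq_of_lt (by omega) (by omega), Int.toNat_natCast]
    change (ρ stable)⁻¹ ^ (((r : ℤ) + p * q) / p) *
      ρ (base ((hatHom P.hat ^ (((r : ℤ) + p * q) % p).toNat) u)) *
      ((ρ stable)⁻¹ ^ (((r : ℤ) + p * q) / p))⁻¹ = _
    rw [h1, h2]
  have hdiv : ∀ i : ℤ, ∃ (r : ℕ) (q : ℤ), r < p ∧ i = r + p * q := by
    intro i
    have h1 := Int.emod_nonneg i (b := p) (by omega)
    have h2 := Int.emod_lt_of_pos i (b := p) (by omega)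
    refine ⟨(i % p).toNat, i / p, by omega, ?_⟩
    rw [Int.toNat_of_nonneg h1]
    exact (Int.emod_add_mul_ediv i p).symm
  -- Applying `φ̂` shifts the sequence. Within a block of length `p` this holds by definition; from
  -- one block to the next it is the relation in `Q` by which `t⁻¹ a t` is `φ̂ ^ p` applied to `a`.
  have hshift : ∀ u, x (hatHom P.hat u) = shift _ (x u) := by
    intro u
    funext i
    obtain ⟨r, q, hr, rfl⟩ := hdiv i
    change _ = x u (r + p * q + 1)
    rw [hx _ _ _ hr]
    have h1 : (hatHom P.hat ^ r) (hatHom P.hat u) = (hatHom P.hat ^ (r + 1)) u := by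
      rw [pow_succ]
      rfl
    rw [h1]
    by_cases hr' : r + 1 < p
    · have h2 : (r : ℤ) + p * q + 1 = (r + 1 : ℕ) + p * q := by push_cast; ring
      rw [h2, hx _ _ _ hr']
    · obtain rfl : p = r + 1 := by omega
      have h2 : (r : ℤ) + (r + 1 : ℕ) * q + 1 = (0 : ℕ) + (r + 1 : ℕ) * (q + 1) := by
        push_cast; ring
      rw [h2, hx _ _ _ hp, ← hhom, ← stable_inv_mul_base hρ, zpow_add_one]
      change _ = (ρ stable)⁻¹ ^ q * (ρ stable)⁻¹ * ρ (base u) * _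
      group
  have hlift : FreeGroup.lift (fun a => x (FreeGroup.of a)) = x := FreeGroup.ext_hom _ _ (by simp)
  have hker : ∀ u : FreeGroup P.A, FreeGroup.lift P.gen u = 1 → ρ (base u) = 1 := by
    intro u hu
    have h1 : base u ∈ (eval φ P.gen).ker := by
      change eval φ P.gen (base u) = 1
      rw [eval_base, hu, map_one]
    have h2 := relators_le_ker (φ := shift (FreeGroup (P.A ⊕ PUnit.{1}) ⧸ N))
      (gen := fun a => x (FreeGroup.of a)) (hat := P.hat) (R := P.R) (fun a => by
        rw [hlift, ← hatHom_of, hshift]) (fun v hv => by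
        rw [hlift]
        funext i
        obtain ⟨r, q, hr, rfl⟩ := hdiv i
        rw [hx _ _ _ hr]
        have h3 := hρ _ (.inl ⟨_, ⟨(r, v), ⟨hr, hv⟩, rfl⟩, rfl⟩)
        rw [hword] at h3
        change ρ (base _) = 1 at h3
        rw [h3, mul_one, mul_inv_cancel]
        rfl)
    have h4 : eval (shift _) (fun a => x (FreeGroup.of a)) (base u) = 1 := h2 (P.presents.symm ▸ h1)
    rw [eval_base, hlift] at h4
    have h5 := congrFun
      (SemidirectProduct.inl_injective (h4.trans (map_one _).symm)) ((0 : ℕ) + p * 0)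
    rw [hx _ _ _ hp] at h5
    simpa using h5
  intro g hg
  obtain ⟨a, b, u, h⟩ := exists_normalForm hρ g
  have h1 : eval (φ ^ p) P.gen (g⁻¹ * _) = 1 := relators_le_ker hhat (R := R) (by
    rintro _ ⟨⟨i, v⟩, ⟨-, hv⟩, rfl⟩
    dsimp only at hv ⊢
    rw [hword, lift_hatHom_pow P.hat_eq, hPR v hv, map_one]) (QuotientGroup.eq.1 h)
  rw [map_mul, map_inv, (show eval (φ ^ p) P.gen g = 1 from hg), inv_one, one_mul] at h1
  obtain ⟨rfl, h2⟩ := eval_normalForm h1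
  refine (QuotientGroup.eq_one_iff g).1 (h.trans ?_)
  rw [map_mul, map_mul, hker u h2, mul_one, map_inv, mul_inv_cancel]

end CyclicPresentation

open OneComplex Relation

/-! ### Comparison of the corridor length functions -/

namespace EdgePathMap

section Compare

variable {G₁ : TwoComplex.{u}} {G₂ : TwoComplex.{v}} {f₁ : EdgePathMap G₁.toOneComplex}
  {f₂ : EdgePathMap G₂.toOneComplex} {H : Type w} [Group H] {φ ψ : MulAut H}

theorem PairedLoops.mono {n n' k k' : ℕ} (h : f₁.PairedLoops n k) (hn : n' ≤ n) (hk : k ≤ k') :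
    f₁.PairedLoops n' k' := fun x w hw hl => (h x w hw (hl.trans hn)).mono hk

/-- The factor `2` and the summand `1` of the constant come from `corridorLength_le`, that is, from
the passage from pairings to diagrams. -/
theorem coarseLE_of_dominates (hG₁ : G₁.IsFinite) (h : Dominates f₁.PairedLoops f₂.PairedLoops) :
    CoarseLE f₂.corridorLength f₁.corridorLength := by
  obtain ⟨C, h⟩ := h
  refine ⟨2 * C + 1, fun n => ?_⟩
  have h1 := f₁.pairedLoops_corridorLength hG₁ ((2 * C + 1) * n + (2 * C + 1))
  have h2 := corridorLength_le f₂ (h n _ (h1.mono (by nlinarith [Nat.zero_le (C * n)]) le_rfl))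
  refine h2.trans ?_
  nlinarith [Nat.zero_le (f₁.corridorLength ((2 * C + 1) * n + (2 * C + 1)))]

theorem Marking.fg (m : f₁.Marking φ) (hG : G₁.IsFinite) (x : G₁.Vert) : Group.FG H := by
  have := hG.2.1
  refine Group.fg_iff.2 ⟨Set.range m.lab, ?_, Set.finite_range _⟩
  rw [← FreeGroup.range_lift_eq_closure]
  refine MonoidHom.range_eq_top.2 fun h => ?_
  obtain ⟨p, -, hp⟩ := m.surj x x h
  exact ⟨FreeGroup.mk p, (prod_dartVal _ p).symm.trans hp⟩

theorem Marking.dominates {ℓ : H → ℕ} (hℓ : IsWordLength ℓ) (m₁ : f₁.Marking φ)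
    (m₂ : f₂.Marking ψ) (hG₁ : G₁.IsFinite) (hG₂ : G₂.IsFinite) (x : G₁.Vert)
    (h : Dominates (Cyclic.PairedWords ℓ φ) (Cyclic.PairedWords ℓ ψ)) :
    Dominates f₁.PairedLoops f₂.PairedLoops := by
  have h1 := (m₁.dominates_words hℓ hG₁ x).trans h
    (fun _ _ _ hn h => h.mono hn le_rfl) (fun _ _ _ hk h => h.mono le_rfl hk)
  exact h1.trans (m₂.dominates_loops hℓ hG₂)
    (fun _ _ _ hn h => h.mono hn le_rfl) (fun _ _ _ hk h => h.mono le_rfl hk)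

theorem Marking.coarseEquiv (m₁ : f₁.Marking φ) (m₂ : f₂.Marking φ) (hG₁ : G₁.IsFinite)
    (hG₂ : G₂.IsFinite) (x₁ : G₁.Vert) (x₂ : G₂.Vert) :
    CoarseEquiv f₁.corridorLength f₂.corridorLength := by
  obtain ⟨ℓ, hℓ⟩ := exists_isWordLength (m₁.fg hG₁ x₁)
  have h : Dominates (Cyclic.PairedWords ℓ φ) (Cyclic.PairedWords ℓ φ) :=
    ⟨1, fun n k h => h.mono (by omega) (by omega)⟩
  exact ⟨coarseLE_of_dominates hG₂ (m₂.dominates hℓ m₁ hG₂ hG₁ x₂ h),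
    coarseLE_of_dominates hG₁ (m₁.dominates hℓ m₂ hG₁ hG₂ x₁ h)⟩

end Compare

end EdgePathMap

theorem CyclicPresentation.coarseEquiv {H : Type w} [Group H] {φ : MulAut H} (hH : Group.FG H)
    {p : ℕ} (hp : 1 ≤ p) (P : CyclicPresentation H φ) (Q : CyclicPresentation H (φ ^ p)) :
    CoarseEquiv P.corridorLength Q.corridorLength := by
  obtain ⟨ℓ, hℓ⟩ := exists_isWordLength hH
  obtain ⟨m⟩ := P.nonempty_marking
  obtain ⟨m'⟩ := Q.nonempty_marking
  exact ⟨EdgePathMap.coarseLE_of_dominates Q.isFinite (m'.dominates hℓ m Q.isFinite P.isFinite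
      PUnit.unit (Cyclic.PairedWords.of_pow hp hℓ φ)),
    EdgePathMap.coarseLE_of_dominates P.isFinite (m.dominates hℓ m' P.isFinite Q.isFinite
      PUnit.unit (Cyclic.PairedWords.dominates_pow hp φ))⟩

theorem mainTheorem9 {H : Type w} [Group H] :
    (∀ (φ : Out H) (G₁ : TwoComplex.{u}) (G₂ : TwoComplex.{v}),
      G₁.IsFinite → G₂.IsFinite → G₁.Connected → G₂.Connected →
      ∀ (x₁ : G₁.Vert) (x₂ : G₂.Vert) (ι₁ : G₁.FundGroup x₁ ≃* H) (ι₂ : G₂.FundGroup x₂ ≃* H)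
        (f₁ : EdgePathMap G₁.toOneComplex) (f₂ : EdgePathMap G₂.toOneComplex),
      f₁.Induces ι₁ φ → f₂.Induces ι₂ φ →
      CoarseEquiv f₁.corridorLength f₂.corridorLength) ∧
    (∀ φ : MulAut H, Group.FG H → Group.IsFinitelyPresented (Cyclic H φ) →
      ∀ p : ℕ, 1 ≤ p →
        Nonempty (CyclicPresentation H φ) ∧ Nonempty (CyclicPresentation H (φ ^ p)) ∧
        ∀ (P : CyclicPresentation H φ) (Q : CyclicPresentation H (φ ^ p)),
          CoarseEquiv P.corridorLength Q.corridorLength) := by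
  refine ⟨fun φ G₁ G₂ hG₁ hG₂ hc₁ hc₂ x₁ x₂ ι₁ ι₂ f₁ f₂ h₁ h₂ => ?_, fun φ hH hφ p hp => ?_⟩
  -- One representative `Φ` is used for both complexes, so that both mapping tori are marked by the
  -- same group.
  · obtain ⟨Φ, rfl⟩ := QuotientGroup.mk_surjective φ
    obtain ⟨γ₁, h₁⟩ := h₁.exists_path Φ rfl
    obtain ⟨γ₂, h₂⟩ := h₂.exists_path Φ rfl
    obtain ⟨m₁⟩ := EdgePathMap.exists_marking hc₁ ι₁ Φ γ₁ h₁
    obtain ⟨m₂⟩ := EdgePathMap.exists_marking hc₂ ι₂ Φ γ₂ h₂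
    exact m₁.coarseEquiv m₂ hG₁ hG₂ x₁ x₂
  · obtain ⟨P⟩ := CyclicPresentation.nonempty hH hφ
    exact ⟨⟨P⟩, P.nonempty_pow hp, fun P Q => P.coarseEquiv hH hp Q⟩
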